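/- **Dynamic problems.** $\mathrm{StringEquality}$ over a finite alphabet $\Sigma$ maintains two sequences $u_0\ldots u_{n-1}$ and $v_0\ldots v_{n-1}$ with entries in $\Sigma\cup\{\epsilon\}$, initially all $\epsilon$, under the changes "set $x_i$ to $\sigma$ if $x_i=\epsilon$" and "reset $x_i$ to $\epsilon$" ($x\in\{u,v\}$, $\sigma\in\Sigma$); its query asks whether the strings $u_0\circ\cdots\circ u_{n-1}$ and $v_0\circ\cdots\circ v_{n-1}$ are equal. $\mathrm{Member}(L)$ maintains one such sequence $w$ under the same changes; its query asks whether $w_0\circ\cdots\circ w_{n-1}\in L$. $D_k$ is the Dyck language of well-balanced strings of parentheses of $k$ types. **Dynamic programs and their work.** A dynamic program maintains, over the domain $\{0,\ldots,n-1\}$ of the input, finitely many auxiliary relations and partial functions, initialised by formulas of first-order logic with $\le,+,\times$, and finitely many supplementary instances (or families of instances, indexed by tuples of domain elements) of other dynamic programs, over a domain of size $c\cdot n$ for a constant $c\ge 0$. For each change operation $\delta(\bar p)$ and auxiliary symbol $R$ it has an update rule "run $P_1$; update $R$ at $\bar t(\bar p,\bar x)$, for all $\bar x$ with $x_i\le g_i(n)$,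 by the value returned by $P_2$"; each query has a query procedure. Rules are evaluated on the old auxiliary structure. Procedures consist of assignments to local relations and functions, conditionals and parallel branches $z\le g(n)$, with terms and conditions built from the built-in arithmetic, auxiliary and local symbols, queries to supplementary instances, if-then-else, Boolean connectives, and bounded "exists $z\le g(n)$" and "unique $z\le g(n)$"; all bounds $g$ are first-order definable. The initial procedure $P_1$ (which does not see $\bar x$) may also invoke changes of supplementary instances, within parallel branches only with the branch variables among the indices of the instance, and at most one rule per change operation invokes changes of a given instance (family). The work of a procedure is the maximum of the work of its parts, where variables count $1$, an operation of a supplementary instance costs the work of its rule on the domain of that instance, and parallel branches, "exists" and "unique" with bound $g$ multiply the work by the number of domain elements $z\le g(n)$; the work of an update rule is the maximum of that of $P_1$ and of the number of tuples $\bar x$ times that of $P_2$ and $\bar t$. A problem *can be maintained in DynFO with work $O(W(n))$* if such a program answers every query correctly, for every $n$ and after every sequence of changes of the initially empty input, and the work of each of its change and query operations is $O(W(n))$. **Lemma.** Let $W:\mathbb N\to\mathbb R_{\ge 0}$. (a) For each $k\ge 1$: if $\mathrm{StringEquality}$ over an alphabet with $k$ letters can be maintained in DynFO with work $O(W(n))$,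 then $\mathrm{Member}(D_k)$ can be maintained in DynFO with work $O(W(n)\cdot\log n+(\log n)^3)$. (b) If for all $k\ge 1$ $\mathrm{Member}(D_k)$ can be maintained in DynFO with work $O(W(n))$, then, for every finite alphabet, $\mathrm{StringEquality}$ can be maintained in DynFO with work $O(W(2n))$, and thus with work $O(W(n))$ if $W(2n)=O(W(n))$. -/

import Mathlib

open Filter Asymptotics

noncomputable section

namespace DynFO

/-! ### First-order logic with order and arithmetic on the domain `{0, …, n-1}` -/

/-- The built-in relations: the order and the graphs of addition and multiplication. -/
inductive ArithRel : ℕ → Type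
  | le : ArithRel 2
  | add : ArithRel 3
  | mul : ArithRel 3

/-- The language of `FO(≤, +, ×)`. -/
def arith : FirstOrder.Language := ⟨fun _ => Empty, ArithRel⟩

instance arithStructure (n : ℕ) : arith.Structure (Fin n) where
  funMap := fun f => Empty.elim f
  RelMap := fun r => match r with
    | .le => fun a => (a 0 : ℕ) ≤ a 1
    | .add => fun a => (a 0 : ℕ) + a 1 = a 2
    | .mul => fun a => (a 0 : ℕ) * a 1 = a 2

/-- A first-order definable function `ℕ → ℕ`, used as the bound `z ≤ g(n)` of a variable `z` that
ranges over the domain `{0, …, n-1}`.  Values `g(n) ≥ n - 1` all stand for the whole domain. -/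
structure Bound where
  fn : ℕ → ℕ
  definable : ∃ φ : arith.Formula (Fin 1),
    ∀ (n : ℕ) (a : Fin n), φ.Realize (fun _ => a) ↔ (a : ℕ) ≤ fn n

/-- The number of domain elements `z ≤ g(n)`. -/
def Bound.count (g : Bound) (n : ℕ) : ℕ := min (g.fn n + 1) n

/-! ### Schemas, structures, operations, dynamic problems -/

/-- Relations and conditions have kind `cond`; functions and terms have kind `term`. -/
inductive Kind
  | cond
  | term

/-- A condition has a truth value, a term has a domain element or `⊥` (`none`) as its value. -/
abbrev Val (n : ℕ) : Kind → Type
  | .cond => Prop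
  | .term => Option (Fin n)

/-- The value of a symbol that was never set: `false` and `⊥`, respectively. -/
def Val.empty (n : ℕ) : (κ : Kind) → Val n κ
  | .cond => False
  | .term => none

/-- A finite set of relation symbols (kind `cond`) and function symbols (kind `term`). -/
structure Schema where
  Sym : Type
  fin : Fintype Sym
  kind : Sym → Kind
  arity : Sym → ℕ

attribute [instance] Schema.fin

/-- A structure with domain `{0, …, n-1}`, with relations and partial functions. -/
abbrev Str (τ : Schema) (n : ℕ) : Type :=
  ∀ s : τ.Sym, (Fin (τ.arity s) → Fin n) → Val n (τ.kind s)

/-- The operations of a dynamic problem: change operations, and relational and functional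
query operations, with their numbers of parameters. -/
structure Sig where
  Change : Type
  changeArity : Change → ℕ
  queries : Schema

/-- A data type over the domain `{0, …, n-1}` with the operations `S`. -/
structure DataType (S : Sig) (n : ℕ) where
  State : Type
  start : State
  change : (δ : S.Change) → (Fin (S.changeArity δ) → Fin n) → State → State
  query : State → (Q : S.queries.Sym) → (Fin (S.queries.arity Q) → Fin n) →
    Val n (S.queries.kind Q)

/-- The state after a sequence of change operations. -/
def DataType.run {S : Sig} {n : ℕ} (D : DataType S n)
    (α : List (Σ δ : S.Change, Fin (S.changeArity δ) → Fin n)) : D.State :=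
  α.foldl (fun st op => D.change op.1 op.2 st) D.start

/-- A dynamic problem: its input structures over each domain, with the empty one as start, and
the effects and results of the operations. -/
def DynProblem (S : Sig) : Type 1 := ∀ n : ℕ, DataType S n

/-! ### Procedures -/

/-- What the procedures of a program can refer to: the auxiliary schema and the supplementary
instances.  An instance identifier `i` stands for one instance for each `idx i`-tuple of domain
elements (so for a single one if `idx i = 0`), and the domain of these instances has size
`scale i * n`, where `n` is the size of the domain of the main instance. -/
structure Env where
  aux : Schema
  Sup : Type
  supFin : Fintype Sup
  sig : Sup → Sig
  idx : Sup → ℕ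
  scale : Sup → ℕ

/-- Terms and conditions over the environment `E` and the locally assigned symbols `L`, with
`k` variables in scope.  In `exist` and `unique` the bound variable is the last one.  An argument
of an operation of a supplementary instance with domain size `c * n` is a term together with a
block `b < c`; it denotes the element `b * n + t`.  The result of a functional query is
likewise read in the block `out`, and is `⊥` if it lies in another block. -/
inductive Expr (E : Env) (L : Schema) : Kind → ℕ → Type
  | var {k : ℕ} (i : Fin k) : Expr E L .term k
  | undef {k : ℕ} : Expr E L .term k
  | add {k : ℕ} (t t' : Expr E L .term k) : Expr E L .term k
  | mul {k : ℕ} (t t' : Expr E L .term k) : Expr E L .term k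
  | eq {k : ℕ} (t t' : Expr E L .term k) : Expr E L .cond k
  | le {k : ℕ} (t t' : Expr E L .term k) : Expr E L .cond k
  | aux {k : ℕ} (s : E.aux.Sym) (args : Fin (E.aux.arity s) → Expr E L .term k) :
      Expr E L (E.aux.kind s) k
  | loc {k : ℕ} (s : L.Sym) (args : Fin (L.arity s) → Expr E L .term k) :
      Expr E L (L.kind s) k
  | query {k : ℕ} (i : E.Sup) (idx : Fin (E.idx i) → Expr E L .term k)
      (Q : (E.sig i).queries.Sym)
      (blk : Fin ((E.sig i).queries.arity Q) → Fin (E.scale i))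
      (args : Fin ((E.sig i).queries.arity Q) → Expr E L .term k)
      (out : Fin (E.scale i)) : Expr E L ((E.sig i).queries.kind Q) k
  | ite {κ : Kind} {k : ℕ} (C : Expr E L .cond k) (e e' : Expr E L κ k) : Expr E L κ k
  | unique {k : ℕ} (g : Bound) (C : Expr E L .cond (k + 1)) : Expr E L .term k
  | exist {k : ℕ} (g : Bound) (C : Expr E L .cond (k + 1)) : Expr E L .cond k
  | not {k : ℕ} (C : Expr E L .cond k) : Expr E L .cond k
  | and {k : ℕ} (C C' : Expr E L .cond k) : Expr E L .cond k

/-- Update procedures consist of an initial and a main procedure. -/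
inductive Phase
  | initial
  | main

/-- Instructions, with `k` variables in scope.  The first `base` of them are parameters; the
others are bound by the enclosing parallel branches.  The latter have to occur among the
arguments of the head of an assignment, and among the indices of the supplementary instance in a
change invocation, so that parallel branches write to different places.  Only initial procedures
invoke change operations of supplementary instances. -/
inductive Stmt (E : Env) (L : Schema) (base : ℕ) (ph : Phase) : ℕ → Type
  | skip {k : ℕ} : Stmt E L base ph k
  | seq {k : ℕ} (P P' : Stmt E L base ph k) : Stmt E L base ph k
  | assign {k : ℕ} (s : L.Sym) (args : Fin (L.arity s) → Expr E L .term k)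
      (e : Expr E L (L.kind s) k)
      (guarded : ∀ j : Fin k, base ≤ j → ∃ a, args a = Expr.var j) : Stmt E L base ph k
  | ite {k : ℕ} (C : Expr E L .cond k) (P P' : Stmt E L base ph k) : Stmt E L base ph k
  | fordo {k : ℕ} (g : Bound) (P : Stmt E L base ph (k + 1)) : Stmt E L base ph k
  | invoke {k : ℕ} (allowed : ph = Phase.initial) (i : E.Sup)
      (idx : Fin (E.idx i) → Expr E L .term k) (δ : (E.sig i).Change)
      (blk : Fin ((E.sig i).changeArity δ) → Fin (E.scale i))
      (args : Fin ((E.sig i).changeArity δ) → Expr E L .term k)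
      (guarded : ∀ j : Fin k, base ≤ j → ∃ a, idx a = Expr.var j) : Stmt E L base ph k

/-- Main procedures and query procedures with `k` parameters: instructions, with a return
statement of the appropriate kind at the end of each execution path. -/
inductive Body (E : Env) (L : Schema) (κ : Kind) (k : ℕ) : Type
  | ret (e : Expr E L κ k) : Body E L κ k
  | seq (P : Stmt E L k .main k) (B : Body E L κ k) : Body E L κ k
  | ite (C : Expr E L .cond k) (B B' : Body E L κ k) : Body E L κ k

/-- The instructions contain a change invocation for the supplementary instance `i`. -/
def Stmt.Invokes {E : Env} {L : Schema} {base : ℕ} {ph : Phase} (i : E.Sup) :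
    {k : ℕ} → Stmt E L base ph k → Prop
  | _, .skip => False
  | _, .seq P P' => P.Invokes i ∨ P'.Invokes i
  | _, .assign _ _ _ _ => False
  | _, .ite _ P P' => P.Invokes i ∨ P'.Invokes i
  | _, .fordo _ P => P.Invokes i
  | _, .invoke _ j _ _ _ _ _ => j = i

/-- The update rule, for a change operation with `m` parameters `p`, of an auxiliary symbol of
kind `κ` and arity `r`:
`on change δ(p) with initial update R at target(p, x) where x₁ ≤ g₁(n), … by main`. -/
structure UpdateRule (E : Env) (m : ℕ) (κ : Kind) (r : ℕ) where
  L : Schema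
  initial : Stmt E L m .initial m
  numVars : ℕ
  bound : Fin numVars → Bound
  target : Fin r → Expr E L .term (m + numVars)
  main : Body E L κ (m + numVars)

/-- The query rule of a query operation of kind `κ` with `m` parameters. -/
structure QueryRule (E : Env) (m : ℕ) (κ : Kind) where
  L : Schema
  body : Body E L κ m

/-- A first-order definition of the initial value of an auxiliary symbol of the given kind and
arity; functions are defined through their graph. -/
abbrev StartDef : Kind → ℕ → Type
  | .cond, r => arith.Formula (Fin r)
  | .term, r => arith.Formula (Fin (r + 1))

/-- A dynamic program for the operations `S`: supplementary instances of other dynamic programs,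
a first-order initialisation, one update rule for each change operation and auxiliary symbol, and
one query rule for each query operation.  For each change operation and each supplementary
instance, at most one update rule invokes changes of that instance. -/
inductive Program : Sig → Type 1
  | mk {S : Sig} (E : Env) (sup : ∀ i : E.Sup, Program (E.sig i))
      (start : ∀ s : E.aux.Sym, StartDef (E.aux.kind s) (E.aux.arity s))
      (update : ∀ (δ : S.Change) (s : E.aux.Sym),
        UpdateRule E (S.changeArity δ) (E.aux.kind s) (E.aux.arity s))
      (query : ∀ Q : S.queries.Sym, QueryRule E (S.queries.arity Q) (S.queries.kind Q))
      (exclusive : ∀ (δ : S.Change) (i : E.Sup) (s s' : E.aux.Sym),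
        (update δ s).initial.Invokes i → (update δ s').initial.Invokes i → s = s') :
      Program S

/-! ### Semantics -/

open scoped Classical in
/-- The element with property `p` if there is exactly one, and `⊥` otherwise. -/
def theUnique {α : Type} (p : α → Prop) : Option α :=
  if h : ∃! a, p a then some h.choose else none

/-- A tuple of values, if none of them is `⊥`. -/
def allSome {α : Type} {r : ℕ} (f : Fin r → Option α) : Option (Fin r → α) :=
  if h : ∀ i, (f i).isSome then some (fun i => (f i).get (h i)) else none

/-- The domain element `a`, if `a < n`, and `⊥` otherwise. -/
def toDomain (n a : ℕ) : Option (Fin n) := if h : a < n then some ⟨a, h⟩ else none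

/-- The element `b * n + a` of the domain of size `c * n`. -/
def inBlock {c n : ℕ} (b : Fin c) (a : Fin n) : Fin (c * n) := finProdFinEquiv (b, a)

/-- Reads the result of a query to an instance with domain size `c * n`: truth values as they
are, elements `b * n + a` as `a`, and elements outside block `b` as `⊥`. -/
def Val.fromBlock {c n : ℕ} (b : Fin c) : {κ : Kind} → Val (c * n) κ → Val n κ
  | .cond, v => v
  | .term, v => Option.bind v fun y =>
      if (finProdFinEquiv.symm y).1 = b then some (finProdFinEquiv.symm y).2 else none

open scoped Classical in
/-- Conditional choice between two values. -/
def choice {α : Type} (p : Prop) (a b : α) : α := if p then a else b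

/-- The values of the locally assigned symbols, and the states of the supplementary instances. -/
structure Store (E : Env) (L : Schema) (n : ℕ) (D : ∀ i, DataType (E.sig i) (E.scale i * n)) where
  loc : Str L n
  sup : ∀ i : E.Sup, (Fin (E.idx i) → Fin n) → (D i).State

section semantics

variable {E : Env} {L : Schema} {n : ℕ} {D : ∀ i, DataType (E.sig i) (E.scale i * n)}

/-- The value of a term or condition.  Function values and queries with an undefined argument are
undefined, and atomic conditions with an undefined term are false. -/
def Expr.eval (A : Str E.aux n) (σ : Store E L n D) :
    {κ : Kind} → {k : ℕ} → Expr E L κ k → (Fin k → Fin n) → Val n κ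
  | _, _, .var i, v => some (v i)
  | _, _, .undef, _ => (none : Option (Fin n))
  | _, _, .add t t', v =>
      Option.bind (t.eval A σ v) fun a : Fin n =>
        Option.bind (t'.eval A σ v) fun b : Fin n => toDomain n (a + b : ℕ)
  | _, _, .mul t t', v =>
      Option.bind (t.eval A σ v) fun a : Fin n =>
        Option.bind (t'.eval A σ v) fun b : Fin n => toDomain n (a * b : ℕ)
  | _, _, .eq t t', v =>
      ∃ a : Fin n, t.eval A σ v = some a ∧ t'.eval A σ v = some a
  | _, _, .le t t', v =>
      ∃ a b : Fin n, t.eval A σ v = some a ∧ t'.eval A σ v = some b ∧ a ≤ b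
  | _, _, .aux s args, v =>
      match allSome (fun j => (args j).eval A σ v) with
      | some a => A s a
      | none => Val.empty n _
  | _, _, .loc s args, v =>
      match allSome (fun j => (args j).eval A σ v) with
      | some a => σ.loc s a
      | none => Val.empty n _
  | _, _, .query i idx Q blk args out, v =>
      match allSome (fun j => (idx j).eval A σ v), allSome (fun j => (args j).eval A σ v) with
      | some x, some a =>
          ((D i).query (σ.sup i x) Q (fun j => inBlock (blk j) (a j))).fromBlock out
      | _, _ => Val.empty n _
  | _, _, .ite C e e', v => choice (C.eval A σ v) (e.eval A σ v) (e'.eval A σ v)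
  | _, _, .unique g C, v =>
      theUnique fun a : Fin n => (a : ℕ) ≤ g.fn n ∧ C.eval A σ (Fin.snoc v a)
  | _, _, .exist g C, v => ∃ a : Fin n, (a : ℕ) ≤ g.fn n ∧ C.eval A σ (Fin.snoc v a)
  | _, _, .not C, v => ¬ C.eval A σ v
  | _, _, .and C C', v => C.eval A σ v ∧ C'.eval A σ v

/-- The content of one place after a parallel branch: `old` if no branch changed it, and the
new value otherwise.  (Conflicting changes cancel.) -/
def merge {α β : Type} (old : α) (active : β → Prop) (new : β → α) : α :=
  (theUnique fun y => y ≠ old ∧ ∃ b, active b ∧ new b = y).getD old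

open scoped Classical in
/-- The effect of instructions.  The parallel branches `z ≤ g(n)` all start with the same store,
and do not see each other's changes. -/
def Stmt.exec {base : ℕ} {ph : Phase} (A : Str E.aux n) :
    {k : ℕ} → Stmt E L base ph k → (Fin k → Fin n) → Store E L n D → Store E L n D
  | _, .skip, _, σ => σ
  | _, .seq P P', v, σ => P'.exec A v (P.exec A v σ)
  | _, .assign s args e _, v, σ =>
      match allSome (fun j => (args j).eval A σ v) with
      | some a => { σ with
          loc := Function.update σ.loc s (Function.update (σ.loc s) a (e.eval A σ v)) }
      | none => σ
  | _, .ite C P P', v, σ => choice (C.eval A σ v) (P.exec A v σ) (P'.exec A v σ)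
  | _, .fordo g P, v, σ =>
      { loc := fun s a => merge (σ.loc s a) (fun z : Fin n => (z : ℕ) ≤ g.fn n)
          fun z => (P.exec A (Fin.snoc v z) σ).loc s a
        sup := fun i x => merge (σ.sup i x) (fun z : Fin n => (z : ℕ) ≤ g.fn n)
          fun z => (P.exec A (Fin.snoc v z) σ).sup i x }
  | _, .invoke _ i idx δ blk args _, v, σ =>
      match allSome (fun j => (idx j).eval A σ v), allSome (fun j => (args j).eval A σ v) with
      | some x, some a => { σ with
          sup := Function.update σ.sup i (Function.update (σ.sup i) x
            ((D i).change δ (fun j => inBlock (blk j) (a j)) (σ.sup i x))) }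
      | _, _ => σ

/-- The returned value. -/
def Body.eval {κ : Kind} {k : ℕ} (A : Str E.aux n) (v : Fin k → Fin n) :
    Body E L κ k → Store E L n D → Val n κ
  | .ret e, σ => e.eval A σ v
  | .seq P B, σ => B.eval A v (P.exec A v σ)
  | .ite C B B', σ => choice (C.eval A σ v) (B.eval A v σ) (B'.eval A v σ)

end semantics

/-- The new content of one place of an auxiliary relation or function, if the tuples `x` with
`hit x` write the values `val x` to it.  A tuple is in the new relation if it is written with the
value true at least once, or if it is not written and was in the old relation. -/
def Val.write {n : ℕ} {β : Type} : {κ : Kind} → Val n κ → (β → Prop) → (β → Val n κ) → Val n κ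
  | .cond, old, hit, val => ((old : Prop) ∧ ¬ ∃ x, hit x) ∨ ∃ x, hit x ∧ val x
  | .term, old, hit, val =>
      choice (∃ x, hit x) (theUnique fun y => ∃ x, hit x ∧ val x = y).join old

/-- The store after the initial procedure of an update rule; local symbols are empty before. -/
def UpdateRule.storeAfter {E : Env} {n : ℕ} {D : ∀ i, DataType (E.sig i) (E.scale i * n)}
    {m : ℕ} {κ : Kind} {r : ℕ} (π : UpdateRule E m κ r) (A : Str E.aux n)
    (B : ∀ i : E.Sup, (Fin (E.idx i) → Fin n) → (D i).State) (p : Fin m → Fin n) :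
    Store E π.L n D :=
  π.initial.exec A p ⟨fun s _ => Val.empty n (π.L.kind s), B⟩

/-- The new interpretation of the auxiliary symbol that an update rule updates. -/
def UpdateRule.newValue {E : Env} {n : ℕ} {D : ∀ i, DataType (E.sig i) (E.scale i * n)}
    {m : ℕ} {κ : Kind} {r : ℕ} (π : UpdateRule E m κ r) (A : Str E.aux n)
    (B : ∀ i : E.Sup, (Fin (E.idx i) → Fin n) → (D i).State) (p : Fin m → Fin n)
    (old : (Fin r → Fin n) → Val n κ) : (Fin r → Fin n) → Val n κ :=
  let σ : Store E π.L n D := π.storeAfter A B p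
  fun a => (old a).write
    (fun x : Fin π.numVars → Fin n => (∀ j, (x j : ℕ) ≤ (π.bound j).fn n) ∧
      allSome (fun j => (π.target j).eval A σ (Fin.append p x)) = some a)
    (fun x => π.main.eval A (Fin.append p x) σ)

/-- The initial value that a first-order definition defines. -/
def StartDef.eval (n : ℕ) : {κ : Kind} → {r : ℕ} → StartDef κ r → (Fin r → Fin n) → Val n κ
  | .cond, _, φ, a => FirstOrder.Language.Formula.Realize φ a
  | .term, _, φ, a =>
      theUnique fun y : Fin n => FirstOrder.Language.Formula.Realize φ (Fin.snoc a y : _ → Fin n)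

open scoped Classical in
/-- The data type that a dynamic program implements on the domain `{0, …, n-1}`.  Its states are
the auxiliary structures together with the states of the supplementary instances.  All update
rules are evaluated on the old state. -/
def Program.sem : {S : Sig} → Program S → (n : ℕ) → DataType S n
  | _, .mk E sup start update query _, n =>
    let D : ∀ i, DataType (E.sig i) (E.scale i * n) := fun i => (sup i).sem (E.scale i * n)
    { State := Str E.aux n × (∀ i : E.Sup, (Fin (E.idx i) → Fin n) → (D i).State)
      start := (fun s => (start s).eval n, fun i _ => (D i).start)
      change := fun δ p st =>
        (fun s => (update δ s).newValue st.1 st.2 p (st.1 s),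
         fun i => if h : ∃ s, (update δ s).initial.Invokes i then
            ((update δ h.choose).storeAfter st.1 st.2 p).sup i else st.2 i)
      query := fun st Q p => (query Q).body.eval st.1 p
        (⟨fun s _ => Val.empty n ((query Q).L.kind s), st.2⟩ : Store E (query Q).L n D) }

/-- The program answers every query correctly, on every domain and after every sequence of change
operations that starts with the empty input structure. -/
def Program.Maintains {S : Sig} (P : Program S) (Γ : DynProblem S) : Prop :=
  ∀ (n : ℕ) (α : List (Σ δ : S.Change, Fin (S.changeArity δ) → Fin n)) (Q : S.queries.Sym)
    (a : Fin (S.queries.arity Q) → Fin n),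
    (P.sem n).query ((P.sem n).run α) Q a = (Γ n).query ((Γ n).run α) Q a

/-! ### Work -/

/-- The work of each operation. -/
structure Cost (S : Sig) where
  change : S.Change → ℕ
  query : S.queries.Sym → ℕ

section work

variable {E : Env} {L : Schema} (n : ℕ) (c : ∀ i : E.Sup, Cost (E.sig i))

/-- The work of a term or condition, where `c` is the work of the supplementary instances. -/
def Expr.work : {κ : Kind} → {k : ℕ} → Expr E L κ k → ℕ
  | _, _, .var _ => 1
  | _, _, .undef => 1
  | _, _, .add t t' => max t.work t'.work
  | _, _, .mul t t' => max t.work t'.work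
  | _, _, .eq t t' => max t.work t'.work
  | _, _, .le t t' => max t.work t'.work
  | _, _, .aux _ args => max 1 (Finset.univ.sup fun j => (args j).work)
  | _, _, .loc _ args => max 1 (Finset.univ.sup fun j => (args j).work)
  | _, _, .query i idx Q _ args _ =>
      max (max 1 ((c i).query Q))
        (max (Finset.univ.sup fun j => (idx j).work) (Finset.univ.sup fun j => (args j).work))
  | _, _, .ite C e e' => max C.work (max e.work e'.work)
  | _, _, .unique g C => g.count n * C.work
  | _, _, .exist g C => g.count n * C.work
  | _, _, .not C => C.work
  | _, _, .and C C' => max C.work C'.work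

/-- The work of instructions. -/
def Stmt.work {base : ℕ} {ph : Phase} : {k : ℕ} → Stmt E L base ph k → ℕ
  | _, .skip => 1
  | _, .seq P P' => max P.work P'.work
  | _, .assign _ args e _ => max (e.work n c) (Finset.univ.sup fun j => (args j).work n c)
  | _, .ite C P P' => max (C.work n c) (max P.work P'.work)
  | _, .fordo g P => g.count n * P.work
  | _, .invoke _ i idx δ _ args _ =>
      max (max 1 ((c i).change δ))
        (max (Finset.univ.sup fun j => (idx j).work n c)
          (Finset.univ.sup fun j => (args j).work n c))

/-- The work of a main procedure or query procedure. -/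
def Body.work {κ : Kind} {k : ℕ} : Body E L κ k → ℕ
  | .ret e => e.work n c
  | .seq P B => max (P.work n c) B.work
  | .ite C B B' => max (C.work n c) (max B.work B'.work)

/-- The work of an update rule: the initial procedure counts once, the main procedure once for
each tuple that satisfies the constraint. -/
def UpdateRule.work {m : ℕ} {κ : Kind} {r : ℕ} (π : UpdateRule E m κ r) : ℕ :=
  max (π.initial.work n c)
    ((∏ j, (π.bound j).count n) *
      max (π.main.work n c) (Finset.univ.sup fun j => (π.target j).work n c))

end work

/-- The work of the operations of a program on a domain of size `n`. -/
def Program.cost : {S : Sig} → Program S → ℕ → Cost S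
  | _, .mk E sup _ update query _, n =>
    let c : ∀ i : E.Sup, Cost (E.sig i) := fun i => (sup i).cost (E.scale i * n)
    { change := fun δ => Finset.univ.sup fun s => (update δ s).work n c
      query := fun Q => (query Q).body.work n c }

/-- The dynamic problem can be maintained in DynFO with work `O(W(n))` per change and query
operation. -/
def MaintainableWithWork {S : Sig} (Γ : DynProblem S) (W : ℕ → ℝ) : Prop :=
  ∃ P : Program S, P.Maintains Γ ∧
    (∀ δ : S.Change, (fun n => ((P.cost n).change δ : ℝ)) =O[atTop] W) ∧
    (∀ Q : S.queries.Sym, (fun n => ((P.cost n).query Q : ℝ)) =O[atTop] W)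

/-! ### The dynamic problems -/

/-- A sequence `w₀ … wₙ₋₁` of letters or `ε` (`none`). -/
abbrev Word (A : Type) (n : ℕ) : Type := Fin n → Option A

/-- The string `w₀ ∘ … ∘ wₙ₋₁`. -/
def Word.str {A : Type} {n : ℕ} (w : Word A n) : List A := (List.ofFn w).reduceOption

/-- Elementary changes of one position. -/
inductive LetterOp (A : Type)
  | set (a : A)
  | reset

open scoped Classical in
/-- `set a` sets a position to `a` if it is `ε`; `reset` sets it to `ε`. -/
def Word.apply {A : Type} {n : ℕ} (w : Word A n) (i : Fin n) : LetterOp A → Word A n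
  | .set a => if w i = none then Function.update w i (some a) else w
  | .reset => Function.update w i none

/-- A single Boolean query without parameters. -/
abbrev boolQuery : Schema := ⟨Unit, inferInstance, fun _ => .cond, fun _ => 0⟩

abbrev memberSig (A : Type) : Sig := ⟨LetterOp A, fun _ => 1, boolQuery⟩

/-- `Member(L)`: is the current string in `L`? -/
def Member {A : Type} (L : Language A) : DynProblem (memberSig A) := fun n =>
  { State := Word A n
    start := fun _ => none
    change := fun op p w => w.apply (p (0 : Fin 1)) op
    query := fun w _ _ => w.str ∈ L }

/-- The change operations come with a flag that says to which of the two strings they apply. -/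
abbrev stringEqualitySig (A : Type) : Sig := ⟨Bool × LetterOp A, fun _ => 1, boolQuery⟩

/-- `StringEquality` over the alphabet `A`: are the two current strings equal? -/
def StringEquality (A : Type) : DynProblem (stringEqualitySig A) := fun n =>
  { State := Word A n × Word A n
    start := (fun _ => none, fun _ => none)
    change := fun op p w => match op.1 with
      | false => (w.1.apply (p (0 : Fin 1)) op.2, w.2)
      | true => (w.1, w.2.apply (p (0 : Fin 1)) op.2)
    query := fun w _ _ => w.1.str = w.2.str }

/-- Opening and closing parentheses of `k` types. -/
inductive Paren (k : ℕ)
  | op (i : Fin k)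
  | cl (i : Fin k)

/-- Well-balanced strings of parentheses. -/
inductive Balanced {k : ℕ} : List (Paren k) → Prop
  | nil : Balanced []
  | wrap (i : Fin k) {w : List (Paren k)} : Balanced w → Balanced (.op i :: w ++ [.cl i])
  | append {w w' : List (Paren k)} : Balanced w → Balanced w' → Balanced (w ++ w')

/-- The Dyck language `D_k`. -/
def dyck (k : ℕ) : Language (Paren k) := {w | Balanced w}

end DynFO

end

noncomputable section

namespace DynFO

/-! ### Elementary facts about the semantics -/

/-! Part (b) is a direct reduction. Write `u` with opening parentheses and append the reversal of
`v` in closing ones: running the result on a stack shows that it is well-balanced exactly if `u = v`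
(`balanced_op_cl_iff`). One instance of `Member(D_k)` on a domain of size `2n` holds this string,
and the reflected position `n - 1 - i` is read from a static, first-order defined function. The
additional constant work is absorbed by `W`, because every query procedure has work at least one
(`one_isBigO_of_query`).

For part (a), regard the string as a height function and split the positions, for each level `z`,
into dyadic intervals of length `2 ^ z`. A parenthesis is unmatched at level `z` if it has no
partner in its interval. Partners that meet at level `z + 1` but not at level `z` lie on different
sides of the midpoint of their interval, so all such pairs of one interval are nested in each other.
Reflecting the closing ones inside each interval therefore lines them up with the opening ones, and
the statement that all pairs of a level have equal types becomes a single equality of strings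
(`str_levelTypes_eq_iff`). The word is well-balanced exactly if these equalities hold at all levels
and some level has no unmatched parenthesis (`balanced_str_iff`). There are `O(log n)` levels, hence
`O(log n)` instances of `StringEquality`.

An effective change raises or lowers the step at one position `p` by one, and then the set of
unmatched parentheses of each level changes at exactly one position (`IsToggle.toggles`). For a
raise this is the next unmatched closing parenthesis from `p` on in the interval of `p`; if there is
none, the left end of the outermost pair around `p`; and if there is no such pair, `p` itself.
Lowering is the mirror image (`IsToggle.toggles_mirror`), which is why everything is kept in both
directions. A pair around `p` of a lower level cannot begin before one of a higher level, so the
outermost pair is found at the highest level that has parentheses on both sides of `p` in its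
interval, and its left end is the leftmost of these parentheses (`partner_of_least_matchedAt`). The
parentheses that belong to level `z` are those unmatched at `z - 1` but not at `z`; hence at most
two positions of the data of each level have to be repaired (`HasInput.fixLevel`).

The sets are accessed through successor queries. `succProgram` answers them with work `O((log n) ^
2)` from the least element in each dyadic interval. One round over all levels then costs `O(log n)`
times the work of a string equality operation plus `(log n) ^ 2`.

The static functions on dyadic intervals need powers of two, which are first-order definable from
order, addition and multiplication on `{0, …, n-1}` (`FODef.two_pow`). -/

theorem theUnique_eq_some {α : Type} {p : α → Prop} {a : α} :
    theUnique p = some a ↔ p a ∧ ∀ b, p b → b = a := by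
  unfold theUnique
  constructor
  · intro h
    split_ifs at h with hu
    obtain rfl := Option.some.inj h
    exact ⟨hu.choose_spec.1, hu.choose_spec.2⟩
  · rintro ⟨h1, h2⟩
    have hu : ∃! a, p a := ⟨a, h1, h2⟩
    rw [dif_pos hu]
    exact congrArg some (h2 _ hu.choose_spec.1)

theorem theUnique_of {α : Type} {p : α → Prop} {a : α} (h : p a) (h' : ∀ b, p b → b = a) :
    theUnique p = some a := theUnique_eq_some.2 ⟨h, h'⟩

theorem theUnique_eq_none {α : Type} {p : α → Prop} :
    theUnique p = none ↔ ¬ ∃! a, p a := by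
  unfold theUnique
  split_ifs with hu <;> simp [hu]

theorem theUnique_congr {α : Type} {p q : α → Prop} (h : ∀ a, p a ↔ q a) :
    theUnique p = theUnique q := by
  have : p = q := funext fun a => propext (h a)
  rw [this]

theorem allSome_of_forall {α : Type} {r : ℕ} {f : Fin r → Option α} {a : Fin r → α}
    (h : ∀ i, f i = some (a i)) : allSome f = some a := by
  unfold allSome
  rw [dif_pos (fun i => by simp [h i])]
  congr 1
  funext i
  simp [h i]

theorem allSome_eq_some {α : Type} {r : ℕ} {f : Fin r → Option α} {a : Fin r → α} :
    allSome f = some a ↔ ∀ i, f i = some (a i) := by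
  refine ⟨fun h i => ?_, allSome_of_forall⟩
  unfold allSome at h
  split_ifs at h with hs
  obtain rfl := Option.some.inj h
  simp

theorem allSome_eq_none {α : Type} {r : ℕ} {f : Fin r → Option α} (i : Fin r) (h : f i = none) :
    allSome f = none := by
  unfold allSome
  rw [dif_neg]
  intro hs
  simpa [h] using hs i

@[simp] theorem allSome_zero {α : Type} (f : Fin 0 → Option α) (a : Fin 0 → α) :
    allSome f = some a := allSome_of_forall fun i => i.elim0

@[simp] theorem allSome_two {α : Type} (f : Fin 2 → Option α) :
    allSome f = (f 0).bind fun x => (f 1).map fun y => ![x, y] := by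
  cases h : f 0 with
  | none => simp [allSome_eq_none 0 h]
  | some x =>
    cases h1 : f 1 with
    | none => simp [allSome_eq_none 1 h1]
    | some y =>
      refine allSome_of_forall fun i => ?_
      fin_cases i <;> simp [h, h1]

theorem choice_true {α : Type} {p : Prop} (h : p) (a b : α) : choice p a b = a := if_pos h

theorem choice_false {α : Type} {p : Prop} (h : ¬ p) (a b : α) : choice p a b = b := if_neg h

/-- Cancellation of conflicting writes never arises if only one branch can change a place. All
parallel loops below are of this kind: the branch of level `z` owns the places with index `z`. -/
theorem merge_of_owner {α β : Type} {old : α} {active : β → Prop} {new : β → α} (b₀ : β)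
    (h : ∀ b, b ≠ b₀ → new b = old) :
    merge old active new = choice (active b₀) (new b₀) old := by
  unfold merge
  by_cases hb : active b₀ ∧ new b₀ ≠ old
  · rw [choice_true hb.1, theUnique_of (a := new b₀) ⟨hb.2, b₀, hb.1, rfl⟩]
    · rfl
    · rintro y ⟨hy, b, -, rfl⟩
      by_cases h0 : b = b₀
      · rw [h0]
      · exact absurd (h b h0) hy
  · rw [theUnique_eq_none.2]
    · simp only [Option.getD_none]
      by_cases h1 : active b₀
      · rw [choice_true h1]
        by_contra h2
        exact hb ⟨h1, fun h3 => h2 h3.symm⟩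
      · rw [choice_false h1]
    · rintro ⟨y, ⟨hy, b, hba, rfl⟩, -⟩
      by_cases h0 : b = b₀
      · subst h0; exact hb ⟨hba, hy⟩
      · exact hy (h b h0)

theorem Val.write_of_hit {n : ℕ} {β : Type} {κ : Kind} {old v : Val n κ} {hit : β → Prop}
    {val : β → Val n κ} (x₀ : β) (h₀ : hit x₀) (h : ∀ x, hit x → val x = v) :
    Val.write old hit val = v := by
  cases κ with
  | cond =>
    simp only [Val.write]
    apply propext
    constructor
    · rintro (⟨-, h2⟩ | ⟨x, hx, hv⟩)
      · exact absurd ⟨x₀, h₀⟩ h2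
      · rw [← h x hx]; exact hv
    · intro hv
      exact Or.inr ⟨x₀, h₀, by rw [h x₀ h₀]; exact hv⟩
  | term =>
    simp only [Val.write]
    rw [choice_true ⟨x₀, h₀⟩, theUnique_of (a := v) ⟨x₀, h₀, h x₀ h₀⟩]
    · rfl
    · rintro b ⟨x, hx, rfl⟩
      exact h x hx

theorem Val.write_of_not_hit {n : ℕ} {β : Type} {κ : Kind} {old : Val n κ} {hit : β → Prop}
    {val : β → Val n κ} (h : ∀ x, ¬ hit x) : Val.write old hit val = old := by
  cases κ with
  | cond =>
    simp only [Val.write]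
    apply propext
    constructor
    · rintro (⟨h1, -⟩ | ⟨x, hx, -⟩)
      · exact h1
      · exact absurd hx (h x)
    · intro ho
      exact Or.inl ⟨ho, fun ⟨x, hx⟩ => h x hx⟩
  | term =>
    simp only [Val.write]
    rw [choice_false (fun ⟨x, hx⟩ => h x hx)]

theorem Val.write_of_same {n : ℕ} {β : Type} {κ : Kind} {old : Val n κ} {hit : β → Prop}
    {val : β → Val n κ} (h : ∀ x, hit x → val x = old) : Val.write old hit val = old := by
  by_cases hx : ∃ x, hit x
  · obtain ⟨x, hx⟩ := hx
    exact Val.write_of_hit x hx h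
  · exact Val.write_of_not_hit fun x hx' => hx ⟨x, hx'⟩

@[simp] theorem inBlock_val {c n : ℕ} (b : Fin c) (a : Fin n) :
    (inBlock b a : ℕ) = a + n * b := rfl

theorem Expr.eval_aux_of {E : Env} {L : Schema} {n : ℕ}
    {D : ∀ i, DataType (E.sig i) (E.scale i * n)} {A : Str E.aux n} {σ : Store E L n D} {k : ℕ}
    {v : Fin k → Fin n} {s : E.aux.Sym} {args : Fin (E.aux.arity s) → Expr E L .term k}
    {a : Fin (E.aux.arity s) → Fin n} (h : allSome (fun j => (args j).eval A σ v) = some a) :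
    (Expr.aux s args).eval A σ v = A s a := by
  simp only [Expr.eval, h]

theorem Expr.eval_query_of {E : Env} {L : Schema} {n : ℕ}
    {D : ∀ i, DataType (E.sig i) (E.scale i * n)} {A : Str E.aux n} {σ : Store E L n D} {k : ℕ}
    {v : Fin k → Fin n} {i : E.Sup} {idx : Fin (E.idx i) → Expr E L .term k}
    {Q : (E.sig i).queries.Sym} {blk : Fin ((E.sig i).queries.arity Q) → Fin (E.scale i)}
    {args : Fin ((E.sig i).queries.arity Q) → Expr E L .term k} {out : Fin (E.scale i)}
    {x : Fin (E.idx i) → Fin n} {a : Fin ((E.sig i).queries.arity Q) → Fin n}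
    (hx : allSome (fun j => (idx j).eval A σ v) = some x)
    (ha : allSome (fun j => (args j).eval A σ v) = some a) :
    (Expr.query i idx Q blk args out).eval A σ v =
      ((D i).query (σ.sup i x) Q (fun j => inBlock (blk j) (a j))).fromBlock out := by
  simp only [Expr.eval, hx, ha]

section invoke

variable {E : Env} {L : Schema} {n : ℕ} {D : ∀ i, DataType (E.sig i) (E.scale i * n)}
  {A : Str E.aux n} {σ : Store E L n D} {base k : ℕ} {ph : Phase} {v : Fin k → Fin n}
  {allowed : ph = .initial} {i : E.Sup} {idx : Fin (E.idx i) → Expr E L .term k}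
  {δ : (E.sig i).Change} {blk : Fin ((E.sig i).changeArity δ) → Fin (E.scale i)}
  {args : Fin ((E.sig i).changeArity δ) → Expr E L .term k}
  {guarded : ∀ j : Fin k, base ≤ j → ∃ a, idx a = Expr.var j}

theorem Stmt.exec_invoke_loc :
    ((Stmt.invoke (base := base) allowed i idx δ blk args guarded).exec A v σ).loc = σ.loc := by
  simp only [Stmt.exec]
  split <;> rfl

theorem Stmt.exec_invoke_sup_of_ne {i' : E.Sup} (h : i' ≠ i) :
    ((Stmt.invoke (base := base) allowed i idx δ blk args guarded).exec A v σ).sup i' =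
      σ.sup i' := by
  simp only [Stmt.exec]
  split
  · classical exact Function.update_of_ne h _ _
  · rfl

theorem Stmt.exec_invoke_sup_self {x : Fin (E.idx i) → Fin n}
    {a : Fin ((E.sig i).changeArity δ) → Fin n}
    (hx : allSome (fun j => (idx j).eval A σ v) = some x)
    (ha : allSome (fun j => (args j).eval A σ v) = some a) :
    ((Stmt.invoke (base := base) allowed i idx δ blk args guarded).exec A v σ).sup i x =
      (D i).change δ (fun j => inBlock (blk j) (a j)) (σ.sup i x) := by
  simp only [Stmt.exec, hx, ha, Function.update_self]

theorem Stmt.exec_invoke_sup_of_idx_ne {x y : Fin (E.idx i) → Fin n}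
    (hx : allSome (fun j => (idx j).eval A σ v) = some x) (hy : y ≠ x) :
    ((Stmt.invoke (base := base) allowed i idx δ blk args guarded).exec A v σ).sup i y =
      σ.sup i y := by
  simp only [Stmt.exec, hx]
  split
  · rename_i h1 h2
    obtain rfl := Option.some.inj h1
    simp only [Function.update_self, Function.update_of_ne hy]
  · rfl

theorem Stmt.exec_invoke_of_undef {j : Fin ((E.sig i).changeArity δ)}
    (h : (args j).eval A σ v = none) :
    (Stmt.invoke (base := base) allowed i idx δ blk args guarded).exec A v σ = σ := by
  have h' : allSome (fun j => (args j).eval A σ v) = none := allSome_eq_none j h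
  simp only [Stmt.exec, h']
  split
  · contradiction
  · rfl

end invoke

/-! ### The operations of a program -/

section mk

variable {S : Sig} {E : Env} {sup : ∀ i : E.Sup, Program (E.sig i)}
  {start : ∀ s : E.aux.Sym, StartDef (E.aux.kind s) (E.aux.arity s)}
  {update : ∀ (δ : S.Change) (s : E.aux.Sym),
    UpdateRule E (S.changeArity δ) (E.aux.kind s) (E.aux.arity s)}
  {query : ∀ Q : S.queries.Sym, QueryRule E (S.queries.arity Q) (S.queries.kind Q)}
  {exclusive : ∀ (δ : S.Change) (i : E.Sup) (s s' : E.aux.Sym),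
    (update δ s).initial.Invokes i → (update δ s').initial.Invokes i → s = s'}

theorem Program.sem_mk_change_aux (n : ℕ) (δ : S.Change) (p : Fin (S.changeArity δ) → Fin n)
    (st : ((Program.mk E sup start update query exclusive).sem n).State) (s : E.aux.Sym)
    (a : Fin (E.aux.arity s) → Fin n) :
    (((Program.mk E sup start update query exclusive).sem n).change δ p st).1 s a =
      Val.write (st.1 s a)
        (fun x : Fin (update δ s).numVars → Fin n =>
          (∀ j, (x j : ℕ) ≤ ((update δ s).bound j).fn n) ∧
            allSome (fun j => ((update δ s).target j).eval st.1
              ((update δ s).storeAfter (D := fun i => (sup i).sem (E.scale i * n)) st.1 st.2 p)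
              (Fin.append p x)) = some a)
        (fun x => (update δ s).main.eval st.1 (Fin.append p x)
          ((update δ s).storeAfter (D := fun i => (sup i).sem (E.scale i * n)) st.1 st.2 p)) :=
  rfl

theorem Program.sem_mk_change_sup (n : ℕ) (δ : S.Change) (p : Fin (S.changeArity δ) → Fin n)
    (st : ((Program.mk E sup start update query exclusive).sem n).State) (i : E.Sup)
    (s : E.aux.Sym) (h : (update δ s).initial.Invokes i) :
    (((Program.mk E sup start update query exclusive).sem n).change δ p st).2 i =
      ((update δ s).storeAfter (D := fun i => (sup i).sem (E.scale i * n)) st.1 st.2 p).sup i := by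
  have hex : ∃ s, (update δ s).initial.Invokes i := ⟨s, h⟩
  have hs : hex.choose = s := exclusive δ i _ _ hex.choose_spec h
  simp only [Program.sem]
  rw [dif_pos hex, hs]

theorem Program.sem_mk_query (n : ℕ)
    (st : ((Program.mk E sup start update query exclusive).sem n).State) (Q : S.queries.Sym)
    (p : Fin (S.queries.arity Q) → Fin n) :
    ((Program.mk E sup start update query exclusive).sem n).query st Q p =
      (query Q).body.eval (D := fun i => (sup i).sem (E.scale i * n)) st.1 p
        ⟨fun s _ => Val.empty n ((query Q).L.kind s), st.2⟩ := rfl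

theorem Program.cost_mk_change (n : ℕ) (δ : S.Change) :
    ((Program.mk E sup start update query exclusive).cost n).change δ =
      Finset.univ.sup fun s => (update δ s).work n fun i => (sup i).cost (E.scale i * n) := rfl

theorem Program.cost_mk_query (n : ℕ) (Q : S.queries.Sym) :
    ((Program.mk E sup start update query exclusive).cost n).query Q =
      (query Q).body.work n fun i => (sup i).cost (E.scale i * n) := rfl

end mk

/-! ### States of instances that represent an input -/

/-- The state `st` of a program and the state `γ` of a problem result from the same changes. -/
def Reps {S : Sig} (P : Program S) (Γ : DynProblem S) {n : ℕ} (st : (P.sem n).State)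
    (γ : (Γ n).State) : Prop :=
  ∃ α, st = (P.sem n).run α ∧ γ = (Γ n).run α

theorem Reps.start {S : Sig} (P : Program S) (Γ : DynProblem S) (n : ℕ) :
    Reps P Γ (P.sem n).start (Γ n).start := ⟨[], rfl, rfl⟩

theorem Reps.change {S : Sig} {P : Program S} {Γ : DynProblem S} {n : ℕ} {st : (P.sem n).State}
    {γ : (Γ n).State} (h : Reps P Γ st γ) (δ : S.Change) (p : Fin (S.changeArity δ) → Fin n) :
    Reps P Γ ((P.sem n).change δ p st) ((Γ n).change δ p γ) := by
  obtain ⟨α, rfl, rfl⟩ := h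
  exact ⟨α ++ [⟨δ, p⟩], by simp [DataType.run], by simp [DataType.run]⟩

theorem Reps.query {S : Sig} {P : Program S} {Γ : DynProblem S} (hP : P.Maintains Γ) {n : ℕ}
    {st : (P.sem n).State} {γ : (Γ n).State} (h : Reps P Γ st γ) (Q : S.queries.Sym)
    (a : Fin (S.queries.arity Q) → Fin n) :
    (P.sem n).query st Q a = (Γ n).query γ Q a := by
  obtain ⟨α, rfl, rfl⟩ := h
  exact hP n α Q a

/-- The invariant relates both states after the same changes, so correctness is an induction that
removes the last change. -/
theorem maintains_of_invariant {S : Sig} {P : Program S} {Γ : DynProblem S}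
    (I : ∀ n, (P.sem n).State → (Γ n).State → Prop)
    (start : ∀ n, I n (P.sem n).start (Γ n).start)
    (change : ∀ n st γ, I n st γ → ∀ δ p, I n ((P.sem n).change δ p st) ((Γ n).change δ p γ))
    (query : ∀ n st γ, I n st γ → ∀ Q a, (P.sem n).query st Q a = (Γ n).query γ Q a) :
    P.Maintains Γ := by
  intro n α Q a
  refine query n _ _ ?_ Q a
  induction α using List.reverseRecOn with
  | nil => exact start n
  | append_singleton α op ih =>
    simp only [DataType.run, List.foldl_append, List.foldl_cons, List.foldl_nil] at ih ⊢
    exact change n _ _ ih op.1 op.2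

/-! ### Bounds for the work -/

theorem UpdateRule.work_le_of_numVars_zero {E : Env} {n : ℕ} {c : ∀ i : E.Sup, Cost (E.sig i)}
    {m r : ℕ} {κ : Kind} {π : UpdateRule E m κ r} {B : ℕ} (h0 : π.numVars = 0)
    (hi : π.initial.work n c ≤ B) (hm : π.main.work n c ≤ B)
    (ht : ∀ j, (π.target j).work n c ≤ B) : π.work n c ≤ B := by
  have : IsEmpty (Fin π.numVars) := by rw [h0]; infer_instance
  rw [UpdateRule.work, Finset.univ_eq_empty, Finset.prod_empty, one_mul]
  exact max_le hi (max_le hm (Finset.sup_le fun j _ => ht j))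

theorem Bound.one_le_count (g : Bound) {n : ℕ} (hn : 1 ≤ n) : 1 ≤ g.count n :=
  le_min (Nat.le_add_left 1 _) hn

/-- On a nonempty domain a bounded quantifier ranges over at least one element, so no construct can
bring the work down to zero. -/
theorem Expr.one_le_work {E : Env} {L : Schema} {n : ℕ} (hn : 1 ≤ n)
    (c : ∀ i : E.Sup, Cost (E.sig i)) {κ : Kind} {k : ℕ} (e : Expr E L κ k) : 1 ≤ e.work n c := by
  induction e with
  | var => simp [Expr.work]
  | undef => simp [Expr.work]
  | add t t' h h' => simp [Expr.work, h]
  | mul t t' h h' => simp [Expr.work, h]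
  | eq t t' h h' => simp [Expr.work, h]
  | le t t' h h' => simp [Expr.work, h]
  | aux => simp [Expr.work]
  | loc => simp [Expr.work]
  | query => simp [Expr.work]
  | ite C e e' h => simp [Expr.work, h]
  | unique g C h => simpa [Expr.work] using Nat.mul_le_mul (g.one_le_count hn) h
  | exist g C h => simpa [Expr.work] using Nat.mul_le_mul (g.one_le_count hn) h
  | not C h => simpa [Expr.work] using h
  | and C C' h => simp [Expr.work, h]

theorem Body.one_le_work {E : Env} {L : Schema} {n : ℕ} (hn : 1 ≤ n)
    (c : ∀ i : E.Sup, Cost (E.sig i)) {κ : Kind} {k : ℕ} (B : Body E L κ k) :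
    1 ≤ B.work n c := by
  induction B with
  | ret e => exact e.one_le_work hn c
  | seq P B h => simp [Body.work, h]
  | ite C B B' h => simp [Body.work, h]

theorem Program.one_le_cost_query {S : Sig} (P : Program S) {n : ℕ} (hn : 1 ≤ n)
    (Q : S.queries.Sym) : 1 ≤ (P.cost n).query Q := by
  cases P with
  | mk E sup start update query exclusive => exact Body.one_le_work hn _ _

/-! ### First-order definability with order, addition and multiplication -/

/-- The family `R` of relations on the domains `{0, …, n-1}` is defined by one formula. -/
def FODef {α : Type} (R : ∀ n, (α → Fin n) → Prop) : Prop :=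
  ∃ φ : arith.Formula α, ∀ n (a : α → Fin n), φ.Realize a ↔ R n a

namespace FODef

open FirstOrder FirstOrder.Language

variable {α : Type}

theorem of_iff {R S : ∀ n, (α → Fin n) → Prop} (h : FODef R) (h' : ∀ n a, S n a ↔ R n a) :
    FODef S := by
  obtain ⟨φ, hφ⟩ := h
  exact ⟨φ, fun n a => (hφ n a).trans (h' n a).symm⟩

theorem le (i j : α) : FODef fun n a => (a i : Fin n) ≤ a j := by
  refine ⟨Relations.formula₂ (L := arith) ArithRel.le (Term.var i) (Term.var j), fun n a => ?_⟩
  exact Formula.realize_rel₂ (L := arith)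

theorem add (i j k : α) : FODef fun _ a => (a i : ℕ) + (a j : ℕ) = (a k : ℕ) := by
  refine ⟨Relations.formula (L := arith) ArithRel.add ![Term.var i, Term.var j, Term.var k],
    fun n a => ?_⟩
  exact Formula.realize_rel (L := arith)

theorem mul (i j k : α) : FODef fun _ a => (a i : ℕ) * (a j : ℕ) = (a k : ℕ) := by
  refine ⟨Relations.formula (L := arith) ArithRel.mul ![Term.var i, Term.var j, Term.var k],
    fun n a => ?_⟩
  exact Formula.realize_rel (L := arith)

theorem false : FODef fun n (_ : α → Fin n) => False :=
  ⟨⊥, fun _ _ => Iff.rfl⟩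

theorem not {R : ∀ n, (α → Fin n) → Prop} (h : FODef R) : FODef fun n a => ¬ R n a := by
  obtain ⟨φ, hφ⟩ := h
  exact ⟨φ.not, fun n a => by rw [Formula.realize_not, hφ]⟩

theorem and {R S : ∀ n, (α → Fin n) → Prop} (h : FODef R) (h' : FODef S) :
    FODef fun n a => R n a ∧ S n a := by
  obtain ⟨φ, hφ⟩ := h
  obtain ⟨ψ, hψ⟩ := h'
  exact ⟨φ ⊓ ψ, fun n a => by rw [Formula.realize_inf, hφ, hψ]⟩

theorem or {R S : ∀ n, (α → Fin n) → Prop} (h : FODef R) (h' : FODef S) :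
    FODef fun n a => R n a ∨ S n a :=
  (h.not.and h'.not).not.of_iff fun n a => by tauto

theorem imp {R S : ∀ n, (α → Fin n) → Prop} (h : FODef R) (h' : FODef S) :
    FODef fun n a => R n a → S n a :=
  (h.and h'.not).not.of_iff fun n a => by tauto

/-- The element `none` of `Option α` plays the role of the quantified variable, so nested
quantifiers are nested options and no variable has to be renamed. -/
theorem ex {S : ∀ n, (α → Fin n) → Fin n → Prop}
    (h : FODef (α := Option α) fun n a => S n (fun i => a (some i)) (a none)) :
    FODef fun n a => ∃ x, S n a x := by
  obtain ⟨φ, hφ⟩ := h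
  let f : Option α → α ⊕ Unit := fun o => o.elim (Sum.inr ()) Sum.inl
  refine ⟨(φ.relabel f).iExs Unit, fun n a => ?_⟩
  rw [Formula.realize_iExs]
  constructor
  · rintro ⟨x, hx⟩
    rw [Formula.realize_relabel, hφ] at hx
    exact ⟨x (), hx⟩
  · rintro ⟨x, hx⟩
    refine ⟨fun _ => x, ?_⟩
    rw [Formula.realize_relabel, hφ]
    exact hx

theorem all {S : ∀ n, (α → Fin n) → Fin n → Prop}
    (h : FODef (α := Option α) fun n a => S n (fun i => a (some i)) (a none)) :
    FODef fun n a => ∀ x, S n a x :=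
  (ex (S := fun n a x => ¬ S n a x) h.not).not.of_iff fun n a => by simp

theorem zero (i : α) : FODef fun n a => ((a i : Fin n) : ℕ) = 0 :=
  (add i i i).of_iff fun n a => by omega

theorem one (i : α) : FODef fun n a => ((a i : Fin n) : ℕ) = 1 :=
  ((mul i i i).and (zero i).not).of_iff fun n a => by
    constructor
    · intro h; rw [h]; simp
    · rintro ⟨h1, h2⟩
      exact Nat.eq_of_mul_eq_mul_left (Nat.pos_of_ne_zero h2) (by rw [h1, mul_one])

theorem lt (i j : α) : FODef fun n a => (a i : Fin n) < a j :=
  (le j i).not.of_iff fun n a => by simp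

/-- A positive number is a power of two exactly if each of its divisors is one or even, since
otherwise an odd prime divides it. Divisors and cofactors do not exceed the number, so the
quantifiers can stay inside the domain. -/
theorem isTwoPow (i : α) : FODef fun n a => ∃ s : ℕ, ((a i : Fin n) : ℕ) = 2 ^ s := by
  refine ((zero i).not.and (all (S := fun n a d => (∃ e : Fin n, (d : ℕ) * e = a i) →
    (d : ℕ) = 1 ∨ ∃ f : Fin n, (f : ℕ) + f = d) ?_)).of_iff fun n a => ?_
  · exact (ex (mul (some none) none (some (some i)))).imp
      ((one none).or (ex (add none none (some none))))
  · constructor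
    · rintro ⟨s, hs⟩
      refine ⟨by rw [hs]; positivity, fun d ⟨e, he⟩ => ?_⟩
      have hd : (d : ℕ) ∣ 2 ^ s := ⟨e, by rw [he, hs]⟩
      obtain ⟨m, hm, hdm⟩ := (Nat.dvd_prime_pow Nat.prime_two).1 hd
      rcases m with _ | m
      · left; simpa using hdm
      · right
        have : 2 ^ m < n := by
          have := d.isLt
          rw [hdm, pow_succ] at this
          omega
        exact ⟨⟨2 ^ m, this⟩, by simp [hdm, pow_succ]; ring⟩
    · rintro ⟨h0, h⟩
      rcases Nat.eq_two_pow_or_exists_odd_prime_and_dvd (a i : ℕ) with ⟨s, hs⟩ | ⟨p, hp, hd, ho⟩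
      · exact ⟨s, hs⟩
      · exfalso
        have hpn : p < n := lt_of_le_of_lt (Nat.le_of_dvd (Nat.pos_of_ne_zero h0) hd) (a i).isLt
        obtain ⟨e, he⟩ := hd
        have hen : e < n := lt_of_le_of_lt
          (Nat.le_of_dvd (Nat.pos_of_ne_zero h0) ⟨p, by rw [he, mul_comm]⟩) (a i).isLt
        rcases h ⟨p, hpn⟩ ⟨⟨e, hen⟩, he.symm⟩ with h1 | ⟨f, hf⟩
        · exact hp.one_lt.ne' h1
        · simp only at hf
          rw [← hf] at ho
          exact (Nat.not_odd_iff_even.2 ⟨_, rfl⟩) ho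

end FODef

/-! ### Definability of powers of two -/

/-- The first two terms of the expansion of a power in the base minus one. -/
theorem exists_pow_expansion (b w : ℕ) :
    ∃ t u : ℕ, b * t + 1 = (b + 1) ^ w ∧ b * u + w = t := by
  induction w with
  | zero => exact ⟨0, 0, by simp⟩
  | succ w ih =>
    obtain ⟨t, u, h1, h2⟩ := ih
    refine ⟨b * t + t + 1, t + u, ?_, ?_⟩
    · rw [pow_succ, ← h1]; ring
    · rw [← h2]; ring

/-- Since `2 ^ s - 1` divides `2 ^ m - 1`, also `s` divides `m`, so `2 ^ m` is a power of `b + 1`,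
with exponent `w'` say. Expanding that power in `b` gives `w' ≡ t ≡ w` modulo `b`, and `w < b` is
the least exponent in this residue class. -/
theorem pow_le_of_expansion {s m b w t u : ℕ} (hb : b + 1 = 2 ^ s) (hw : w < b)
    (ht : b * t + 1 = 2 ^ m) (hu : b * u + w = t) : (b + 1) ^ w ≤ 2 ^ m := by
  have hd : s ∣ m := by
    have h1 := Nat.pow_sub_one_mod_pow_sub_one 2 s m
    rw [← hb, ← ht] at h1
    simp only [Nat.add_sub_cancel, Nat.mul_mod_right] at h1
    have h2 : 2 ^ (m % s) = 1 := by
      have : 0 < 2 ^ (m % s) := by positivity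
      omega
    have h3 : m % s = 0 := by
      by_contra h3
      have := Nat.one_lt_two_pow h3
      omega
    exact Nat.dvd_of_mod_eq_zero h3
  obtain ⟨w', rfl⟩ := hd
  rw [pow_mul, ← hb] at ht ⊢
  obtain ⟨t', u', h1, h2⟩ := exists_pow_expansion b w'
  have htt : t' = t := Nat.eq_of_mul_eq_mul_left (by omega : 0 < b) (by omega)
  subst htt
  refine Nat.pow_le_pow_right (by omega) ?_
  have h3 : (b * u + w) % b = (b * u' + w') % b := by rw [hu, h2]
  rw [Nat.mul_add_mod, Nat.mul_add_mod, Nat.mod_eq_of_lt hw] at h3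
  rw [h3]
  exact Nat.mod_le _ _

namespace FODef

variable {α : Type}

/-- Powers of a power of two, with small exponents. -/
theorem pow_base (i j k : α) : FODef fun n a => (∃ s : ℕ, ((a i : Fin n) : ℕ) = 2 ^ s) ∧
    ((a j : Fin n) : ℕ) + 1 < a i ∧ ((a k : Fin n) : ℕ) = (a i : ℕ) ^ (a j : ℕ) := by
  -- With `B = b + 1`, the equations `P = b t + 1` and `t = b u + w` say that the exponent of `P` to
  -- the base `B` is congruent to `w` modulo `b`. They involve no exponentiation except in the test
  -- for powers of two.
  have key : ∀ (β : Type) (i j k : β), FODef fun n a =>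
      (∃ s : ℕ, ((a i : Fin n) : ℕ) = 2 ^ s) ∧ (∃ s : ℕ, ((a k : Fin n) : ℕ) = 2 ^ s) ∧
      ∃ o b t u x y : Fin n, (o : ℕ) = 1 ∧ (b : ℕ) + o = a i ∧ a j < b ∧ (b : ℕ) * t = x ∧
        (x : ℕ) + o = a k ∧ (b : ℕ) * u = y ∧ (y : ℕ) + a j = t := by
    intro β i j k
    refine (isTwoPow i).and ((isTwoPow k).and ?_)
    refine ex (ex (ex (ex (ex (ex ?_)))))
    exact (one _).and ((add _ _ _).and ((lt _ _).and ((mul _ _ _).and ((add _ _ _).and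
      ((mul _ _ _).and (add _ _ _))))))
  have hS : ∀ (n : ℕ) (B w P : Fin n),
      ((∃ s : ℕ, (B : ℕ) = 2 ^ s) ∧ (∃ s : ℕ, (P : ℕ) = 2 ^ s) ∧
        ∃ o b t u x y : Fin n, (o : ℕ) = 1 ∧ (b : ℕ) + o = B ∧ w < b ∧ (b : ℕ) * t = x ∧
          (x : ℕ) + o = P ∧ (b : ℕ) * u = y ∧ (y : ℕ) + w = t) →
      (w : ℕ) + 1 < B ∧ (B : ℕ) ^ (w : ℕ) ≤ P := by
    rintro n B w P ⟨⟨s, hs⟩, ⟨m, hm⟩, o, b, t, u, x, y, ho, hb, hw, hx, hP, hy, hu⟩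
    rw [Fin.lt_def] at hw
    refine ⟨by omega, ?_⟩
    rw [← hb, ho, hm]
    exact pow_le_of_expansion (by rw [← hs, ← hb, ho]) hw (by rw [hx, ← hm, ← hP, ho])
      (by rw [hy, hu])
  have hC : ∀ (n : ℕ) (B w P : Fin n), (∃ s : ℕ, (B : ℕ) = 2 ^ s) → (w : ℕ) + 1 < B →
      (P : ℕ) = (B : ℕ) ^ (w : ℕ) →
      ((∃ s : ℕ, (B : ℕ) = 2 ^ s) ∧ (∃ s : ℕ, (P : ℕ) = 2 ^ s) ∧
        ∃ o b t u x y : Fin n, (o : ℕ) = 1 ∧ (b : ℕ) + o = B ∧ w < b ∧ (b : ℕ) * t = x ∧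
          (x : ℕ) + o = P ∧ (b : ℕ) * u = y ∧ (y : ℕ) + w = t) := by
    rintro n B w P ⟨s, hs⟩ hw hP
    obtain ⟨b, hb⟩ : ∃ b, (B : ℕ) = b + 1 := ⟨B - 1, by omega⟩
    obtain ⟨t, u, h1, h2⟩ := exists_pow_expansion b w
    rw [← hb, ← hP] at h1
    have hBn := B.isLt
    have hPn := P.isLt
    have hb0 : 1 ≤ b := by omega
    have ht : t ≤ b * t := Nat.le_mul_of_pos_left _ hb0
    have hu : u ≤ b * u := Nat.le_mul_of_pos_left _ hb0
    refine ⟨⟨s, hs⟩, ⟨s * w, by rw [hP, hs, pow_mul]⟩, ⟨1, by omega⟩, ⟨b, by omega⟩,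
      ⟨t, by omega⟩, ⟨u, by omega⟩, ⟨b * t, by omega⟩, ⟨b * u, by omega⟩, rfl, hb.symm, ?_, rfl,
      h1, rfl, h2⟩
    rw [Fin.lt_def]
    simp only
    omega
  -- The congruence leaves several candidates for the exponent; the least `P` that satisfies the
  -- equations has exponent exactly `w`.
  refine ((key α i j k).and (all (S := fun n a P =>
      ((∃ s : ℕ, (a i : ℕ) = 2 ^ s) ∧ (∃ s : ℕ, (P : ℕ) = 2 ^ s) ∧
        ∃ o b t u x y : Fin n, (o : ℕ) = 1 ∧ (b : ℕ) + o = a i ∧ a j < b ∧ (b : ℕ) * t = x ∧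
          (x : ℕ) + o = P ∧ (b : ℕ) * u = y ∧ (y : ℕ) + a j = t) → a k ≤ P)
    ((key (Option α) (some i) (some j) none).imp (le _ _)))).of_iff fun n a => ?_
  constructor
  · rintro ⟨h1, h2, h3⟩
    refine ⟨hC n _ _ _ h1 h2 h3, fun P hP => ?_⟩
    rw [Fin.le_def, h3]
    exact (hS n _ _ _ hP).2
  · rintro ⟨h1, h2⟩
    obtain ⟨h3, h4⟩ := hS n _ _ _ h1
    refine ⟨h1.1, h3, ?_⟩
    have h5 : (a i : ℕ) ^ (a j : ℕ) < n := lt_of_le_of_lt h4 (a k).isLt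
    have h6 := h2 ⟨_, h5⟩ (hC n _ _ ⟨_, h5⟩ h1.1 h3 rfl)
    exact le_antisymm h6 h4

/-- Powers of two with small exponents, as quotients of powers of larger bases. -/
theorem two_pow_small (i j : α) : FODef fun n a => ((a j : Fin n) : ℕ) = 2 ^ ((a i : Fin n) : ℕ) ∧
    ∃ t : ℕ, 2 ^ (t + 1) < n ∧ (a i : ℕ) + 1 < 2 ^ t ∧ 2 ^ ((t + 1) * (a i : ℕ)) < n := by
  -- For `D = 2 B` the quotient of `D ^ x` by `B ^ x` is `2 ^ x`. The exponent `t` in the statement,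
  -- with `B = 2 ^ t`, records that these powers are still elements of the domain.
  refine (ex (S := fun n a B => ∃ D P Q : Fin n,
    (B : ℕ) + B = D ∧ ((∃ s : ℕ, (B : ℕ) = 2 ^ s) ∧ (a i : ℕ) + 1 < B ∧ (P : ℕ) = B ^ (a i : ℕ)) ∧
    ((∃ s : ℕ, (D : ℕ) = 2 ^ s) ∧ (a i : ℕ) + 1 < D ∧ (Q : ℕ) = D ^ (a i : ℕ)) ∧
    (P : ℕ) * a j = Q) ?_).of_iff fun n a => ?_
  · refine ex (ex (ex ?_))
    exact (add _ _ _).and ((pow_base _ _ _).and ((pow_base _ _ _).and (mul _ _ _)))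
  · constructor
    · rintro ⟨h1, t, h2, h3, h4⟩
      have h5 : 2 ^ t < n := lt_trans (Nat.pow_lt_pow_right (by norm_num) (Nat.lt_succ_self t)) h2
      have h6 : (2 ^ (t + 1)) ^ (a i : ℕ) < n := by rwa [← pow_mul]
      have h7 : (2 ^ t) ^ (a i : ℕ) < n := lt_of_le_of_lt (Nat.pow_le_pow_left
        (Nat.pow_le_pow_right (by norm_num) (Nat.le_succ t)) _) h6
      refine ⟨⟨_, h5⟩, ⟨_, h2⟩, ⟨_, h7⟩, ⟨_, h6⟩, ?_, ⟨⟨t, rfl⟩, h3, rfl⟩,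
        ⟨⟨t + 1, rfl⟩, ?_, rfl⟩, ?_⟩
      · simp only; ring
      · simp only; rw [pow_succ]; omega
      · simp only; rw [h1, ← mul_pow, pow_succ]
    · rintro ⟨B, D, P, Q, h1, ⟨⟨t, ht⟩, h2, hP⟩, ⟨-, h3, hQ⟩, h4⟩
      have hD : (D : ℕ) = 2 ^ (t + 1) := by rw [← h1, ht]; ring
      refine ⟨?_, t, hD ▸ D.isLt, ht ▸ h2, ?_⟩
      · rw [hP, hQ, ← h1, ← two_mul, mul_pow, mul_comm] at h4
        exact Nat.eq_of_mul_eq_mul_right (by rw [ht]; positivity) h4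
      · rw [pow_mul, ← hD, ← hQ]; exact Q.isLt

/-- Recursion on the fixed bound `m`. It covers the finitely many small exponents for which the
estimate `log_bound` is not available. -/
theorem two_pow_le (m : ℕ) (i j : α) :
    FODef fun n a => ((a j : Fin n) : ℕ) = 2 ^ ((a i : Fin n) : ℕ) ∧ (a i : ℕ) ≤ m := by
  induction m generalizing α with
  | zero =>
    refine ((one j).and (zero i)).of_iff fun n a => ?_
    constructor
    · rintro ⟨h1, h2⟩
      have : (a i : ℕ) = 0 := by omega
      exact ⟨by rw [h1, this, pow_zero], this⟩
    · rintro ⟨h1, h2⟩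
      exact ⟨by rw [h1, h2, pow_zero], by omega⟩
  | succ m ih =>
    refine ((ih i j).or (ex (S := fun n a z => ∃ P o : Fin n, (o : ℕ) = 1 ∧ (z : ℕ) + o = a i ∧
      (P : ℕ) + P = a j ∧ (P : ℕ) = 2 ^ (z : ℕ) ∧ (z : ℕ) ≤ m)
      (ex (ex ((one _).and ((add _ _ _).and ((add _ _ _).and (ih _ _)))))))).of_iff fun n a => ?_
    constructor
    · rintro ⟨h1, h2⟩
      rcases Nat.lt_or_ge m (a i) with h3 | h3
      · right
        obtain ⟨z, hz⟩ : ∃ z, (a i : ℕ) = z + 1 := ⟨a i - 1, by omega⟩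
        have hi := (a i).isLt
        have hj := (a j).isLt
        rw [hz, pow_succ] at h1
        exact ⟨⟨z, by omega⟩, ⟨2 ^ z, by omega⟩, ⟨1, by omega⟩, rfl, hz.symm, by
          simp only; omega, rfl, by simp only; omega⟩
      · exact Or.inl ⟨h1, h3⟩
    · rintro (⟨h1, h2⟩ | ⟨z, P, o, h1, h2, h3, h4, h5⟩)
      · exact ⟨h1, by omega⟩
      · rw [← h2, ← h3, h4, h1, pow_succ]
        exact ⟨by omega, by omega⟩

end FODef

/-- For `s = log z + 2` and `t = log s + 2` this bounds `(t + 1) * s` by `z`. Hence the auxiliary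
powers in the definition of `2 ^ z` are at most `2 ^ z` and lie in the domain whenever `2 ^ z` does.
-/
theorem log_bound (s : ℕ) (hs : 8 ≤ s) : (Nat.log 2 s + 3) * s ≤ 2 ^ (s - 2) := by
  have h1 : ∀ m, 8 + m < 2 ^ (4 + m) := by
    intro m
    induction m with
    | zero => norm_num
    | succ m ih => rw [← add_assoc, ← add_assoc, pow_succ]; omega
  have h2 : ∀ m, (6 + m) * (8 + m) ≤ 2 ^ (6 + m) := by
    intro m
    induction m with
    | zero => norm_num
    | succ m ih =>
      rw [← add_assoc, pow_succ]
      nlinarith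
  obtain ⟨m, rfl⟩ := Nat.exists_eq_add_of_le hs
  have h3 : Nat.log 2 (8 + m) < 4 + m := Nat.log_lt_of_lt_pow (by omega) (h1 m)
  have h4 : 8 + m - 2 = 6 + m := by omega
  rw [h4]
  exact (Nat.mul_le_mul_right _ (by omega)).trans (h2 m)

/-- Division with remainder `z = s w + r` gives `2 ^ z = (2 ^ s) ^ w * 2 ^ r`. If `s` is slightly
larger than `log z`, then `w` is small compared with the base `2 ^ s`, as `pow_base` requires, and
`s` and `r` are small enough for `two_pow_small`. -/
theorem FODef.two_pow {α : Type} (i j : α) :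
    FODef fun n a => ((a j : Fin n) : ℕ) = 2 ^ ((a i : Fin n) : ℕ) := by
  refine ((two_pow_le 63 i j).or (ex (S := fun n a s => ∃ w r b c Q x : Fin n,
    (s : ℕ) * w = x ∧ (x : ℕ) + r = a i ∧
    ((b : ℕ) = 2 ^ (s : ℕ) ∧
      ∃ t : ℕ, 2 ^ (t + 1) < n ∧ (s : ℕ) + 1 < 2 ^ t ∧ 2 ^ ((t + 1) * (s : ℕ)) < n) ∧
    ((c : ℕ) = 2 ^ (r : ℕ) ∧
      ∃ t : ℕ, 2 ^ (t + 1) < n ∧ (r : ℕ) + 1 < 2 ^ t ∧ 2 ^ ((t + 1) * (r : ℕ)) < n) ∧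
    ((∃ s : ℕ, (b : ℕ) = 2 ^ s) ∧ (w : ℕ) + 1 < b ∧ (Q : ℕ) = b ^ (w : ℕ)) ∧
    (Q : ℕ) * c = a j)
    (ex (ex (ex (ex (ex (ex ((mul _ _ _).and ((add _ _ _).and ((two_pow_small _ _).and
      ((two_pow_small _ _).and ((pow_base _ _ _).and (mul _ _ _)))))))))))))).of_iff fun n a => ?_
  constructor
  · intro h
    rcases Nat.lt_or_ge 63 (a i) with hz | hz
    · right
      have hn := (a j).isLt
      have hin := (a i).isLt
      rw [h] at hn
      generalize (a i : ℕ) = z at *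
      have hz0 : z ≠ 0 := by omega
      -- The summand two makes `2 ^ s` exceed `z + 1` with room to spare. Exponents above `63` yield
      -- `8 ≤ s`, which is what `log_bound` asks for.
      obtain ⟨s, hs⟩ : ∃ s, s = Nat.log 2 z + 2 := ⟨_, rfl⟩
      have hs8 : 8 ≤ s := by
        have : 6 ≤ Nat.log 2 z := Nat.le_log_of_pow_le (by norm_num) (by omega)
        omega
      have hzs : 2 ^ (s - 2) ≤ z := by
        rw [hs]; exact Nat.pow_log_le_self 2 hz0
      have hsz : z < 2 ^ (s - 1) := by
        rw [hs]; exact Nat.lt_pow_succ_log_self (by norm_num) z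
      have hs2 : 2 ^ s = 2 * 2 ^ (s - 1) := by
        rw [← pow_succ']; congr 1; omega
      obtain ⟨t, ht⟩ : ∃ t, t = Nat.log 2 s + 2 := ⟨_, rfl⟩
      have hts : (t + 1) * s ≤ z := by
        have := (log_bound s hs8).trans hzs
        rwa [ht]
      have hst : s + 1 < 2 ^ t := by
        have h1 : s < 2 ^ (t - 1) := by
          rw [ht]; exact Nat.lt_pow_succ_log_self (by norm_num) s
        have h2 : 2 ^ t = 2 * 2 ^ (t - 1) := by
          rw [← pow_succ']; congr 1; omega
        omega
      have hsz' : s ≤ z := le_trans (Nat.le_mul_of_pos_left _ (by omega)) hts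
      have htz : t + 1 ≤ z := le_trans (Nat.le_mul_of_pos_right _ (by omega)) hts
      have hpow : ∀ m, m ≤ z → 2 ^ m < n := fun m hm =>
        lt_of_le_of_lt (Nat.pow_le_pow_right (by norm_num) hm) hn
      have hr : z % s < s := Nat.mod_lt _ (by omega)
      have hrz : z % s ≤ z := Nat.mod_le _ _
      have hw : s * (z / s) ≤ z := Nat.mul_div_le z s
      have hwz : z / s ≤ z := Nat.div_le_self _ _
      refine ⟨⟨s, by omega⟩, ⟨z / s, by omega⟩, ⟨z % s, by omega⟩, ⟨2 ^ s, hpow _ hsz'⟩,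
        ⟨2 ^ (z % s), hpow _ hrz⟩, ⟨(2 ^ s) ^ (z / s), by rw [← pow_mul]; exact hpow _ hw⟩,
        ⟨s * (z / s), by omega⟩, rfl, Nat.div_add_mod z s,
        ⟨rfl, t, hpow _ htz, hst, hpow _ hts⟩,
        ⟨rfl, t, hpow _ htz, by simp only; omega, hpow _ (le_trans (Nat.mul_le_mul_left _ hr.le) hts)⟩,
        ⟨⟨s, rfl⟩, by simp only; omega, rfl⟩, ?_⟩
      simp only
      rw [h, ← pow_mul, ← pow_add, Nat.div_add_mod]
    · exact Or.inl ⟨h, by omega⟩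
  · rintro (⟨h, -⟩ | ⟨s, w, r, b, c, Q, x, h1, h2, ⟨h3, -⟩, ⟨h4, -⟩, ⟨-, -, h5⟩, h6⟩)
    · exact h
    · rw [← h6, h5, h4, h3, ← h2, ← h1, pow_add, pow_mul]

/-! ### Dyadic intervals -/

/-- The first element of the dyadic interval of length `2 ^ z` that contains `x`. -/
def dyadicBase (z x : ℕ) : ℕ := x / 2 ^ z * 2 ^ z

/-- The last element below `n` of the dyadic interval of length `2 ^ z` that contains `x`. -/
def dyadicLast (n z x : ℕ) : ℕ := min (dyadicBase z x + 2 ^ z - 1) (n - 1)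

/-- The reflection of the part below `n` of each dyadic interval of length `2 ^ z`. -/
def dyadicRev (n z x : ℕ) : ℕ := dyadicBase z x + dyadicLast n z x - x

theorem dyadicBase_le (z x : ℕ) : dyadicBase z x ≤ x := Nat.div_mul_le_self x _

theorem lt_dyadicBase_add (z x : ℕ) : x < dyadicBase z x + 2 ^ z := by
  have h := Nat.lt_div_mul_add (a := x) (b := 2 ^ z) (by positivity)
  exact h

theorem dyadicBase_eq_iff {z x y : ℕ} : dyadicBase z x = dyadicBase z y ↔ x / 2 ^ z = y / 2 ^ z := by
  unfold dyadicBase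
  exact Nat.mul_left_inj (by positivity)

theorem div_eq_of_dyadicBase_le {z x y : ℕ} (h1 : dyadicBase z x ≤ y)
    (h2 : y < dyadicBase z x + 2 ^ z) : y / 2 ^ z = x / 2 ^ z := by
  unfold dyadicBase at *
  rw [Nat.div_eq_iff (by positivity)]
  constructor
  · exact h1
  · omega

theorem dyadicBase_eq_of_le {z x y : ℕ} (h1 : dyadicBase z x ≤ y)
    (h2 : y < dyadicBase z x + 2 ^ z) : dyadicBase z y = dyadicBase z x :=
  dyadicBase_eq_iff.2 (div_eq_of_dyadicBase_le h1 h2)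

theorem dyadicBase_dyadicBase (z x : ℕ) : dyadicBase z (dyadicBase z x) = dyadicBase z x :=
  dyadicBase_eq_of_le le_rfl (Nat.lt_add_of_pos_right (by positivity))

theorem dyadicBase_self (x : ℕ) : dyadicBase x x = 0 := by
  simp [dyadicBase, Nat.div_eq_of_lt (Nat.lt_two_pow_self)]

theorem dyadicBase_zero (x : ℕ) : dyadicBase 0 x = x := by simp [dyadicBase]

theorem le_dyadicLast {n z x : ℕ} (h : x < n) : x ≤ dyadicLast n z x := by
  have := lt_dyadicBase_add z x
  exact le_min (by omega) (by omega)

theorem dyadicLast_lt {n z x : ℕ} (h : x < n) : dyadicLast n z x < n :=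
  lt_of_le_of_lt (min_le_right _ _) (by omega)

theorem dyadicLast_lt_add (n z x : ℕ) : dyadicLast n z x < dyadicBase z x + 2 ^ z := by
  have := lt_dyadicBase_add z x
  exact lt_of_le_of_lt (min_le_left _ _) (by omega)

theorem dyadicBase_dyadicLast {n z x : ℕ} (h : x < n) :
    dyadicBase z (dyadicLast n z x) = dyadicBase z x :=
  dyadicBase_eq_of_le ((dyadicBase_le z x).trans (le_dyadicLast h)) (dyadicLast_lt_add n z x)

theorem dyadicLast_congr {n z x y : ℕ} (h : dyadicBase z x = dyadicBase z y) :
    dyadicLast n z x = dyadicLast n z y := by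
  unfold dyadicLast; rw [h]

theorem dyadicRev_lt {n z x : ℕ} (h : x < n) : dyadicRev n z x < n := by
  have h1 := dyadicBase_le z x
  have h2 := dyadicLast_lt (z := z) h
  unfold dyadicRev
  omega

theorem dyadicBase_dyadicRev {n z x : ℕ} (h : x < n) :
    dyadicBase z (dyadicRev n z x) = dyadicBase z x := by
  have h1 := dyadicBase_le z x
  have h2 := le_dyadicLast (z := z) h
  have h3 := dyadicLast_lt_add n z x
  refine dyadicBase_eq_of_le ?_ ?_ <;> unfold dyadicRev <;> omega

theorem dyadicRev_dyadicRev {n z x : ℕ} (h : x < n) :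
    dyadicRev n z (dyadicRev n z x) = x := by
  have h0 := dyadicBase_dyadicRev (z := z) h
  have h1 := dyadicBase_le z x
  have h2 := le_dyadicLast (z := z) h
  rw [dyadicRev, h0, dyadicLast_congr h0, dyadicRev]
  omega

theorem dyadicRev_lt_dyadicRev {n z x y : ℕ} (hy : y < n) (hxy : x < y)
    (h : dyadicBase z x = dyadicBase z y) : dyadicRev n z y < dyadicRev n z x := by
  have h1 := dyadicBase_le z x
  have h2 := le_dyadicLast (z := z) hy
  unfold dyadicRev
  rw [h, dyadicLast_congr h]
  omega

/-- Reflection does not leave the interval, so it keeps the order of elements of different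
intervals. -/
theorem dyadicRev_lt_of_base_lt {n z x y : ℕ} (hx : x < n) (hy : y < n)
    (h : dyadicBase z x < dyadicBase z y) : dyadicRev n z x < dyadicRev n z y := by
  have h1 := dyadicBase_dyadicRev (z := z) hx
  have h2 := dyadicBase_dyadicRev (z := z) hy
  by_contra hlt
  have h3 : dyadicBase z (dyadicRev n z y) ≤ dyadicBase z (dyadicRev n z x) := by
    unfold dyadicBase
    exact Nat.mul_le_mul_right _ (Nat.div_le_div_right (not_lt.1 hlt))
  omega

/-! ### First-order definitions of the static functions -/

namespace FODef

variable {α : Type}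

/-- The base is the last multiple of `2 ^ z` that is at most `x`. If `2 ^ z` is not in the domain,
then a single interval covers everything and the base is `0`; this is the second disjunct. -/
theorem dyadicBase (i j k : α) :
    FODef fun n a => ((a k : Fin n) : ℕ) = DynFO.dyadicBase (a i : Fin n) (a j : Fin n) := by
  refine ((ex (S := fun n a P => (P : ℕ) = 2 ^ (a i : ℕ) ∧ (∃ q : Fin n, (q : ℕ) * P = a k) ∧
      a k ≤ a j ∧ ¬ ∃ e : Fin n, (a k : ℕ) + P = e ∧ e ≤ a j)
      ((two_pow _ _).and ((ex (mul _ _ _)).and ((le _ _).and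
        (ex ((add _ _ _).and (le _ _))).not)))).or
    ((ex (S := fun n a P => (P : ℕ) = 2 ^ (a i : ℕ)) (two_pow _ _)).not.and
      (zero k))).of_iff fun n a => ?_
  have hp : 0 < 2 ^ (a i : ℕ) := by positivity
  constructor
  · intro h
    have h1 := dyadicBase_le (a i) (a j)
    have h2 := lt_dyadicBase_add (a i) (a j)
    by_cases hP : 2 ^ (a i : ℕ) < n
    · left
      refine ⟨⟨_, hP⟩, rfl, ⟨⟨(a j : ℕ) / 2 ^ (a i : ℕ),
        lt_of_le_of_lt (Nat.div_le_self _ _) (a j).isLt⟩, h.symm⟩, ?_, ?_⟩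
      · rw [Fin.le_def, h]; exact h1
      · rintro ⟨e, he, hle⟩
        have hle' : (e : ℕ) ≤ a j := hle
        have he' : (a k : ℕ) + 2 ^ (a i : ℕ) = e := he
        rw [h] at he'
        omega
    · right
      refine ⟨fun ⟨P, hP'⟩ => hP (hP' ▸ P.isLt), ?_⟩
      rw [h, DynFO.dyadicBase, Nat.div_eq_of_lt (lt_of_lt_of_le (a j).isLt (not_lt.1 hP)),
        zero_mul]
  · rintro (⟨P, hP, ⟨q, hq⟩, hle, hnot⟩ | ⟨hP, h0⟩)
    · rw [Fin.le_def] at hle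
      have h3 : (a j : ℕ) / 2 ^ (a i : ℕ) = q := by
        rw [Nat.div_eq_iff hp, ← hP, hq]
        refine ⟨hle, ?_⟩
        by_contra hc
        refine hnot ⟨⟨(a k : ℕ) + P, ?_⟩, rfl, ?_⟩
        · have := (a j).isLt
          omega
        · rw [Fin.le_def]; simp only; omega
      rw [DynFO.dyadicBase, h3, ← hP, hq]
    · have h4 : n ≤ 2 ^ (a i : ℕ) := by
        by_contra hc
        exact hP ⟨⟨_, not_le.1 hc⟩, rfl⟩
      rw [h0, DynFO.dyadicBase, Nat.div_eq_of_lt (lt_of_lt_of_le (a j).isLt h4), zero_mul]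

theorem dyadicNext (i j k : α) : FODef fun n a => ((a k : Fin n) : ℕ) =
    DynFO.dyadicBase (a i : Fin n) (a j : Fin n) + 2 ^ ((a i : Fin n) : ℕ) := by
  refine (ex (S := fun n a b => ∃ P : Fin n, (b : ℕ) = DynFO.dyadicBase (a i) (a j) ∧
    (P : ℕ) = 2 ^ (a i : ℕ) ∧ (b : ℕ) + P = a k) (ex ((dyadicBase _ _ _).and ((two_pow _ _).and
      (add _ _ _))))).of_iff fun n a => ?_
  constructor
  · intro h
    have := (a k).isLt
    have : 0 < 2 ^ (a i : ℕ) := by positivity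
    exact ⟨⟨DynFO.dyadicBase (a i) (a j), by omega⟩, ⟨2 ^ (a i : ℕ), by omega⟩, rfl, rfl, h.symm⟩
  · rintro ⟨b, P, h1, h2, h3⟩
    rw [← h3, h1, h2]

/-- The end of the interval is described as the greatest domain element with the same base, so the
truncation at `n - 1` takes care of itself. Both summands of the result are then differences within
the domain. -/
theorem dyadicRev (i j k : α) : FODef fun n a =>
    ((a k : Fin n) : ℕ) = DynFO.dyadicRev n (a i : Fin n) (a j : Fin n) := by
  refine (ex (S := fun n a b => ∃ l d : Fin n, (b : ℕ) = DynFO.dyadicBase (a i) (a j) ∧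
    (b : ℕ) = DynFO.dyadicBase (a i) l ∧
    (∀ l' : Fin n, (b : ℕ) = DynFO.dyadicBase (a i) l' → l' ≤ l) ∧
    (b : ℕ) + d = a k ∧ (a j : ℕ) + d = l) (ex (ex ((dyadicBase _ _ _).and ((dyadicBase _ _ _).and
      ((all ((dyadicBase _ _ _).imp (le _ _))).and ((add _ _ _).and
        (add _ _ _)))))))).of_iff fun n a => ?_
  have hj := (a j).isLt
  have h1 := dyadicBase_le (a i) (a j)
  have h2 := le_dyadicLast (z := a i) hj
  have h3 := dyadicLast_lt (z := a i) hj
  have hl : ∀ l' : Fin n, DynFO.dyadicBase (a i) (a j) = DynFO.dyadicBase (a i) l' →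
      (l' : ℕ) ≤ dyadicLast n (a i) (a j) := by
    intro l' hl'
    rw [dyadicLast_congr hl']
    exact le_dyadicLast l'.isLt
  constructor
  · intro h
    refine ⟨⟨_, lt_of_le_of_lt h1 hj⟩, ⟨_, h3⟩, ⟨dyadicLast n (a i) (a j) - a j, by omega⟩, rfl,
      (dyadicBase_dyadicLast hj).symm, fun l' hl' => hl l' hl', ?_, ?_⟩
    · rw [h, DynFO.dyadicRev]; simp only; omega
    · simp only; omega
  · rintro ⟨b, l, d, hb, hbl, hmax, hk, hd⟩
    have h4 : (l : ℕ) = dyadicLast n (a i) (a j) :=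
      le_antisymm (hl l (hb.symm.trans hbl)) (hmax ⟨_, h3⟩ (by
        rw [hb]; exact (dyadicBase_dyadicLast hj).symm))
    rw [DynFO.dyadicRev, ← h4, ← hb]
    omega

theorem flip (i j : α) : FODef fun n a => ((a j : Fin n) : ℕ) = n - 1 - (a i : Fin n) := by
  refine (ex (S := fun n a l => (∀ x : Fin n, x ≤ l) ∧ (a i : ℕ) + a j = l)
    ((all (le _ _)).and (add _ _ _))).of_iff fun n a => ?_
  have hi := (a i).isLt
  constructor
  · intro h
    exact ⟨⟨n - 1, by omega⟩, fun x => by rw [Fin.le_def]; simp only; omega,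
      by simp only; omega⟩
  · rintro ⟨l, hl, h⟩
    have h1 := hl ⟨n - 1, by omega⟩
    rw [Fin.le_def] at h1
    simp only at h1
    have := l.isLt
    omega

theorem pred (i j : α) : FODef fun n a => ((a j : Fin n) : ℕ) + 1 = (a i : Fin n) := by
  refine (ex (S := fun n a o => (o : ℕ) = 1 ∧ (a j : ℕ) + o = a i)
    ((one _).and (add _ _ _))).of_iff fun n a => ?_
  constructor
  · intro h
    have := (a i).isLt
    exact ⟨⟨1, by omega⟩, rfl, h⟩
  · rintro ⟨o, h1, h2⟩
    rw [← h2, h1]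

end FODef

/-- The number of levels of the dyadic intervals below `n`, minus one. -/
def logBound : Bound where
  fn n := Nat.log 2 (n - 1) + 1
  definable := by
    obtain ⟨φ, hφ⟩ : FODef (α := Fin 1) fun n a => ((a 0 : Fin n) : ℕ) ≤ Nat.log 2 (n - 1) + 1 := by
      -- A positive `a` satisfies the bound exactly if `2 ^ (a - 1)` is at most `n - 1`, that is, an
      -- element of the domain.
      refine ((FODef.zero 0).or (FODef.ex (S := fun n a o => ∃ y P : Fin n, (o : ℕ) = 1 ∧
        (y : ℕ) + o = a 0 ∧ (P : ℕ) = 2 ^ (y : ℕ)) (FODef.ex (FODef.ex ((FODef.one _).and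
          ((FODef.add _ _ _).and (FODef.two_pow _ _))))))).of_iff fun n a => ?_
      have hn := (a 0).isLt
      constructor
      · intro h
        rcases Nat.eq_zero_or_pos (a 0 : ℕ) with h0 | h0
        · exact Or.inl h0
        · right
          have h1 : 2 ^ ((a 0 : ℕ) - 1) ≤ n - 1 :=
            Nat.pow_le_of_le_log (by omega) (by omega)
          exact ⟨⟨1, by omega⟩, ⟨(a 0 : ℕ) - 1, by omega⟩,
            ⟨2 ^ ((a 0 : ℕ) - 1), by omega⟩, rfl,
            by simp only; omega, rfl⟩
      · rintro (h | ⟨o, y, P, h1, h2, h3⟩)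
        · omega
        · have h4 : 2 ^ (y : ℕ) ≤ n - 1 := by
            rw [← h3]
            have := P.isLt
            omega
          have h5 := Nat.le_log_of_pow_le (by norm_num) h4
          omega
    refine ⟨φ, fun n a => hφ n _⟩

theorem lt_two_pow_logBound (n : ℕ) (hn : 1 ≤ n) : n ≤ 2 ^ logBound.fn n := by
  have h := Nat.lt_pow_succ_log_self (b := 2) (by norm_num) (n - 1)
  have : logBound.fn n = (Nat.log 2 (n - 1)).succ := rfl
  rw [this]
  omega

/-- There is a level at which there is only one interval. -/
theorem exists_top_level (n : ℕ) (hn : 1 ≤ n) :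
    ∃ z : Fin n, (z : ℕ) ≤ logBound.fn n ∧ n ≤ 2 ^ (z : ℕ) := by
  rcases Nat.lt_or_ge (logBound.fn n) n with h | h
  · exact ⟨⟨_, h⟩, le_rfl, lt_two_pow_logBound n hn⟩
  -- If the logarithmic bound is not itself a domain element, then the last element is below it and
  -- is already a top level.
  · refine ⟨⟨n - 1, by omega⟩, ?_, ?_⟩
    · simp only; omega
    · have := Nat.lt_two_pow_self (n := n - 1)
      simp only
      omega

/-! ### Initial values -/

theorem StartDef.eval_term {r : ℕ} {R : ∀ n, (Fin (r + 1) → Fin n) → Prop} (h : FODef R) (n : ℕ)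
    (a : Fin r → Fin n) :
    StartDef.eval (κ := .term) n h.choose a =
      theUnique fun y : Fin n => R n (Fin.snoc a y : Fin (r + 1) → Fin n) :=
  theUnique_congr fun _ => h.choose_spec n _

theorem StartDef.eval_cond {r : ℕ} {R : ∀ n, (Fin r → Fin n) → Prop} (h : FODef R) (n : ℕ)
    (a : Fin r → Fin n) : StartDef.eval (κ := .cond) n h.choose a = R n a :=
  propext (h.choose_spec n _)

theorem snoc_one {α : Type} (a : Fin 1 → α) (b : α) :
    (Fin.snoc a b : Fin 2 → α) = ![a 0, b] := by
  funext i; fin_cases i <;> rfl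

theorem snoc_two {α : Type} (a : Fin 2 → α) (b : α) :
    (Fin.snoc a b : Fin 3 → α) = ![a 0, a 1, b] := by
  funext i; fin_cases i <;> rfl

theorem snoc_three {α : Type} (a : Fin 3 → α) (b : α) :
    (Fin.snoc a b : Fin 4 → α) = ![a 0, a 1, a 2, b] := by
  funext i; fin_cases i <;> rfl

theorem append_one_one {α : Type} (a : Fin 1 → α) (b : Fin 1 → α) :
    (Fin.append a b : Fin 2 → α) = ![a 0, b 0] := by
  funext i; fin_cases i <;> rfl

theorem append_one_zero {α : Type} (a : Fin 1 → α) (b : Fin 0 → α) :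
    (Fin.append a b : Fin 1 → α) = ![a 0] := by
  funext i; fin_cases i; rfl

theorem toDomain_eq_theUnique (n a : ℕ) : toDomain n a = theUnique fun y : Fin n => (y : ℕ) = a := by
  unfold toDomain
  split_ifs with h
  · symm
    exact theUnique_of rfl fun b hb => Fin.ext hb
  · symm
    rw [theUnique_eq_none]
    rintro ⟨y, hy, -⟩
    exact h (hy ▸ y.isLt)

theorem toDomain_of_lt {n a : ℕ} (h : a < n) : toDomain n a = some ⟨a, h⟩ := dif_pos h

/-! ### String equality through well-balanced strings -/

/-- Reads a string of parentheses with a stack of types of open parentheses. -/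
def popStack {k : ℕ} : List (Paren k) → List (Fin k) → Option (List (Fin k))
  | [], s => some s
  | .op i :: w, s => popStack w (i :: s)
  | .cl _ :: _, [] => none
  | .cl i :: w, j :: s => if i = j then popStack w s else none

theorem popStack_append {k : ℕ} (w w' : List (Paren k)) (s : List (Fin k)) :
    popStack (w ++ w') s = (popStack w s).bind (popStack w') := by
  induction w generalizing s with
  | nil => rfl
  | cons a w ih =>
    cases a with
    | op i => simp [popStack, ih]
    | cl i =>
      cases s with
      | nil => rfl
      | cons j s =>
        simp only [List.cons_append, popStack]
        split_ifs
        · exact ih s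
        · rfl

/-- An arbitrary initial stack is needed for the induction: inside a pair of parentheses the stack
already carries their type. -/
theorem Balanced.popStack_eq {k : ℕ} {w : List (Paren k)} (h : Balanced w) (s : List (Fin k)) :
    popStack w s = some s := by
  induction h generalizing s with
  | nil => rfl
  | wrap i _ ih => simp [popStack, popStack_append, ih]
  | append _ _ ih ih' => simp [popStack_append, ih, ih']

theorem popStack_map_op {k : ℕ} (u s : List (Fin k)) :
    popStack (u.map Paren.op) s = some (u.reverse ++ s) := by
  induction u generalizing s with
  | nil => rfl
  | cons i u ih => simp [popStack, ih]

theorem popStack_map_cl {k : ℕ} (v s : List (Fin k)) (h : popStack (v.map Paren.cl) s = some []) :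
    v = s := by
  induction v generalizing s with
  | nil => simpa [popStack, eq_comm] using h
  | cons i v ih =>
    cases s with
    | nil => simp [popStack] at h
    | cons j s =>
      simp only [List.map_cons, popStack] at h
      split_ifs at h with hij
      rw [hij, ih s h]

/-- The opening part leaves the reversal of `u` on the stack, and the closing part can empty the
stack only if it spells the same string. Conversely, equal strings are built up by wrapping from the
inside. -/
theorem balanced_op_cl_iff {k : ℕ} (u v : List (Fin k)) :
    Balanced (u.map Paren.op ++ (v.map Paren.cl).reverse) ↔ u = v := by
  constructor
  · intro h
    have h1 := h.popStack_eq []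
    rw [popStack_append, popStack_map_op, ← List.map_reverse, Option.bind_some] at h1
    exact (List.reverse_injective (by simpa using popStack_map_cl _ _ h1)).symm
  · rintro rfl
    induction u with
    | nil => exact .nil
    | cons i u ih => simpa using Balanced.wrap i ih

theorem reduceOption_ofFn_eq {A : Type} {n m : ℕ} (w : Word A n) (w' : Word A m) (h : n = m)
    (hw : ∀ i : Fin n, w i = w' (Fin.cast h i)) : w.str = w'.str := by
  subst h
  have : w = w' := funext hw
  rw [this]

theorem Word.str_two_blocks {A : Type} {n : ℕ} (w : Word A (2 * n)) :
    w.str = Word.str (fun i => w (inBlock 0 i)) ++ Word.str (fun i => w (inBlock 1 i)) := by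
  have h1 : w.str = Word.str (fun i : Fin (n + n) => w (Fin.cast (two_mul n).symm i)) :=
    reduceOption_ofFn_eq _ _ (two_mul n) fun i => rfl
  rw [h1]
  unfold Word.str
  rw [List.ofFn_add, List.reduceOption_append]
  congr 3
  funext i
  congr 1
  ext
  simp [inBlock_val, add_comm]

theorem Word.str_map {A B : Type} {n : ℕ} (w : Word A n) (f : A → B) :
    Word.str (fun i => (w i).map f) = w.str.map f := by
  unfold Word.str
  have : (List.ofFn fun i => (w i).map f) = (List.ofFn w).map (Option.map f) := by
    rw [List.map_ofFn]; rfl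
  rw [this, List.reduceOption_map]

theorem Word.str_rev {A : Type} {n : ℕ} (w : Word A n) :
    Word.str (fun i => w i.rev) = w.str.reverse := by
  unfold Word.str
  have : (List.ofFn fun i => w i.rev) = (List.ofFn w).reverse := by
    refine List.ext_getElem (by simp) fun i h1 h2 => ?_
    simp only [List.getElem_ofFn, List.getElem_reverse, List.length_ofFn]
    congr 1
    ext
    simp only [Fin.val_rev]
    omega
  rw [this]
  simp [List.reduceOption]

/-- The types of the parentheses of a pair of words on the two halves of a word. -/
def PairCode {A : Type} {k n : ℕ} (e : A → Fin k) (w : Word A n × Word A n)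
    (x : Word (Paren k) (2 * n)) : Prop :=
  (∀ i, x (inBlock 0 i) = (w.1 i).map fun a => .op (e a)) ∧
  ∀ i, x (inBlock 1 i) = (w.2 i.rev).map fun a => .cl (e a)

theorem PairCode.str_mem_dyck {A : Type} {k n : ℕ} {e : A → Fin k} (he : Function.Injective e)
    {w : Word A n × Word A n} {x : Word (Paren k) (2 * n)} (h : PairCode e w x) :
    x.str ∈ dyck k ↔ w.1.str = w.2.str := by
  have h2 : x.str = (w.1.str.map e).map Paren.op ++ ((w.2.str.map e).map Paren.cl).reverse := by
    rw [Word.str_two_blocks, funext h.1, funext h.2, Word.str_map w.1 fun a => Paren.op (e a),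
      Word.str_rev fun i => (w.2 i).map fun a => Paren.cl (e a),
      Word.str_map w.2 fun a => Paren.cl (e a), List.map_map, List.map_map]
    rfl
  rw [h2]
  exact (balanced_op_cl_iff _ _).trans (List.map_injective_iff.2 he).eq_iff

theorem inBlock_injective {c n : ℕ} {b b' : Fin c} {a a' : Fin n}
    (h : inBlock b a = inBlock b' a') : b = b' ∧ a = a' := by
  simpa [inBlock] using h

/-- The change of one half of a pair of words. -/
def letterOpCode {A : Type} {k : ℕ} (e : A → Fin k) : Bool × LetterOp A → LetterOp (Paren k)
  | (false, .set a) => .set (.op (e a))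
  | (true, .set a) => .set (.cl (e a))
  | (_, .reset) => .reset

theorem Word.apply_of_ne {A : Type} {n : ℕ} (w : Word A n) {i j : Fin n} (h : j ≠ i)
    (op : LetterOp A) : w.apply i op j = w j := by
  cases op with
  | set a =>
    simp only [Word.apply]
    split_ifs
    · exact Function.update_of_ne h _ _
    · rfl
  | reset => exact Function.update_of_ne h _ _

theorem Word.apply_reset_self {A : Type} {n : ℕ} (w : Word A n) (i : Fin n) :
    w.apply i .reset i = none := Function.update_self _ _ _

theorem Word.apply_set_self {A : Type} {n : ℕ} (w : Word A n) (i : Fin n) (a : A) :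
    w.apply i (.set a) i = (w i).or (some a) := by
  simp only [Word.apply]
  split_ifs with h
  · simp [h]
  · obtain ⟨b, hb⟩ := Option.ne_none_iff_exists'.1 h
    simp [hb]

theorem PairCode.change {A : Type} {k n : ℕ} {e : A → Fin k} {w : Word A n × Word A n}
    {x : Word (Paren k) (2 * n)} (h : PairCode e w x) (δ : Bool × LetterOp A) (p : Fin n) :
    PairCode e (match δ.1 with
      | false => (w.1.apply p δ.2, w.2)
      | true => (w.1, w.2.apply p δ.2))
      (x.apply (match δ.1 with
        | false => inBlock 0 p
        | true => inBlock 1 p.rev) (letterOpCode e δ)) := by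
  obtain ⟨b, op⟩ := δ
  cases b with
  | false =>
    refine ⟨fun i => ?_, fun i => ?_⟩
    · simp only
      by_cases hi : i = p
      · subst hi
        cases op with
        | set a =>
          rw [letterOpCode, Word.apply_set_self, Word.apply_set_self, h.1]
          cases w.1 i <;> rfl
        | reset => rw [letterOpCode, Word.apply_reset_self, Word.apply_reset_self]; rfl
      · rw [Word.apply_of_ne _ (fun hc => hi (inBlock_injective hc).2), Word.apply_of_ne _ hi, h.1]
    · simp only
      rw [Word.apply_of_ne _ (fun hc => by simpa using (inBlock_injective hc).1), h.2]
  | true =>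
    refine ⟨fun i => ?_, fun i => ?_⟩
    · simp only
      rw [Word.apply_of_ne _ (fun hc => by simpa using (inBlock_injective hc).1), h.1]
    · simp only
      by_cases hi : i.rev = p
      · subst hi
        rw [Fin.rev_rev]
        cases op with
        | set a =>
          rw [letterOpCode, Word.apply_set_self, Word.apply_set_self, h.2]
          cases w.2 i.rev <;> rfl
        | reset => rw [letterOpCode, Word.apply_reset_self, Word.apply_reset_self]; rfl
      · rw [Word.apply_of_ne _ (fun hc => hi ?_), Word.apply_of_ne _ hi, h.2]
        rw [(inBlock_injective hc).2, Fin.rev_rev]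

/-! ### The program for string equality -/

/-- One static unary function, and one instance of `Member(D_k)` on a domain of twice the size. -/
abbrev pairEnv (k : ℕ) : Env where
  aux := ⟨Unit, inferInstance, fun _ => .term, fun _ => 1⟩
  Sup := Unit
  supFin := inferInstance
  sig := fun _ => memberSig (Paren k)
  idx := fun _ => 0
  scale := fun _ => 2

abbrev noSymbols : Schema := ⟨Empty, inferInstance, fun _ => .term, fun _ => 0⟩

/-- The static function applied to a parameter. -/
def pairFlip {k : ℕ} {L : Schema} : Expr (pairEnv k) L .term 1 :=
  Expr.aux (E := pairEnv k) () fun _ => .var 0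

/-- Changes of an instance have to be attached to a rule for some auxiliary symbol. This rule
rewrites one value of the static function by itself, and its initial procedure does the actual work.
Positions of the second word go reflected into block `1`. -/
def pairUpdate {A : Type} {k : ℕ} (e : A → Fin k) (δ : Bool × LetterOp A) :
    UpdateRule (pairEnv k) 1 .term 1 where
  L := noSymbols
  initial := .invoke (E := pairEnv k) rfl () Fin.elim0 (letterOpCode e δ)
    (fun _ => if δ.1 then (1 : Fin 2) else (0 : Fin 2))
    (fun _ => if δ.1 then pairFlip else .var 0) (fun j hj => absurd j.isLt (not_lt.2 hj))
  numVars := 0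
  bound := Fin.elim0
  target := fun _ => .var 0
  main := .ret pairFlip

def pairProgram {A : Type} {k : ℕ} (e : A → Fin k) (P : Program (memberSig (Paren k))) :
    Program (stringEqualitySig A) :=
  .mk (pairEnv k) (fun _ => P) (fun _ => (FODef.flip (0 : Fin 2) 1).choose)
    (fun δ _ => pairUpdate e δ)
    (fun _ => ⟨noSymbols, .ret (.query (E := pairEnv k) () Fin.elim0 () Fin.elim0 Fin.elim0 0)⟩)
    (fun _ _ _ _ _ _ => rfl)

theorem pairProgram_maintains {A : Type} {k : ℕ} {e : A → Fin k} (he : Function.Injective e)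
    {P : Program (memberSig (Paren k))} (hP : P.Maintains (Member (dyck k))) :
    (pairProgram e P).Maintains (StringEquality A) := by
  refine maintains_of_invariant (fun n st w =>
    (∀ a : Fin 1 → Fin n, st.1 () a = some (a 0).rev) ∧
    ∃ x : Word (Paren k) (2 * n), Reps P (Member (dyck k)) (st.2 () Fin.elim0) x ∧
      PairCode e w x) ?_ ?_ ?_
  · intro n
    refine ⟨fun a => ?_, fun _ => none, Reps.start P (Member (dyck k)) (2 * n),
      fun i => rfl, fun i => rfl⟩
    refine (StartDef.eval_term (FODef.flip (0 : Fin 2) 1) n a).trans ?_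
    refine theUnique_of ?_ fun b hb => ?_
    · show ((a 0).rev : ℕ) = n - 1 - (a 0 : ℕ)
      rw [Fin.val_rev]; omega
    · have hb' : (b : ℕ) = n - 1 - (a 0 : ℕ) := hb
      ext
      rw [Fin.val_rev]; omega
  · rintro n st w ⟨hs, x, hx, hc⟩ δ p
    have hflip : ∀ (L : Schema) (σ : Store (pairEnv k) L n fun _ => P.sem (2 * n)),
        pairFlip.eval st.1 σ p = some (p 0).rev := fun L σ =>
      (Expr.eval_aux_of (allSome_of_forall fun _ => rfl)).trans (hs fun _ => p 0)
    refine ⟨fun a => ?_, ?_⟩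
    · refine (Program.sem_mk_change_aux n δ p st () a).trans ?_
      rw [Val.write_of_same]
      · exact hs a
      rintro y ⟨-, hy⟩
      exact Expr.eval_aux_of hy
    · refine ⟨_, ?_, hc.change δ (p 0)⟩
      have h1 : (((pairProgram e P).sem n).change δ p st).2 () = _ :=
        Program.sem_mk_change_sup n δ p st () () rfl
      rw [h1]
      have h2 := hx.change (letterOpCode e δ) fun _ => match δ.1 with
        | false => inBlock (0 : Fin 2) (p 0)
        | true => inBlock (1 : Fin 2) (p 0).rev
      refine Eq.mpr (congrArg (fun s => Reps P (Member (dyck k)) s _) ?_) h2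
      refine (Stmt.exec_invoke_sup_self (E := pairEnv k) (i := ()) (a := fun _ => if δ.1 then (p 0).rev else p 0)
        (x := Fin.elim0)
        (allSome_of_forall fun j => j.elim0) (allSome_of_forall fun j => ?_)).trans ?_
      · split_ifs with hb
        · exact hflip _ _
        · rfl
      · congr 1
        funext j
        obtain ⟨b, op⟩ := δ
        cases b <;> rfl
  · rintro n st w ⟨-, x, hx, hc⟩ Q a
    refine Eq.trans ?_ (propext (hc.str_mem_dyck he))
    refine Eq.trans ?_ (hx.query hP () Fin.elim0)
    refine (Program.sem_mk_query n st Q a).trans ?_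
    refine (Expr.eval_query_of (a := Fin.elim0) (x := Fin.elim0) ?_ ?_).trans ?_
    · exact allSome_of_forall fun j => j.elim0
    · exact allSome_of_forall fun j => j.elim0
    · exact congrArg ((P.sem (2 * n)).query (st.2 () Fin.elim0) ()) (funext fun j : Fin 0 => j.elim0)

/-! ### Work of the program for string equality -/

theorem pairProgram_cost_change {A : Type} {k : ℕ} (e : A → Fin k)
    (P : Program (memberSig (Paren k))) (n : ℕ) (δ : Bool × LetterOp A) :
    ((pairProgram e P).cost n).change δ ≤
      max 1 ((P.cost (2 * n)).change (letterOpCode e δ)) := by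
  refine (Program.cost_mk_change (S := stringEqualitySig A) n δ).le.trans (Finset.sup_le fun _ _ => ?_)
  obtain ⟨b, op⟩ := δ
  cases b <;> refine UpdateRule.work_le_of_numVars_zero rfl ?_ ?_ ?_ <;>
    simp [pairUpdate, Stmt.work, Body.work, pairFlip, Expr.work]

theorem pairProgram_cost_query {A : Type} {k : ℕ} (e : A → Fin k)
    (P : Program (memberSig (Paren k))) (n : ℕ) :
    ((pairProgram e P).cost n).query () ≤ max 1 ((P.cost (2 * n)).query ()) := by
  refine (Program.cost_mk_query (S := stringEqualitySig A) n ()).le.trans ?_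
  simp [Body.work, Expr.work]

theorem isBigO_natCast_max_one {f : ℕ → ℕ} {W : ℕ → ℝ}
    (h1 : (fun _ : ℕ => (1 : ℝ)) =O[atTop] W) (hf : (fun n => (f n : ℝ)) =O[atTop] W) {g : ℕ → ℕ}
    (hg : ∀ n, g n ≤ max 1 (f n)) : (fun n => (g n : ℝ)) =O[atTop] W := by
  refine IsBigO.trans (IsBigO.of_bound 1 (Eventually.of_forall fun n => ?_)) (h1.add hf)
  have h2 : (g n : ℝ) ≤ (max 1 (f n) : ℕ) := by exact_mod_cast hg n
  have h3 : ((max 1 (f n) : ℕ) : ℝ) ≤ 1 + (f n : ℝ) := by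
    exact_mod_cast max_le (by omega) (by omega)
  rw [one_mul, Real.norm_of_nonneg (by positivity), Real.norm_of_nonneg (by positivity)]
  linarith

/-- A bound for the work of any query bounds the constant one as well, because that work is at least
one on nonempty domains. Constant overhead is therefore free, whatever `W` is. -/
theorem one_isBigO_of_query {S : Sig} {P : Program S} {W : ℕ → ℝ} (Q : S.queries.Sym)
    (h : (fun n => ((P.cost n).query Q : ℝ)) =O[atTop] W) :
    (fun _ : ℕ => (1 : ℝ)) =O[atTop] W := by
  refine IsBigO.trans (IsBigO.of_bound 1 ?_) h
  filter_upwards [eventually_ge_atTop 1] with n hn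
  rw [one_mul, norm_one, Real.norm_of_nonneg (by positivity)]
  exact_mod_cast P.one_le_cost_query hn Q

theorem stringEquality_of_member {W : ℕ → ℝ}
    (h : ∀ k : ℕ, 1 ≤ k → MaintainableWithWork (Member (dyck k)) W) (A : Type) [Fintype A] :
    MaintainableWithWork (StringEquality A) fun n => W (2 * n) := by
  -- One superfluous type of parentheses ensures that there is at least one even for the empty
  -- alphabet.
  obtain ⟨P, hP, hc, hq⟩ := h (Fintype.card A + 1) (by omega)
  have he : Function.Injective fun a : A => (Fintype.equivFin A a).castSucc := fun a b hab =>
    (Fintype.equivFin A).injective (Fin.castSucc_injective _ hab)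
  have ht : Tendsto (fun n : ℕ => 2 * n) atTop atTop :=
    tendsto_id.const_mul_atTop' (by norm_num)
  have h1 := (one_isBigO_of_query _ (hq ())).comp_tendsto ht
  refine ⟨pairProgram _ P, pairProgram_maintains he hP, fun δ => ?_, fun Q => ?_⟩
  · exact isBigO_natCast_max_one h1 ((hc _).comp_tendsto ht) fun n =>
      pairProgram_cost_change _ P n δ
  · exact isBigO_natCast_max_one h1 ((hq _).comp_tendsto ht) fun n =>
      pairProgram_cost_query _ P n

/-! ### Unmatched parentheses in nested systems of intervals

A string of parentheses is given by its height function `h`: position `i` holds an opening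
parenthesis if `h (i + 1) = h i + 1`, a closing one if `h i = h (i + 1) + 1`, and nothing if
`h (i + 1) = h i`. -/

/-- `E z i j` says that `i` and `j` lie in the same interval of level `z`.  Intervals of level `0`
are singletons, and each interval of level `z + 1` is a union of at most two of level `z`. -/
structure Levels (E : ℕ → ℤ → ℤ → Prop) : Prop where
  refl : ∀ z i, E z i i
  symm : ∀ {z i j}, E z i j → E z j i
  trans : ∀ {z i j k}, E z i j → E z j k → E z i k
  mono : ∀ {z z' i j}, z ≤ z' → E z i j → E z' i j
  convex : ∀ {z i j k}, i ≤ j → j ≤ k → E z i k → E z i j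
  zero : ∀ {i j}, E 0 i j → i = j
  split : ∀ {z i j k}, i ≤ j → j ≤ k → E (z + 1) i k → E z i j ∨ E z j k

theorem Levels.convex_right {E : ℕ → ℤ → ℤ → Prop} (hE : Levels E) {z : ℕ} {i j k : ℤ}
    (h1 : i ≤ j) (h2 : j ≤ k) (h : E z i k) : E z j k :=
  hE.trans (hE.symm (hE.convex h1 h2 h)) h

def Steps (h : ℤ → ℤ) : Prop := ∀ i, h (i + 1) ≤ h i + 1 ∧ h i ≤ h (i + 1) + 1

/-- Position `i` holds a closing parenthesis without a partner in its interval of level `z`. -/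
def UnmClose (h : ℤ → ℤ) (E : ℕ → ℤ → ℤ → Prop) (z : ℕ) (i : ℤ) : Prop :=
  h i = h (i + 1) + 1 ∧ ∀ j, j ≤ i → E z j i → h (i + 1) < h j

/-- Position `i` holds an opening parenthesis without a partner in its interval of level `z`. -/
def UnmOpen (h : ℤ → ℤ) (E : ℕ → ℤ → ℤ → Prop) (z : ℕ) (i : ℤ) : Prop :=
  h (i + 1) = h i + 1 ∧ ∀ j, i ≤ j → E z j i → h i < h (j + 1)

def Unm (h : ℤ → ℤ) (E : ℕ → ℤ → ℤ → Prop) (z : ℕ) (i : ℤ) : Prop :=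
  UnmClose h E z i ∨ UnmOpen h E z i

/-- The parentheses with a partner in their interval of level `z`, but not of level `z - 1`. -/
def MatchedAt (h : ℤ → ℤ) (E : ℕ → ℤ → ℤ → Prop) : ℕ → ℤ → Prop
  | 0, _ => False
  | z + 1, i => Unm h E z i ∧ ¬ Unm h E (z + 1) i

/-- The parentheses at positions `i` and `j` are partners. -/
def Partner (h : ℤ → ℤ) (i j : ℤ) : Prop :=
  i < j ∧ h (i + 1) = h i + 1 ∧ h (j + 1) = h i ∧ ∀ k, i < k → k ≤ j → h i < h k

/-- The reflection of positions `i ↦ N - 1 - i`, on height functions. -/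
def mirror (N : ℤ) (h : ℤ → ℤ) (i : ℤ) : ℤ := h (N - i)

def mirrorLevels (N : ℤ) (E : ℕ → ℤ → ℤ → Prop) (z : ℕ) (i j : ℤ) : Prop :=
  E z (N - 1 - i) (N - 1 - j)

/-! ### Reflection of positions -/

section mirror

variable {h : ℤ → ℤ} {E : ℕ → ℤ → ℤ → Prop} {N : ℤ} {z : ℕ} {i j : ℤ}

/-- The axioms for levels are symmetric under reflection, although dyadic intervals themselves are
not preserved. This is the reason for the abstract notion: every result for one direction holds for
the other as well. -/
theorem Levels.mirror (hE : Levels E) (N : ℤ) : Levels (mirrorLevels N E) where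
  refl _ _ := hE.refl _ _
  symm h := hE.symm h
  trans h h' := hE.trans h h'
  mono h h' := hE.mono h h'
  convex h h' h'' := hE.symm (hE.convex_right (by omega) (by omega) (hE.symm h''))
  zero h := by have := hE.zero h; omega
  split h h' h'' := (hE.split (by omega) (by omega) (hE.symm h'')).symm.imp hE.symm hE.symm

theorem Steps.mirror (hs : Steps h) (N : ℤ) : Steps (mirror N h) := by
  intro i
  have h1 := hs (N - 1 - i)
  have h2 : N - 1 - i + 1 = N - i := by ring
  have h3 : N - (i + 1) = N - 1 - i := by ring
  rw [h2] at h1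
  simp only [DynFO.mirror, h3]
  omega

theorem unmOpen_mirror :
    UnmOpen (mirror N h) (mirrorLevels N E) z i ↔ UnmClose h E z (N - 1 - i) := by
  have h1 : N - (i + 1) = N - 1 - i := by ring
  have h2 : N - 1 - i + 1 = N - i := by ring
  simp only [UnmOpen, UnmClose, mirror, mirrorLevels, h1, h2]
  refine and_congr Iff.rfl ⟨fun H j hj hE => ?_, fun H j hj hE => ?_⟩
  · have := H (N - 1 - j) (by omega)
    have h3 : N - 1 - (N - 1 - j) = j := by ring
    have h4 : N - (N - 1 - j + 1) = j := by ring
    rw [h3, h4] at this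
    exact this hE
  · have h5 : N - (j + 1) = N - 1 - j := by ring
    rw [h5]
    exact H _ (by omega) hE

theorem unmClose_mirror :
    UnmClose (mirror N h) (mirrorLevels N E) z i ↔ UnmOpen h E z (N - 1 - i) := by
  have h1 : N - (i + 1) = N - 1 - i := by ring
  have h2 : N - 1 - i + 1 = N - i := by ring
  simp only [UnmOpen, UnmClose, mirror, mirrorLevels, h1, h2]
  refine and_congr Iff.rfl ⟨fun H j hj hE => ?_, fun H j hj hE => ?_⟩
  · have := H (N - 1 - j) (by omega)
    have h3 : N - 1 - (N - 1 - j) = j := by ring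
    have h4 : N - (N - 1 - j) = j + 1 := by ring
    rw [h3, h4] at this
    exact this hE
  · have := H (N - 1 - j) (by omega) hE
    have h5 : N - 1 - j + 1 = N - j := by ring
    rwa [h5] at this

theorem unm_mirror : Unm (mirror N h) (mirrorLevels N E) z i ↔ Unm h E z (N - 1 - i) := by
  rw [Unm, Unm, unmClose_mirror, unmOpen_mirror, or_comm]

theorem matchedAt_mirror :
    MatchedAt (mirror N h) (mirrorLevels N E) z i ↔ MatchedAt h E z (N - 1 - i) := by
  cases z with
  | zero => exact Iff.rfl
  | succ z => simp only [MatchedAt, unm_mirror]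

theorem Partner.of_mirror (hs : Steps h) (hp : Partner (mirror N h) i j) :
    Partner h (N - 1 - j) (N - 1 - i) := by
  have h1 : ∀ i, N - (i + 1) = N - 1 - i := fun i => by ring
  have h2 : ∀ i, N - 1 - i + 1 = N - i := fun i => by ring
  obtain ⟨a, b, c, d⟩ := hp
  simp only [mirror, h1] at b c
  have d' : ∀ k, N - 1 - j < k → k ≤ N - 1 - i → h (N - 1 - j) < h k := by
    intro k hk hk'
    have := d (N - k) (by omega) (by omega)
    rwa [mirror, mirror, ← c, sub_sub_cancel] at this
  refine ⟨by omega, ?_, by rw [h2]; exact c.symm, d'⟩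
  have h3 := d' (N - 1 - j + 1) (by omega) (by omega)
  have h4 := hs (N - 1 - j)
  omega

end mirror

/-! ### Partners, nesting, and unmatched parentheses -/

section

variable {h : ℤ → ℤ} {E : ℕ → ℤ → ℤ → Prop} {z : ℕ} {i j i' j' : ℤ}

theorem Partner.close (hs : Steps h) (hp : Partner h i j) : h j = h (j + 1) + 1 := by
  obtain ⟨h1, h2, h3, h4⟩ := hp
  have := h4 j h1 le_rfl
  have := hs j
  omega

theorem Partner.right_unique (hp : Partner h i j) (hp' : Partner h i j') : j = j' := by
  have key : ∀ {j j'}, Partner h i j → Partner h i j' → ¬ j < j' := by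
    rintro j j' ⟨h1, -, h3, -⟩ ⟨-, -, -, h4⟩ hlt
    have := h4 (j + 1) (by omega) (by omega)
    omega
  have h1 := key hp hp'
  have h2 := key hp' hp
  omega

theorem Partner.left_unique (hp : Partner h i j) (hp' : Partner h i' j) : i = i' := by
  have key : ∀ {i i'}, Partner h i j → Partner h i' j → ¬ i < i' := by
    rintro i i' ⟨h1, -, h3, h4⟩ ⟨h1', -, h3', -⟩ hlt
    have := h4 i' (by omega) (by omega)
    omega
  have h1 := key hp hp'
  have h2 := key hp' hp
  omega

/-- If the two pairs crossed, then the height after `j` would be `h i`, which is below `h i'`, and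
at the same time above `h i'` because `j` lies inside the second pair. -/
theorem Partner.nested (hp : Partner h i j) (hp' : Partner h i' j') (h1 : i < i') (h2 : i' ≤ j) :
    j' < j := by
  rcases lt_trichotomy j' j with h3 | h3 | h3
  · exact h3
  · subst h3
    have := hp.left_unique hp'
    omega
  · have h4 := hp.2.2.2 i' h1 h2
    have h5 := hp'.2.2.2 (j + 1) (by omega) (by omega)
    have h6 := hp.2.2.1
    omega

theorem exists_least_int {P : ℤ → Prop} (a : ℤ) (h : ∃ j, a ≤ j ∧ P j) :
    ∃ j, a ≤ j ∧ P j ∧ ∀ k, a ≤ k → k < j → ¬ P k := by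
  obtain ⟨j, ⟨h1, h2⟩, h3⟩ := Int.exists_least_of_bdd (P := fun j => a ≤ j ∧ P j)
    ⟨a, fun z hz => hz.1⟩ h
  exact ⟨j, h1, h2, fun k hk hkj hP => by have := h3 k ⟨hk, hP⟩; omega⟩

/-- If the parenthesis is not unmatched, then the height returns to `h i` within the interval. The
first return is the partner, and it hits `h i` exactly because steps have size at most one. -/
theorem exists_partner_of_open (hE : Levels E) (hs : Steps h) (ho : h (i + 1) = h i + 1)
    (hu : ¬ UnmOpen h E z i) : ∃ j, Partner h i j ∧ E z i j := by
  have h1 : ∃ j, i ≤ j ∧ (E z j i ∧ h (j + 1) ≤ h i) := by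
    by_contra hc
    refine hu ⟨ho, fun j hj hEj => ?_⟩
    by_contra hlt
    exact hc ⟨j, hj, hEj, not_lt.1 hlt⟩
  obtain ⟨j, hj, ⟨hEj, hle⟩, hmin⟩ := exists_least_int i h1
  have hk : ∀ k, i < k → k ≤ j → h i < h k := by
    intro k hk hkj
    have := hmin (k - 1) (by omega) (by omega)
    rw [not_and, not_le] at this
    have h2 := this (hE.symm (hE.convex (by omega) (by omega) (hE.symm hEj)))
    rwa [sub_add_cancel] at h2
  have hij : i < j := by
    rcases hj.lt_or_eq with h2 | h2
    · exact h2
    · subst h2; omega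
  have h3 := hk j hij le_rfl
  have h4 := hs j
  exact ⟨j, ⟨hij, ho, by omega, hk⟩, hE.symm hEj⟩

theorem Partner.not_unmOpen (hE : Levels E) (hp : Partner h i j) (hz : E z i j) :
    ¬ UnmOpen h E z i := by
  rintro ⟨-, hu⟩
  have := hu j hp.1.le (hE.symm hz)
  have := hp.2.2.1
  omega

theorem Partner.not_unmClose (hp : Partner h i j) (hz : E z i j) :
    ¬ UnmClose h E z j := by
  rintro ⟨-, hu⟩
  have := hu i hp.1.le hz
  have := hp.2.2.1
  omega

theorem Partner.not_unm_left (hE : Levels E) (hp : Partner h i j) (hz : E z i j) :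
    ¬ Unm h E z i := by
  rintro (hu | hu)
  · have := hu.1
    have := hp.2.1
    omega
  · exact hp.not_unmOpen hE hz hu

theorem Partner.not_unm_right (hs : Steps h) (hp : Partner h i j) (hz : E z i j) :
    ¬ Unm h E z j := by
  rintro (hu | hu)
  · exact hp.not_unmClose hz hu
  · have := hu.1
    have := hp.close hs
    omega

/-- This is the reflection of `exists_partner_of_open`, with `N = 0`. -/
theorem exists_partner_of_close (hE : Levels E) (hs : Steps h) (hc : h j = h (j + 1) + 1)
    (hu : ¬ UnmClose h E z j) : ∃ i, Partner h i j ∧ E z i j := by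
  have h1 := exists_partner_of_open (hE.mirror 0) (hs.mirror 0) (i := -1 - j) (z := z)
    (by
      have e1 : 0 - (-1 - j + 1) = j := by ring
      have e2 : 0 - (-1 - j) = j + 1 := by ring
      rw [mirror, mirror, e1, e2]
      exact hc)
    (by
      rw [unmOpen_mirror]
      have e1 : 0 - 1 - (-1 - j) = j := by ring
      rwa [e1])
  obtain ⟨k, hk, hEk⟩ := h1
  replace hk := hk.of_mirror hs
  have e1 : 0 - 1 - (-1 - j) = j := by ring
  rw [e1] at hk
  rw [mirrorLevels, e1] at hEk
  exact ⟨_, hk, hE.symm hEk⟩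

/-! ### The effect of a change on the unmatched parentheses -/

/-- The height function after the step at position `p` is increased by one. -/
def bump (h : ℤ → ℤ) (p i : ℤ) : ℤ := h i + if p < i then 1 else 0

def Toggles (U U' : ℤ → Prop) (d : ℤ) : Prop := (∀ i, i ≠ d → (U' i ↔ U i)) ∧ (U' d ↔ ¬ U d)

/-- Level `z` has partners on both sides of `p` in the interval of `p`. -/
def Encloses (h : ℤ → ℤ) (E : ℕ → ℤ → ℤ → Prop) (z : ℕ) (p : ℤ) : Prop :=
  (∃ x, x ≤ p ∧ E z x p ∧ MatchedAt h E z x) ∧ ∃ y, p ≤ y ∧ E z p y ∧ MatchedAt h E z y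

/-- The position at which an increased step at `p` changes the unmatched parentheses of level `z`:
the next unmatched closing parenthesis, or the left end of the outermost pair around `p`. -/
def IsToggle (h : ℤ → ℤ) (E : ℕ → ℤ → ℤ → Prop) (z : ℕ) (p d : ℤ) : Prop :=
  (p ≤ d ∧ E z p d ∧ UnmClose h E z d ∧ ∀ e, p ≤ e → e < d → ¬ UnmClose h E z e) ∨
  (∀ e, p ≤ e → E z p e → ¬ UnmClose h E z e) ∧
    ((∃ z', z' ≤ z ∧ Encloses h E z' p ∧ (∀ z'', z'' ≤ z → z' < z'' → ¬ Encloses h E z'' p) ∧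
        MatchedAt h E z' d ∧ E z' d p ∧ ∀ x, MatchedAt h E z' x → E z' x p → d ≤ x) ∨
      (∀ z', z' ≤ z → ¬ Encloses h E z' p) ∧ d = p)

variable {p d : ℤ}

/-- Within an interval all unmatched closing parentheses precede all unmatched opening ones. Hence
the next unmatched parenthesis from `p` on already decides whether an unmatched closing one follows.
-/
theorem not_unmOpen_unmClose (hE : Levels E) (h1 : UnmOpen h E z i) (h2 : UnmClose h E z j)
    (hij : i ≤ j) (hz : E z i j) : False := by
  have h3 := h1.2 j hij (hE.symm hz)
  have h4 := h2.2 i hij hz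
  omega

theorem bump_of_le (hi : i ≤ p) : bump h p i = h i := by
  rw [bump, if_neg (by omega), add_zero]

theorem bump_of_lt (hi : p < i) : bump h p i = h i + 1 := by
  rw [bump, if_pos hi]

theorem unmClose_bump_of_lt (hi : i < p) : UnmClose (bump h p) E z i ↔ UnmClose h E z i := by
  unfold UnmClose
  rw [bump_of_le hi.le, bump_of_le (by omega : i + 1 ≤ p)]
  refine and_congr Iff.rfl (forall_congr' fun j => imp_congr_right fun hj => ?_)
  rw [bump_of_le (by omega : j ≤ p)]

theorem unmOpen_bump_of_gt (hi : p < i) : UnmOpen (bump h p) E z i ↔ UnmOpen h E z i := by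
  unfold UnmOpen
  rw [bump_of_lt hi, bump_of_lt (by omega : p < i + 1)]
  refine and_congr (by omega) (forall_congr' fun j => imp_congr_right fun hj => ?_)
  rw [bump_of_lt (by omega : p < j + 1)]
  exact imp_congr_right fun _ => by omega

theorem unmClose_bump_of_not (hi : p < i) (hz : ¬ E z i p) (hE : Levels E) :
    UnmClose (bump h p) E z i ↔ UnmClose h E z i := by
  unfold UnmClose
  rw [bump_of_lt hi, bump_of_lt (by omega : p < i + 1)]
  refine and_congr (by omega) (forall_congr' fun j => imp_congr_right fun hj =>
    imp_congr_right fun hji => ?_)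
  have : p < j := by
    by_contra hc
    exact hz (hE.symm (hE.convex_right (not_lt.1 hc) hi.le hji))
  rw [bump_of_lt this]
  omega

theorem unmOpen_bump_of_not (hi : i < p) (hz : ¬ E z i p) (hE : Levels E) :
    UnmOpen (bump h p) E z i ↔ UnmOpen h E z i := by
  unfold UnmOpen
  rw [bump_of_le hi.le, bump_of_le (by omega : i + 1 ≤ p)]
  refine and_congr Iff.rfl (forall_congr' fun j => imp_congr_right fun hj =>
    imp_congr_right fun hji => ?_)
  have : j < p := by
    by_contra hc
    exact hz (hE.convex hi.le (not_lt.1 hc) (hE.symm hji))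
  rw [bump_of_le (by omega : j + 1 ≤ p)]

/-- In an interval that does not contain `p` the heights that matter are all unchanged or all
shifted by one, and only their differences count. -/
theorem unm_bump_of_not (hE : Levels E) (hz : ¬ E z i p) :
    Unm (bump h p) E z i ↔ Unm h E z i := by
  rcases lt_trichotomy i p with hi | hi | hi
  · rw [Unm, Unm, unmClose_bump_of_lt hi, unmOpen_bump_of_not hi hz hE]
  · subst hi
    exact absurd (hE.refl z i) hz
  · rw [Unm, Unm, unmOpen_bump_of_gt hi, unmClose_bump_of_not hi hz hE]

/-- The additional opening height is used up by the first unmatched closing parenthesis `d` from `p`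
on. Openings up to `p` are matched before and after, since the height falls to its minimum at `d`,
and closing parentheses behind `d` that were unmatched reach still lower heights and remain
unmatched. -/
theorem toggles_of_unmClose (hE : Levels E) (hs : Steps h) (hp : h (p + 1) ≤ h p)
    (hpd : p ≤ d) (hz : E z p d) (hd : UnmClose h E z d)
    (hmin : ∀ e, p ≤ e → e < d → ¬ UnmClose h E z e) :
    Toggles (Unm h E z) (Unm (bump h p) E z) d := by
  have hlow : ∀ j, j ≤ d → E z j d → h (d + 1) < h j := hd.2
  -- the interval contains a position before `p` whose height is just above the one after `d`
  have hex : ∃ j, j ≤ p ∧ E z j p ∧ h j ≤ h (d + 1) + 1 := by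
    by_contra hc
    push Not at hc
    have h1 := hc p le_rfl (hE.refl z p)
    -- Otherwise the first step from `p` on that goes down to height `h (d + 1) + 1` would be an
    -- unmatched closing parenthesis before `d`.
    obtain ⟨e, he, hle, hemin⟩ := exists_least_int (P := fun e => h (e + 1) ≤ h (d + 1) + 1) p
      ⟨d, hpd, by omega⟩
    have hed : e < d := by
      rcases hpd.lt_or_eq with h2 | h2
      · by_contra hde
        refine hemin (d - 1) (by omega) (by omega) ?_
        have := hd.1
        rw [sub_add_cancel]
        omega
      · subst h2
        have := hd.1
        omega
    have hpe : ∀ k, p ≤ k → k ≤ e → h (d + 1) + 1 < h k := by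
      intro k hk hke
      rcases hk.lt_or_eq with h2 | h2
      · have := hemin (k - 1) (by omega) (by omega)
        rwa [sub_add_cancel, not_le] at this
      · rw [← h2]; exact h1
    refine hmin e he hed ⟨?_, fun j hj hje => ?_⟩
    · have := hs e
      have := hpe e he le_rfl
      have := hlow (e + 1) (by omega) (hE.convex_right (by omega) (by omega) hz)
      omega
    · rcases le_or_gt j p with h2 | h2
      · have := hc j h2 (hE.convex h2 he hje)
        omega
      · have := hpe j h2.le hj
        omega
  have hOpen : ∀ i, i ≤ p → E z i p → ¬ UnmOpen (bump h p) E z i := by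
    rintro i hi hip ⟨-, hu⟩
    have h1 := hu d (by omega) (hE.symm (hE.trans hip hz))
    have h2 := hlow i (by omega) (hE.trans hip hz)
    rw [bump_of_le hi, bump_of_lt (by omega)] at h1
    omega
  have hOpen' : ∀ i, i ≤ p → E z i p → ¬ UnmOpen h E z i := fun i hi hip hu =>
    not_unmOpen_unmClose hE hu hd (by omega) (hE.trans hip hz)
  refine ⟨fun i hi => ?_, iff_of_false ?_ (not_not.2 (Or.inl hd))⟩
  · by_cases hip : E z i p
    · rcases lt_trichotomy i p with h1 | h1 | h1
      · rw [Unm, Unm, unmClose_bump_of_lt h1, iff_false_intro (hOpen i h1.le hip),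
          iff_false_intro (hOpen' i h1.le hip)]
      · subst h1
        refine iff_of_false ?_ ?_
        · rintro (hu | hu)
          · have := hu.1
            rw [bump_of_le le_rfl, bump_of_lt (by omega)] at this
            have := hs i
            omega
          · exact hOpen i le_rfl hip hu
        · rintro (hu | hu)
          · rcases hpd.lt_or_eq with h2 | h2
            · exact hmin i le_rfl h2 hu
            · exact hi h2
          · exact hOpen' i le_rfl hip hu
      · rw [Unm, Unm, unmOpen_bump_of_gt h1]
        refine or_congr ⟨fun hu => ⟨?_, fun j hj hji => ?_⟩, fun hu => ⟨?_, fun j hj hji => ?_⟩⟩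
          Iff.rfl
        · have := hu.1
          rw [bump_of_lt h1, bump_of_lt (by omega : p < i + 1)] at this
          omega
        · have := hu.2 j hj hji
          rw [bump_of_lt (by omega : p < i + 1), bump] at this
          split_ifs at this <;> omega
        · rw [bump_of_lt h1, bump_of_lt (by omega : p < i + 1)]
          have := hu.1
          omega
        · have hdi : d < i := by
            rcases lt_trichotomy i d with h2 | h2 | h2
            · exact absurd hu (hmin i h1.le h2)
            · exact absurd h2 hi
            · exact h2
          rw [bump_of_lt (by omega : p < i + 1)]
          rcases le_or_gt j p with h2 | h2
          · rw [bump_of_le h2]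
            -- Heights before `p` are not raised, but they exceed `h (d + 1)`, which in turn exceeds
            -- `h (i + 1)`; two strict inequalities outweigh the shift by one.
            have h3 := hlow j (by omega) (hE.convex (by omega) hdi.le hji)
            have h4 := hu.2 (d + 1) (by omega)
              (hE.convex_right (i := j) (by omega) (by omega) hji)
            omega
          · rw [bump_of_lt h2]
            have := hu.2 j hj hji
            omega
    · exact unm_bump_of_not hE hip
  · rintro (hu | hu)
    · obtain ⟨j, hj, hjp, hle⟩ := hex
      have h1 := hu.2 j (by omega) (hE.trans hjp hz)
      rw [bump_of_le hj, bump_of_lt (by omega)] at h1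
      omega
    · have h1 := hu.1
      have h2 := hd.1
      have h3 := hs d
      rw [bump_of_lt (by omega : p < d + 1), bump] at h1
      split_ifs at h1 with h4
      · omega
      · have h5 : d = p := by omega
        subst h5
        omega

/-- There is no unmatched closing parenthesis after `p`, and `d` starts the outermost pair around
`p`, or there is no such pair and `d = p`. -/
theorem toggles_of_outermost (hE : Levels E) (hs : Steps h) (hp : h (p + 1) ≤ h p)
    (hno : ∀ e, p ≤ e → E z p e → ¬ UnmClose h E z e)
    (hd : (∃ j, Partner h d j ∧ d ≤ p ∧ p ≤ j ∧ E z d j ∧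
        ∀ i j, Partner h i j → i ≤ p → p ≤ j → E z i j → d ≤ i) ∨
      (∀ i j, Partner h i j → i ≤ p → p ≤ j → ¬ E z i j) ∧ d = p) :
    Toggles (Unm h E z) (Unm (bump h p) E z) d := by
  -- a first step below the height `c` after `p` closes a pair around `p`
  have key : ∀ c, c ≤ h p → (∃ j, p ≤ j ∧ (E z p j ∧ h (j + 1) < c)) →
      ∃ i j, Partner h i j ∧ i < p ∧ p ≤ j ∧ E z i j ∧ h i < c := by
    intro c hc hj
    obtain ⟨j, hj, ⟨hpj, hlt⟩, hmin⟩ := exists_least_int p hj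
    have hk : ∀ k, p ≤ k → k ≤ j → c ≤ h k := by
      intro k hk hkj
      rcases hk.lt_or_eq with h1 | h1
      · have := hmin (k - 1) (by omega) (by omega)
        rw [not_and, not_lt, sub_add_cancel] at this
        exact this (hE.convex (by omega) (by omega) hpj)
      · rw [← h1]; exact hc
    have hcl : h j = h (j + 1) + 1 := by
      have := hk j hj le_rfl
      have := hs j
      omega
    obtain ⟨i, hi, hij⟩ := exists_partner_of_close hE hs hcl (hno j hj hpj)
    have h1 : h i < c := by rw [← hi.2.2.1]; exact hlt
    -- From `p` to `j` the height is at least `c`, while the partner of `j` starts at a height below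
    -- `c`; hence it lies before `p`.
    refine ⟨i, j, hi, ?_, hj, hij, h1⟩
    by_contra hip
    have := hk i (by omega) hi.1.le
    omega
  have hclose : ∀ i, UnmClose (bump h p) E z i ↔ UnmClose h E z i := by
    intro i
    by_cases hip : E z i p
    · rcases lt_or_ge i p with h1 | h1
      · exact unmClose_bump_of_lt h1
      · refine iff_of_false (fun hu => hno i h1 (hE.symm hip) ⟨?_, fun j hj hji => ?_⟩)
          (hno i h1 (hE.symm hip))
        · have h2 := hu.1
          rw [bump_of_lt (by omega : p < i + 1), bump] at h2
          have h3 := hs i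
          split_ifs at h2 <;> omega
        · have h2 := hu.2 j hj hji
          rw [bump_of_lt (by omega : p < i + 1), bump] at h2
          split_ifs at h2 <;> omega
    · rcases lt_trichotomy i p with h1 | h1 | h1
      · exact unmClose_bump_of_lt h1
      · subst h1
        exact absurd (hE.refl z i) hip
      · exact unmClose_bump_of_not h1 hip hE
  -- the openings before `p` that are unmatched afterwards
  have hopen : ∀ i, i ≤ p → E z i p → UnmOpen (bump h p) E z i → ¬ UnmOpen h E z i →
      (i = p ∧ h (p + 1) = h p) ∨ ∃ j, Partner h i j ∧ i < p ∧ p ≤ j ∧ E z i j := by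
    intro i hi hip hu hn
    rcases hi.lt_or_eq with h1 | h1
    · right
      have ho : h (i + 1) = h i + 1 := by
        have := hu.1
        rwa [bump_of_le hi, bump_of_le (by omega : i + 1 ≤ p)] at this
      obtain ⟨j, hj, hij⟩ := exists_partner_of_open hE hs ho hn
      refine ⟨j, hj, h1, ?_, hij⟩
      by_contra hc
      have h2 := hu.2 j hj.1.le (hE.symm hij)
      rw [bump_of_le hi, bump_of_le (by omega : j + 1 ≤ p)] at h2
      have := hj.2.2.1
      omega
    · left
      subst h1
      have := hu.1
      rw [bump_of_le le_rfl, bump_of_lt (by omega)] at this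
      exact ⟨rfl, by omega⟩
  have hmono : ∀ i, i ≤ p → UnmOpen h E z i → UnmOpen (bump h p) E z i := by
    intro i hi hu
    have h1 : i < p := by
      rcases hi.lt_or_eq with h1 | h1
      · exact h1
      · subst h1
        have := hu.1
        omega
    refine ⟨?_, fun j hj hji => ?_⟩
    · rw [bump_of_le hi, bump_of_le (by omega : i + 1 ≤ p)]; exact hu.1
    · have := hu.2 j hj hji
      rw [bump_of_le hi, bump]
      split_ifs <;> omega
  have hunm : ∀ i, (i ≤ p → E z i p → (UnmOpen (bump h p) E z i ↔ UnmOpen h E z i)) →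
      (Unm (bump h p) E z i ↔ Unm h E z i) := by
    intro i hi
    by_cases hip : E z i p
    · rw [Unm, Unm, hclose]
      rcases le_or_gt i p with h1 | h1
      · rw [hi h1 hip]
      · rw [unmOpen_bump_of_gt h1]
    · exact unm_bump_of_not hE hip
  rcases hd with ⟨j₀, hj₀, hdp, hpj, hdj, hmin⟩ | ⟨hnone, rfl⟩
  · have hdp' : d < p := by
      rcases hdp.lt_or_eq with h1 | h1
      · exact h1
      · subst h1
        have := hj₀.2.1
        omega
    have hdE : E z d p := hE.convex hdp hpj hdj
    have hnd : ¬ Unm h E z d := hj₀.not_unm_left hE hdj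
    -- If the height fell below `h d` after `p`, then `key` would provide a pair around `p` that
    -- begins at a lower height than the outermost one.
    have hge : ∀ j, p ≤ j → E z p j → h d ≤ h (j + 1) := by
      intro j hj hpj'
      by_contra hc
      obtain ⟨i, j', hi, hip, hpj'', hij, hlt⟩ := key (h d) (hj₀.2.2.2 p hdp' hpj).le
        ⟨j, hj, hpj', not_le.1 hc⟩
      have h1 := hmin i j' hi hip.le hpj'' hij
      rcases h1.lt_or_eq with h2 | h2
      · have := hj₀.2.2.2 i h2 (by omega)
        omega
      · subst h2; omega
    have hnew : UnmOpen (bump h p) E z d := by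
      refine ⟨?_, fun j hj hjd => ?_⟩
      · rw [bump_of_le hdp, bump_of_le (by omega : d + 1 ≤ p)]; exact hj₀.2.1
      · rw [bump_of_le hdp]
        rcases lt_or_ge j p with h1 | h1
        · rw [bump_of_le (by omega : j + 1 ≤ p)]
          exact hj₀.2.2.2 _ (by omega) (by omega)
        · rw [bump_of_lt (by omega : p < j + 1)]
          have := hge j h1 (hE.symm (hE.trans hjd hdE))
          omega
    refine ⟨fun i hi => hunm i fun hip hiE => ⟨fun hu => ?_, hmono i hip⟩,
      iff_of_true (Or.inr hnew) hnd⟩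
    by_contra hn
    -- Evaluated at the end `j₀` of the outermost pair, a newly unmatched opening at `i` would
    -- satisfy `h i < h d + 1`. But any other candidate lies strictly inside this pair, at a height
    -- above `h d`.
    have h4 := hu.2 j₀ (by omega) (hE.trans (hE.convex_right hdp hpj hdj |> hE.symm) (hE.symm hiE))
    rw [bump_of_le hip, bump_of_lt (by omega : p < j₀ + 1), hj₀.2.2.1] at h4
    rcases hopen i hip hiE hu hn with ⟨h1, h2⟩ | ⟨j, hj, h1, h2, h3⟩
    · subst h1
      have h3 := hj₀.2.2.2 i hdp' hpj
      omega
    · have h5 := hmin i j hj hip h2 h3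
      have h6 := hj₀.2.2.2 i (by omega) (by omega)
      omega
  -- A closing parenthesis at `d` would have a partner in the interval, as it is not unmatched, and
  -- thus belong to a pair around `d`. So the position is empty before the change.
  · have hp' : h (d + 1) = h d := by
      by_contra hc
      have h1 : h d = h (d + 1) + 1 := by
        have := hs d
        omega
      obtain ⟨i, hi, hid⟩ := exists_partner_of_close hE hs h1 (hno d le_rfl (hE.refl z d))
      exact hnone i d hi hi.1.le le_rfl hid
    have hnew : UnmOpen (bump h d) E z d := by
      refine ⟨by rw [bump_of_le le_rfl, bump_of_lt (by omega)]; omega, fun j hj hjd => ?_⟩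
      rw [bump_of_le le_rfl, bump_of_lt (by omega : d < j + 1)]
      by_contra hc
      obtain ⟨i, j', hi, hip, hpj'', hij, -⟩ := key (h d) le_rfl ⟨j, hj, hE.symm hjd, by omega⟩
      exact hnone i j' hi hip.le hpj'' hij
    refine ⟨fun i hi => hunm i fun hip hiE => ⟨fun hu => ?_, hmono i hip⟩,
      iff_of_true (Or.inr hnew) ?_⟩
    · by_contra hn
      rcases hopen i hip hiE hu hn with ⟨h1, h2⟩ | ⟨j, hj, h1, h2, h3⟩
      · exact hi h1
      · exact hnone i j hj hip h2 h3
    · rintro (hu | hu)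
      · have := hu.1; omega
      · have := hu.1; omega

/-! ### The outermost pair around a position -/

theorem MatchedAt.exists_partner (hE : Levels E) (hs : Steps h) (hm : MatchedAt h E (z + 1) i) :
    (∃ j, Partner h i j ∧ E (z + 1) i j ∧ ¬ E z i j) ∨
      ∃ j, Partner h j i ∧ E (z + 1) j i ∧ ¬ E z j i := by
  obtain ⟨hu | hu, hn⟩ := hm
  · right
    obtain ⟨j, hj, hji⟩ := exists_partner_of_close hE hs hu.1 fun hc => hn (Or.inl hc)
    exact ⟨j, hj, hji, fun hz => hj.not_unmClose hz hu⟩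
  · left
    obtain ⟨j, hj, hij⟩ := exists_partner_of_open hE hs hu.1 fun hc => hn (Or.inr hc)
    exact ⟨j, hj, hij, fun hz => hj.not_unmOpen hE hz hu⟩

/-- Partners are unique, so neither of them finds another partner at the lower level. Thus both
become matched at the first level at which they share an interval. -/
theorem Partner.matchedAt (hE : Levels E) (hs : Steps h) (hp : Partner h i j)
    (h1 : E (z + 1) i j) (h2 : ¬ E z i j) :
    MatchedAt h E (z + 1) i ∧ MatchedAt h E (z + 1) j := by
  refine ⟨⟨Or.inr ?_, hp.not_unm_left hE h1⟩, Or.inl ?_, hp.not_unm_right hs h1⟩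
  · by_contra hn
    obtain ⟨j', hj', hz⟩ := exists_partner_of_open hE hs hp.2.1 hn
    rw [hp.right_unique hj'] at h2
    exact h2 hz
  · by_contra hn
    obtain ⟨i', hi', hz⟩ := exists_partner_of_close hE hs (hp.close hs) hn
    rw [hp.left_unique hi'] at h2
    exact h2 hz

theorem Partner.exists_level (hE : Levels E) (hp : Partner h i j) (hz : E z i j) :
    ∃ z', z' + 1 ≤ z ∧ E (z' + 1) i j ∧ ¬ E z' i j := by
  classical
  have hex : ∃ z, E z i j := ⟨z, hz⟩
  obtain ⟨m, hm⟩ : ∃ m, Nat.find hex = m := ⟨_, rfl⟩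
  have h1 := Nat.find_spec hex
  have h2 : ∀ z', z' < m → ¬ E z' i j := fun z' hz' => Nat.find_min hex (hm ▸ hz')
  rw [hm] at h1
  have h3 : m ≤ z := hm ▸ Nat.find_le hz
  cases m with
  | zero => have := hE.zero h1; have := hp.1; omega
  | succ m => exact ⟨m, h3, h1, h2 m (Nat.lt_succ_self m)⟩

/-- The leftmost parenthesis `d` of the level cannot be closing, as its partner would lie further
left. If its partner `j` lay before `p`, then `y` would share with `j` the right half of the
interval. The partner of `y` would have to be in the left half, hence inside the pair of `d`, and
the pair of `y` would be nested before `j`, contradicting `p ≤ y`. -/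
theorem partner_of_least_matchedAt (hE : Levels E) (hs : Steps h)
    (hp : Encloses h E (z + 1) p) (hd : MatchedAt h E (z + 1) d) (hdp : E (z + 1) d p)
    (hmin : ∀ x, MatchedAt h E (z + 1) x → E (z + 1) x p → d ≤ x) :
    ∃ j, Partner h d j ∧ d ≤ p ∧ p ≤ j ∧ E (z + 1) d j ∧ ¬ E z d j := by
  obtain ⟨⟨x, hxp, hx, hxm⟩, y, hpy, hy, hym⟩ := hp
  have hdx := hmin x hxm hx
  rcases hd.exists_partner hE hs with ⟨j, hj, hdj, hnj⟩ | ⟨j, hj, hjd, hnj⟩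
  · refine ⟨j, hj, by omega, ?_, hdj, hnj⟩
    by_contra hjp
    rw [not_le] at hjp
    have hdy : E (z + 1) d y := hE.trans hdp hy
    have hjy : E z j y := (hE.split hj.1.le (by omega) hdy).resolve_left hnj
    rcases hym.exists_partner hE hs with ⟨y', hy', hyy, hny⟩ | ⟨y', hy', hyy, hny⟩
    · have hdy' : E (z + 1) d y' := hE.trans hdy hyy
      rcases hE.split (by omega : d ≤ y) hy'.1.le hdy' with h1 | h1
      · exact hnj (hE.convex hj.1.le (by omega) h1)
      · exact hny h1
    · have h1 : y' < j := by
        by_contra hc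
        exact hny (hE.convex_right (not_lt.1 hc) hy'.1.le hjy)
      have h2 : d ≤ y' := by
        refine hmin y' (hy'.matchedAt hE hs hyy hny).1 (hE.trans hyy (hE.symm hy))
      rcases h2.lt_or_eq with h3 | h3
      · have := hj.nested hy' h3 h1.le
        omega
      · subst h3
        have := hj.right_unique hy'
        omega
  · have h1 := hmin j (hj.matchedAt hE hs hjd hnj).1 (hE.trans hjd hdp)
    have := hj.1
    omega

/-- It remains to see that the pair found at the highest enclosing level is the outermost one around
`p` in the interval of level `z`. Each pair around `p` makes its own level enclosing, so it has to
be compared only with pairs of lower levels and of the same level. -/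
theorem IsToggle.toggles (hE : Levels E) (hs : Steps h) (hp : h (p + 1) ≤ h p)
    (hd : IsToggle h E z p d) : Toggles (Unm h E z) (Unm (bump h p) E z) d := by
  -- pairs around `p` show at some level
  have henc : ∀ i j, Partner h i j → i ≤ p → p ≤ j → E z i j →
      ∃ z', z' + 1 ≤ z ∧ E (z' + 1) i j ∧ ¬ E z' i j ∧ Encloses h E (z' + 1) p := by
    intro i j hij hip hpj hz
    obtain ⟨z', h1, h2, h3⟩ := hij.exists_level hE hz
    have hm := hij.matchedAt hE hs h2 h3
    exact ⟨z', h1, h2, h3, ⟨i, hip, hE.convex hip hpj h2, hm.1⟩, j, hpj,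
      hE.convex_right hip hpj h2, hm.2⟩
  rcases hd with ⟨h1, h2, h3, h4⟩ | ⟨hno, ⟨z', hz', hen, hmax, hdm, hdp, hmin⟩ | ⟨hnone, rfl⟩⟩
  · exact toggles_of_unmClose hE hs hp h1 h2 h3 h4
  · refine toggles_of_outermost hE hs hp hno (Or.inl ?_)
    cases z' with
    | zero => exact hdm.elim
    | succ z' =>
      obtain ⟨j, hj, hdp', hpj, hdj, hnj⟩ := partner_of_least_matchedAt hE hs hen hdm hdp hmin
      refine ⟨j, hj, hdp', hpj, hE.mono hz' hdj, fun i₁ j₁ hij hip hpj₁ hz => ?_⟩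
      obtain ⟨z₁, h1, h2, h3, h4⟩ := henc i₁ j₁ hij hip hpj₁ hz
      rcases lt_trichotomy z₁ z' with h5 | h5 | h5
      -- A pair of a lower level that began before `d` would contain the pair of `d`, whose two ends
      -- would then meet at that lower level.
      · by_contra hlt
        rw [not_le] at hlt
        have h6 := hij.nested hj hlt (by omega)
        exact hnj (hE.mono (by omega : z₁ + 1 ≤ z')
          (hE.convex hj.1.le h6.le (hE.convex_right hlt.le (by omega) h2)))
      · subst h5
        exact hmin i₁ (hij.matchedAt hE hs h2 h3).1 (hE.convex hip hpj₁ h2)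
      · exact absurd h4 (hmax _ h1 (by omega))
  · refine toggles_of_outermost hE hs hp hno (Or.inr ⟨fun i j hij hip hpj hz => ?_, rfl⟩)
    obtain ⟨z', h1, h2, h3, h4⟩ := henc i j hij hip hpj hz
    exact hnone _ h1 h4

/-! ### Decreasing a step, by reflection -/

/-- The height function after the step at position `p` is decreased by one. -/
def unbump (h : ℤ → ℤ) (p i : ℤ) : ℤ := h i - if p < i then 1 else 0

theorem unm_congr {h' : ℤ → ℤ} {c : ℤ} (hh : ∀ i, h' i = h i + c) : Unm h' E z i ↔ Unm h E z i := by
  simp only [Unm, UnmClose, UnmOpen, hh]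
  refine or_congr (and_congr (by omega) ?_) (and_congr (by omega) ?_) <;>
  exact forall_congr' fun _ => imp_congr_right fun _ => imp_congr_right fun _ => by omega

/-- Read from right to left, a decreased step is an increased one. -/
theorem IsToggle.toggles_mirror {N : ℤ} (hE : Levels E) (hs : Steps h) (hp : h p ≤ h (p + 1))
    (hd : IsToggle (mirror N h) (mirrorLevels N E) z (N - 1 - p) (N - 1 - d)) :
    Toggles (Unm h E z) (Unm (unbump h p) E z) d := by
  have h1 := hd.toggles (hE.mirror N) (hs.mirror N) (by
    have e1 : N - (N - 1 - p + 1) = p := by ring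
    have e2 : N - (N - 1 - p) = p + 1 := by ring
    rw [mirror, mirror, e1, e2]
    exact hp)
  have h2 : ∀ i, Unm (bump (mirror N h) (N - 1 - p)) (mirrorLevels N E) z (N - 1 - i) ↔
      Unm (unbump h p) E z i := by
    intro i
    -- The two height functions differ by the constant one, which `unm_congr` ignores: raising what
    -- follows the reflected position amounts to lowering what follows `p`, up to a global shift.
    have e : ∀ i, bump (mirror N h) (N - 1 - p) i = mirror N (unbump h p) i + 1 := by
      intro i
      simp only [bump, mirror, unbump]
      split_ifs <;> omega
    rw [unm_congr e, unm_mirror, sub_sub_cancel]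
  have h3 : ∀ i, Unm (mirror N h) (mirrorLevels N E) z (N - 1 - i) ↔ Unm h E z i := by
    intro i
    rw [unm_mirror, sub_sub_cancel]
  refine ⟨fun i hi => ?_, ?_⟩
  · rw [← h2, ← h3]
    exact h1.1 _ (by omega)
  · rw [← h2, ← h3]
    exact h1.2

end

/-! ### Evaluation of conditions -/

section eval

variable {E : Env} {L : Schema} {n : ℕ} {D : ∀ i, DataType (E.sig i) (E.scale i * n)}
  {A : Str E.aux n} {σ : Store E L n D} {k : ℕ} {v : Fin k → Fin n}

theorem Expr.eval_eq_iff {t t' : Expr E L .term k} :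
    (Expr.eq t t').eval A σ v ↔ ∃ a : Fin n, t.eval A σ v = some a ∧ t'.eval A σ v = some a :=
  Iff.rfl

theorem Expr.eval_le_of {t t' : Expr E L .term k} {a b : Fin n} (h : t.eval A σ v = some a)
    (h' : t'.eval A σ v = some b) : (Expr.le t t').eval A σ v ↔ a ≤ b := by
  simp only [Expr.eval, h, h']
  constructor
  · rintro ⟨a', b', ha, hb, hab⟩
    rwa [Option.some.inj ha, Option.some.inj hb]
  · intro hab
    exact ⟨a, b, rfl, rfl, hab⟩

theorem Expr.eval_eq_of {t t' : Expr E L .term k} {a b : Fin n} (h : t.eval A σ v = some a)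
    (h' : t'.eval A σ v = some b) : (Expr.eq t t').eval A σ v ↔ a = b := by
  simp only [Expr.eval, h, h']
  constructor
  · rintro ⟨a', ha, hb⟩
    rw [Option.some.inj ha, Option.some.inj hb]
  · rintro rfl
    exact ⟨a, rfl, rfl⟩

/-- Since an equation with an undefined side is false, an equation of a term with itself tests
whether the term is defined. The programs express nonemptiness of sets in this way. -/
theorem Expr.eval_eq_self {t : Expr E L .term k} :
    (Expr.eq t t).eval A σ v ↔ ∃ a : Fin n, t.eval A σ v = some a := by
  simp only [Expr.eval, and_self]

theorem Expr.eval_ite_of_true {κ : Kind} {C : Expr E L .cond k} {e e' : Expr E L κ k}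
    (h : C.eval A σ v) : (Expr.ite C e e').eval A σ v = e.eval A σ v := choice_true h _ _

theorem Expr.eval_ite_of_false {κ : Kind} {C : Expr E L .cond k} {e e' : Expr E L κ k}
    (h : ¬ C.eval A σ v) : (Expr.ite C e e').eval A σ v = e'.eval A σ v := choice_false h _ _

end eval

section assign

variable {E : Env} {L : Schema} {n : ℕ} {D : ∀ i, DataType (E.sig i) (E.scale i * n)}
  {A : Str E.aux n} {σ : Store E L n D} {base k : ℕ} {ph : Phase} {v : Fin k → Fin n}
  {s : L.Sym} {args : Fin (L.arity s) → Expr E L .term k} {e : Expr E L (L.kind s) k}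
  {guarded : ∀ j : Fin k, base ≤ j → ∃ a, args a = Expr.var j} {a : Fin (L.arity s) → Fin n}

theorem Stmt.exec_assign_loc_self (h : allSome (fun j => (args j).eval A σ v) = some a) :
    ((Stmt.assign (base := base) (ph := ph) s args e guarded).exec A v σ).loc s a =
      e.eval A σ v := by
  simp only [Stmt.exec, h, Function.update_self]

theorem Stmt.exec_assign_loc_of_ne (h : allSome (fun j => (args j).eval A σ v) = some a)
    {b : Fin (L.arity s) → Fin n} (hb : b ≠ a) :
    ((Stmt.assign (base := base) (ph := ph) s args e guarded).exec A v σ).loc s b =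
      σ.loc s b := by
  simp only [Stmt.exec, h, Function.update_self, Function.update_of_ne hb]

theorem Stmt.exec_assign_sup :
    ((Stmt.assign (base := base) (ph := ph) s args e guarded).exec A v σ).sup = σ.sup := by
  simp only [Stmt.exec]
  split <;> rfl

end assign

/-- The update rule that leaves a static symbol unchanged. -/
def staticRule (E : Env) (s : E.aux.Sym) : UpdateRule E 1 (E.aux.kind s) (E.aux.arity s) where
  L := noSymbols
  initial := .skip
  numVars := 0
  bound := Fin.elim0
  target := fun _ => .var 0
  main := .ret (.aux s fun _ => .var 0)

theorem staticRule_work (E : Env) (s : E.aux.Sym) (n : ℕ) (c : ∀ i : E.Sup, Cost (E.sig i)) :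
    (staticRule E s).work n c ≤ 1 := by
  refine UpdateRule.work_le_of_numVars_zero rfl ?_ ?_ ?_ <;>
    simp [staticRule, Stmt.work, Body.work, Expr.work]

/-! ### Dynamic sets with successor queries -/

inductive SetOp
  | ins
  | del

abbrev setSig : Sig := ⟨SetOp, fun _ => 1, ⟨Unit, inferInstance, fun _ => .term, fun _ => 1⟩⟩

/-- The least element of a set of numbers, if it is in the domain. -/
def leastIn (n : ℕ) (S : Set ℕ) : Option (Fin n) := theUnique fun q : Fin n => IsLeast S q

/-- A set of domain elements, with queries for the least element that is at least `p`. -/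
def SuccSet : DynProblem setSig := fun n =>
  { State := Set ℕ
    start := ∅
    change := fun op p S => match op with
      | .ins => insert (p (0 : Fin 1) : ℕ) S
      | .del => S \ {(p (0 : Fin 1) : ℕ)}
    query := fun S _ p => leastIn n {x | x ∈ S ∧ (p (0 : Fin 1) : ℕ) ≤ x} }

theorem leastIn_eq_some {n : ℕ} {S : Set ℕ} {q : Fin n} : leastIn n S = some q ↔ IsLeast S q := by
  rw [leastIn, theUnique_eq_some]
  exact ⟨fun h => h.1, fun h => ⟨h, fun b hb => Fin.ext (hb.unique h)⟩⟩

theorem leastIn_eq_none {n : ℕ} {S : Set ℕ} (hS : ∀ x ∈ S, x < n) :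
    leastIn n S = none ↔ S = ∅ := by
  rw [leastIn, theUnique_eq_none]
  constructor
  · intro h
    by_contra hne
    obtain ⟨q, hq⟩ : ∃ q, IsLeast S q := by
      have hne' := Set.nonempty_iff_ne_empty.2 hne
      exact ⟨sInf S, Nat.sInf_mem hne', fun x hx => Nat.sInf_le hx⟩
    exact h ⟨⟨q, hS q hq.1⟩, hq, fun b hb => Fin.ext (hb.unique hq)⟩
  · rintro rfl ⟨q, hq, -⟩
    exact hq.1

theorem leastIn_insert {n : ℕ} {S : Set ℕ} (hS : ∀ x ∈ S, x < n) (p : Fin n) :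
    leastIn n (insert (p : ℕ) S) = match leastIn n S with
      | some q => if q ≤ p then some q else some p
      | none => some p := by
  cases h : leastIn n S with
  | none =>
    rw [leastIn_eq_none hS] at h
    subst h
    simp only [leastIn_eq_some, insert_empty_eq]
    exact isLeast_singleton
  | some q =>
    rw [leastIn_eq_some] at h
    simp only
    split_ifs with hqp
    · rw [leastIn_eq_some]
      refine ⟨Set.mem_insert_of_mem _ h.1, ?_⟩
      rintro x (rfl | hx)
      · exact hqp
      · exact h.2 hx
    · rw [leastIn_eq_some]
      refine ⟨Set.mem_insert _ _, ?_⟩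
      rintro x (rfl | hx)
      · exact le_rfl
      · have h1 : (q : ℕ) ≤ x := h.2 hx
        have h2 : (p : ℕ) < q := not_le.1 hqp
        omega

/-- At the largest level that separates `p` and `q`, they lie in the two halves of one interval, and
hence in adjacent intervals. -/
theorem exists_adjacent_level {Z p q : ℕ} (hpq : p < q) (h : dyadicBase Z p = dyadicBase Z q) :
    ∃ z, z < Z ∧ dyadicBase z q = dyadicBase z p + 2 ^ z := by
  induction Z with
  | zero => rw [dyadicBase_zero, dyadicBase_zero] at h; omega
  | succ Z ih =>
    by_cases h' : dyadicBase Z p = dyadicBase Z q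
    · obtain ⟨z, hz, he⟩ := ih h'
      exact ⟨z, by omega, he⟩
    · refine ⟨Z, by omega, ?_⟩
      have h1 : p / 2 ^ Z ≤ q / 2 ^ Z := Nat.div_le_div_right hpq.le
      rw [dyadicBase_eq_iff] at h h'
      rw [pow_succ, ← Nat.div_div_eq_div_mul, ← Nat.div_div_eq_div_mul] at h
      have h2 : q / 2 ^ Z = p / 2 ^ Z + 1 := by omega
      rw [dyadicBase, dyadicBase, h2]
      ring

/-- The elements of `S` in the dyadic interval of level `z` after the one of `p`. -/
def nextPart (S : Set ℕ) (z p : ℕ) : Set ℕ := {x | x ∈ S ∧ dyadicBase z x = dyadicBase z p + 2 ^ z}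

theorem lt_of_mem_nextPart {S : Set ℕ} {z p x : ℕ} (h : x ∈ nextPart S z p) : p < x := by
  have h1 := lt_dyadicBase_add z p
  have h2 := dyadicBase_le z x
  have h3 := h.2
  omega

/-- The first nonempty part of the set after `p` contains the successor of `p`. -/
theorem isLeast_nextPart {S : Set ℕ} {z p : ℕ} {q : ℕ}
    (hq : IsLeast {x | x ∈ S ∧ p < x} q) (h : (nextPart S z p).Nonempty)
    (hz : ∀ z', z' < z → ¬ (nextPart S z' p).Nonempty) : IsLeast (nextPart S z p) q := by
  refine ⟨⟨hq.1.1, ?_⟩, fun x hx => hq.2 ⟨hx.1, lt_of_mem_nextPart hx⟩⟩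
  obtain ⟨x, hx⟩ := h
  have h1 := hq.2 ⟨hx.1, lt_of_mem_nextPart hx⟩
  have h2 := lt_dyadicBase_add z x
  have h3 := hx.2
  have hpq : p < q := hq.1.2
  have h4 : dyadicBase z p + 2 ^ z ≤ q := by
    by_contra hlt
    have h5 := dyadicBase_eq_of_le (z := z) ((dyadicBase_le z p).trans hpq.le) (not_le.1 hlt)
    obtain ⟨z', hz', he⟩ := exists_adjacent_level hpq h5.symm
    exact hz z' hz' ⟨q, hq.1.1, he⟩
  rw [← h3] at h4 ⊢
  exact dyadicBase_eq_of_le h4 (by omega)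

theorem exists_nextPart {S : Set ℕ} {n : ℕ} {p q : Fin n} (hq : (q : ℕ) ∈ S) (hpq : p < q) :
    ∃ z : Fin n, (z : ℕ) ≤ logBound.fn n ∧ (nextPart S z p).Nonempty := by
  obtain ⟨Z, hZ, hn⟩ := exists_top_level n (by have := p.isLt; omega)
  have h1 : ∀ x : Fin n, dyadicBase Z x = 0 := fun x => by
    rw [dyadicBase, Nat.div_eq_of_lt (lt_of_lt_of_le x.isLt hn), zero_mul]
  obtain ⟨z, hz, he⟩ := exists_adjacent_level (Z := Z) hpq (by rw [h1, h1])
  have := Z.isLt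
  exact ⟨⟨z, by omega⟩, by simp only; omega, q, hq, he⟩

/-! ### The program for successor queries -/

inductive SuccSym
  | base
  | next
  | least

instance : Fintype SuccSym :=
  by classical exact Fintype.ofList [.base, .next, .least] (by rintro ⟨⟩ <;> simp)

/-- Two static functions, and the least element of the set in each dyadic interval. -/
abbrev succEnv : Env where
  aux := ⟨SuccSym, inferInstance, fun _ => .term, fun _ => 2⟩
  Sup := Empty
  supFin := inferInstance
  sig := fun _ => setSig
  idx := fun _ => 0
  scale := fun _ => 0

abbrev succLoc : Schema := ⟨Unit, inferInstance, fun _ => .term, fun _ => 0⟩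

section terms

variable {L : Schema} {k : ℕ}

def succTerm (s : SuccSym) (a b : Expr succEnv L .term k) : Expr succEnv L .term k :=
  Expr.aux (E := succEnv) s ![a, b]

/-- The least element of the set in the interval of level `a` after the one of `b`. -/
def nextLeast (a b : Expr succEnv L .term k) : Expr succEnv L .term k :=
  succTerm .least a (succTerm .next a b)

/-- The first level at which the interval after the one of `x` contains elements of the set. -/
def nextLevel (x : Fin k) : Expr succEnv L .term k :=
  .unique logBound (.and
    (.eq (nextLeast (.var (Fin.last k)) (.var x.castSucc))
      (nextLeast (.var (Fin.last k)) (.var x.castSucc)))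
    (.not (.exist logBound (.and
      (.not (.le (.var (Fin.last k).castSucc) (.var (Fin.last (k + 1)))))
      (.eq (nextLeast (.var (Fin.last (k + 1))) (.var x.castSucc.castSucc))
        (nextLeast (.var (Fin.last (k + 1))) (.var x.castSucc.castSucc)))))))

/-- The least element of the set greater than `x`. -/
def strictSucc (x : Fin k) : Expr succEnv L .term k := nextLeast (nextLevel x) (.var x)

variable {n : ℕ} {A : Str succEnv.aux n}
  {D : ∀ i, DataType (succEnv.sig i) (succEnv.scale i * n)} {σ : Store succEnv L n D}
  {v : Fin k → Fin n}

theorem eval_succTerm (s : SuccSym) (a b : Expr succEnv L .term k) :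
    (succTerm s a b).eval A σ v = Option.bind (a.eval A σ v) fun x : Fin n =>
      Option.bind (b.eval A σ v) fun y : Fin n => (A s ![x, y] : Option (Fin n)) := by
  have h := allSome_two fun j => (![a, b] j).eval A σ v
  simp only [Matrix.cons_val_zero, Matrix.cons_val_one] at h
  cases h1 : a.eval A σ v with
  | none =>
    rw [h1] at h
    simp only [Option.bind_none] at h
    simp only [succTerm, Expr.eval, h]
    rfl
  | some x =>
    cases h2 : b.eval A σ v with
    | none =>
      rw [h1, h2] at h
      simp only [Option.bind_some, Option.map_none] at h
      simp only [succTerm, Expr.eval, h]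
      rfl
    | some y =>
      rw [h1, h2] at h
      simp only [Option.bind_some, Option.map_some] at h
      exact Expr.eval_aux_of h

/-- The auxiliary structure for the set `S`. -/
structure SuccInv (n : ℕ) (A : Str succEnv.aux n) (S : Set ℕ) : Prop where
  base : ∀ z p : Fin n, (A .base ![z, p] : Option (Fin n)) = toDomain n (dyadicBase z p)
  next : ∀ z p : Fin n, (A .next ![z, p] : Option (Fin n)) = toDomain n (dyadicBase z p + 2 ^ (z : ℕ))
  least : ∀ z b : Fin n, (z : ℕ) ≤ logBound.fn n →
    (A .least ![z, b] : Option (Fin n)) = leastIn n {x | x ∈ S ∧ dyadicBase z x = b}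
  lt : ∀ x ∈ S, x < n

variable {S : Set ℕ}

/-- If the next interval would begin outside the domain, then the inner term is undefined, and
correspondingly the part is empty because the set is contained in the domain. -/
theorem SuccInv.eval_nextLeast (hA : SuccInv n A S) {a b : Expr succEnv L .term k} {z p : Fin n}
    (ha : a.eval A σ v = some z) (hb : b.eval A σ v = some p) (hz : (z : ℕ) ≤ logBound.fn n) :
    (nextLeast a b).eval A σ v = leastIn n (nextPart S z p) := by
  rw [nextLeast, eval_succTerm, eval_succTerm, ha, hb]
  simp only [Option.bind_some]
  rw [hA.next]
  by_cases h : dyadicBase z p + 2 ^ (z : ℕ) < n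
  · rw [toDomain_of_lt h, Option.bind_some, hA.least _ _ hz]
    rfl
  · have h1 : nextPart S z p = ∅ := by
      rw [Set.eq_empty_iff_forall_notMem]
      intro x hx
      have h2 := hA.lt x hx.1
      have h3 := dyadicBase_le z x
      have h4 := hx.2
      omega
    rw [h1, toDomain, dif_neg h, (leastIn_eq_none (by simp)).2 rfl]
    rfl

/-- The lowest level whose next interval meets the set is unique when it exists, and by
`isLeast_nextPart` the least element of that part is the successor. If there is no greater element,
then no level qualifies and the term is undefined. -/
theorem SuccInv.eval_strictSucc (hA : SuccInv n A S) (x : Fin k) :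
    (strictSucc x).eval A σ v = leastIn n {y | y ∈ S ∧ ((v x : Fin n) : ℕ) < y} := by
  have hdef : ∀ {m : ℕ} {w : Fin m → Fin n} {a b : Expr succEnv L .term m} {z p : Fin n},
      a.eval A σ w = some z → b.eval A σ w = some p → (z : ℕ) ≤ logBound.fn n →
      ((Expr.eq (nextLeast a b) (nextLeast a b)).eval A σ w ↔ (nextPart S z p).Nonempty) := by
    intro m w a b z p ha hb hz
    rw [Expr.eval_eq_self, hA.eval_nextLeast ha hb hz, Set.nonempty_iff_ne_empty, Ne,
      ← leastIn_eq_none (n := n) fun x hx => hA.lt x hx.1, ← Ne, Option.ne_none_iff_exists']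
  have hlevel : (nextLevel x).eval A σ v = theUnique fun z : Fin n => (z : ℕ) ≤ logBound.fn n ∧
      (nextPart S z (v x)).Nonempty ∧ ¬ ∃ z' : Fin n, (z' : ℕ) ≤ logBound.fn n ∧
        ¬ z ≤ z' ∧ (nextPart S z' (v x)).Nonempty := by
    refine theUnique_congr fun z => and_congr_right fun hz => and_congr ?_ (not_congr ?_)
    · refine hdef ?_ ?_ hz <;> simp [Expr.eval]
    · refine exists_congr fun z' => and_congr_right fun hz' => and_congr ?_ ?_
      · refine not_congr (Expr.eval_le_of ?_ ?_) <;> simp [Expr.eval]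
      · refine hdef ?_ ?_ hz' <;> simp [Expr.eval]
  cases hq : leastIn n {y | y ∈ S ∧ ((v x : Fin n) : ℕ) < y} with
  | none =>
    rw [leastIn_eq_none fun y hy => hA.lt y hy.1] at hq
    have h1 : (nextLevel x).eval A σ v = none := by
      rw [hlevel, theUnique_eq_none]
      rintro ⟨z, ⟨-, ⟨y, hy⟩, -⟩, -⟩
      have : y ∈ {y | y ∈ S ∧ ((v x : Fin n) : ℕ) < y} := ⟨hy.1, lt_of_mem_nextPart hy⟩
      rw [hq] at this
      exact this
    rw [strictSucc, nextLeast, eval_succTerm, h1]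
    rfl
  | some q =>
    rw [leastIn_eq_some] at hq
    obtain ⟨z, ⟨hz, hne⟩, hmin⟩ : ∃ z : Fin n, ((z : ℕ) ≤ logBound.fn n ∧
        (nextPart S z (v x)).Nonempty) ∧ ∀ z' : Fin n, ((z' : ℕ) ≤ logBound.fn n ∧
          (nextPart S z' (v x)).Nonempty) → z ≤ z' := by
      classical
      have h1 := exists_nextPart hq.1.1 hq.1.2
      obtain ⟨z, hz, hzmin⟩ := (Set.toFinite {z : Fin n | (z : ℕ) ≤ logBound.fn n ∧
        (nextPart S z (v x)).Nonempty}).exists_minimal h1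
      exact ⟨z, hz, fun z' hz' => (le_total z z').elim id fun h => hzmin hz' h⟩
    have h1 : (nextLevel x).eval A σ v = some z := by
      rw [hlevel, theUnique_eq_some]
      refine ⟨⟨hz, hne, ?_⟩, ?_⟩
      · rintro ⟨z', h1, h2, h3⟩
        exact h2 (hmin z' ⟨h1, h3⟩)
      · rintro z' ⟨h1, h2, h3⟩
        refine le_antisymm ?_ (hmin z' ⟨h1, h2⟩)
        by_contra hc
        exact h3 ⟨z, hz, hc, hne⟩
    rw [strictSucc, hA.eval_nextLeast h1 rfl hz, leastIn_eq_some]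
    refine isLeast_nextPart hq hne fun z' hz' hne' => ?_
    have h2 : z' < n := hz'.trans z.isLt
    have h3 := hmin ⟨z', h2⟩ ⟨by simp only; omega, hne'⟩
    rw [Fin.le_def] at h3
    simp only at h3
    omega

end terms

def succNode (L : Schema) : Expr succEnv L .term 2 := succTerm .base (.var 1) (.var 0)

def succNodeLeast (L : Schema) : Expr succEnv L .term 2 := succTerm .least (.var 1) (succNode L)

def succSaved : Expr succEnv succLoc .term 2 := Expr.loc (L := succLoc) () Fin.elim0

/-- A position lies in one interval of each level, so one place per level has to be updated. When
the least element of an interval is deleted, its replacement can only be the global successor,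
provided this lies in the same interval. That successor does not depend on the level and is computed
once, in the initial procedure. -/
def succUpdate : SetOp → UpdateRule succEnv 1 .term 2
  | .ins =>
    { L := succLoc
      initial := .skip
      numVars := 1
      bound := fun _ => logBound
      target := ![.var 1, succNode _]
      main := .ret (.ite (.le (succNodeLeast _) (.var 0)) (succNodeLeast _) (.var 0)) }
  | .del =>
    { L := succLoc
      initial := .assign (L := succLoc) () Fin.elim0 (strictSucc 0)
        (fun j hj => absurd j.isLt (not_lt.2 hj))
      numVars := 1
      bound := fun _ => logBound
      target := ![.var 1, succNode _]
      main := .ret (.ite (.eq (succNodeLeast _) (.var 0))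
        (.ite (.eq (succTerm .base (.var 1) succSaved) (succNode _)) succSaved .undef)
        (succNodeLeast _)) }

/-- The language has no constants, but the term `base(x, x)` denotes `0` because `x < 2 ^ x`. The
intervals of level `0` are singletons, so the first condition tests whether `x` is an element. -/
def succQuery : QueryRule succEnv 1 .term where
  L := noSymbols
  body := .ret (.ite
    (.eq (succTerm .least (succTerm .base (.var 0) (.var 0)) (.var 0)) (.var 0))
    (.var 0) (strictSucc 0))

/-- An empty graph as initial definition makes `least` undefined everywhere, which is right for the
empty set. -/
def succProgram : Program setSig :=
  .mk succEnv (fun i => i.elim)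
    (fun s => match s with
      | .base => (FODef.dyadicBase (0 : Fin 3) 1 2).choose
      | .next => (FODef.dyadicNext (0 : Fin 3) 1 2).choose
      | .least => (FODef.false (α := Fin 3)).choose)
    (fun δ s => match s with
      | .base => staticRule succEnv .base
      | .next => staticRule succEnv .next
      | .least => succUpdate δ)
    (fun _ => succQuery)
    (fun _ i => i.elim)

theorem toDomain_dyadicBase {n z : ℕ} (p : Fin n) :
    toDomain n (dyadicBase z p) = some ⟨dyadicBase z p, (dyadicBase_le z p).trans_lt p.isLt⟩ :=
  toDomain_of_lt _

theorem succNode_eval {n : ℕ} {A : Str succEnv.aux n} {L : Schema} {S : Set ℕ}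
    {D : ∀ i, DataType (succEnv.sig i) (succEnv.scale i * n)} {σ : Store succEnv L n D}
    (hA : SuccInv n A S) (v : Fin 2 → Fin n) :
    (succNode L).eval A σ v =
      some ⟨dyadicBase (v 1) (v 0), (dyadicBase_le _ _).trans_lt (v 0).isLt⟩ := by
  rw [succNode, eval_succTerm]
  exact (hA.base _ _).trans (toDomain_dyadicBase _)

theorem succNodeLeast_eval {n : ℕ} {A : Str succEnv.aux n} {L : Schema} {S : Set ℕ}
    {D : ∀ i, DataType (succEnv.sig i) (succEnv.scale i * n)} {σ : Store succEnv L n D}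
    (hA : SuccInv n A S) (v : Fin 2 → Fin n) (hv : (v 1 : ℕ) ≤ logBound.fn n) :
    (succNodeLeast L).eval A σ v =
      leastIn n {x | x ∈ S ∧ dyadicBase (v 1) x = dyadicBase (v 1) (v 0)} := by
  rw [succNodeLeast, eval_succTerm, succNode_eval hA]
  exact hA.least _ _ hv

theorem succIns_eval {n : ℕ} {A : Str succEnv.aux n} {L : Schema} {S : Set ℕ}
    {D : ∀ i, DataType (succEnv.sig i) (succEnv.scale i * n)} {σ : Store succEnv L n D}
    (hA : SuccInv n A S) (v : Fin 2 → Fin n) (hv : (v 1 : ℕ) ≤ logBound.fn n) :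
    (Expr.ite (.le (succNodeLeast L) (.var 0)) (succNodeLeast L) (.var 0)).eval A σ v =
      leastIn n {x | x ∈ insert ((v 0 : Fin n) : ℕ) S ∧
        dyadicBase (v 1) x = dyadicBase (v 1) (v 0)} := by
  have hset : {x | x ∈ insert ((v 0 : Fin n) : ℕ) S ∧
      dyadicBase (v 1) x = dyadicBase (v 1) (v 0)} = insert ((v 0 : Fin n) : ℕ)
        {x | x ∈ S ∧ dyadicBase (v 1) x = dyadicBase (v 1) (v 0)} := by
    ext y
    constructor
    · rintro ⟨h3 | h3, h4⟩
      · exact Or.inl h3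
      · exact Or.inr ⟨h3, h4⟩
    · rintro (rfl | ⟨h3, h4⟩)
      · exact ⟨Or.inl rfl, rfl⟩
      · exact ⟨Or.inr h3, h4⟩
  have h1 := succNodeLeast_eval (L := L) (σ := σ) hA v hv
  have h0 : (Expr.var 0 : Expr succEnv L .term 2).eval A σ v = some (v 0) := rfl
  rw [hset, leastIn_insert (fun y hy => hA.lt y hy.1)]
  cases hq : leastIn n {x | x ∈ S ∧ dyadicBase (v 1) x = dyadicBase (v 1) (v 0)} with
  | none =>
    rw [hq] at h1
    refine Expr.eval_ite_of_false ?_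
    rintro ⟨a, b, ha, -⟩
    rw [h1] at ha
    cases ha
  | some q =>
    rw [hq] at h1
    simp only
    split_ifs with hle
    · exact (Expr.eval_ite_of_true ((Expr.eval_le_of h1 h0).2 hle)).trans h1
    · exact Expr.eval_ite_of_false (mt (Expr.eval_le_of h1 h0).1 hle)

theorem succDel_eval {n : ℕ} {A : Str succEnv.aux n} {S : Set ℕ}
    {D : ∀ i, DataType (succEnv.sig i) (succEnv.scale i * n)} {σ : Store succEnv succLoc n D}
    (hA : SuccInv n A S) (v : Fin 2 → Fin n) (hv : (v 1 : ℕ) ≤ logBound.fn n)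
    (hσ : ∀ a, (σ.loc () a : Option (Fin n)) = leastIn n {y | y ∈ S ∧ ((v 0 : Fin n) : ℕ) < y}) :
    (Expr.ite (.eq (succNodeLeast succLoc) (.var 0))
        (.ite (.eq (succTerm .base (.var 1) succSaved) (succNode _)) succSaved .undef)
        (succNodeLeast _)).eval A σ v =
      leastIn n {x | x ∈ S \ {((v 0 : Fin n) : ℕ)} ∧
        dyadicBase (v 1) x = dyadicBase (v 1) (v 0)} := by
  have h1 := succNodeLeast_eval (L := succLoc) (σ := σ) hA v hv
  have h0 : (Expr.var 0 : Expr succEnv succLoc .term 2).eval A σ v = some (v 0) := rfl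
  have hs : succSaved.eval A σ v = leastIn n {y | y ∈ S ∧ ((v 0 : Fin n) : ℕ) < y} := by
    rw [← hσ Fin.elim0]
    simp only [succSaved, Expr.eval, allSome_zero _ Fin.elim0]
  have hb : (succTerm .base (.var 1) succSaved).eval A σ v = Option.map (fun s : Fin n =>
      (⟨dyadicBase (v 1) s, (dyadicBase_le _ _).trans_lt s.isLt⟩ : Fin n))
      (leastIn n {y | y ∈ S ∧ ((v 0 : Fin n) : ℕ) < y}) := by
    rw [eval_succTerm, hs]
    cases leastIn n {y | y ∈ S ∧ ((v 0 : Fin n) : ℕ) < y} with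
    | none => rfl
    | some s => exact (hA.base _ _).trans (toDomain_dyadicBase _)
  have hn := succNode_eval (L := succLoc) (σ := σ) hA v
  have hlt : ∀ x ∈ {x | x ∈ S \ {((v 0 : Fin n) : ℕ)} ∧
      dyadicBase (v 1) x = dyadicBase (v 1) (v 0)}, x < n := fun x hx => hA.lt x hx.1.1
  by_cases hmin : IsLeast {x | x ∈ S ∧ dyadicBase (v 1) x = dyadicBase (v 1) (v 0)} (v 0 : Fin n)
  · rw [leastIn_eq_some.2 hmin] at h1
    refine (Expr.eval_ite_of_true ((Expr.eval_eq_of h1 h0).2 rfl)).trans ?_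
    cases hq : leastIn n {y | y ∈ S ∧ ((v 0 : Fin n) : ℕ) < y} with
    | none =>
      rw [hq] at hb
      rw [leastIn_eq_none fun y hy => hA.lt y hy.1] at hq
      refine Eq.trans (Expr.eval_ite_of_false ?_) (Eq.symm ((leastIn_eq_none hlt).2 ?_))
      · rintro ⟨a, ha, -⟩
        rw [hb] at ha
        cases ha
      · rw [Set.eq_empty_iff_forall_notMem] at hq ⊢
        rintro y ⟨⟨h2, h3⟩, h4⟩
        have h5 : ((v 0 : Fin n) : ℕ) ≤ y := hmin.2 ⟨h2, h4⟩
        exact hq y ⟨h2, lt_of_le_of_ne h5 (Ne.symm h3)⟩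
    | some s =>
      rw [hq] at hb hs
      rw [leastIn_eq_some] at hq
      have hsv : ((v 0 : Fin n) : ℕ) < s := hq.1.2
      by_cases hnode : dyadicBase (v 1) s = dyadicBase (v 1) (v 0)
      · refine (Expr.eval_ite_of_true ((Expr.eval_eq_of hb hn).2 (Fin.ext hnode))).trans
          (hs.trans (Eq.symm (leastIn_eq_some.2 ⟨⟨⟨hq.1.1, hsv.ne'⟩, hnode⟩, ?_⟩)))
        rintro y ⟨⟨h2, h3⟩, h4⟩
        have h5 : ((v 0 : Fin n) : ℕ) ≤ y := hmin.2 ⟨h2, h4⟩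
        exact hq.2 ⟨h2, lt_of_le_of_ne h5 (Ne.symm h3)⟩
      · refine (Expr.eval_ite_of_false (mt (Expr.eval_eq_of hb hn).1
          fun h => hnode (congrArg Fin.val h))).trans (Eq.symm ((leastIn_eq_none hlt).2 ?_))
        -- A remaining element of the interval would be at least the successor `s`, so `s` would lie
        -- between two elements of the interval and belong to it.
        rw [Set.eq_empty_iff_forall_notMem]
        rintro y ⟨⟨h2, h3⟩, h4⟩
        have h5 : ((v 0 : Fin n) : ℕ) ≤ y := hmin.2 ⟨h2, h4⟩
        have h6 : (s : ℕ) ≤ y := hq.2 ⟨h2, lt_of_le_of_ne h5 (Ne.symm h3)⟩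
        have h7 := lt_dyadicBase_add (v 1) y
        have h8 := dyadicBase_le (v 1) (v 0)
        exact hnode (dyadicBase_eq_of_le (h8.trans hsv.le) (by omega))
  · refine (Expr.eval_ite_of_false ?_).trans (h1.trans ?_)
    · rintro ⟨a, ha, ha'⟩
      rw [h1, leastIn_eq_some] at ha
      rw [h0] at ha'
      obtain rfl := Option.some.inj ha'
      exact hmin ha
    -- The deleted element is not the least one of this interval, so the least element stays the
    -- same.
    · refine theUnique_congr fun q => ⟨fun hq => ?_, fun hq => ?_⟩
      · refine ⟨⟨⟨hq.1.1, fun hc => hmin ?_⟩, hq.1.2⟩, fun y hy => hq.2 ⟨hy.1.1, hy.2⟩⟩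
        have hc' : (q : ℕ) = (v 0 : Fin n) := hc
        have h2 := hq
        rw [hc'] at h2
        exact h2
      · refine ⟨⟨hq.1.1.1, hq.1.2⟩, fun y hy => ?_⟩
        by_cases hy0 : y = (v 0 : Fin n)
        · by_contra hc
          refine hmin ⟨hy0 ▸ hy, fun x hx => ?_⟩
          by_cases hx0 : x = (v 0 : Fin n)
          · exact hx0.ge
          · have h2 : (q : ℕ) ≤ x := hq.2 ⟨⟨hx.1, hx0⟩, hx.2⟩
            omega
        · exact hq.2 ⟨⟨hy.1, hy0⟩, hy.2⟩

/-- If each tuple `x` that hits the place writes the right value, and the value does not change at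
the places that are not hit, then the update is right. -/
theorem Val.write_eq {n : ℕ} {β : Type} {κ : Kind} {old v : Val n κ} {hit : β → Prop}
    {val : β → Val n κ} (h : ∀ x, hit x → val x = v) (h' : (∀ x, ¬ hit x) → old = v) :
    Val.write old hit val = v := by
  by_cases hx : ∃ x, hit x
  · obtain ⟨x, hx⟩ := hx
    exact Val.write_of_hit x hx h
  · have hx' : ∀ x, ¬ hit x := fun x hh => hx ⟨x, hh⟩
    rw [Val.write_of_not_hit hx', h' hx']

theorem succProgram_change {n : ℕ} {st : (succProgram.sem n).State} {S : Set ℕ}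
    (hA : SuccInv n st.1 S) (δ : SetOp) (p : Fin 1 → Fin n) :
    SuccInv n ((succProgram.sem n).change δ p st).1 ((SuccSet n).change δ p S) := by
  have hstatic : ∀ (s : SuccSym) (a : Fin 2 → Fin n), s ≠ .least →
      ((succProgram.sem n).change δ p st).1 s a = st.1 s a := by
    intro s a hs
    refine (Program.sem_mk_change_aux n δ p st s a).trans ?_
    cases s with
    | least => exact absurd rfl hs
    | base => exact Val.write_of_same fun y hy => Expr.eval_aux_of hy.2
    | next => exact Val.write_of_same fun y hy => Expr.eval_aux_of hy.2
  refine ⟨fun z b => (hstatic .base _ (by simp)).trans (hA.base z b),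
    fun z b => (hstatic .next _ (by simp)).trans (hA.next z b), fun z b hz => ?_, ?_⟩
  · refine (Program.sem_mk_change_aux n δ p st .least ![z, b]).trans ?_
    have happ : ∀ x : Fin 1 → Fin n, (Fin.append p x : Fin 2 → Fin n) = ![p 0, x 0] :=
      fun x => append_one_one p x
    have hhit : ∀ (L : Schema) (x : Fin 1 → Fin n)
        (D : ∀ i, DataType (succEnv.sig i) (succEnv.scale i * n)) (σ : Store succEnv L n D),
        allSome (fun j : Fin 2 => (![.var 1, succNode L] j : Expr succEnv L .term 2).eval st.1 σ
          (Fin.append p x)) = some ![z, b] ↔ x 0 = z ∧ dyadicBase z (p 0) = b := by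
      intro L x D σ
      rw [happ, allSome_eq_some, Fin.forall_fin_two]
      simp only [Matrix.cons_val_zero, Matrix.cons_val_one, Expr.eval, succNode_eval hA,
        Option.some.injEq]
      constructor
      · rintro ⟨rfl, h2⟩
        exact ⟨rfl, congrArg Fin.val h2⟩
      · rintro ⟨rfl, h2⟩
        exact ⟨rfl, Fin.ext h2⟩
    have hmiss : (∀ x : Fin 1 → Fin n, ¬ ((∀ j, (x j : ℕ) ≤ logBound.fn n) ∧
        (x 0 = z ∧ dyadicBase z (p 0) = b))) → dyadicBase z (p 0) ≠ b := fun h hb =>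
      h (fun _ => z) ⟨fun _ => hz, rfl, hb⟩
    cases δ with
    | ins =>
      refine Val.write_eq (fun x hx => ?_) fun hx => ?_
      · obtain ⟨y, hy⟩ : ∃ y : Fin 1 → Fin n, y = x := ⟨x, rfl⟩
        subst hy
        obtain ⟨h1, h2⟩ := (hhit _ y _ _).1 hx.2
        refine (congrArg (fun w => Expr.eval st.1 _ _ w) (happ y)).trans
          ((succIns_eval hA ![p 0, y 0] (h1 ▸ hz)).trans ?_)
        simp only [Matrix.cons_val_zero, Matrix.cons_val_one, h1, h2]
        rfl
      · have hb := hmiss fun x hx' => hx x ⟨hx'.1, (hhit _ x _ _).2 hx'.2⟩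
        refine (hA.least z b hz).trans (congrArg (leastIn n) ?_)
        ext y
        constructor
        · rintro ⟨h3, h4⟩
          exact ⟨Or.inr h3, h4⟩
        · rintro ⟨rfl | h3, h4⟩
          · exact absurd h4 hb
          · exact ⟨h3, h4⟩
    | del =>
      refine Val.write_eq (fun x hx => ?_) fun hx => ?_
      · obtain ⟨y, hy⟩ : ∃ y : Fin 1 → Fin n, y = x := ⟨x, rfl⟩
        subst hy
        obtain ⟨h1, h2⟩ := (hhit _ y _ _).1 hx.2
        refine (congrArg (fun w => Expr.eval st.1 _ _ w) (happ y)).trans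
          ((succDel_eval hA ![p 0, y 0] (h1 ▸ hz) fun a => ?_).trans ?_)
        · refine (Stmt.exec_assign_loc_self (allSome_zero _ a)).trans (hA.eval_strictSucc 0)
        · simp only [Matrix.cons_val_zero, Matrix.cons_val_one, h1, h2]
          rfl
      · have hb := hmiss fun x hx' => hx x ⟨hx'.1, (hhit _ x _ _).2 hx'.2⟩
        refine (hA.least z b hz).trans (congrArg (leastIn n) ?_)
        ext y
        constructor
        · rintro ⟨h3, h4⟩
          exact ⟨⟨h3, fun hc => hb (hc ▸ h4)⟩, h4⟩
        · rintro ⟨h3, h4⟩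
          exact ⟨h3.1, h4⟩
  · cases δ with
    | ins =>
      rintro x (rfl | hx)
      · exact (p 0).isLt
      · exact hA.lt x hx
    | del => exact fun x hx => hA.lt x hx.1

theorem succProgram_start (n : ℕ) : SuccInv n (succProgram.sem n).start.1 (SuccSet n).start := by
  refine ⟨fun z p => ?_, fun z p => ?_, fun z b _ => ?_, fun x hx => hx.elim⟩
  · refine Eq.trans ?_ (toDomain_eq_theUnique _ _).symm
    refine theUnique_congr fun q => ?_
    exact (FODef.dyadicBase (0 : Fin 3) 1 2).choose_spec n _
  · refine Eq.trans ?_ (toDomain_eq_theUnique _ _).symm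
    refine theUnique_congr fun q => ?_
    exact (FODef.dyadicNext (0 : Fin 3) 1 2).choose_spec n _
  · refine Eq.trans (theUnique_congr fun q => ?_)
      ((theUnique_eq_none (p := fun _ : Fin n => False)).2 fun ⟨_, h, _⟩ => h |>.elim) |>.trans ?_
    · exact (FODef.false (α := Fin 3)).choose_spec n _
    · exact ((leastIn_eq_none fun x hx => hx.1.elim).2
        (Set.eq_empty_iff_forall_notMem.2 fun x hx => hx.1)).symm

theorem succQuery_eval {n : ℕ} {A : Str succEnv.aux n} {S : Set ℕ}
    {D : ∀ i, DataType (succEnv.sig i) (succEnv.scale i * n)} {σ : Store succEnv noSymbols n D}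
    (hA : SuccInv n A S) (p : Fin 1 → Fin n) :
    succQuery.body.eval A p σ = leastIn n {x | x ∈ S ∧ ((p 0 : Fin n) : ℕ) ≤ x} := by
  have h0 : (Expr.var 0 : Expr succEnv noSymbols .term 1).eval A σ p = some (p 0) := rfl
  have hb : (succTerm .base (.var 0) (.var 0) : Expr succEnv noSymbols .term 1).eval A σ p =
      some ⟨0, (Nat.zero_le _).trans_lt (p 0).isLt⟩ := by
    rw [eval_succTerm]
    refine (hA.base _ _).trans ?_
    rw [dyadicBase_self]
    exact toDomain_of_lt _
  have hl : (succTerm .least (succTerm .base (.var 0) (.var 0)) (.var 0) :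
      Expr succEnv noSymbols .term 1).eval A σ p = leastIn n {x | x ∈ S ∧ x = (p 0 : Fin n)} := by
    rw [eval_succTerm, hb]
    refine (hA.least _ _ (Nat.zero_le _)).trans ?_
    simp only [dyadicBase_zero]
  by_cases hp : ((p 0 : Fin n) : ℕ) ∈ S
  · have h1 : leastIn n {x | x ∈ S ∧ x = ((p 0 : Fin n) : ℕ)} = some (p 0) :=
      leastIn_eq_some.2 ⟨⟨hp, rfl⟩, fun x hx => hx.2.ge⟩
    rw [h1] at hl
    refine (Expr.eval_ite_of_true ((Expr.eval_eq_of hl h0).2 rfl)).trans ?_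
    refine (leastIn_eq_some.2 ?_).symm
    exact ⟨⟨hp, le_rfl⟩, fun x hx => hx.2⟩
  · refine (Expr.eval_ite_of_false ?_).trans ((hA.eval_strictSucc 0).trans (congrArg _ ?_))
    · rintro ⟨a, ha, -⟩
      have ha := leastIn_eq_some.1 (hl.symm.trans ha)
      exact hp (ha.1.2 ▸ ha.1.1)
    · ext x
      refine and_congr_right fun hx => ⟨le_of_lt, fun h => lt_of_le_of_ne h ?_⟩
      rintro rfl
      exact hp hx

theorem succProgram_maintains : succProgram.Maintains SuccSet :=
  maintains_of_invariant (fun n st S => SuccInv n st.1 S) succProgram_start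
    (fun _ _ _ h δ p => succProgram_change h δ p)
    (fun _ _ _ h _ p => succQuery_eval h p)

theorem sup_fin_two_le {f : Fin 2 → ℕ} {B : ℕ} (h0 : f 0 ≤ B) (h1 : f 1 ≤ B) :
    Finset.univ.sup f ≤ B := by
  refine Finset.sup_le fun j _ => ?_
  fin_cases j
  · exact h0
  · exact h1

/-! ### Work of the program for successor queries -/

section work

variable {L : Schema} {k n B : ℕ} {c : ∀ i : succEnv.Sup, Cost (succEnv.sig i)}

theorem succTerm_work {s : SuccSym} {a b : Expr succEnv L .term k} (hB : 1 ≤ B)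
    (ha : a.work n c ≤ B) (hb : b.work n c ≤ B) : (succTerm s a b).work n c ≤ B := by
  exact max_le hB (sup_fin_two_le ha hb)

theorem nextLeast_work {a b : Expr succEnv L .term k} (hB : 1 ≤ B)
    (ha : a.work n c ≤ B) (hb : b.work n c ≤ B) : (nextLeast a b).work n c ≤ B :=
  succTerm_work hB ha (succTerm_work hB ha hb)

/-- The search for the lowest suitable level nests two bounded quantifiers over levels; this is
where the square of the logarithm comes from. -/
theorem strictSucc_work (hn : 1 ≤ n) (x : Fin k) :
    (strictSucc (L := L) x).work n c ≤ logBound.count n * logBound.count n := by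
  have h1 := logBound.one_le_count hn
  have h2 : 1 ≤ logBound.count n * logBound.count n := Nat.mul_le_mul h1 h1
  refine nextLeast_work h2 (Nat.mul_le_mul le_rfl ?_) h2
  have h3 : ∀ {m : ℕ} (y z : Fin m),
      (nextLeast (.var y) (.var z) : Expr succEnv L .term m).work n c ≤ 1 :=
    fun y z => nextLeast_work le_rfl le_rfl le_rfl
  refine max_le (max_le ((h3 _ _).trans h1) ((h3 _ _).trans h1)) ?_
  refine (Nat.mul_le_mul le_rfl ?_).trans (mul_one _).le
  exact max_le (max_le le_rfl le_rfl) (max_le (h3 _ _) (h3 _ _))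

theorem succNode_work : (succNode L).work n c ≤ 1 := succTerm_work le_rfl le_rfl le_rfl

theorem succNodeLeast_work : (succNodeLeast L).work n c ≤ 1 :=
  succTerm_work le_rfl le_rfl succNode_work

theorem succUpdate_work (hn : 1 ≤ n) (δ : SetOp) :
    (succUpdate δ).work n c ≤ logBound.count n * logBound.count n := by
  have h1 := logBound.one_le_count hn
  have h2 : 1 ≤ logBound.count n * logBound.count n := Nat.mul_le_mul h1 h1
  have hs : succSaved.work n c ≤ 1 := max_le le_rfl (Finset.sup_le fun j _ => j.elim0)
  have hmain : ∀ m, m ≤ 1 → (∏ _j : Fin 1, logBound.count n) * m ≤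
      logBound.count n * logBound.count n := by
    intro m hm
    rw [Finset.prod_const, Finset.card_univ, Fintype.card_fin, pow_one]
    exact Nat.mul_le_mul le_rfl (hm.trans h1)
  cases δ with
  | ins =>
    refine max_le h2 (hmain _ (max_le ?_ ?_))
    · exact max_le (max_le succNodeLeast_work le_rfl) (max_le succNodeLeast_work le_rfl)
    · exact sup_fin_two_le le_rfl succNode_work
  | del =>
    refine max_le (max_le (strictSucc_work hn 0) (Finset.sup_le fun j _ => j.elim0))
      (hmain _ (max_le ?_ ?_))
    · refine max_le (max_le succNodeLeast_work le_rfl) (max_le (max_le (max_le ?_ succNode_work)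
        (max_le hs le_rfl)) succNodeLeast_work)
      exact succTerm_work le_rfl le_rfl hs
    · exact sup_fin_two_le le_rfl succNode_work

end work

theorem succProgram_cost_change {n : ℕ} (hn : 1 ≤ n) (δ : SetOp) :
    (succProgram.cost n).change δ ≤ logBound.count n * logBound.count n := by
  have h1 := logBound.one_le_count hn
  have h2 : 1 ≤ logBound.count n * logBound.count n := Nat.mul_le_mul h1 h1
  refine (Program.cost_mk_change (S := setSig) n δ).trans_le (Finset.sup_le fun s _ => ?_)
  cases s with
  | base => exact (staticRule_work _ _ _ _).trans h2
  | next => exact (staticRule_work _ _ _ _).trans h2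
  | least => exact succUpdate_work hn δ

theorem succProgram_cost_query {n : ℕ} (hn : 1 ≤ n) (Q : Unit) :
    (succProgram.cost n).query Q ≤ logBound.count n * logBound.count n := by
  have h1 := logBound.one_le_count hn
  have h2 : 1 ≤ logBound.count n * logBound.count n := Nat.mul_le_mul h1 h1
  refine max_le (max_le ?_ h2) (max_le h2 (strictSucc_work hn 0))
  exact succTerm_work h2 (succTerm_work h2 h2 h2) h2

/-! ### Heights of words of parentheses -/

section height

variable {k : ℕ}

/-- The contribution of a letter to the number of open parentheses. -/
def step : Option (Paren k) → ℤ
  | none => 0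
  | some (.op _) => 1
  | some (.cl _) => -1

/-- The number of opening minus the number of closing parentheses before a position. -/
def height (l : ℕ → Option (Paren k)) (i : ℤ) : ℤ := ∑ x ∈ Finset.range i.toNat, step (l x)

/-- Positions in the same dyadic interval of length `2 ^ z`. -/
def dyadicLevels (z : ℕ) (i j : ℤ) : Prop := i / 2 ^ z = j / 2 ^ z

/-- Only the last axiom uses that intervals are halved: the index at level `z` takes at most two
consecutive values on an interval of level `z + 1`, so of three ordered positions two neighbouring
ones agree. -/
theorem levels_dyadic : Levels dyadicLevels where
  refl _ _ := rfl
  symm h := Eq.symm h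
  trans h h' := Eq.trans h h'
  mono {z z' i j} hz h := by
    obtain ⟨d, rfl⟩ := Nat.exists_eq_add_of_le hz
    unfold dyadicLevels at *
    rw [pow_add, ← Int.ediv_ediv_of_nonneg (by positivity),
      ← Int.ediv_ediv_of_nonneg (by positivity), h]
  convex {z i j k} h1 h2 h := by
    unfold dyadicLevels at *
    have h3 : i / 2 ^ z ≤ j / 2 ^ z := Int.ediv_le_ediv (by positivity) h1
    have h4 : j / 2 ^ z ≤ k / 2 ^ z := Int.ediv_le_ediv (by positivity) h2
    omega
  zero h := by simpa [dyadicLevels] using h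
  split {z i j k} h1 h2 h := by
    unfold dyadicLevels at *
    have h3 : i / 2 ^ z ≤ j / 2 ^ z := Int.ediv_le_ediv (by positivity) h1
    have h4 : j / 2 ^ z ≤ k / 2 ^ z := Int.ediv_le_ediv (by positivity) h2
    rw [pow_succ, ← Int.ediv_ediv_of_nonneg (by positivity),
      ← Int.ediv_ediv_of_nonneg (by positivity)] at h
    omega

theorem dyadicLevels_natCast {z x y : ℕ} :
    dyadicLevels z x y ↔ dyadicBase z x = dyadicBase z y := by
  rw [dyadicBase_eq_iff, dyadicLevels]
  norm_cast

variable {l l' : ℕ → Option (Paren k)}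

theorem height_succ (x : ℕ) : height l (x + 1) = height l x + step (l x) := by
  have h : ((x : ℤ) + 1).toNat = x + 1 := by omega
  rw [height, height, h, Finset.sum_range_succ, Int.toNat_natCast]

theorem height_of_nonpos {i : ℤ} (hi : i ≤ 0) : height l i = 0 := by
  rw [height, Int.toNat_of_nonpos hi, Finset.sum_range_zero]

theorem exists_natCast_of_height_ne {i : ℤ} (h : height l (i + 1) ≠ height l i) :
    ∃ x : ℕ, i = x := by
  refine ⟨i.toNat, ?_⟩
  by_contra hi
  exact h (by rw [height_of_nonpos (by omega), height_of_nonpos (by omega)])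

theorem step_bounds (a : Option (Paren k)) : step a ≤ 1 ∧ -1 ≤ step a := by
  rcases a with _ | ⟨_ | _⟩ <;> simp [step]

theorem steps_height (l : ℕ → Option (Paren k)) : Steps (height l) := by
  intro i
  by_cases h : height l (i + 1) = height l i
  · omega
  · obtain ⟨x, rfl⟩ := exists_natCast_of_height_ne h
    have := step_bounds (l x)
    rw [height_succ]
    omega

theorem step_eq_one {a : Option (Paren k)} : step a = 1 ↔ ∃ i, a = some (.op i) := by
  rcases a with _ | ⟨_ | _⟩ <;> simp [step]

theorem step_eq_neg_one {a : Option (Paren k)} : step a = -1 ↔ ∃ i, a = some (.cl i) := by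
  rcases a with _ | ⟨_ | _⟩ <;> simp [step]

theorem height_eq_bump {p : ℕ} (hp : step (l' p) = step (l p) + 1)
    (h : ∀ x, x ≠ p → l' x = l x) : height l' = bump (height l) p := by
  have key : ∀ m : ℕ, ∑ x ∈ Finset.range m, step (l' x) =
      (∑ x ∈ Finset.range m, step (l x)) + if p < m then 1 else 0 := by
    intro m
    induction m with
    | zero => simp
    | succ m ih =>
      rw [Finset.sum_range_succ, Finset.sum_range_succ, ih]
      rcases lt_trichotomy m p with hm | hm | hm
      · rw [h m hm.ne, if_neg (by omega), if_neg (by omega)]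
        ring
      · subst hm
        rw [hp, if_neg (by omega), if_pos (by omega)]
        ring
      · rw [h m hm.ne', if_pos (by omega), if_pos (by omega)]
        ring
  funext i
  rw [height, bump, key, height]
  congr 1
  refine if_congr ?_ rfl rfl
  omega

theorem height_eq_unbump {p : ℕ} (hp : step (l' p) = step (l p) - 1)
    (h : ∀ x, x ≠ p → l' x = l x) : height l' = unbump (height l) p := by
  have h1 := height_eq_bump (l := l') (l' := l) (p := p) (by omega) fun x hx => (h x hx).symm
  funext i
  rw [unbump, h1, bump]
  ring

theorem partner_nat {i j : ℤ} (h : Partner (height l) i j) :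
    ∃ x y : ℕ, i = x ∧ j = y ∧ (∃ a, l x = some (.op a)) ∧ ∃ b, l y = some (.cl b) := by
  have h1 := h.2.1
  have h2 := h.close (steps_height l)
  obtain ⟨x, rfl⟩ := exists_natCast_of_height_ne (l := l) (i := i) (by omega)
  obtain ⟨y, rfl⟩ := exists_natCast_of_height_ne (l := l) (i := j) (by omega)
  rw [height_succ] at h1 h2
  exact ⟨x, y, rfl, rfl, step_eq_one.1 (by omega), step_eq_neg_one.1 (by omega)⟩

end height

/-! ### Segments of words -/

section segment

variable {A : Type} (l : ℕ → Option A)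

/-- The string at the positions from `i` on and before `j`. -/
def segment (i j : ℕ) : List A := (List.range' i (j - i)).filterMap l

theorem segment_self (i : ℕ) : segment l i i = [] := by simp [segment]

variable {l}

theorem segment_append {i m j : ℕ} (h1 : i ≤ m) (h2 : m ≤ j) :
    segment l i j = segment l i m ++ segment l m j := by
  have h3 : j - i = (m - i) + (j - m) := by omega
  have h4 : m = i + (m - i) := by omega
  rw [segment, segment, segment, h3, ← List.filterMap_append]
  congr 1
  conv_rhs => rw [h4]
  rw [← List.range'_append_1]
  congr 2 <;> omega

theorem segment_succ {i : ℕ} : segment l i (i + 1) = (l i).toList := by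
  rw [segment, show i + 1 - i = 1 by omega, List.range'_one]
  cases h : l i <;> simp [h]

theorem segment_of_none {i j : ℕ} (h : ∀ x, i ≤ x → x < j → l x = none) : segment l i j = [] := by
  rw [segment, List.filterMap_eq_nil_iff]
  intro x hx
  rw [List.mem_range'_1] at hx
  exact h x hx.1 (by omega)

theorem none_of_segment {i j : ℕ} (h : segment l i j = []) {x : ℕ} (h1 : i ≤ x) (h2 : x < j) :
    l x = none := by
  rw [segment, List.filterMap_eq_nil_iff] at h
  exact h x (List.mem_range'_1.2 ⟨h1, by omega⟩)

theorem segment_eq_cons {i j : ℕ} (hij : i ≤ j) {a : A} {s : List A} (h : segment l i j = a :: s) :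
    ∃ m, i ≤ m ∧ m < j ∧ l m = some a ∧ segment l (m + 1) j = s ∧
      ∀ x, i ≤ x → x < m → l x = none := by
  obtain ⟨d, rfl⟩ := Nat.exists_eq_add_of_le hij
  clear hij
  induction d generalizing i with
  | zero => simp [segment_self] at h
  | succ d ih =>
    have h1 := h
    rw [segment_append (m := i + 1) (by omega) (by omega), segment_succ] at h1
    cases hi : l i with
    | some b =>
      rw [hi] at h1
      simp only [Option.toList_some, List.singleton_append, List.cons.injEq] at h1
      exact ⟨i, le_rfl, by omega, by rw [hi, h1.1], h1.2, fun x h3 h4 => by omega⟩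
    | none =>
      rw [hi] at h1
      simp only [Option.toList_none, List.nil_append] at h1
      rw [show i + (d + 1) = i + 1 + d by omega] at h1 ⊢
      obtain ⟨m, h3, h4, h5, h6, h7⟩ := ih h1
      refine ⟨m, by omega, h4, h5, h6, fun x h8 h9 => ?_⟩
      by_cases hx : x = i
      · rw [hx, hi]
      · exact h7 x (by omega) h9

theorem segment_eq_append {i j : ℕ} (hij : i ≤ j) {s t : List A} (h : segment l i j = s ++ t) :
    ∃ m, i ≤ m ∧ m ≤ j ∧ segment l i m = s ∧ segment l m j = t := by
  induction s generalizing i with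
  | nil => exact ⟨i, le_rfl, hij, segment_self l i, h⟩
  | cons a s ih =>
    obtain ⟨m, h1, h2, h3, h4, h5⟩ := segment_eq_cons hij h
    obtain ⟨m', h6, h7, h8, h9⟩ := ih h2 h4
    refine ⟨m', by omega, h7, ?_, h9⟩
    rw [segment_append (m := m) h1 (by omega), segment_append (m := m + 1) (by omega) h6,
      segment_of_none h5, segment_succ, h3, h8]
    rfl

/-- The letter at a position, and `ε` outside of the domain. -/
def Word.letter {n : ℕ} (w : Word A n) (x : ℕ) : Option A := if h : x < n then w ⟨x, h⟩ else none

theorem Word.letter_val {n : ℕ} (w : Word A n) (x : Fin n) : w.letter x = w x := dif_pos x.isLt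

theorem Word.str_eq_filterMap {n : ℕ} (w : Word A n) : w.str = (List.finRange n).filterMap w := by
  rw [Word.str, List.ofFn_eq_map, List.reduceOption, List.filterMap_map]
  rfl

theorem Word.str_eq_segment {n : ℕ} (w : Word A n) : w.str = segment w.letter 0 n := by
  rw [Word.str_eq_filterMap, segment, Nat.sub_zero, ← List.range_eq_range',
    ← List.map_coe_finRange_eq_range, List.filterMap_map]
  exact List.filterMap_congr fun x _ => (w.letter_val x).symm

end segment

/-! ### Well-balanced words -/

section balanced

variable {k : ℕ} {l : ℕ → Option (Paren k)}

/-- Partners have the same type. -/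
def TypesAgree (l : ℕ → Option (Paren k)) (i j : ℕ) : Prop :=
  ∀ x y : ℕ, i ≤ x → y < j → Partner (height l) x y →
    ∀ a b, l x = some (.op a) → l y = some (.cl b) → a = b

theorem height_of_none {i j : ℕ} (hij : i ≤ j) (h : ∀ x, i ≤ x → x < j → l x = none) :
    height l j = height l i := by
  induction j, hij using Nat.le_induction with
  | base => rfl
  | succ j hj ih =>
    rw [Nat.cast_succ, height_succ, h j hj (by omega), ih fun x h1 h2 => h x h1 (by omega)]
    simp [step]

/-- Induction on the length. An empty first position is dropped; an opening one is wrapped around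
the part up to the first return to the initial height, which is its partner; a closing one would
lead below the initial height. -/
theorem balanced_segment {i j : ℕ} (hij : i ≤ j) (h1 : height l i = height l j)
    (h2 : ∀ x : ℕ, i ≤ x → x ≤ j → height l i ≤ height l x) (h3 : TypesAgree l i j) :
    Balanced (segment l i j) := by
  obtain ⟨d, hd⟩ : ∃ d, j - i = d := ⟨_, rfl⟩
  induction d using Nat.strong_induction_on generalizing i j with
  | _ d ih =>
  rcases hij.eq_or_lt with rfl | hlt
  · rw [segment_self]
    exact .nil
  have hs := height_succ (l := l) i
  have h4 := h2 (i + 1) (by omega) (by omega)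
  rw [Nat.cast_succ, hs] at h4
  rw [segment_append (m := i + 1) (by omega) hlt, segment_succ]
  rcases hi : l i with _ | ⟨a | a⟩
  · rw [hi] at hs
    simp only [step, add_zero] at hs
    refine ih _ (by omega) hlt (by push_cast; omega) (fun x hx hx' => ?_)
      (fun x y hx hy => h3 x y (by omega) hy) rfl
    push_cast
    rw [hs]
    exact h2 x (by omega) hx'
  · rw [hi] at hs
    simp only [step] at hs
    -- the partner of the first letter
    obtain ⟨y, hiy, hy, hmin⟩ : ∃ y : ℤ, (i : ℤ) + 1 ≤ y ∧ height l (y + 1) = height l i ∧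
        ∀ m, (i : ℤ) + 1 ≤ m → m < y → ¬ height l (m + 1) = height l i := by
      refine exists_least_int _ ⟨(j : ℤ) - 1, ?_, ?_⟩
      · by_contra hc
        have : j = i + 1 := by omega
        rw [this] at h1
        push_cast at h1
        omega
      · rw [sub_add_cancel, h1]
    obtain ⟨y, rfl⟩ := Int.eq_ofNat_of_zero_le (show 0 ≤ y by omega)
    have hyj : y < j := by
      by_contra hc
      refine hmin ((j : ℤ) - 1) ?_ (by omega) (by rw [sub_add_cancel, h1])
      by_contra hc
      have : j = i + 1 := by omega
      rw [this] at h1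
      push_cast at h1
      omega
    have hgt : ∀ m : ℤ, i < m → m ≤ y → height l i < height l m := by
      intro m him hmy
      rcases eq_or_lt_of_le (show (i : ℤ) + 1 ≤ m by omega) with rfl | hm
      · omega
      · have h5 := hmin (m - 1) (by omega) (by omega)
        rw [sub_add_cancel] at h5
        obtain ⟨m, rfl⟩ := Int.eq_ofNat_of_zero_le (show 0 ≤ m by omega)
        have h6 := h2 m (by omega) (by omega)
        omega
    have hp : Partner (height l) i y := ⟨by omega, by omega, hy, hgt⟩
    obtain ⟨x', y', hx', hy', -, b, hb⟩ := partner_nat hp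
    obtain rfl : y = y' := by omega
    have hyy := hp.close (steps_height l)
    have hab := h3 i y le_rfl hyj hp a b hi hb
    subst hab
    rw [segment_append (m := y) (by omega) hyj.le, segment_append (m := y + 1) (j := j) (by omega) hyj,
      segment_succ, hb]
    have hin : Balanced (segment l (i + 1) y) := by
      refine ih (y - (i + 1)) (by omega) (by omega) (by push_cast; omega) (fun x hx hx' => ?_)
        (fun x y' hx hy' => h3 x y' (by omega) (by omega)) rfl
      have := hgt x (by omega) (by omega)
      push_cast
      omega
    have hout : Balanced (segment l (y + 1) j) := by
      refine ih (j - (y + 1)) (by omega) hyj (by push_cast; omega) (fun x hx hx' => ?_)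
        (fun x y' hx hy' => h3 x y' (by omega) hy') rfl
      push_cast
      rw [hy]
      exact h2 x (by omega) hx'
    have := (Balanced.wrap a hin).append hout
    simpa using this
  · rw [hi] at h4
    simp [step] at h4

/-- Induction on the derivation. The string occurs with gaps in the word, so each rule first has to
be located at positions of the segment; gaps do not affect the height. -/
theorem Balanced.height {s : List (Paren k)} (hs : Balanced s) {i j : ℕ} (hij : i ≤ j)
    (h : segment l i j = s) : height l i = height l j ∧
      (∀ x : ℕ, i ≤ x → x ≤ j → DynFO.height l i ≤ DynFO.height l x) ∧ TypesAgree l i j := by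
  induction hs generalizing i j with
  | nil =>
    have h1 : ∀ x : ℕ, i ≤ x → x ≤ j → DynFO.height l x = DynFO.height l i := fun x hx hx' =>
      height_of_none hx fun y hy hy' => none_of_segment h hy (by omega)
    refine ⟨(h1 j hij le_rfl).symm, fun x hx hx' => (h1 x hx hx').ge, ?_⟩
    intro x y hx hy hp a b ha
    have := hp.1
    rw [none_of_segment h hx (by omega)] at ha
    cases ha
  | append _ _ ih ih' =>
    obtain ⟨m, h1, h2, h3, h4⟩ := segment_eq_append hij h
    obtain ⟨a1, a2, a3⟩ := ih h1 h3
    obtain ⟨b1, b2, b3⟩ := ih' h2 h4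
    refine ⟨a1.trans b1, fun x hx hx' => ?_, fun x y hx hy hp => ?_⟩
    · rcases le_total x m with h5 | h5
      · exact a2 x hx h5
      · exact a1.trans_le (b2 x h5 hx')
    · rcases lt_or_ge y m with h5 | h5
      · exact a3 x y hx h5 hp
      · rcases lt_or_ge x m with h6 | h6
        -- No pair crosses the boundary of two balanced parts: inside a pair the height stays above
        -- its start, but at the boundary it is back at the minimum.
        · have h7 := hp.2.2.2 m (by omega) (by omega)
          have h8 := a2 x hx h6.le
          omega
        · exact b3 x y h6 hy hp
  | @wrap c s _ ih =>
    rw [List.cons_append] at h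
    obtain ⟨m, h1, h2, h3, h4, h5⟩ := segment_eq_cons hij h
    obtain ⟨q, h6, h7, h8, h9⟩ := segment_eq_append h2 h4
    obtain ⟨y, g1, g2, g3, g4, g5⟩ := segment_eq_cons h7 h9
    have h8' : segment l (m + 1) y = s := by
      rw [segment_append h6 g1, h8, segment_of_none g5, List.append_nil]
    obtain ⟨a1, a2, a3⟩ := ih (h6.trans g1) h8'
    have e1 : ∀ x : ℕ, i ≤ x → x ≤ m → DynFO.height l x = DynFO.height l i := fun x hx hx' =>
      height_of_none hx fun y hy hy' => h5 y hy (by omega)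
    have e2 : ∀ x : ℕ, y + 1 ≤ x → x ≤ j → DynFO.height l x = DynFO.height l (y + 1 : ℕ) :=
      fun x hx hx' => height_of_none hx fun y hy hy' => none_of_segment g4 hy (by omega)
    have e3 := height_succ (l := l) m
    have e4 := height_succ (l := l) y
    have e5 := e1 m h1 le_rfl
    rw [h3] at e3
    rw [g3] at e4
    simp only [step] at e3 e4
    push_cast at a1 a2 e2
    have hp' : Partner (DynFO.height l) m y := by
      refine ⟨by omega, e3, by omega, fun x hx hx' => ?_⟩
      obtain ⟨x, rfl⟩ := Int.eq_ofNat_of_zero_le (show 0 ≤ x by omega)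
      have := a2 x (by omega) (by omega)
      omega
    refine ⟨?_, fun x hx hx' => ?_, fun x z hx hz hp => ?_⟩
    · rw [e2 j g2 le_rfl]
      omega
    · rcases le_or_gt x m with h10 | h10
      · rw [e1 x hx h10]
      · rcases le_or_gt x y with h11 | h11
        · have := a2 x (by omega) h11
          omega
        · rw [e2 x h11 hx']
          omega
    · intro a b ha hb
      have hxz := hp.1
      rcases lt_trichotomy x m with h10 | h10 | h10
      · rw [h5 x hx h10] at ha
        cases ha
      · subst h10
        have hzy := hp.right_unique hp'
        obtain rfl : z = y := by omega
        rw [h3] at ha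
        rw [g3] at hb
        cases ha
        cases hb
        rfl
      · rcases lt_trichotomy x y with h11 | h11 | h11
        · have := hp'.nested hp (by omega) (by omega)
          exact a3 x z h10 (by omega) hp a b ha hb
        · subst h11
          rw [g3] at ha
          cases ha
        · rw [none_of_segment g4 h11 (by omega)] at ha
          cases ha

/-- At the first drop below the initial height there would be an unmatched closing parenthesis.
After the last position before `n` with a height below the final one, there would be an unmatched
opening one. -/
theorem height_nonneg_of_not_unm {n z : ℕ} (hn : n ≤ 2 ^ z) (hl : ∀ x, n ≤ x → l x = none)
    (hU : ∀ i, ¬ Unm (height l) dyadicLevels z i) :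
    (∀ x : ℕ, height l 0 ≤ height l x) ∧ height l n = height l 0 := by
  have hE : ∀ x : ℕ, x < n → ∀ i : ℤ, dyadicLevels z i x → 0 ≤ i := by
    intro x hx i hi
    have hx0 : (x : ℤ) / 2 ^ z = 0 :=
      Int.ediv_eq_zero_of_lt (by omega) (by exact_mod_cast hx.trans_le hn)
    rw [dyadicLevels, hx0] at hi
    by_contra hc
    have := Int.ediv_neg_of_neg_of_pos (not_le.1 hc) (show (0 : ℤ) < 2 ^ z by positivity)
    omega
  have hbig : ∀ x : ℕ, n ≤ x → height l x = height l n := fun x hx =>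
    height_of_none hx fun y hy _ => hl y hy
  have hnn : ∀ x : ℕ, height l 0 ≤ height l x := by
    intro x
    by_contra hc
    classical
    have hex : ∃ x : ℕ, height l x < height l 0 := ⟨x, not_le.1 hc⟩
    obtain ⟨m, hm⟩ : ∃ m, Nat.find hex = m := ⟨_, rfl⟩
    have h1 := Nat.find_spec hex
    have h2 : ∀ y, y < m → ¬ height l y < height l 0 := fun y hy => Nat.find_min hex (hm ▸ hy)
    rw [hm] at h1
    cases m with
    | zero => simp at h1
    | succ m =>
      have h3 := h2 m (by omega)
      have h4 := steps_height l m
      push_cast at h1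
      have hmn : m < n := by
        by_contra hc
        have := hbig m (not_lt.1 hc)
        have h5 := hbig (m + 1) (by omega)
        push_cast at h5
        omega
      refine hU m (Or.inl ⟨by omega, fun j hj hjE => ?_⟩)
      have h5 := hE m hmn j hjE
      obtain ⟨j, rfl⟩ := Int.eq_ofNat_of_zero_le h5
      have := h2 j (by omega)
      omega
  refine ⟨hnn, le_antisymm ?_ (hnn n)⟩
  by_contra hc
  classical
  -- the last position below the final height
  obtain ⟨m, hm⟩ : ∃ m, Nat.findGreatest (fun x => height l x < height l n) n = m := ⟨_, rfl⟩
  have h1 : height l m < height l n := hm ▸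
    Nat.findGreatest_spec (P := fun x : ℕ => height l x < height l n) (m := 0) (Nat.zero_le n)
      (by simpa using hc)
  have h2 : ∀ y : ℕ, m < y → y ≤ n → ¬ height l y < height l n := fun y hy hy' =>
    Nat.findGreatest_is_greatest (P := fun x : ℕ => height l x < height l n) (hm ▸ hy) hy'
  have hmn : m < n := by
    have h3 : m ≤ n := hm ▸ Nat.findGreatest_le n
    rcases h3.eq_or_lt with rfl | h3
    · omega
    · exact h3
  have h3 := h2 (m + 1) (by omega) hmn
  have h4 := steps_height l m
  push_cast at h3
  refine hU m (Or.inr ⟨by omega, fun j hj _ => ?_⟩)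
  obtain ⟨j, rfl⟩ := Int.eq_ofNat_of_zero_le (show 0 ≤ j by omega)
  rcases le_total (j + 1) n with h5 | h5
  · have := h2 (j + 1) (by omega) h5
    push_cast at this
    omega
  · have := hbig (j + 1) h5
    push_cast at this
    omega

/-- A word is well-balanced if all its parentheses have partners of the same type. -/
theorem balanced_iff {n z : ℕ} (hn : n ≤ 2 ^ z) (hl : ∀ x, n ≤ x → l x = none) :
    Balanced (segment l 0 n) ↔
      (∀ i, ¬ Unm (height l) dyadicLevels z i) ∧ TypesAgree l 0 n := by
  constructor
  · intro h
    obtain ⟨h1, h2, h3⟩ := h.height (Nat.zero_le n) rfl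
    have hbig : ∀ x : ℕ, n ≤ x → height l x = height l n := fun x hx =>
      height_of_none hx fun y hy _ => hl y hy
    have hnn : ∀ x : ℕ, height l 0 ≤ height l x := by
      intro x
      rcases le_total x n with hx | hx
      · exact h2 x (Nat.zero_le x) hx
      · exact (hbig x hx).symm ▸ h1.le
    refine ⟨fun i hi => ?_, h3⟩
    have hne : height l (i + 1) ≠ height l i := by
      rcases hi with hi | hi <;> have := hi.1 <;> omega
    obtain ⟨x, rfl⟩ := exists_natCast_of_height_ne hne
    have hx : x < n := by
      by_contra hc
      have h4 := hbig x (not_lt.1 hc)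
      have h5 := hbig (x + 1) (by omega)
      push_cast at h5
      omega
    have hlt : ∀ y : ℕ, y < n → dyadicLevels z y x := by
      intro y hy
      have hx0 : (x : ℤ) / 2 ^ z = 0 :=
        Int.ediv_eq_zero_of_lt (by omega) (by exact_mod_cast hx.trans_le hn)
      have hy0 : (y : ℤ) / 2 ^ z = 0 :=
        Int.ediv_eq_zero_of_lt (by omega) (by exact_mod_cast hy.trans_le hn)
      rw [dyadicLevels, hx0, hy0]
    rcases hi with hi | hi
    · have h4 := hi.2 0 (by omega) (by exact_mod_cast hlt 0 (by omega))
      have h5 := hnn (x + 1)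
      push_cast at h5
      omega
    · have h4 := hi.2 (n - 1 : ℕ) (by omega) (hlt _ (by omega))
      have h5 : ((n - 1 : ℕ) : ℤ) + 1 = n := by omega
      rw [h5, ← h1] at h4
      have h6 := hnn x
      simp only [Nat.cast_zero] at h4
      omega
  · rintro ⟨hU, hT⟩
    obtain ⟨h1, h2⟩ := height_nonneg_of_not_unm hn hl hU
    exact balanced_segment (Nat.zero_le n) (by rw [h2, Nat.cast_zero]) (fun x _ _ => h1 x) hT

end balanced

/-! ### Matching types as an equality of strings -/

/-- The map `f` is an order isomorphism between the nonempty positions of both words, so the letters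
of the two strings are compared one by one along `f`. -/
theorem Word.str_eq_str_iff {A : Type} {n : ℕ} {u v : Word A n} (f : Fin n → Fin n)
    (hf : ∀ i, u i ≠ none → v (f i) ≠ none)
    (hsurj : ∀ j, v j ≠ none → ∃ i, u i ≠ none ∧ f i = j)
    (hmono : ∀ i i', u i ≠ none → u i' ≠ none → i < i' → f i < f i') :
    u.str = v.str ↔ ∀ i, u i ≠ none → u i = v (f i) := by
  have key : ∀ w : Word A n, w.str.map some = ((List.finRange n).filter fun i => (w i).isSome).map w := by
    intro w
    rw [Word.str_eq_filterMap]
    induction List.finRange n with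
    | nil => rfl
    | cons a t ih =>
      cases h : w a with
      | none => simp [h, ih]
      | some b => simp [h, ih]
  have hsort : ∀ w : Word A n, ((List.finRange n).filter fun i => (w i).isSome).Pairwise (· < ·) :=
    fun w => List.Pairwise.filter _ (List.pairwise_lt_finRange n)
  -- Both lists are strictly increasing and have the same elements, hence are equal.
  have hlist : ((List.finRange n).filter fun i => (v i).isSome) =
      ((List.finRange n).filter fun i => (u i).isSome).map f := by
    have h1 : (((List.finRange n).filter fun i => (u i).isSome).map f).Pairwise (· < ·) := by
      rw [List.pairwise_map]
      refine (hsort u).imp_of_mem fun {a b} ha hb hab => hmono a b ?_ ?_ hab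
      · simpa [Option.isSome_iff_ne_none] using ha
      · simpa [Option.isSome_iff_ne_none] using hb
    refine List.Perm.eq_of_pairwise (le := (· < ·)) (fun a b _ _ h h' => absurd h' h.asymm) (hsort v) h1 ?_
    rw [List.perm_ext_iff_of_nodup ((hsort v).imp ne_of_lt) (h1.imp ne_of_lt)]
    intro j
    simp only [List.mem_filter, List.mem_finRange, true_and, List.mem_map,
      Option.isSome_iff_ne_none]
    exact ⟨fun h => hsurj j h, fun ⟨i, hi, hij⟩ => hij ▸ hf i hi⟩
  rw [← (List.map_injective_iff.2 (Option.some_injective A)).eq_iff, key, key, hlist, List.map_map,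
    List.map_inj_left]
  simp only [List.mem_filter, List.mem_finRange, true_and, Option.isSome_iff_ne_none,
    Function.comp_apply]

section types

variable {k : ℕ}

def Paren.isCl : Paren k → Bool
  | .op _ => false
  | .cl _ => true

def Paren.type : Paren k → Fin k
  | .op i => i
  | .cl i => i

/-- The types of the opening or closing parentheses whose partners are in the other half of an
interval of level `z`; the closing ones in reverse order. -/
def levelTypes (l : ℕ → Option (Paren k)) (n z : ℕ) : Bool → ℕ → Option (Fin k)
  | false, x => choice (MatchedAt (height l) dyadicLevels z x)
      (match l x with
        | some (.op a) => some a
        | _ => none) none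
  | true, x => choice (MatchedAt (height l) dyadicLevels z (dyadicRev n z x : ℕ))
      (match l (dyadicRev n z x) with
        | some (.cl a) => some a
        | _ => none) none

variable {l : ℕ → Option (Paren k)} {n z : ℕ}

theorem levelTypes_false_eq_some {x : ℕ} {a : Fin k} : levelTypes l n z false x = some a ↔
    MatchedAt (height l) dyadicLevels z x ∧ l x = some (.op a) := by
  rw [levelTypes]
  by_cases h : MatchedAt (height l) dyadicLevels z x
  · rw [choice_true h]
    rcases l x with _ | ⟨_ | _⟩ <;> simp [h]
  · rw [choice_false h]
    simp [h]

theorem levelTypes_true_eq_some {x : ℕ} {a : Fin k} : levelTypes l n z true x = some a ↔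
    MatchedAt (height l) dyadicLevels z (dyadicRev n z x : ℕ) ∧
      l (dyadicRev n z x) = some (.cl a) := by
  rw [levelTypes]
  by_cases h : MatchedAt (height l) dyadicLevels z (dyadicRev n z x : ℕ)
  · rw [choice_true h]
    rcases l (dyadicRev n z x) with _ | ⟨_ | _⟩ <;> simp [h]
  · rw [choice_false h]
    simp [h]

theorem matchedAt_op {x : ℕ} {a : Fin k} (hl : l x = some (.op a))
    (hm : MatchedAt (height l) dyadicLevels (z + 1) x) :
    ∃ y : ℕ, Partner (height l) x y ∧ dyadicLevels (z + 1) x y ∧ ¬ dyadicLevels z x y ∧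
      ∃ b, l y = some (.cl b) := by
  rcases hm.exists_partner levels_dyadic (steps_height l) with ⟨j, hj, h1, h2⟩ | ⟨j, hj, h1, h2⟩
  · obtain ⟨x', y, hx, rfl, -, hb⟩ := partner_nat hj
    exact ⟨y, hj, h1, h2, hb⟩
  · obtain ⟨y, x', hy, hx, -, b, hb⟩ := partner_nat hj
    obtain rfl : x = x' := by omega
    rw [hl] at hb
    cases hb

theorem matchedAt_cl {y : ℕ} {a : Fin k} (hl : l y = some (.cl a))
    (hm : MatchedAt (height l) dyadicLevels (z + 1) y) :
    ∃ x : ℕ, Partner (height l) x y ∧ dyadicLevels (z + 1) x y ∧ ¬ dyadicLevels z x y ∧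
      ∃ b, l x = some (.op b) := by
  rcases hm.exists_partner levels_dyadic (steps_height l) with ⟨j, hj, h1, h2⟩ | ⟨j, hj, h1, h2⟩
  · obtain ⟨y', x, hy, hx, ⟨b, hb⟩, -⟩ := partner_nat hj
    obtain rfl : y = y' := by omega
    rw [hl] at hb
    cases hb
  · obtain ⟨x, y', rfl, hx, hb, -⟩ := partner_nat hj
    exact ⟨x, hj, h1, h2, hb⟩

/-- The pairs of level `z + 1` in one interval are nested. -/
theorem Partner.level_nested {h : ℤ → ℤ} {i j i' j' : ℤ} (hp : Partner h i j)
    (hp' : Partner h i' j') (h1 : dyadicLevels (z + 1) i j) (h2 : ¬ dyadicLevels z i j)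
    (h1' : dyadicLevels (z + 1) i' j') (h2' : ¬ dyadicLevels z i' j')
    (hi : dyadicLevels (z + 1) i i') (hii : i < i') : j' < j := by
  refine hp.nested hp' hii ?_
  have h3 : i / 2 ^ z ≤ j / 2 ^ z := Int.ediv_le_ediv (by positivity) hp.1.le
  have h4 : i' / 2 ^ z ≤ j' / 2 ^ z := Int.ediv_le_ediv (by positivity) hp'.1.le
  unfold dyadicLevels at *
  rw [pow_succ, ← Int.ediv_ediv_of_nonneg (by positivity),
    ← Int.ediv_ediv_of_nonneg (by positivity)] at h1 h1' hi
  by_contra hc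
  have h5 : j / 2 ^ z ≤ i' / 2 ^ z := Int.ediv_le_ediv (by positivity) (not_le.1 hc).le
  omega

/-- The strings of the types of the pairs of a level are equal if the types of partners agree. -/
theorem str_levelTypes_eq_iff {N : ℕ} (hN : N = n) (hl : ∀ x, n ≤ x → l x = none) :
    Word.str (fun x : Fin N => levelTypes l n (z + 1) false x) =
        Word.str (fun x : Fin N => levelTypes l n (z + 1) true x) ↔
      ∀ x y : ℕ, Partner (height l) x y → dyadicLevels (z + 1) x y → ¬ dyadicLevels z x y →
        ∀ a b, l x = some (.op a) → l y = some (.cl b) → a = b := by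
  subst hN
  have hlt : ∀ {x a}, l x = some a → x < N := fun {x a} h => by
    by_contra hc
    rw [hl x (not_lt.1 hc)] at h
    cases h
  -- The correspondence sends an opening parenthesis to the reflection of its partner, which is the
  -- place where the type of that partner is stored.
  have hex : ∀ i : Fin N, ∃ j : Fin N, levelTypes l N (z + 1) false i ≠ none →
      Partner (height l) i (dyadicRev N (z + 1) j : ℕ) ∧
      dyadicLevels (z + 1) i (dyadicRev N (z + 1) j : ℕ) ∧
      ¬ dyadicLevels z i (dyadicRev N (z + 1) j : ℕ) ∧
      ∃ b, l (dyadicRev N (z + 1) j) = some (.cl b) := by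
    intro i
    by_cases h : levelTypes l N (z + 1) false i = none
    · exact ⟨i, fun h' => absurd h h'⟩
    · obtain ⟨a, ha⟩ := Option.ne_none_iff_exists'.1 h
      obtain ⟨hm, hla⟩ := levelTypes_false_eq_some.1 ha
      obtain ⟨y, h1, h2, h3, b, hb⟩ := matchedAt_op hla hm
      have hy := hlt hb
      refine ⟨⟨dyadicRev N (z + 1) y, dyadicRev_lt hy⟩, fun _ => ?_⟩
      simp only [dyadicRev_dyadicRev hy]
      exact ⟨h1, h2, h3, b, hb⟩
  choose f hf using hex
  have hv : ∀ i : Fin N, levelTypes l N (z + 1) false i ≠ none → ∀ b,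
      l (dyadicRev N (z + 1) (f i)) = some (.cl b) →
      levelTypes l N (z + 1) true (f i) = some b := by
    intro i hi b hb
    obtain ⟨h1, h2, h3, -⟩ := hf i hi
    exact levelTypes_true_eq_some.2
      ⟨(h1.matchedAt levels_dyadic (steps_height l) h2 h3).2, hb⟩
  rw [Word.str_eq_str_iff f]
  · constructor
    · intro H x y hp h1 h2 a b ha hb
      have hx := hlt ha
      have hu : levelTypes l N (z + 1) false x = some a := levelTypes_false_eq_some.2
        ⟨(hp.matchedAt levels_dyadic (steps_height l) h1 h2).1, ha⟩
      have hne : levelTypes l N (z + 1) false (⟨x, hx⟩ : Fin N) ≠ none := by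
        simp [hu]
      have h3 := H ⟨x, hx⟩ hne
      obtain ⟨g1, g2, g3, -⟩ := hf ⟨x, hx⟩ hne
      have hxy := hp.right_unique g1
      have hxy' : y = dyadicRev N (z + 1) (f ⟨x, hx⟩) := by exact_mod_cast hxy
      rw [hxy'] at hb
      simp only at h3
      rw [hu, hv _ hne b hb] at h3
      exact Option.some.inj h3
    · intro H i hi
      obtain ⟨h1, h2, h3, b, hb⟩ := hf i hi
      obtain ⟨a, ha⟩ := Option.ne_none_iff_exists'.1 hi
      rw [ha, hv i hi b hb, H _ _ h1 h2 h3 a b (levelTypes_false_eq_some.1 ha).2 hb]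
  · intro i hi
    obtain ⟨h1, h2, h3, b, hb⟩ := hf i hi
    rw [hv i hi b hb]
    simp
  · intro j hj
    obtain ⟨b, hb⟩ := Option.ne_none_iff_exists'.1 hj
    obtain ⟨hm, hlb⟩ := levelTypes_true_eq_some.1 hb
    obtain ⟨x, h1, h2, h3, a, ha⟩ := matchedAt_cl hlb hm
    have hx := hlt ha
    have hu : levelTypes l N (z + 1) false x = some a := levelTypes_false_eq_some.2
      ⟨(h1.matchedAt levels_dyadic (steps_height l) h2 h3).1, ha⟩
    have hne : levelTypes l N (z + 1) false (⟨x, hx⟩ : Fin N) ≠ none := by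
      simp [hu]
    refine ⟨⟨x, hx⟩, hne, ?_⟩
    have h4 := h1.right_unique (hf ⟨x, hx⟩ hne).1
    have h4' : dyadicRev N (z + 1) j = dyadicRev N (z + 1) (f ⟨x, hx⟩) := by exact_mod_cast h4
    have h5 := congrArg (dyadicRev N (z + 1)) h4'
    rw [dyadicRev_dyadicRev j.isLt, dyadicRev_dyadicRev (f ⟨x, hx⟩).isLt] at h5
    exact Fin.ext h5.symm
  · intro i i' hi hi' hii
    obtain ⟨h1, h2, h3, b, hb⟩ := hf i hi
    obtain ⟨h1', h2', h3', b', hb'⟩ := hf i' hi'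
    have e1 := dyadicRev_dyadicRev (z := z + 1) (f i).isLt
    have e2 := dyadicRev_dyadicRev (z := z + 1) (f i').isLt
    have b1 := dyadicLevels_natCast.1 h2
    have b2 := dyadicLevels_natCast.1 h2'
    rw [Fin.lt_def, ← e1, ← e2]
    -- In one interval the pairs are nested, so partners come in reverse order and reflection
    -- restores the order. Different intervals keep their order anyway.
    by_cases hE : dyadicBase (z + 1) i = dyadicBase (z + 1) i'
    · refine dyadicRev_lt_dyadicRev (dyadicRev_lt (f i).isLt) ?_ (by rw [← b1, ← b2, hE])
      have := h1.level_nested h1' h2 h3 h2' h3' (dyadicLevels_natCast.2 hE) (by exact_mod_cast hii)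
      exact_mod_cast this
    · refine dyadicRev_lt_of_base_lt (dyadicRev_lt (f i).isLt) (dyadicRev_lt (f i').isLt) ?_
      rw [← b1, ← b2]
      refine lt_of_le_of_ne ?_ hE
      exact Nat.mul_le_mul_right _ (Nat.div_le_div_right (Fin.le_def.1 hii.le))

theorem str_levelTypes_zero {N : ℕ} :
    Word.str (fun x : Fin N => levelTypes l n 0 false x) =
      Word.str (fun x : Fin N => levelTypes l n 0 true x) := by
  congr 1
  funext x
  exact (choice_false (fun h => h) _ _).trans (choice_false (fun h => h) _ _).symm

/-- A larger interval contains more candidates for a partner. -/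
theorem Unm.anti {h : ℤ → ℤ} {E : ℕ → ℤ → ℤ → Prop} (hE : Levels E) {z z' : ℕ} (hz : z ≤ z')
    {i : ℤ} (hu : Unm h E z' i) : Unm h E z i := by
  rcases hu with hu | hu
  · exact Or.inl ⟨hu.1, fun j hj hji => hu.2 j hj (hE.mono hz hji)⟩
  · exact Or.inr ⟨hu.1, fun j hj hji => hu.2 j hj (hE.mono hz hji)⟩

/-- A level without unmatched parentheses need not be a top level; since unmatched sets shrink with
the level, the maximum with a top level serves both purposes. Every pair meets at some level within
the bound, where the equality of strings compares its types. The length `N` allows for the domain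
size `1 * n` of the instances. -/
theorem balanced_str_iff {N : ℕ} (hN : N = n) (hn : 1 ≤ n) (w : Word (Paren k) n) :
    Balanced w.str ↔
      (∀ z : Fin n, (z : ℕ) ≤ logBound.fn n →
        Word.str (fun x : Fin N => levelTypes w.letter n z false x) =
          Word.str (fun x : Fin N => levelTypes w.letter n z true x)) ∧
      ∃ z : Fin n, (z : ℕ) ≤ logBound.fn n ∧
        ∀ i, ¬ Unm (height w.letter) dyadicLevels z i := by
  have hl : ∀ x, n ≤ x → w.letter x = none := fun x hx => dif_neg (not_lt.2 hx)
  have hlt : ∀ {x a}, w.letter x = some a → x < n := fun {x a} h => by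
    by_contra hc
    rw [hl x (not_lt.1 hc)] at h
    cases h
  obtain ⟨Z, hZ, hnZ⟩ := exists_top_level n hn
  rw [Word.str_eq_segment]
  constructor
  · intro h
    obtain ⟨h1, h2⟩ := (balanced_iff hnZ hl).1 h
    refine ⟨fun z hz => ?_, Z, hZ, h1⟩
    cases hz' : (z : ℕ) with
    | zero => exact str_levelTypes_zero
    | succ z' =>
      exact (str_levelTypes_eq_iff hN hl).2 fun x y hp _ _ a b ha hb =>
        h2 x y (Nat.zero_le x) (hlt hb) hp a b ha hb
  · rintro ⟨h1, z, hz, h2⟩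
    have h3 : ∀ i, ¬ Unm (height w.letter) dyadicLevels (max (Z : ℕ) z) i := fun i hi =>
      h2 i (hi.anti levels_dyadic (le_max_right _ _))
    have h4 : n ≤ 2 ^ max (Z : ℕ) z := hnZ.trans (Nat.pow_le_pow_right (by omega) (le_max_left _ _))
    refine (balanced_iff h4 hl).2 ⟨h3, fun x y hx hy hp a b ha hb => ?_⟩
    have hE : dyadicLevels Z x y := by
      rw [dyadicLevels_natCast, dyadicBase_eq_iff, Nat.div_eq_of_lt ((hlt ha).trans_le hnZ),
        Nat.div_eq_of_lt ((hlt hb).trans_le hnZ)]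
    obtain ⟨z', hz', h5, h6⟩ := hp.exists_level levels_dyadic hE
    have hZn := Z.isLt
    exact (str_levelTypes_eq_iff hN hl).1 (h1 ⟨z' + 1, by omega⟩ (by simp only; omega)) x y hp h5 h6
      a b ha hb

end types

/-! ### The position at which a level changes -/

section worlds

/-- The heights of a word or of its reflection. -/
def worldHeight (n : ℕ) (h : ℤ → ℤ) : Bool → ℤ → ℤ
  | false => h
  | true => mirror n h

def worldLevels (n : ℕ) (E : ℕ → ℤ → ℤ → Prop) : Bool → ℕ → ℤ → ℤ → Prop
  | false => E
  | true => mirrorLevels n E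

def worldPos {n : ℕ} : Bool → Fin n → Fin n
  | false, x => x
  | true, x => x.rev

theorem worldPos_worldPos {n : ℕ} (r : Bool) (x : Fin n) : worldPos r (worldPos r x) = x := by
  cases r
  · rfl
  · exact Fin.rev_rev x

theorem cast_rev {n : ℕ} (x : Fin n) : ((x.rev : ℕ) : ℤ) = (n : ℤ) - 1 - x := by
  rw [Fin.val_rev]
  omega

variable {n z : ℕ} {h : ℤ → ℤ} {E : ℕ → ℤ → ℤ → Prop}

theorem unm_world (r : Bool) (x : Fin n) :
    Unm (worldHeight n h r) (worldLevels n E r) z (worldPos r x : Fin n) ↔ Unm h E z x := by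
  cases r
  · exact Iff.rfl
  · rw [worldPos, worldHeight, worldLevels, unm_mirror, cast_rev]
    simp only [sub_sub_cancel]

theorem matchedAt_world (r : Bool) (x : Fin n) :
    MatchedAt (worldHeight n h r) (worldLevels n E r) z (worldPos r x : Fin n) ↔
      MatchedAt h E z x := by
  cases r
  · exact Iff.rfl
  · rw [worldPos, worldHeight, worldLevels, matchedAt_mirror, cast_rev]
    simp only [sub_sub_cancel]

theorem worldLevels_iff (r : Bool) (x y : Fin n) :
    worldLevels n E r z (worldPos r x : Fin n) (worldPos r y : Fin n) ↔ E z x y := by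
  cases r
  · exact Iff.rfl
  · rw [worldPos, worldLevels, mirrorLevels, worldPos, cast_rev, cast_rev]
    simp only [sub_sub_cancel]

theorem Levels.world (hE : Levels E) (r : Bool) : Levels (worldLevels n E r) := by
  cases r
  · exact hE
  · exact hE.mirror n

/-- All unmatched parentheses are in the domain. -/
def InDomain (n : ℕ) (h : ℤ → ℤ) (E : ℕ → ℤ → ℤ → Prop) : Prop :=
  ∀ z i, Unm h E z i → ∃ x : Fin n, i = x

theorem InDomain.world (hd : InDomain n h E) (r : Bool) :
    InDomain n (worldHeight n h r) (worldLevels n E r) := by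
  cases r
  · exact hd
  · intro z i hi
    obtain ⟨x, hx⟩ := hd z _ (unm_mirror.1 hi)
    exact ⟨x.rev, by rw [cast_rev]; omega⟩

theorem InDomain.matchedAt (hd : InDomain n h E) {i : ℤ} (hm : MatchedAt h E z i) :
    ∃ x : Fin n, i = x := by
  cases z with
  | zero => exact hm.elim
  | succ z => exact hd z i hm.1

/-- The leftmost parenthesis of level `z` in the interval of `p`, which begins at `first`, provided
that there are such parentheses on both sides of `p`. -/
def leftEnd (n : ℕ) (h : ℤ → ℤ) (E : ℕ → ℤ → ℤ → Prop) (p : Fin n) (z first : ℕ) :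
    Option (Fin n) :=
  choice ((∃ x : Fin n, leastIn n {x : ℕ | MatchedAt h E z x ∧ first ≤ x} = some x ∧ x ≤ p) ∧
      ∃ y : Fin n, leastIn n {x : ℕ | MatchedAt h E z x ∧ (p : ℕ) ≤ x} = some y ∧ E z y p)
    (leastIn n {x : ℕ | MatchedAt h E z x ∧ first ≤ x}) none

variable {p : Fin n} {first : ℕ}

/-- To the left of `p` the condition `first ≤ x` describes exactly the interval of `p`, so one
successor query from `first` finds its leftmost parenthesis of the level. A second query, from `p`,
tests the other side. -/
theorem leftEnd_eq_some (hE : Levels E) (hd : InDomain n h E)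
    (hf : ∀ x : Fin n, x ≤ p → (first ≤ x ↔ E z x p)) {d : Fin n}
    (hg : leftEnd n h E p z first = some d) : Encloses h E z p ∧ MatchedAt h E z d ∧ E z d p ∧
      ∀ x, MatchedAt h E z x → E z x p → d ≤ x := by
  unfold leftEnd at hg
  by_cases hc : (∃ x : Fin n, leastIn n {x : ℕ | MatchedAt h E z x ∧ first ≤ x} = some x ∧ x ≤ p) ∧
      ∃ y : Fin n, leastIn n {x : ℕ | MatchedAt h E z x ∧ (p : ℕ) ≤ x} = some y ∧ E z y p
  · rw [choice_true hc] at hg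
    obtain ⟨⟨x, hx, hxp⟩, y, hy, hyp⟩ := hc
    rw [hg] at hx
    cases hx
    rw [leastIn_eq_some] at hg hy
    have hdp := (hf d hxp).1 hg.1.2
    refine ⟨⟨⟨d, by exact_mod_cast hxp, hdp, hg.1.1⟩, y, by exact_mod_cast hy.1.2, hE.symm hyp,
      hy.1.1⟩, hg.1.1, hdp, fun x hx hxE => ?_⟩
    obtain ⟨x, rfl⟩ := hd.matchedAt hx
    rcases le_total x p with h1 | h1
    · have h2 : (d : ℕ) ≤ x := hg.2 ⟨hx, (hf x h1).2 hxE⟩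
      exact_mod_cast h2
    · exact_mod_cast hxp.trans h1
  · rw [choice_false hc] at hg
    cases hg

theorem leftEnd_eq_none (hE : Levels E) (hd : InDomain n h E)
    (hf : ∀ x : Fin n, x ≤ p → (first ≤ x ↔ E z x p))
    (hg : leftEnd n h E p z first = none) : ¬ Encloses h E z p := by
  rintro ⟨⟨x, hxp, hx, hxm⟩, y, hpy, hy, hym⟩
  obtain ⟨x, rfl⟩ := hd.matchedAt hxm
  obtain ⟨y, rfl⟩ := hd.matchedAt hym
  have hxp' : x ≤ p := by exact_mod_cast hxp
  have hpy' : p ≤ y := by exact_mod_cast hpy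
  have hleast : ∀ (m : ℕ) (q : Fin n), MatchedAt h E z q → m ≤ q →
      ∃ q' : Fin n, leastIn n {x : ℕ | MatchedAt h E z x ∧ m ≤ x} = some q' ∧ q' ≤ q := by
    intro m q hq hmq
    cases hl : leastIn n {x : ℕ | MatchedAt h E z x ∧ m ≤ x} with
    | none =>
      rw [leastIn_eq_none] at hl
      · exact (Set.eq_empty_iff_forall_notMem.1 hl q ⟨hq, hmq⟩).elim
      · intro x hx
        obtain ⟨x', hx'⟩ := hd.matchedAt hx.1
        have : x = x' := by exact_mod_cast hx'
        exact this ▸ x'.isLt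
    | some q' => exact ⟨q', rfl, (leastIn_eq_some.1 hl).2 ⟨hq, hmq⟩⟩
  obtain ⟨x', hx', hxx⟩ := hleast first x hxm ((hf x hxp').2 hx)
  obtain ⟨y', hy', hyy⟩ := hleast p y hym hpy'
  have hyE : E z y' p := by
    refine hE.symm (hE.convex ?_ ?_ hy)
    · exact_mod_cast (leastIn_eq_some.1 hy').1.2
    · exact_mod_cast hyy
  rw [leftEnd, choice_true ⟨⟨x', hx', hxx.trans hxp'⟩, y', hy', hyE⟩, hx'] at hg
  cases hg

/-- The next unmatched parenthesis, if it is a closing one in the interval of `p`. -/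
def NextClose (h : ℤ → ℤ) (E : ℕ → ℤ → ℤ → Prop) (p : Fin n) (z : ℕ) (c : Fin n) : Prop :=
  leastIn n {x : ℕ | Unm h E z x ∧ (p : ℕ) ≤ x} = some c ∧ E z c p ∧ h c = h (c + 1) + 1

/-- This translates the answers of successor queries into the description of the changed position.
The queried set contains unmatched parentheses of both kinds. -/
theorem isToggle_of (hE : Levels E) (hd : InDomain n h E) {firsts : ℕ → ℕ}
    (hf : ∀ z', z' ≤ z → ∀ x : Fin n, x ≤ p → (firsts z' ≤ x ↔ E z' x p)) {d : Fin n}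
    (H : NextClose h E p z d ∨ (∀ c, ¬ NextClose h E p z c) ∧
      ((∃ z', z' ≤ z ∧ leftEnd n h E p z' (firsts z') = some d ∧
          ∀ z'', z'' ≤ z → z' < z'' → leftEnd n h E p z'' (firsts z'') = none) ∨
        (∀ z', z' ≤ z → leftEnd n h E p z' (firsts z') = none) ∧ d = p)) :
    IsToggle h E z p d := by
  rcases H with ⟨h1, h2, h3⟩ | ⟨h1, h2⟩
  · rw [leastIn_eq_some] at h1
    refine Or.inl ⟨by exact_mod_cast h1.1.2, hE.symm h2, ?_, fun e he hed hu => ?_⟩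
    · rcases h1.1.1 with hu | hu
      · exact hu
      · have := hu.1
        omega
    · obtain ⟨e, rfl⟩ := hd z e (Or.inl hu)
      have h4 : (d : ℕ) ≤ e := h1.2 ⟨Or.inl hu, by exact_mod_cast he⟩
      omega
  · refine Or.inr ⟨fun e he hpe hu => ?_, ?_⟩
    · obtain ⟨e, rfl⟩ := hd z e (Or.inl hu)
      cases hl : leastIn n {x : ℕ | Unm h E z x ∧ (p : ℕ) ≤ x} with
      | none =>
        rw [leastIn_eq_none] at hl
        · exact Set.eq_empty_iff_forall_notMem.1 hl e ⟨Or.inl hu, by exact_mod_cast he⟩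
        · intro x hx
          obtain ⟨x', hx'⟩ := hd z x hx.1
          have : x = x' := by exact_mod_cast hx'
          exact this ▸ x'.isLt
      | some c =>
        have hc := leastIn_eq_some.1 hl
        have hce : (c : ℤ) ≤ e := by
          have h4 : (c : ℕ) ≤ e := hc.2 ⟨Or.inl hu, by exact_mod_cast he⟩
          exact_mod_cast h4
        have hpc : (p : ℤ) ≤ c := by exact_mod_cast hc.1.2
        refine h1 c ⟨hl, hE.symm (hE.convex hpc hce hpe), ?_⟩
        rcases hc.1.1 with hu' | hu'
        · exact hu'.1
        -- The next unmatched parenthesis cannot be an opening one if an unmatched closing one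
        -- follows in the same interval.
        · exact (not_unmOpen_unmClose hE hu' hu hce (hE.convex_right hpc hce hpe)).elim
    · rcases h2 with ⟨z', hz', h3, h4⟩ | ⟨h3, rfl⟩
      · obtain ⟨g1, g2, g3, g4⟩ := leftEnd_eq_some hE hd (hf z' hz') h3
        exact Or.inl ⟨z', hz', g1, fun z'' hz'' hlt =>
          leftEnd_eq_none hE hd (hf z'' hz'') (h4 z'' hz'' hlt), g2, g3, g4⟩
      · exact Or.inr ⟨fun z' hz' => leftEnd_eq_none hE hd (hf z' hz') (h3 z' hz'), rfl⟩

end worlds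

/-! ### The program for well-balanced strings: symbols and terms -/

/-- The relations `lett` and `sgn` store the letters and whether they are closing. The four
functions are static; `pred` leads from a level to the one below. -/
inductive DyckSym (k : ℕ)
  | lett (a : Paren k)
  | sgn (b : Bool)
  | base
  | rev
  | flip
  | pred

instance (k : ℕ) : Fintype (DyckSym k) := by
  classical
  refine @Fintype.ofFinite _ (Finite.of_surjective (α := (Bool × Fin k) ⊕ Bool ⊕ Fin 4) (fun s =>
    match s with
      | .inl (false, i) => .lett (.op i)
      | .inl (true, i) => .lett (.cl i)
      | .inr (.inl b) => .sgn b
      | .inr (.inr 0) => .base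
      | .inr (.inr 1) => .rev
      | .inr (.inr 2) => .flip
      | .inr (.inr 3) => .pred) ?_)
  rintro ((i | i) | b | _ | _ | _ | _)
  · exact ⟨.inl (false, i), rfl⟩
  · exact ⟨.inl (true, i), rfl⟩
  · exact ⟨.inr (.inl b), rfl⟩
  · exact ⟨.inr (.inr 0), rfl⟩
  · exact ⟨.inr (.inr 1), rfl⟩
  · exact ⟨.inr (.inr 2), rfl⟩
  · exact ⟨.inr (.inr 3), rfl⟩

abbrev DyckSym.kind {k : ℕ} : DyckSym k → Kind
  | .lett _ => .cond
  | .sgn _ => .cond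
  | _ => .term

abbrev DyckSym.arity {k : ℕ} : DyckSym k → ℕ
  | .base => 2
  | .rev => 2
  | _ => 1

/-- For each level an instance of `StringEquality` for the types of its pairs, and the sets of the
unmatched parentheses and of the parentheses of the level, forwards and backwards. -/
inductive DyckSup
  | eq
  | set (m r : Bool)

instance : Fintype DyckSup := by
  classical
  refine @Fintype.ofFinite _ (Finite.of_surjective (α := Option (Bool × Bool)) (fun s =>
    match s with
      | none => .eq
      | some (m, r) => .set m r) ?_)
  rintro (_ | ⟨m, r⟩)
  · exact ⟨none, rfl⟩
  · exact ⟨some (m, r), rfl⟩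

abbrev DyckSup.sig (k : ℕ) : DyckSup → Sig
  | .eq => stringEqualitySig (Fin k)
  | .set _ _ => setSig

abbrev dyckEnv (k : ℕ) : Env where
  aux := ⟨DyckSym k, inferInstance, DyckSym.kind, DyckSym.arity⟩
  Sup := DyckSup
  supFin := inferInstance
  sig := DyckSup.sig k
  idx := fun _ => 1
  scale := fun _ => 1

/-- The left ends of outermost pairs (`false`), and the positions that change (`true`). -/
abbrev dyckLoc : Schema := ⟨Bool, inferInstance, fun _ => .term, fun _ => 1⟩

abbrev dyckSup {k : ℕ} (P : Program (stringEqualitySig (Fin k))) :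
    ∀ i : DyckSup, Program (DyckSup.sig k i)
  | .eq => P
  | .set _ _ => succProgram

abbrev dyckProblem (k : ℕ) : ∀ i : DyckSup, DynProblem (DyckSup.sig k i)
  | .eq => StringEquality (Fin k)
  | .set _ _ => SuccSet

section terms

variable {k : ℕ} {L : Schema} {m : ℕ}

def flipTerm : Bool → Expr (dyckEnv k) L .term m → Expr (dyckEnv k) L .term m
  | false, t => t
  | true, t => Expr.aux (E := dyckEnv k) .flip fun _ => t

def baseTerm (z t : Expr (dyckEnv k) L .term m) : Expr (dyckEnv k) L .term m :=
  Expr.aux (E := dyckEnv k) .base ![z, t]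

def revTerm (z t : Expr (dyckEnv k) L .term m) : Expr (dyckEnv k) L .term m :=
  Expr.aux (E := dyckEnv k) .rev ![z, t]

def predTerm (z : Expr (dyckEnv k) L .term m) : Expr (dyckEnv k) L .term m :=
  Expr.aux (E := dyckEnv k) .pred fun _ => z

def sgnCond (b : Bool) (t : Expr (dyckEnv k) L .term m) : Expr (dyckEnv k) L .cond m :=
  Expr.aux (E := dyckEnv k) (.sgn b) fun _ => t

def lettCond (a : Paren k) (t : Expr (dyckEnv k) L .term m) : Expr (dyckEnv k) L .cond m :=
  Expr.aux (E := dyckEnv k) (.lett a) fun _ => t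

def emptyCond (t : Expr (dyckEnv k) L .term m) : Expr (dyckEnv k) L .cond m :=
  .and (.not (sgnCond false t)) (.not (sgnCond true t))

/-- The next element of a set. -/
def setTerm (b r : Bool) (z t : Expr (dyckEnv k) L .term m) : Expr (dyckEnv k) L .term m :=
  Expr.query (E := dyckEnv k) (.set b r) (fun _ => z) () (fun _ => (0 : Fin 1)) (fun _ => t)
    (0 : Fin 1)

def memCond (b r : Bool) (z t : Expr (dyckEnv k) L .term m) : Expr (dyckEnv k) L .cond m :=
  .eq (setTerm b r z t) t

def eqCond (z : Expr (dyckEnv k) L .term m) : Expr (dyckEnv k) L .cond m :=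
  Expr.query (E := dyckEnv k) .eq (fun _ => z) () Fin.elim0 Fin.elim0 (0 : Fin 1)

/-- The position of a parenthesis in one of the two words of its level. -/
def slotTerm : Bool → Expr (dyckEnv k) L .term m → Expr (dyckEnv k) L .term m →
    Expr (dyckEnv k) L .term m
  | false, _, t => t
  | true, z, t => revTerm z t

def localTerm (s : Bool) (t : Expr (dyckEnv k) dyckLoc .term m) :
    Expr (dyckEnv k) dyckLoc .term m :=
  Expr.loc (L := dyckLoc) s fun _ => t

end terms

/-! ### The intended auxiliary structure -/

def slot {n : ℕ} (z : ℕ) : Bool → Fin n → Fin n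
  | false, x => x
  | true, x => ⟨dyadicRev n z x, dyadicRev_lt x.isLt⟩

theorem slot_slot {n z : ℕ} (s : Bool) (x : Fin n) : slot z s (slot z s x) = x := by
  cases s
  · rfl
  · exact Fin.ext (dyadicRev_dyadicRev x.isLt)

/-- The static functions, and the letters of the word `w`. -/
structure DyckAux {k n : ℕ} (A : Str (dyckEnv k).aux n) (w : Word (Paren k) n) : Prop where
  base : ∀ z x : Fin n, (A .base ![z, x] : Option (Fin n)) = toDomain n (dyadicBase z x)
  rev : ∀ z x : Fin n, (A .rev ![z, x] : Option (Fin n)) = toDomain n (dyadicRev n z x)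
  flip : ∀ a : Fin 1 → Fin n, (A .flip a : Option (Fin n)) = some (a 0).rev
  pred : ∀ a : Fin 1 → Fin n,
    (A .pred a : Option (Fin n)) = theUnique fun y : Fin n => (y : ℕ) + 1 = a 0
  lett : ∀ (c : Paren k) (a : Fin 1 → Fin n), (A (.lett c) a : Prop) ↔ w (a 0) = some c
  sgn : ∀ (b : Bool) (a : Fin 1 → Fin n),
    (A (.sgn b) a : Prop) ↔ ∃ c, w (a 0) = some c ∧ c.isCl = b

/-- Inputs for the supplementary instances of one level. -/
abbrev LevelInput (k n : ℕ) : Type := ∀ i : DyckSup, (dyckProblem k i (1 * n)).State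

def levelSet (h : ℤ → ℤ) (E : ℕ → ℤ → ℤ → Prop) (z : ℕ) : Bool → Set ℕ
  | false => {x : ℕ | Unm h E z x}
  | true => {x : ℕ | MatchedAt h E z x}

def levelInput {k n : ℕ} (w : Word (Paren k) n) (z : ℕ) : LevelInput k n
  | .eq => (fun x => levelTypes w.letter n z false x, fun x => levelTypes w.letter n z true x)
  | .set b r => levelSet (worldHeight n (height w.letter) r) (worldLevels n dyadicLevels r) z b

section eval

variable {k n : ℕ} {P : Program (stringEqualitySig (Fin k))} {L : Schema}

abbrev DyckStore (P : Program (stringEqualitySig (Fin k))) (L : Schema) (n : ℕ) : Type :=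
  Store (dyckEnv k) L n fun i => (dyckSup P i).sem (1 * n)

/-- The supplementary instances of level `z` have the input `G`. -/
def HasInput (P : Program (stringEqualitySig (Fin k)))
    (sup : ∀ i : DyckSup, (Fin 1 → Fin n) → ((dyckSup P i).sem (1 * n)).State) (z : Fin n)
    (G : LevelInput k n) : Prop :=
  ∀ i, Reps (dyckSup P i) (dyckProblem k i) (sup i fun _ => z) (G i)

variable {A : Str (dyckEnv k).aux n} {w : Word (Paren k) n} {σ : DyckStore P L n} {m : ℕ}
  {v : Fin m → Fin n} {t zt : Expr (dyckEnv k) L .term m} {x z : Fin n}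

theorem DyckAux.eval_flip (hA : DyckAux A w) (r : Bool) (ht : t.eval A σ v = some x) :
    (flipTerm r t).eval A σ v = some (worldPos r x) := by
  cases r
  · exact ht
  · exact (Expr.eval_aux_of (allSome_of_forall fun _ => ht)).trans (hA.flip _)

theorem eval_flip_none (r : Bool) (ht : t.eval A σ v = none) :
    (flipTerm r t).eval A σ v = none := by
  cases r
  · exact ht
  · simp only [flipTerm, Expr.eval, allSome_eq_none (f := fun _ : Fin 1 => t.eval A σ v) 0 ht]
    rfl

theorem DyckAux.eval_base (hA : DyckAux A w) (hz : zt.eval A σ v = some z)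
    (ht : t.eval A σ v = some x) : (baseTerm zt t).eval A σ v =
      some ⟨dyadicBase z x, (dyadicBase_le _ _).trans_lt x.isLt⟩ := by
  refine (Expr.eval_aux_of (a := ![z, x]) ?_).trans ((hA.base z x).trans (toDomain_of_lt _))
  rw [allSome_eq_some]
  exact Fin.forall_fin_two.2 ⟨hz, ht⟩

theorem eval_base_none (ht : t.eval A σ v = none) :
    (baseTerm zt t).eval A σ v = none := by
  have h : allSome (fun j : Fin 2 => (![zt, t] j).eval A σ v) = none := allSome_eq_none 1 ht
  simp only [baseTerm, Expr.eval, h]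
  rfl

theorem DyckAux.eval_rev (hA : DyckAux A w) (hz : zt.eval A σ v = some z)
    (ht : t.eval A σ v = some x) : (revTerm zt t).eval A σ v = some (slot z true x) := by
  refine (Expr.eval_aux_of (a := ![z, x]) ?_).trans
    ((hA.rev z x).trans (toDomain_of_lt (dyadicRev_lt x.isLt)))
  rw [allSome_eq_some]
  exact Fin.forall_fin_two.2 ⟨hz, ht⟩

theorem DyckAux.eval_slot (hA : DyckAux A w) (s : Bool) (hz : zt.eval A σ v = some z)
    (ht : t.eval A σ v = some x) : (slotTerm s zt t).eval A σ v = some (slot z s x) := by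
  cases s
  · exact ht
  · exact hA.eval_rev hz ht

theorem eval_slot_none (s : Bool) (ht : t.eval A σ v = none) :
    (slotTerm s zt t).eval A σ v = none := by
  cases s
  · exact ht
  · have h : allSome (fun j : Fin 2 => (![zt, t] j).eval A σ v) = none := allSome_eq_none 1 ht
    simp only [slotTerm, revTerm, Expr.eval, h]
    rfl

theorem DyckAux.eval_pred (hA : DyckAux A w) (hz : zt.eval A σ v = some z) :
    (predTerm zt).eval A σ v = theUnique fun y : Fin n => (y : ℕ) + 1 = z :=
  (Expr.eval_aux_of (allSome_of_forall fun _ => hz)).trans (hA.pred _)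

theorem DyckAux.eval_sgn (hA : DyckAux A w) (b : Bool) (ht : t.eval A σ v = some x) :
    (sgnCond b t).eval A σ v ↔ ∃ c, w x = some c ∧ c.isCl = b :=
  (iff_of_eq (Expr.eval_aux_of (allSome_of_forall fun _ => ht))).trans (hA.sgn b _)

theorem DyckAux.eval_lett (hA : DyckAux A w) (c : Paren k) (ht : t.eval A σ v = some x) :
    (lettCond c t).eval A σ v ↔ w x = some c :=
  (iff_of_eq (Expr.eval_aux_of (allSome_of_forall fun _ => ht))).trans (hA.lett c _)

theorem DyckAux.eval_empty (hA : DyckAux A w) (ht : t.eval A σ v = some x) :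
    (emptyCond t).eval A σ v ↔ w x = none := by
  refine (and_congr (not_congr (hA.eval_sgn false ht)) (not_congr (hA.eval_sgn true ht))).trans ?_
  rcases w x with _ | ⟨_ | _⟩ <;> simp [Paren.isCl]

/-- The instances have domain size `1 * n`, which is not `n` by definition; reading the single block
identifies the two domains. -/
theorem fromBlock_leastIn {S : Set ℕ} :
    Val.fromBlock (c := 1) (n := n) 0 (κ := .term) (leastIn (1 * n) S) = leastIn n S := by
  have hsurj : ∀ y : Fin (1 * n), ∃ a : Fin n, y = inBlock 0 a := fun y =>
    ⟨⟨y, by have := y.isLt; omega⟩, Fin.ext (by simp)⟩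
  have hb : ∀ a : Fin n, Val.fromBlock (c := 1) (n := n) 0 (κ := .term)
      (some (inBlock 0 a)) = some a := by
    intro a
    simp only [Val.fromBlock, inBlock, Option.bind_some, Equiv.symm_apply_apply, if_true]
  cases h : leastIn (1 * n) S with
  | none =>
    refine Eq.symm (Option.eq_none_iff_forall_ne_some.2 fun q hq => ?_)
    have h1 : leastIn (1 * n) S = some (inBlock 0 q) := by
      rw [leastIn_eq_some] at hq ⊢
      simpa using hq
    rw [h] at h1
    cases h1
  | some y =>
    obtain ⟨a, rfl⟩ := hsurj y
    rw [hb]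
    rw [leastIn_eq_some] at h
    exact (leastIn_eq_some.2 (by simpa using h)).symm

theorem eval_set {b r : Bool} {S : Set ℕ}
    (hS : Reps succProgram SuccSet (n := 1 * n) (σ.sup (.set b r) fun _ => z) S)
    (hz : zt.eval A σ v = some z) (ht : t.eval A σ v = some x) :
    (setTerm b r zt t).eval A σ v = leastIn n {y | y ∈ S ∧ (x : ℕ) ≤ y} := by
  refine (Expr.eval_query_of (x := fun _ => z) (a := fun _ => x) (allSome_of_forall fun _ => hz)
    (allSome_of_forall fun _ => ht)).trans ?_
  refine (congrArg (Val.fromBlock (c := 1) (n := n) 0)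
    (hS.query succProgram_maintains () fun _ => inBlock (0 : Fin 1) x)).trans ?_
  refine fromBlock_leastIn.trans ?_
  simp

theorem eval_set_none {b r : Bool} (h : zt.eval A σ v = none ∨ t.eval A σ v = none) :
    (setTerm b r zt t).eval A σ v = none := by
  rcases h with h | h
  · simp only [setTerm, Expr.eval, allSome_eq_none (f := fun _ : Fin 1 => zt.eval A σ v) 0 h]
    rfl
  · simp only [setTerm, Expr.eval, allSome_eq_none (f := fun _ : Fin 1 => t.eval A σ v) 0 h]
    split
    · contradiction
    · rfl

theorem eval_mem {b r : Bool} {S : Set ℕ}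
    (hS : Reps succProgram SuccSet (n := 1 * n) (σ.sup (.set b r) fun _ => z) S)
    (hz : zt.eval A σ v = some z) (ht : t.eval A σ v = some x) :
    (memCond b r zt t).eval A σ v ↔ (x : ℕ) ∈ S := by
  rw [memCond, Expr.eval_eq_iff, eval_set hS hz ht, ht]
  constructor
  · rintro ⟨a, h1, h2⟩
    cases h2
    exact (leastIn_eq_some.1 h1).1.1
  · intro hx
    exact ⟨x, leastIn_eq_some.2 ⟨⟨hx, le_rfl⟩, fun y hy => hy.2⟩, rfl⟩

theorem not_eval_mem {b r : Bool} (h : zt.eval A σ v = none ∨ t.eval A σ v = none) :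
    ¬ (memCond b r zt t).eval A σ v := by
  rw [memCond, Expr.eval_eq_iff, eval_set_none h]
  rintro ⟨a, h1, -⟩
  cases h1

theorem eval_eqCond (hP : P.Maintains (StringEquality (Fin k)))
    {u : Word (Fin k) (1 * n) × Word (Fin k) (1 * n)}
    (hu : Reps P (StringEquality (Fin k)) (n := 1 * n) (σ.sup .eq fun _ => z) u)
    (hz : zt.eval A σ v = some z) : (eqCond zt).eval A σ v ↔ u.1.str = u.2.str := by
  refine iff_of_eq ?_
  refine (Expr.eval_query_of (E := dyckEnv k) (i := .eq) (Q := ()) (x := fun _ => z)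
    (a := Fin.elim0) (allSome_of_forall fun _ => hz)
    (allSome_of_forall fun j : Fin 0 => j.elim0)).trans ?_
  exact hu.query hP () _

end eval

/-! ### The positions at which the sets of unmatched parentheses change -/

theorem merge_const {α β : Type} {old : α} {active : β → Prop} {new : β → α}
    (h : ∀ b, new b = old) : merge old active new = old := by
  unfold merge
  rw [theUnique_eq_none.2]
  · rfl
  · rintro ⟨y, ⟨hy, b, -, rfl⟩, -⟩
    exact hy (h b)

section find

variable {k : ℕ}

theorem branch_guard {E : Env} {L : Schema} (j : Fin 2) (hj : 1 ≤ (j : ℕ)) :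
    ∃ a : Fin 1, (fun _ : Fin 1 => (Expr.var 1 : Expr E L .term 2)) a = Expr.var j :=
  ⟨0, congrArg Expr.var (Fin.ext (by show 1 = (j : ℕ); omega))⟩

/-- A parallel assignment to a unary local function. -/
def assignAll (s : Bool) (e : Expr (dyckEnv k) dyckLoc .term 2) :
    Stmt (dyckEnv k) dyckLoc 1 .initial 1 :=
  .fordo logBound (.assign (L := dyckLoc) s (fun _ => .var 1) e branch_guard)

/-- In the mirrored direction the interval begins at the reflection of its last position, and the
last position is the reflection of the base within the interval. -/
def firstTerm : Bool → Expr (dyckEnv k) dyckLoc .term 2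
  | false => baseTerm (.var 1) (.var 0)
  | true => flipTerm true (revTerm (.var 1) (baseTerm (.var 1) (.var 0)))

def leftTerm (r : Bool) : Expr (dyckEnv k) dyckLoc .term 2 :=
  .ite (.and (.le (setTerm true r (.var 1) (firstTerm r)) (flipTerm r (.var 0)))
      (.eq (baseTerm (.var 1) (flipTerm r (setTerm true r (.var 1) (flipTerm r (.var 0)))))
        (baseTerm (.var 1) (.var 0))))
    (setTerm true r (.var 1) (firstTerm r)) .undef

/-- The largest level with a left end of an outermost pair. -/
def pairLevel : Expr (dyckEnv k) dyckLoc .term 2 :=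
  .unique logBound (.and (.le (.var 2) (.var 1))
    (.and (.eq (localTerm false (.var 2)) (localTerm false (.var 2)))
      (.not (.exist logBound (.and (.le (.var 3) (.var 1)) (.and (.not (.le (.var 3) (.var 2)))
        (.eq (localTerm false (.var 3)) (localTerm false (.var 3)))))))))

/-- The found position is tested for lying in the interval of the parameter and for being a closing
parenthesis in the chosen direction; read backwards, these are the opening ones, hence `!r`. -/
def nextCloseCond (r : Bool) : Expr (dyckEnv k) dyckLoc .cond 2 :=
  .and (.eq (baseTerm (.var 1) (flipTerm r (setTerm false r (.var 1) (flipTerm r (.var 0)))))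
      (baseTerm (.var 1) (.var 0)))
    (sgnCond (!r) (flipTerm r (setTerm false r (.var 1) (flipTerm r (.var 0)))))

/-- The cases follow `IsToggle`. All positions inside are relative to the chosen direction, and the
outer `flipTerm` translates the result back. -/
def toggleTerm (r : Bool) : Expr (dyckEnv k) dyckLoc .term 2 :=
  flipTerm r (.ite (nextCloseCond r) (setTerm false r (.var 1) (flipTerm r (.var 0)))
    (.ite (.eq (localTerm false pairLevel) (localTerm false pairLevel))
      (localTerm false pairLevel) (flipTerm r (.var 0))))

/-- Two rounds are necessary: the changed position at a level depends on the left ends found at all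
lower levels, and parallel branches do not see each other's results. -/
def findToggles (r : Bool) : Stmt (dyckEnv k) dyckLoc 1 .initial 1 :=
  .seq (assignAll false (leftTerm r)) (assignAll true (toggleTerm r))

variable {n : ℕ} {P : Program (stringEqualitySig (Fin k))} {A : Str (dyckEnv k).aux n}
  {w : Word (Paren k) n} {σ : DyckStore P dyckLoc n}

theorem snoc_one_eq (v : Fin 1 → Fin n) (z : Fin n) : (Fin.snoc v z : Fin 2 → Fin n) = ![v 0, z] :=
  snoc_one v z

theorem assignAll_sup (s : Bool) (e : Expr (dyckEnv k) dyckLoc .term 2) (v : Fin 1 → Fin n) :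
    ((assignAll s e).exec A v σ).sup = σ.sup := by
  funext i x
  exact merge_const fun z => congrFun (congrFun Stmt.exec_assign_sup i) x

theorem assignAll_loc {s : Bool} (e : Expr (dyckEnv k) dyckLoc .term 2)
    (v : Fin 1 → Fin n) (z : Fin n) (hz : (z : ℕ) ≤ logBound.fn n) :
    (((assignAll s e).exec A v σ).loc s fun _ => z) = e.eval A σ ![v 0, z] := by
  refine (merge_of_owner z fun b hb => ?_).trans ((choice_true hz _ _).trans ?_)
  · refine Stmt.exec_assign_loc_of_ne (allSome_of_forall (a := fun _ => b) fun j => ?_) fun h => hb ?_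
    · rw [snoc_one_eq]
      rfl
    · exact (congrFun h 0).symm
  · refine (Stmt.exec_assign_loc_self (allSome_of_forall (a := fun _ => z) fun j => ?_)).trans ?_
    · rw [snoc_one_eq]
      rfl
    · rw [snoc_one_eq]

/-- The first position of the interval of `x`, in one of the two directions. -/
def firstPos (n z x : ℕ) : Bool → ℕ
  | false => dyadicBase z x
  | true => n - 1 - dyadicLast n z x

theorem firstPos_le_iff {z : ℕ} (r : Bool) (p x : Fin n) (hx : x ≤ worldPos r p) :
    firstPos n z p r ≤ x ↔ worldLevels n dyadicLevels r z x (worldPos r p : Fin n) := by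
  have h1 : worldLevels n dyadicLevels r z x (worldPos r p : Fin n) ↔
      dyadicBase z (worldPos r x) = dyadicBase z p := by
    rw [← dyadicLevels_natCast, ← worldLevels_iff (E := dyadicLevels) r, worldPos_worldPos]
  rw [h1]
  have hb := dyadicBase_le z p
  have hl := lt_dyadicBase_add z p
  cases r
  · have hx' : (x : ℕ) ≤ p := hx
    refine ⟨fun h => dyadicBase_eq_of_le h (by simp only [worldPos]; omega), fun h => ?_⟩
    show dyadicBase z p ≤ x
    rw [← h]
    exact dyadicBase_le _ _
  · have hx' : (x : ℕ) ≤ n - (p + 1) := by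
      have := Fin.le_def.1 hx
      rwa [worldPos, Fin.val_rev] at this
    have h2 := dyadicLast_lt (z := z) p.isLt
    have h3 := dyadicLast_lt_add n z p
    have h4 := x.isLt
    have h5 := p.isLt
    simp only [worldPos, firstPos, Fin.val_rev]
    refine ⟨fun h => dyadicBase_eq_of_le (by omega) (by omega), fun h => ?_⟩
    have h6 := le_dyadicLast (n := n) (z := z) (x := n - (x + 1)) (by omega)
    rw [dyadicLast_congr h] at h6
    omega

theorem DyckAux.eval_first (hA : DyckAux A w) (r : Bool) (v : Fin 2 → Fin n) :
    ∃ q : Fin n, (firstTerm r).eval A σ v = some q ∧ (q : ℕ) = firstPos n (v 1) (v 0) r := by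
  have h0 : (Expr.var 0 : Expr (dyckEnv k) dyckLoc .term 2).eval A σ v = some (v 0) := rfl
  have h1 : (Expr.var 1 : Expr (dyckEnv k) dyckLoc .term 2).eval A σ v = some (v 1) := rfl
  have h2 := hA.eval_base h1 h0
  cases r
  · exact ⟨_, h2, rfl⟩
  · refine ⟨_, hA.eval_flip true (hA.eval_rev h1 h2), ?_⟩
    simp only [worldPos, firstPos, Fin.val_rev, slot]
    have h3 : dyadicRev n (v 1) (dyadicBase (v 1) (v 0)) = dyadicLast n (v 1) (v 0) := by
      have h4 := dyadicBase_dyadicBase (v 1) (v 0)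
      rw [dyadicRev, h4, dyadicLast_congr h4]
      omega
    rw [h3]
    omega

theorem DyckAux.eval_sameNode (hA : DyckAux A w) (r : Bool) (v : Fin 2 → Fin n)
    {t : Expr (dyckEnv k) dyckLoc .term 2} :
    (Expr.eq (baseTerm (.var 1) (flipTerm r t)) (baseTerm (.var 1) (.var 0))).eval A σ v ↔
      ∃ y, t.eval A σ v = some y ∧
        worldLevels n dyadicLevels r (v 1) y (worldPos r (v 0) : Fin n) := by
  have h0 : (Expr.var 0 : Expr (dyckEnv k) dyckLoc .term 2).eval A σ v = some (v 0) := rfl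
  have h1 : (Expr.var 1 : Expr (dyckEnv k) dyckLoc .term 2).eval A σ v = some (v 1) := rfl
  cases h : t.eval A σ v with
  | none =>
    refine iff_of_false ?_ (by simp)
    rw [Expr.eval_eq_iff, eval_base_none (eval_flip_none r h)]
    rintro ⟨a, ha, -⟩
    cases ha
  | some y =>
    have h2 := Expr.eval_eq_of (hA.eval_base h1 (hA.eval_flip r h)) (hA.eval_base h1 h0)
    rw [h2, Fin.mk.injEq, ← dyadicLevels_natCast, ← worldLevels_iff (E := dyadicLevels) r, worldPos_worldPos]
    simp

theorem DyckAux.eval_left (hA : DyckAux A w) (r : Bool) (v : Fin 2 → Fin n)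
    (hG : HasInput P σ.sup (v 1) (levelInput w (v 1))) :
    (leftTerm r).eval A σ v = leftEnd n (worldHeight n (height w.letter) r)
      (worldLevels n dyadicLevels r) (worldPos r (v 0)) (v 1) (firstPos n (v 1) (v 0) r) := by
  have h0 : (Expr.var 0 : Expr (dyckEnv k) dyckLoc .term 2).eval A σ v = some (v 0) := rfl
  have h1 : (Expr.var 1 : Expr (dyckEnv k) dyckLoc .term 2).eval A σ v = some (v 1) := rfl
  obtain ⟨q, hq, hq'⟩ := hA.eval_first (σ := σ) r v
  have hX := eval_set (hG (.set true r)) h1 hq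
  have hp := hA.eval_flip r h0
  have hY := eval_set (hG (.set true r)) h1 hp
  rw [hq'] at hX
  have hcond : (Expr.and (.le (setTerm true r (.var 1) (firstTerm r)) (flipTerm r (.var 0)))
      (.eq (baseTerm (.var 1) (flipTerm r (setTerm true r (.var 1) (flipTerm r (.var 0)))))
        (baseTerm (.var 1) (.var 0)))).eval A σ v = (_ ∧ _) := rfl
  unfold leftTerm leftEnd
  rw [Expr.eval, hcond, hX]
  congr 1
  refine propext (and_congr ?_ ?_)
  · constructor
    · rintro ⟨x, y, hx, hy, hxy⟩
      rw [hp] at hy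
      cases hy
      exact ⟨x, hX.symm.trans hx, hxy⟩
    · rintro ⟨x, hx, hxp⟩
      exact ⟨x, _, hX.trans hx, hp, hxp⟩
  · rw [hA.eval_sameNode, hY]
    rfl

theorem Word.exists_of_letter {A : Type} {n : ℕ} {w : Word A n} {x : ℕ} {a : A}
    (h : w.letter x = some a) : ∃ y : Fin n, x = y := by
  unfold Word.letter at h
  split_ifs at h with hx
  exact ⟨⟨x, hx⟩, rfl⟩

theorem inDomain_word (w : Word (Paren k) n) : InDomain n (height w.letter) dyadicLevels := by
  intro z i hi
  have hne : height w.letter (i + 1) ≠ height w.letter i := by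
    rcases hi with hi | hi <;> have := hi.1 <;> omega
  obtain ⟨x, rfl⟩ := exists_natCast_of_height_ne hne
  rw [height_succ] at hne
  obtain ⟨a, ha⟩ := Option.ne_none_iff_exists'.1
    (fun h : w.letter x = none => hne (by rw [h]; simp [step]))
  obtain ⟨y, rfl⟩ := Word.exists_of_letter ha
  exact ⟨y, rfl⟩

/-- Closing parentheses, read in one of the two directions. -/
theorem worldHeight_close_iff (r : Bool) (c : Fin n) :
    worldHeight n (height w.letter) r c = worldHeight n (height w.letter) r (c + 1) + 1 ↔
      ∃ a, w (worldPos r c) = some a ∧ a.isCl = !r := by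
  have hs : ∀ x : Fin n, height w.letter (x + 1) = height w.letter x + step (w x) := fun x => by
    rw [height_succ, Word.letter_val]
  cases r
  · simp only [worldHeight, worldPos]
    rw [hs]
    rcases w c with _ | ⟨_ | _⟩ <;> simp [step, Paren.isCl]
    omega
  · have h1 : (n : ℤ) - (c + 1) = (c.rev : ℕ) := by rw [cast_rev]; ring
    have h2 : (n : ℤ) - c = (c.rev : ℕ) + 1 := by rw [cast_rev]; ring
    simp only [worldHeight, worldPos, mirror]
    rw [h1, h2, hs]
    rcases w c.rev with _ | ⟨_ | _⟩ <;> simp [step, Paren.isCl]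

theorem DyckAux.eval_nextClose (hA : DyckAux A w) (r : Bool) (v : Fin 2 → Fin n)
    (hG : HasInput P σ.sup (v 1) (levelInput w (v 1))) :
    ((nextCloseCond r).eval A σ v ↔ ∃ c, (setTerm false r (.var 1) (flipTerm r (.var 0)) :
        Expr (dyckEnv k) dyckLoc .term 2).eval A σ v = some c ∧
      NextClose (worldHeight n (height w.letter) r) (worldLevels n dyadicLevels r)
        (worldPos r (v 0)) (v 1) c) ∧
    ∀ c, NextClose (worldHeight n (height w.letter) r) (worldLevels n dyadicLevels r)
        (worldPos r (v 0)) (v 1) c → (nextCloseCond r).eval A σ v := by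
  have h0 : (Expr.var 0 : Expr (dyckEnv k) dyckLoc .term 2).eval A σ v = some (v 0) := rfl
  have h1 : (Expr.var 1 : Expr (dyckEnv k) dyckLoc .term 2).eval A σ v = some (v 1) := rfl
  have hX := eval_set (hG (.set false r)) h1 (hA.eval_flip r h0)
  have key : ∀ c, NextClose (worldHeight n (height w.letter) r) (worldLevels n dyadicLevels r)
      (worldPos r (v 0)) (v 1) c → (nextCloseCond r).eval A σ v := by
    rintro c ⟨g1, g2, g3⟩
    have hXc := hX.trans g1
    refine ⟨(hA.eval_sameNode r v).2 ⟨c, hXc, g2⟩, ?_⟩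
    exact (hA.eval_sgn (!r) (hA.eval_flip r hXc)).2 ((worldHeight_close_iff r c).1 g3)
  refine ⟨⟨?_, fun ⟨c, _, hc⟩ => key c hc⟩, key⟩
  rintro ⟨g1, g2⟩
  obtain ⟨c, hc, g3⟩ := (hA.eval_sameNode r v).1 g1
  have g4 := (worldHeight_close_iff r c).2 ((hA.eval_sgn (!r) (hA.eval_flip r hc)).1 g2)
  exact ⟨c, hc, hX.symm.trans hc, g3, g4⟩

theorem eval_local {s : Bool} {m : ℕ} {v : Fin m → Fin n} {z : Fin n}
    {t : Expr (dyckEnv k) dyckLoc .term m} (h : t.eval A σ v = some z) :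
    (localTerm s t).eval A σ v = σ.loc s fun _ => z := by
  simp only [localTerm, Expr.eval, allSome_of_forall (f := fun _ : Fin 1 => t.eval A σ v)
    (a := fun _ => z) fun _ => h]

theorem eval_local_none {s : Bool} {m : ℕ} {v : Fin m → Fin n}
    {t : Expr (dyckEnv k) dyckLoc .term m} (h : t.eval A σ v = none) :
    (localTerm s t).eval A σ v = none := by
  simp only [localTerm, Expr.eval, allSome_eq_none (f := fun _ : Fin 1 => t.eval A σ v) 0 h]
  rfl

theorem eval_pairLevel (v : Fin 2 → Fin n) : pairLevel.eval A σ v = theUnique fun z : Fin n =>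
    (z : ℕ) ≤ logBound.fn n ∧ z ≤ v 1 ∧ (∃ d : Fin n, (σ.loc false fun _ => z) = some d) ∧
      ¬ ∃ z' : Fin n, (z' : ℕ) ≤ logBound.fn n ∧ z' ≤ v 1 ∧ ¬ z' ≤ z ∧
        ∃ d : Fin n, (σ.loc false fun _ => z') = some d := by
  have hdef : ∀ {m : ℕ} {u : Fin m → Fin n} {t : Expr (dyckEnv k) dyckLoc .term m} {z : Fin n},
      t.eval A σ u = some z → ((Expr.eq (localTerm false t) (localTerm false t)).eval A σ u ↔
        ∃ d : Fin n, (σ.loc false fun _ => z) = some d) := fun h => by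
    rw [Expr.eval_eq_self, eval_local h]
  refine theUnique_congr fun z => and_congr_right fun _ => and_congr ?_ (and_congr ?_
    (not_congr (exists_congr fun z' => and_congr_right fun _ => and_congr ?_ (and_congr ?_ ?_))))
  · rw [snoc_two]
    exact Expr.eval_le_of rfl rfl
  · rw [snoc_two]
    exact hdef rfl
  · rw [snoc_two, snoc_three]
    exact Expr.eval_le_of rfl rfl
  · rw [snoc_two, snoc_three]
    exact not_congr (Expr.eval_le_of rfl rfl)
  · rw [snoc_two, snoc_three]
    exact hdef rfl

theorem DyckAux.eval_toggle (hA : DyckAux A w) (r : Bool) (v : Fin 2 → Fin n)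
    (hz : (v 1 : ℕ) ≤ logBound.fn n) (hG : HasInput P σ.sup (v 1) (levelInput w (v 1)))
    (hloc : ∀ z : Fin n, (z : ℕ) ≤ logBound.fn n → (σ.loc false fun _ => z) =
      leftEnd n (worldHeight n (height w.letter) r) (worldLevels n dyadicLevels r)
        (worldPos r (v 0)) z (firstPos n z (v 0) r)) :
    ∃ d : Fin n, (toggleTerm r).eval A σ v = some (worldPos r d) ∧
      IsToggle (worldHeight n (height w.letter) r) (worldLevels n dyadicLevels r) (v 1)
        (worldPos r (v 0) : Fin n) d := by
  have h0 : (Expr.var 0 : Expr (dyckEnv k) dyckLoc .term 2).eval A σ v = some (v 0) := rfl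
  obtain ⟨hC, hC'⟩ := hA.eval_nextClose r v hG
  have hto : ∀ d : Fin n, _ → IsToggle (worldHeight n (height w.letter) r)
      (worldLevels n dyadicLevels r) (v 1) (worldPos r (v 0) : Fin n) d := fun d =>
    isToggle_of (firsts := fun z => firstPos n z (v 0) r) (levels_dyadic.world r)
      ((inDomain_word w).world r) (fun z' _ x hx => firstPos_le_iff r _ x hx)
  have hlev : ∀ z' : ℕ, z' ≤ v 1 → ∃ z : Fin n, z' = z ∧ (z : ℕ) ≤ logBound.fn n := fun z' h =>
    ⟨⟨z', h.trans_lt (v 1).isLt⟩, rfl, h.trans hz⟩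
  by_cases hc : (nextCloseCond r).eval A σ v
  · obtain ⟨c, hXc, hc'⟩ := hC.1 hc
    refine ⟨c, hA.eval_flip r ((Expr.eval_ite_of_true hc).trans hXc), hto c (Or.inl hc')⟩
  · have hno : ∀ c, ¬ NextClose (worldHeight n (height w.letter) r)
        (worldLevels n dyadicLevels r) (worldPos r (v 0)) (v 1) c := fun c h => hc (hC' c h)
    by_cases hpl : ∃ z, pairLevel.eval A σ v = some z
    · obtain ⟨z, hpl⟩ := hpl
      have hz' := hpl
      rw [eval_pairLevel, theUnique_eq_some] at hz'
      obtain ⟨⟨g1, g2, ⟨d, g3⟩, g4⟩, -⟩ := hz'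
      have h2 := (eval_local (s := false) hpl).trans g3
      refine ⟨d, hA.eval_flip r ((Expr.eval_ite_of_false hc).trans
        ((Expr.eval_ite_of_true (Expr.eval_eq_self.2 ⟨d, h2⟩)).trans h2)), hto d (Or.inr ⟨hno,
          Or.inl ⟨z, g2, (hloc z g1).symm.trans g3, fun z'' hz'' hlt => ?_⟩⟩)⟩
      obtain ⟨z'', rfl, g5⟩ := hlev z'' hz''
      refine Option.eq_none_iff_forall_ne_some.2 fun e he => g4 ⟨z'', g5, hz'', ?_, e,
        (hloc z'' g5).trans he⟩
      exact fun h => absurd (Fin.le_def.1 h) (by omega)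
    · have hpn : pairLevel.eval A σ v = none :=
        Option.eq_none_iff_forall_ne_some.2 fun z h => hpl ⟨z, h⟩
      have h2 := eval_local_none (s := false) hpn
      refine ⟨worldPos r (v 0), hA.eval_flip r ((Expr.eval_ite_of_false hc).trans
        ((Expr.eval_ite_of_false ?_).trans (hA.eval_flip r h0))), hto _ (Or.inr ⟨hno, Or.inr
          ⟨fun z' hz' => ?_, rfl⟩⟩)⟩
      · rintro ⟨a, ha, -⟩
        rw [h2] at ha
        cases ha
      -- The set of levels up to the current one that have a left end is finite; if it were
      -- nonempty, its maximum would be the value of `pairLevel`.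
      · by_contra hne
        have hex : ({z : Fin n | (z : ℕ) ≤ logBound.fn n ∧ z ≤ v 1 ∧
            ∃ d : Fin n, (σ.loc false fun _ => z) = some d}).Nonempty := by
          obtain ⟨z', rfl, g5⟩ := hlev z' hz'
          obtain ⟨d, hd⟩ := Option.ne_none_iff_exists'.1 hne
          exact ⟨z', g5, hz', d, (hloc z' g5).trans hd⟩
        obtain ⟨z, hz1, hz2⟩ := (Set.toFinite _).exists_maximal hex
        have : pairLevel.eval A σ v = some z := by
          rw [eval_pairLevel, theUnique_eq_some]
          refine ⟨⟨hz1.1, hz1.2.1, hz1.2.2, ?_⟩, ?_⟩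
          · rintro ⟨y, y1, y2, y3, y4⟩
            exact y3 (((le_total y z).elim id) fun h => hz2 ⟨y1, y2, y4⟩ h)
          · rintro y ⟨y1, y2, y3, y4⟩
            have hyz : y ≤ z := ((le_total y z).elim id) fun h => hz2 ⟨y1, y2, y3⟩ h
            refine le_antisymm hyz ?_
            by_contra hzy
            exact y4 ⟨z, hz1.1, hz1.2.1, hzy, hz1.2.2⟩
        rw [hpn] at this
        cases this

theorem findToggles_spec (hA : DyckAux A w) (r : Bool) (v : Fin 1 → Fin n)
    (hG : ∀ z : Fin n, (z : ℕ) ≤ logBound.fn n → HasInput P σ.sup z (levelInput w z)) :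
    ((findToggles r).exec A v σ).sup = σ.sup ∧
      ∀ z : Fin n, (z : ℕ) ≤ logBound.fn n → ∃ d : Fin n,
        (((findToggles r).exec A v σ).loc true fun _ => z) = some (worldPos r d) ∧
        IsToggle (worldHeight n (height w.letter) r) (worldLevels n dyadicLevels r) z
          (worldPos r (v 0) : Fin n) d := by
  refine ⟨(assignAll_sup _ _ _).trans (assignAll_sup _ _ _), fun z hz => ?_⟩
  have h1 := assignAll_loc (A := A) (σ := (assignAll false (leftTerm r)).exec A v σ) (s := true)
    (toggleTerm r) v z hz
  have h2 : HasInput P ((assignAll false (leftTerm r)).exec A v σ).sup z (levelInput w z) := by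
    rw [assignAll_sup]
    exact hG z hz
  obtain ⟨d, hd, hd'⟩ := hA.eval_toggle r ![v 0, z] hz h2 fun z' hz' => by
    refine (assignAll_loc (leftTerm r) v z' hz').trans ?_
    exact hA.eval_left r ![v 0, z'] (hG z' hz')
  exact ⟨d, h1.trans hd, hd'⟩

end find

/-! ### Changes of the supplementary instances -/

section changes

variable {k : ℕ}

def setChange (b r : Bool) (op : SetOp) (t : Expr (dyckEnv k) dyckLoc .term 2) :
    Stmt (dyckEnv k) dyckLoc 1 .initial 2 :=
  .invoke (E := dyckEnv k) rfl (.set b r) (fun _ => .var 1) op (fun _ => (0 : Fin 1))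
    (fun _ => t) branch_guard

def eqChange (op : Bool × LetterOp (Fin k)) (t : Expr (dyckEnv k) dyckLoc .term 2) :
    Stmt (dyckEnv k) dyckLoc 1 .initial 2 :=
  .invoke (E := dyckEnv k) rfl .eq (fun _ => .var 1) op (fun _ => (0 : Fin 1))
    (fun _ => t) branch_guard

/-- The instructions of the branch of level `z` only change the instances of level `z`. -/
def Confined (s : Stmt (dyckEnv k) dyckLoc 1 .initial 2) : Prop :=
  ∀ {n : ℕ} {P : Program (stringEqualitySig (Fin k))} (A : Str (dyckEnv k).aux n)
    (v : Fin 2 → Fin n) (σ : DyckStore P dyckLoc n),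
    (s.exec A v σ).loc = σ.loc ∧
      ∀ (i : DyckSup) (y : Fin 1 → Fin n), y ≠ (fun _ => v 1) → (s.exec A v σ).sup i y = σ.sup i y

theorem Confined.skip : Confined (k := k) .skip := fun _ _ _ => ⟨rfl, fun _ _ _ => rfl⟩

theorem Confined.seq {s s' : Stmt (dyckEnv k) dyckLoc 1 .initial 2} (h : Confined s)
    (h' : Confined s') : Confined (.seq s s') := fun A v σ =>
  ⟨(h' A v _).1.trans (h A v σ).1,
    fun i y hy => ((h' A v _).2 i y hy).trans ((h A v σ).2 i y hy)⟩

theorem Confined.ite {C : Expr (dyckEnv k) dyckLoc .cond 2}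
    {s s' : Stmt (dyckEnv k) dyckLoc 1 .initial 2} (h : Confined s) (h' : Confined s') :
    Confined (.ite C s s') := fun A v σ => by
  by_cases hC : C.eval A σ v
  · rw [Stmt.exec, choice_true hC]
    exact h A v σ
  · rw [Stmt.exec, choice_false hC]
    exact h' A v σ

theorem confined_setChange (b r : Bool) (op : SetOp) (t : Expr (dyckEnv k) dyckLoc .term 2) :
    Confined (setChange b r op t) := fun A v σ => by
  refine ⟨Stmt.exec_invoke_loc, fun i y hy => ?_⟩
  by_cases hi : i = .set b r
  · subst hi
    exact Stmt.exec_invoke_sup_of_idx_ne (x := fun _ => v 1) (allSome_of_forall fun _ => rfl) hy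
  · exact congrFun (Stmt.exec_invoke_sup_of_ne (E := dyckEnv k) hi) y

theorem confined_eqChange (op : Bool × LetterOp (Fin k)) (t : Expr (dyckEnv k) dyckLoc .term 2) :
    Confined (eqChange op t) := fun A v σ => by
  refine ⟨Stmt.exec_invoke_loc, fun i y hy => ?_⟩
  by_cases hi : i = .eq
  · subst hi
    exact Stmt.exec_invoke_sup_of_idx_ne (x := fun _ => v 1) (allSome_of_forall fun _ => rfl) hy
  · exact congrFun (Stmt.exec_invoke_sup_of_ne (E := dyckEnv k) hi) y

variable {n : ℕ} {P : Program (stringEqualitySig (Fin k))} {A : Str (dyckEnv k).aux n}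
  {w w' : Word (Paren k) n} {σ : DyckStore P dyckLoc n} {v : Fin 2 → Fin n}
  {t : Expr (dyckEnv k) dyckLoc .term 2} {c : Fin n} {G : LevelInput k n}

open scoped Classical in
theorem HasInput.setChange (hG : HasInput P σ.sup (v 1) G) (b r : Bool) (op : SetOp)
    (ht : t.eval A σ v = some c) :
    HasInput P ((setChange b r op t).exec A v σ).sup (v 1) (Function.update G (.set b r)
      ((SuccSet (1 * n)).change op (fun _ => inBlock (0 : Fin 1) c) (G (.set b r)))) := by
  intro i
  by_cases hi : i = .set b r
  · subst hi
    rw [Function.update_self]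
    have h1 := (hG (.set b r)).change op fun _ => inBlock (0 : Fin 1) c
    refine Eq.mpr (congrArg (fun s => Reps succProgram SuccSet (n := 1 * n) s _) ?_) h1
    exact Stmt.exec_invoke_sup_self (E := dyckEnv k) (i := .set b r) (x := fun _ => v 1)
      (a := fun _ => c) (allSome_of_forall fun _ => rfl) (allSome_of_forall fun _ => ht)
  · rw [Function.update_of_ne hi]
    refine Eq.mpr (congrArg (fun s => Reps (dyckSup P i) (dyckProblem k i) (n := 1 * n) s _) ?_)
      (hG i)
    exact congrFun (Stmt.exec_invoke_sup_of_ne (E := dyckEnv k) hi) _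

/-- The inputs of the instances for sets, and for the two words. -/
def setAt (G : LevelInput k n) (b r : Bool) : Set ℕ := G (.set b r)

def wordsAt (G : LevelInput k n) : Bool → Word (Fin k) (1 * n)
  | false => Prod.fst (α := Word (Fin k) (1 * n)) (β := Word (Fin k) (1 * n)) (G .eq)
  | true => Prod.snd (α := Word (Fin k) (1 * n)) (β := Word (Fin k) (1 * n)) (G .eq)

theorem LevelInput.ext {G G' : LevelInput k n} (h : ∀ b r, setAt G b r = setAt G' b r)
    (h' : ∀ s, wordsAt G s = wordsAt G' s) : G = G' := by
  funext i
  cases i with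
  | eq => exact Prod.ext (h' false) (h' true)
  | set b r => exact h b r

theorem HasInput.insert (hG : HasInput P σ.sup (v 1) G) (b r : Bool)
    (ht : t.eval A σ v = some c) :
    ∃ G' : LevelInput k n, HasInput P ((DynFO.setChange b r .ins t).exec A v σ).sup (v 1) G' ∧
      setAt G' b r = insert (c : ℕ) (setAt G b r) ∧ ∀ i, i ≠ .set b r → G' i = G i := by
  classical
  refine ⟨_, hG.setChange b r .ins ht, (Function.update_self _ _ _).trans ?_,
    fun i hi => Function.update_of_ne hi _ _⟩
  exact congrArg (fun y : ℕ => Insert.insert y (setAt G b r)) (by simp)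

theorem HasInput.delete (hG : HasInput P σ.sup (v 1) G) (b r : Bool)
    (ht : t.eval A σ v = some c) :
    ∃ G' : LevelInput k n, HasInput P ((DynFO.setChange b r .del t).exec A v σ).sup (v 1) G' ∧
      setAt G' b r = setAt G b r \ {(c : ℕ)} ∧ ∀ i, i ≠ .set b r → G' i = G i := by
  classical
  refine ⟨_, hG.setChange b r .del ht, (Function.update_self _ _ _).trans ?_,
    fun i hi => Function.update_of_ne hi _ _⟩
  exact congrArg (fun y => setAt G b r \ {y}) (by simp)

open scoped Classical in
theorem HasInput.eqChange (hG : HasInput P σ.sup (v 1) G) (op : Bool × LetterOp (Fin k))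
    (ht : t.eval A σ v = some c) :
    HasInput P ((eqChange op t).exec A v σ).sup (v 1) (Function.update G .eq
      ((StringEquality (Fin k) (1 * n)).change op (fun _ => inBlock (0 : Fin 1) c) (G .eq))) := by
  intro i
  by_cases hi : i = .eq
  · subst hi
    rw [Function.update_self]
    have h1 := (hG .eq).change op fun _ => inBlock (0 : Fin 1) c
    refine Eq.mpr (congrArg (fun s => Reps P (StringEquality (Fin k)) (n := 1 * n) s _) ?_) h1
    exact Stmt.exec_invoke_sup_self (E := dyckEnv k) (i := .eq) (x := fun _ => v 1)
      (a := fun _ => c) (allSome_of_forall fun _ => rfl) (allSome_of_forall fun _ => ht)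
  · rw [Function.update_of_ne hi]
    refine Eq.mpr (congrArg (fun s => Reps (dyckSup P i) (dyckProblem k i) (n := 1 * n) s _) ?_)
      (hG i)
    exact congrFun (Stmt.exec_invoke_sup_of_ne (E := dyckEnv k) hi) _

theorem setChange_of_none (b r : Bool) (op : SetOp) (ht : t.eval A σ v = none) :
    (setChange b r op t).exec A v σ = σ :=
  Stmt.exec_invoke_of_undef (E := dyckEnv k) (i := .set b r) (j := (0 : Fin 1)) ht

theorem eqChange_of_none (op : Bool × LetterOp (Fin k)) (ht : t.eval A σ v = none) :
    (eqChange op t).exec A v σ = σ :=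
  Stmt.exec_invoke_of_undef (E := dyckEnv k) (i := .eq) (j := (0 : Fin 1)) ht

/-- The parallel execution of a branch for each level. -/
def levelwise (s : Stmt (dyckEnv k) dyckLoc 1 .initial 2) : Stmt (dyckEnv k) dyckLoc 1 .initial 1 :=
  .fordo logBound s

theorem levelwise_loc {s : Stmt (dyckEnv k) dyckLoc 1 .initial 2} (hs : Confined s)
    (u : Fin 1 → Fin n) : ((levelwise s).exec A u σ).loc = σ.loc := by
  funext i a
  exact merge_const fun z => congrFun (congrFun (hs A (Fin.snoc u z) σ).1 i) a

/-- Only the branch of level `z` can change the instances with index `z`, so the loop acts on them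
like that branch alone. -/
theorem levelwise_sup {s : Stmt (dyckEnv k) dyckLoc 1 .initial 2} (hs : Confined s)
    (u : Fin 1 → Fin n) {z : Fin n} (hz : (z : ℕ) ≤ logBound.fn n) (i : DyckSup) :
    ((levelwise s).exec A u σ).sup i (fun _ => z) =
      (s.exec A ![u 0, z] σ).sup i fun _ => z := by
  refine (merge_of_owner z fun b hb => ?_).trans ((choice_true hz _ _).trans ?_)
  · refine (hs A (Fin.snoc u b) σ).2 i _ fun h => hb ?_
    have h1 := congrFun h 0
    rw [snoc_one_eq] at h1
    exact h1.symm
  · rw [snoc_one_eq]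

theorem HasInput.levelwise {s : Stmt (dyckEnv k) dyckLoc 1 .initial 2} (hs : Confined s)
    {u : Fin 1 → Fin n} {z : Fin n} (hz : (z : ℕ) ≤ logBound.fn n)
    (hG : HasInput P (s.exec A ![u 0, z] σ).sup z G) :
    HasInput P ((DynFO.levelwise s).exec A u σ).sup z G := fun i => by
  rw [levelwise_sup hs u hz]
  exact hG i

/-! ### Changes of the sets of unmatched parentheses -/

/-- If no position is recorded, then the membership test is false and the insertion of an undefined
element has no effect, so nothing happens. -/
def toggleSet (r : Bool) : Stmt (dyckEnv k) dyckLoc 1 .initial 2 :=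
  .ite (memCond false r (.var 1) (flipTerm r (localTerm true (.var 1))))
    (setChange false r .del (flipTerm r (localTerm true (.var 1))))
    (setChange false r .ins (flipTerm r (localTerm true (.var 1))))

def toggleSets : Stmt (dyckEnv k) dyckLoc 1 .initial 2 := .seq (toggleSet false) (toggleSet true)

theorem confined_toggleSet (r : Bool) : Confined (toggleSet (k := k) r) :=
  Confined.ite (confined_setChange _ _ _ _) (confined_setChange _ _ _ _)

theorem confined_toggleSets : Confined (toggleSets (k := k)) :=
  Confined.seq (confined_toggleSet _) (confined_toggleSet _)

/-- The position `o`, if any, is the one at which membership in `U` and `U'` differs. -/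
def TogglesAt {n : ℕ} (U U' : ℤ → Prop) (o : Option (Fin n)) : Prop :=
  ∀ x : Fin n, (U' x ↔ (o = some x ∧ ¬ U x) ∨ (o ≠ some x ∧ U x))

/-- The sets for the mirrored direction are the reflections of the others. Updates of both can thus
be verified in the original positions. -/
theorem mem_levelSet_iff (u : Word (Paren k) n) (z : ℕ) (b r : Bool) (y : ℕ) :
    y ∈ setAt (levelInput u z) b r ↔ ∃ x : Fin n, y = worldPos r x ∧
      (x : ℕ) ∈ levelSet (height u.letter) dyadicLevels z b := by
  have h1 : ∀ x : Fin n, ((worldPos r x : Fin n) : ℕ) ∈ setAt (levelInput u z) b r ↔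
      (x : ℕ) ∈ levelSet (height u.letter) dyadicLevels z b := by
    cases b
    · exact unm_world r
    · exact matchedAt_world r
  constructor
  · intro hy
    have h2 : ∃ x : Fin n, (y : ℤ) = x := by
      cases b
      · exact (inDomain_word u).world r _ _ hy
      · exact ((inDomain_word u).world r).matchedAt hy
    obtain ⟨x, hx⟩ := h2
    obtain rfl : y = x := by exact_mod_cast hx
    refine ⟨worldPos r x, by rw [worldPos_worldPos], ?_⟩
    rw [← h1, worldPos_worldPos]
    exact hy
  · rintro ⟨x, rfl, hx⟩
    exact (h1 x).2 hx

theorem worldPos_val_inj {r : Bool} {x y : Fin n} :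
    (worldPos r x : ℕ) = worldPos r y ↔ x = y := by
  refine ⟨fun h => ?_, fun h => h ▸ rfl⟩
  rw [← worldPos_worldPos r x, Fin.ext h, worldPos_worldPos]

theorem HasInput.toggleSet (hA : DyckAux A w) (r : Bool) (hG : HasInput P σ.sup (v 1) G)
    (hGr : setAt G false r = setAt (levelInput w (v 1)) false r)
    (ht : TogglesAt (Unm (height w.letter) dyadicLevels (v 1))
      (Unm (height w'.letter) dyadicLevels (v 1)) (σ.loc true fun _ => v 1)) :
    ∃ G' : LevelInput k n, HasInput P ((DynFO.toggleSet r).exec A v σ).sup (v 1) G' ∧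
      setAt G' false r = setAt (levelInput w' (v 1)) false r ∧
      ∀ i, i ≠ .set false r → G' i = G i := by
  have h1 : (Expr.var 1 : Expr (dyckEnv k) dyckLoc .term 2).eval A σ v = some (v 1) := rfl
  have hl := eval_local (s := true) h1
  have hm := fun (u : Word (Paren k) n) (y : ℕ) => mem_levelSet_iff u (v 1) false r y
  cases ho : (σ.loc true fun _ => v 1 : Option (Fin n)) with
  | none =>
    have hf : (flipTerm r (localTerm true (.var 1)) :
        Expr (dyckEnv k) dyckLoc .term 2).eval A σ v = none := eval_flip_none r (hl.trans ho)
    refine ⟨G, ?_, ?_, fun _ _ => rfl⟩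
    · rw [DynFO.toggleSet, Stmt.exec, choice_false (not_eval_mem (Or.inr hf)),
        setChange_of_none _ _ _ hf]
      exact hG
    · rw [hGr]
      ext y
      rw [hm, hm]
      refine exists_congr fun x => and_congr_right fun _ => ?_
      refine Iff.symm ((ht x).trans ?_)
      rw [ho]
      simp only [reduceCtorEq, false_and, ne_eq, not_false_eq_true, true_and, false_or]
      exact Iff.rfl
  | some d =>
    have hf : (flipTerm r (localTerm true (.var 1)) :
        Expr (dyckEnv k) dyckLoc .term 2).eval A σ v = some (worldPos r d) :=
      hA.eval_flip r (hl.trans ho)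
    have hcond := eval_mem (hG (.set false r)) h1 hf
    have hU : ((worldPos r d : Fin n) : ℕ) ∈ setAt G false r ↔
        Unm (height w.letter) dyadicLevels (v 1) d := hGr ▸ unm_world r d
    rw [ho] at ht
    by_cases hc : Unm (height w.letter) dyadicLevels (v 1) d
    · obtain ⟨G', g1, g2, g3⟩ := hG.delete false r hf
      refine ⟨G', ?_, ?_, g3⟩
      · rw [DynFO.toggleSet, Stmt.exec, choice_true (hcond.2 (hU.2 hc))]
        exact g1
      · rw [g2, hGr]
        ext y
        rw [hm]
        constructor
        · rintro ⟨hy, hne⟩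
          obtain ⟨x, rfl, hx⟩ := (hm w _).1 hy
          refine ⟨x, rfl, (ht x).2 (Or.inr ⟨fun h => hne ?_, hx⟩)⟩
          rw [Option.some.inj h]
          rfl
        · rintro ⟨x, rfl, hx⟩
          rcases (ht x).1 hx with h3 | h3
          · rw [← Option.some.inj h3.1] at h3
            exact absurd hc h3.2
          · refine ⟨(hm w _).2 ⟨x, rfl, h3.2⟩, fun h => h3.1 ?_⟩
            rw [worldPos_val_inj.1 h]
    · obtain ⟨G', g1, g2, g3⟩ := hG.insert false r hf
      refine ⟨G', ?_, ?_, g3⟩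
      · rw [DynFO.toggleSet, Stmt.exec, choice_false (fun h => hc (hU.1 (hcond.1 h)))]
        exact g1
      · rw [g2, hGr]
        ext y
        rw [hm]
        constructor
        · rintro (rfl | hy)
          · exact ⟨d, rfl, (ht d).2 (Or.inl ⟨rfl, hc⟩)⟩
          · obtain ⟨x, rfl, hx⟩ := (hm w _).1 hy
            refine ⟨x, rfl, (ht x).2 (Or.inr ⟨fun h => hc ?_, hx⟩)⟩
            rw [Option.some.inj h]
            exact hx
        · rintro ⟨x, rfl, hx⟩
          rcases (ht x).1 hx with h3 | h3
          · exact Or.inl (by rw [Option.some.inj h3.1])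
          · exact Or.inr ((hm w _).2 ⟨x, rfl, h3.2⟩)

/-- The inputs of a level after the changes of the sets of unmatched parentheses. -/
def midInput (w w' : Word (Paren k) n) (z : ℕ) : LevelInput k n
  | .eq => levelInput w z .eq
  | .set false r => levelInput w' z (.set false r)
  | .set true r => levelInput w z (.set true r)

theorem HasInput.toggleSets (hA : DyckAux A w) (hG : HasInput P σ.sup (v 1) (levelInput w (v 1)))
    (ht : TogglesAt (Unm (height w.letter) dyadicLevels (v 1))
      (Unm (height w'.letter) dyadicLevels (v 1)) (σ.loc true fun _ => v 1)) :
    HasInput P (DynFO.toggleSets.exec A v σ).sup (v 1) (midInput w w' (v 1)) := by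
  obtain ⟨G, h1, h2, h3⟩ := hG.toggleSet hA false rfl ht
  have hloc := (confined_toggleSet (k := k) false A v σ).1
  obtain ⟨G', g1, g2, g3⟩ := h1.toggleSet (w' := w') hA true (h3 _ (by simp)) (by rw [hloc]; exact ht)
  have hGG : G' = midInput w w' (v 1) := by
    funext i
    rcases i with _ | ⟨_ | _, _ | _⟩
    · rw [g3 _ (by simp), h3 _ (by simp), midInput]
    · exact (g3 _ (by simp)).trans h2
    · exact g2
    · rw [g3 _ (by simp), h3 _ (by simp), midInput]
    · rw [g3 _ (by simp), h3 _ (by simp), midInput]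
  rw [← hGG]
  exact g1

end changes

/-! ### Changes of the parentheses of a level -/

section levels

variable {k : ℕ}

/-- The position of `t` is a parenthesis of the level of the branch. -/
def matchedCond (t : Expr (dyckEnv k) dyckLoc .term 2) : Expr (dyckEnv k) dyckLoc .cond 2 :=
  .and (memCond false false (predTerm (.var 1)) t) (.not (memCond false false (.var 1) t))

/-- The letter at the position of `t` after the change `δ` of the position of the parameter. -/
def changedLett (δ : LetterOp (Paren k)) (a : Paren k) (t : Expr (dyckEnv k) dyckLoc .term 2) :
    Expr (dyckEnv k) dyckLoc .cond 2 :=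
  match δ with
  | .set b => .ite (.eq t (.var 0))
      (choice (a = b) (.eq (.var 0) (.var 0)) (.not (.eq (.var 0) (.var 0)))) (lettCond a t)
  | .reset => .and (.not (.eq t (.var 0))) (lettCond a t)

def fixSet (r : Bool) (t : Expr (dyckEnv k) dyckLoc .term 2) :
    Stmt (dyckEnv k) dyckLoc 1 .initial 2 :=
  .ite (matchedCond t) (setChange true r .ins (flipTerm r t)) (setChange true r .del (flipTerm r t))

def resetWords (t : Expr (dyckEnv k) dyckLoc .term 2) : Stmt (dyckEnv k) dyckLoc 1 .initial 2 :=
  .seq (eqChange (false, .reset) (slotTerm false (.var 1) t))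
    (eqChange (true, .reset) (slotTerm true (.var 1) t))

def setWords (δ : LetterOp (Paren k)) (t : Expr (dyckEnv k) dyckLoc .term 2) :
    List (Paren k) → Stmt (dyckEnv k) dyckLoc 1 .initial 2
  | [] => .skip
  | a :: l => .ite (changedLett δ a t)
      (eqChange (a.isCl, .set a.type) (slotTerm a.isCl (.var 1) t)) (setWords δ t l)

def parenList (k : ℕ) : List (Paren k) := (List.finRange k).map .op ++ (List.finRange k).map .cl

theorem mem_parenList (a : Paren k) : a ∈ parenList k := by
  rcases a with i | i <;> simp [parenList]

/-- The entries of the position in both words are first cleared, since a letter can only be set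
where there is none. The type is entered again only if the position belongs to the level after the
change. -/
def fixAt (δ : LetterOp (Paren k)) (t : Expr (dyckEnv k) dyckLoc .term 2) :
    Stmt (dyckEnv k) dyckLoc 1 .initial 2 :=
  .seq (.seq (fixSet false t) (fixSet true t))
    (.seq (resetWords t) (.ite (matchedCond t) (setWords δ t (parenList k)) .skip))

/-- Belonging to level `z` is determined by the unmatched sets of the levels `z - 1` and `z`, each
of which changes at one recorded position at most; only these two positions are treated. -/
def fixLevel (δ : LetterOp (Paren k)) : Stmt (dyckEnv k) dyckLoc 1 .initial 2 :=
  .seq (fixAt δ (localTerm true (predTerm (.var 1)))) (fixAt δ (localTerm true (.var 1)))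

theorem confined_fixSet (r : Bool) (t : Expr (dyckEnv k) dyckLoc .term 2) :
    Confined (fixSet r t) :=
  Confined.ite (confined_setChange _ _ _ _) (confined_setChange _ _ _ _)

theorem confined_resetWords (t : Expr (dyckEnv k) dyckLoc .term 2) : Confined (resetWords t) :=
  Confined.seq (confined_eqChange _ _) (confined_eqChange _ _)

theorem confined_setWords (δ : LetterOp (Paren k)) (t : Expr (dyckEnv k) dyckLoc .term 2)
    (l : List (Paren k)) : Confined (setWords δ t l) := by
  induction l with
  | nil => exact Confined.skip
  | cons a l ih => exact Confined.ite (confined_eqChange _ _) ih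

theorem confined_fixAt (δ : LetterOp (Paren k)) (t : Expr (dyckEnv k) dyckLoc .term 2) :
    Confined (fixAt δ t) :=
  Confined.seq (Confined.seq (confined_fixSet _ _) (confined_fixSet _ _))
    (Confined.seq (confined_resetWords _) (Confined.ite (confined_setWords _ _ _) Confined.skip))

theorem confined_fixLevel (δ : LetterOp (Paren k)) : Confined (fixLevel δ) :=
  Confined.seq (confined_fixAt _ _) (confined_fixAt _ _)

variable {n : ℕ} {P : Program (stringEqualitySig (Fin k))} {A : Str (dyckEnv k).aux n}
  {w w' : Word (Paren k) n} {σ : DyckStore P dyckLoc n} {v : Fin 2 → Fin n}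
  {t : Expr (dyckEnv k) dyckLoc .term 2} {c : Fin n} {G : LevelInput k n}

/-- The set of unmatched parentheses of the level below that of the branch is that of `w'`. -/
def PredSet (σ : DyckStore P dyckLoc n) (v : Fin 2 → Fin n) (w' : Word (Paren k) n) : Prop :=
  ∀ z' : Fin n, (z' : ℕ) + 1 = v 1 → Reps succProgram SuccSet (n := 1 * n)
    (σ.sup (.set false false) fun _ => z') (setAt (levelInput w' z') false false)

/-- The branch of a level only changes instances with its own index, so the set of the level below
can still be consulted. -/
theorem PredSet.exec (h : PredSet σ v w') {s : Stmt (dyckEnv k) dyckLoc 1 .initial 2}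
    (hs : Confined s) : PredSet (s.exec A v σ) v w' := by
  intro z' hz'
  rw [(hs A v σ).2 (.set false false) (fun _ => z') fun hc => ?_]
  · exact h z' hz'
  · have := congrArg Fin.val (congrFun hc 0)
    omega

theorem eval_matched (hA : DyckAux A w) (hG : HasInput P σ.sup (v 1) G)
    (hU : setAt G false false = setAt (levelInput w' (v 1)) false false) (hp : PredSet σ v w')
    (ht : t.eval A σ v = some c) :
    (matchedCond t).eval A σ v ↔ MatchedAt (height w'.letter) dyadicLevels (v 1) c := by
  have h1 : (Expr.var 1 : Expr (dyckEnv k) dyckLoc .term 2).eval A σ v = some (v 1) := rfl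
  have h2 := eval_mem (hG (.set false false)) h1 ht
  have h2' : (memCond false false (.var 1) t).eval A σ v ↔
      (c : ℕ) ∈ setAt (levelInput w' (v 1)) false false := hU ▸ h2
  have h3 := hA.eval_pred h1
  refine (and_congr Iff.rfl (not_congr h2')).trans ?_
  cases hz : ((v 1 : Fin n) : ℕ) with
  | zero =>
    -- Level `0` has no predecessor, which makes the term undefined and the test false; in agreement
    -- with this, no parenthesis belongs to level `0`.
    refine iff_of_false (fun h => ?_) id
    refine not_eval_mem (Or.inl ?_) h.1
    rw [h3, theUnique_eq_none]
    rintro ⟨y, hy, -⟩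
    omega
  | succ z =>
    have hz' : z < n := by have := (v 1).isLt; omega
    have h4 : (predTerm (.var 1) : Expr (dyckEnv k) dyckLoc .term 2).eval A σ v =
        some ⟨z, hz'⟩ := by
      rw [h3, theUnique_eq_some]
      refine ⟨hz.symm, fun b hb => Fin.ext ?_⟩
      simp only at hb ⊢
      omega
    exact and_congr (eval_mem (hp ⟨z, hz'⟩ hz.symm) h4 ht) Iff.rfl

theorem HasInput.fixSet (hA : DyckAux A w) (hG : HasInput P σ.sup (v 1) G)
    (hU : setAt G false false = setAt (levelInput w' (v 1)) false false) (hp : PredSet σ v w')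
    (ht : t.eval A σ v = some c) (r : Bool) :
    ∃ G' : LevelInput k n, HasInput P ((DynFO.fixSet r t).exec A v σ).sup (v 1) G' ∧
      (∀ i, i ≠ .set true r → G' i = G i) ∧ ∀ y, y ∈ setAt G' true r ↔
        (y = worldPos r c ∧ MatchedAt (height w'.letter) dyadicLevels (v 1) c) ∨
          (y ≠ worldPos r c ∧ y ∈ setAt G true r) := by
  have hcond := eval_matched hA hG hU hp ht
  by_cases hm : MatchedAt (height w'.letter) dyadicLevels (v 1) c
  · obtain ⟨G', g1, g2, g3⟩ := hG.insert true r (hA.eval_flip r ht)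
    refine ⟨G', ?_, g3, fun y => ?_⟩
    · rw [DynFO.fixSet, Stmt.exec, choice_true (hcond.2 hm)]
      exact g1
    · rw [g2]
      by_cases hy : y = worldPos r c <;> simp [hy, hm]
  · obtain ⟨G', g1, g2, g3⟩ := hG.delete true r (hA.eval_flip r ht)
    refine ⟨G', ?_, g3, fun y => ?_⟩
    · rw [DynFO.fixSet, Stmt.exec, choice_false (mt hcond.1 hm)]
      exact g1
    · rw [g2]
      by_cases hy : y = worldPos r c <;> simp [hy, hm]

theorem HasInput.word (hG : HasInput P σ.sup (v 1) G) (s : Bool) (op : LetterOp (Fin k))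
    (ht : t.eval A σ v = some c) :
    ∃ G' : LevelInput k n, HasInput P ((DynFO.eqChange (s, op) t).exec A v σ).sup (v 1) G' ∧
      (∀ i, i ≠ .eq → G' i = G i) ∧ wordsAt G' s = (wordsAt G s).apply (inBlock 0 c) op ∧
      wordsAt G' (!s) = wordsAt G (!s) := by
  classical
  refine ⟨_, hG.eqChange (s, op) ht, fun i hi => Function.update_of_ne hi _ _, ?_, ?_⟩
  · cases s
    · exact congrArg Prod.fst (Function.update_self (β := fun i => (dyckProblem k i (1 * n)).State)
        DyckSup.eq _ G)
    · exact congrArg Prod.snd (Function.update_self (β := fun i => (dyckProblem k i (1 * n)).State)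
        DyckSup.eq _ G)
  · cases s
    · exact (congrArg Prod.snd (Function.update_self
        (β := fun i => (dyckProblem k i (1 * n)).State) DyckSup.eq _ G)).trans rfl
    · exact (congrArg Prod.fst (Function.update_self
        (β := fun i => (dyckProblem k i (1 * n)).State) DyckSup.eq _ G)).trans rfl

open scoped Classical in
theorem HasInput.resetWords (hA : DyckAux A w) (hG : HasInput P σ.sup (v 1) G)
    (ht : ∀ σ' : DyckStore P dyckLoc n, σ'.loc = σ.loc → t.eval A σ' v = some c) :
    ∃ G' : LevelInput k n, HasInput P ((DynFO.resetWords t).exec A v σ).sup (v 1) G' ∧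
      (∀ i, i ≠ .eq → G' i = G i) ∧ ∀ s y, wordsAt G' s y =
        if y = inBlock 0 (slot (v 1) s c) then none else wordsAt G s y := by
  obtain ⟨G1, a1, a2, a3, a4⟩ := hG.word (A := A) false .reset (hA.eval_slot false (z := v 1) (zt := .var 1)
    rfl (ht σ rfl))
  have hloc := (confined_eqChange (false, .reset) (slotTerm false (.var 1) t) A v σ).1
  obtain ⟨G2, b1, b2, b3, b4⟩ := a1.word (A := A) true .reset (hA.eval_slot true (z := v 1) (zt := .var 1)
    rfl (ht _ hloc))
  refine ⟨G2, b1, fun i hi => (b2 i hi).trans (a2 i hi), fun s y => ?_⟩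
  cases s
  · have e1 : wordsAt G2 false = wordsAt G1 false := b4
    rw [e1, a3]
    split_ifs with hy
    · rw [hy, Word.apply_reset_self]
    · rw [Word.apply_of_ne _ hy]
  · have e1 : wordsAt G1 true = wordsAt G true := a4
    rw [b3, e1]
    split_ifs with hy
    · rw [hy, Word.apply_reset_self]
    · rw [Word.apply_of_ne _ hy]

/-- Rules see the old word, so the letter at the changed position has to be anticipated. Setting a
letter is treated as successful, which is justified by the assumption that the position was empty.
-/
theorem eval_changedLett (hA : DyckAux A w) {δ : LetterOp (Paren k)}
    (hδ : ∀ b, δ = .set b → w (v 0) = none) (ht : t.eval A σ v = some c) (a : Paren k) :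
    (changedLett δ a t).eval A σ v ↔ w.apply (v 0) δ c = some a := by
  have h0 : (Expr.var 0 : Expr (dyckEnv k) dyckLoc .term 2).eval A σ v = some (v 0) := rfl
  have h1 := Expr.eval_eq_of ht h0
  have h2 := hA.eval_lett a ht
  cases δ with
  | set b =>
    have h3 : ((.eq (.var 0) (.var 0) : Expr (dyckEnv k) dyckLoc .cond 2)).eval A σ v :=
      Expr.eval_eq_self.2 ⟨_, h0⟩
    by_cases hc : c = v 0
    · rw [changedLett, Expr.eval_ite_of_true (h1.2 hc), hc, Word.apply_set_self, hδ b rfl,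
        Option.none_or, Option.some.injEq]
      by_cases hab : a = b
      · rw [choice_true hab]
        exact iff_of_true h3 hab.symm
      · rw [choice_false hab]
        exact iff_of_false (fun h => h h3) (Ne.symm hab)
    · rw [changedLett, Expr.eval_ite_of_false (mt h1.1 hc), Word.apply_of_ne _ hc]
      exact h2
  | reset =>
    refine (and_congr (not_congr h1) h2).trans ?_
    by_cases hc : c = v 0
    · rw [hc, Word.apply_reset_self]
      simp
    · rw [Word.apply_of_ne _ hc]
      simp [hc]

/-- The conditions exclude each other, so the chain of conditionals executes the branch of the
actual letter, or none. -/
theorem exec_setWords {δ : LetterOp (Paren k)} {o : Option (Paren k)}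
    (h : ∀ a, (changedLett δ a t).eval A σ v ↔ o = some a) (l : List (Paren k)) :
    (o = none → (setWords δ t l).exec A v σ = σ) ∧ ∀ a, a ∈ l → o = some a →
      (setWords δ t l).exec A v σ =
        (eqChange (a.isCl, .set a.type) (slotTerm a.isCl (.var 1) t)).exec A v σ := by
  induction l with
  | nil => exact ⟨fun _ => rfl, fun a ha => absurd ha (by simp)⟩
  | cons b l ih =>
    refine ⟨fun ho => ?_, fun a ha ho => ?_⟩
    · rw [setWords, Stmt.exec, choice_false (fun hc => by rw [ho] at h; cases (h b).1 hc)]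
      exact ih.1 ho
    · by_cases hab : b = a
      · subst hab
        rw [setWords, Stmt.exec, choice_true ((h b).2 ho)]
      · rw [setWords, Stmt.exec, choice_false (fun hc => hab ?_)]
        · exact ih.2 a ((List.mem_cons.1 ha).resolve_left (Ne.symm hab)) ho
        · exact Option.some.inj (((h b).1 hc).symm.trans ho)

/-- The entry of a parenthesis of the level in one of the two words. -/
def typeEntry (q : Prop) (s : Bool) : Option (Paren k) → Option (Fin k)
  | none => none
  | some a => choice (q ∧ a.isCl = s) (some a.type) none

theorem wordsAt_levelInput (u : Word (Paren k) n) (z : ℕ) (s : Bool) (x : Fin n) :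
    wordsAt (levelInput u z) s (inBlock 0 (slot z s x)) =
      typeEntry (MatchedAt (height u.letter) dyadicLevels z x) s (u x) := by
  have h1 : ((inBlock (0 : Fin 1) (slot z s x) : Fin (1 * n)) : ℕ) = slot z s x := by simp
  have h2 : wordsAt (levelInput u z) s (inBlock 0 (slot z s x)) =
      levelTypes u.letter n z s (slot z s x : Fin n) := by
    cases s
    · exact congrArg (levelTypes u.letter n z false) h1
    · exact congrArg (levelTypes u.letter n z true) h1
  rw [h2]
  have h3 : dyadicRev n z (slot z true x : Fin n) = x := dyadicRev_dyadicRev x.isLt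
  cases s
  · rw [levelTypes]
    simp only [slot]
    rw [u.letter_val]
    rcases u x with _ | ⟨a | a⟩ <;> by_cases hm : MatchedAt (height u.letter) dyadicLevels z x <;>
      simp [typeEntry, choice, hm, Paren.isCl, Paren.type]
  · rw [levelTypes, h3, u.letter_val]
    rcases u x with _ | ⟨a | a⟩ <;> by_cases hm : MatchedAt (height u.letter) dyadicLevels z x <;>
      simp [typeEntry, choice, hm, Paren.isCl, Paren.type]

/-- The inputs `G` and `T` are the same at the places for position `x`. -/
def AgreeAt (z : ℕ) (G T : LevelInput k n) (x : Fin n) : Prop :=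
  (∀ r, (worldPos r x : ℕ) ∈ setAt G true r ↔ (worldPos r x : ℕ) ∈ setAt T true r) ∧
    ∀ s, wordsAt G s (inBlock 0 (slot z s x)) = wordsAt T s (inBlock 0 (slot z s x))

theorem slot_inj {z : ℕ} {s : Bool} {x y : Fin n}
    (h : (inBlock 0 (slot z s x) : Fin (1 * n)) = inBlock 0 (slot z s y)) : x = y := by
  rw [← slot_slot (z := z) s x, (inBlock_injective h).2, slot_slot]

theorem HasInput.setWords (hA : DyckAux A w) {δ : LetterOp (Paren k)}
    (hδ : ∀ b, δ = .set b → w (v 0) = none) (hw : w.apply (v 0) δ = w')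
    (hG : HasInput P σ.sup (v 1) G)
    (hU : setAt G false false = setAt (levelInput w' (v 1)) false false) (hp : PredSet σ v w')
    (ht : t.eval A σ v = some c)
    (hnone : ∀ s, wordsAt G s (inBlock 0 (slot (v 1) s c)) = none) :
    ∃ G' : LevelInput k n, HasInput P ((Stmt.ite (matchedCond t)
        (DynFO.setWords δ t (parenList k)) .skip).exec A v σ).sup (v 1) G' ∧
      (∀ i, i ≠ .eq → G' i = G i) ∧
      (∀ s, wordsAt G' s (inBlock 0 (slot (v 1) s c)) =
        typeEntry (MatchedAt (height w'.letter) dyadicLevels (v 1) c) s (w' c)) ∧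
      ∀ s y, y ≠ inBlock 0 (slot (v 1) s c) → wordsAt G' s y = wordsAt G s y := by
  have hcond := eval_matched hA hG hU hp ht
  have hlett := fun a => hw ▸ eval_changedLett (σ := σ) (t := t) hA hδ ht a
  obtain ⟨e1, e2⟩ := exec_setWords hlett (parenList k)
  by_cases hm : MatchedAt (height w'.letter) dyadicLevels (v 1) c
  · rw [Stmt.exec, choice_true (hcond.2 hm)]
    cases hc : w' c with
    | none =>
      rw [e1 hc]
      exact ⟨G, hG, fun _ _ => rfl, hnone, fun _ _ _ => rfl⟩
    | some a =>
      rw [e2 a (mem_parenList a) hc]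
      obtain ⟨G', g1, g2, g3, g4⟩ := hG.word (A := A) a.isCl (.set a.type)
        (hA.eval_slot a.isCl (z := v 1) (zt := .var 1) rfl ht)
      have hother : ∀ s, s ≠ a.isCl → wordsAt G' s = wordsAt G s := by
        intro s hs
        have : s = !a.isCl := by cases s <;> cases h : a.isCl <;> simp_all
        rw [this]
        exact g4
      refine ⟨G', g1, g2, fun s => ?_, fun s y hy => ?_⟩
      · by_cases hs : s = a.isCl
        · subst hs
          rw [g3, Word.apply_set_self, hnone, typeEntry, choice_true ⟨hm, rfl⟩]
          rfl
        · rw [hother s hs, hnone, typeEntry, choice_false fun h => hs h.2.symm]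
      · by_cases hs : s = a.isCl
        · subst hs
          rw [g3, Word.apply_of_ne _ hy]
        · rw [hother s hs]
  · rw [Stmt.exec, choice_false (mt hcond.1 hm)]
    refine ⟨G, hG, fun _ _ => rfl, fun s => ?_, fun _ _ _ => rfl⟩
    rw [hnone]
    cases w' c with
    | none => rfl
    | some a => rw [typeEntry, choice_false fun h => hm h.1]

/-- What the changes at one position achieve. -/
structure Fixed (z : ℕ) (G G' T : LevelInput k n) (o : Option (Fin n)) : Prop where
  unm : ∀ r, setAt G' false r = setAt G false r
  lt : (∀ r, ∀ y ∈ setAt G true r, y < n) → ∀ r, ∀ y ∈ setAt G' true r, y < n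
  self : ∀ c, o = some c → AgreeAt z G' T c
  other : ∀ x, AgreeAt z G T x → AgreeAt z G' T x

theorem fixAt_of_none {δ : LetterOp (Paren k)}
    (ht : ∀ σ' : DyckStore P dyckLoc n, σ'.loc = σ.loc → t.eval A σ' v = none) :
    (fixAt δ t).exec A v σ = σ := by
  have h0 := ht σ rfl
  have h1 : ¬ (matchedCond t).eval A σ v := fun h => not_eval_mem (Or.inr h0) h.1
  have h2 : ∀ r, (fixSet r t).exec A v σ = σ := fun r => by
    rw [fixSet, Stmt.exec, choice_false h1, setChange_of_none _ _ _ (eval_flip_none r h0)]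
  have h3 : (resetWords t).exec A v σ = σ := by
    rw [resetWords, Stmt.exec, eqChange_of_none _ (eval_slot_none false h0),
      eqChange_of_none _ (eval_slot_none true h0)]
  rw [fixAt, Stmt.exec, Stmt.exec, Stmt.exec, h2, h2, h3, Stmt.exec, choice_false h1]
  rfl

theorem HasInput.fixAt (hA : DyckAux A w) {δ : LetterOp (Paren k)} {o : Option (Fin n)}
    (hδ : o ≠ none → ∀ b, δ = .set b → w (v 0) = none) (hw : w.apply (v 0) δ = w')
    (hG : HasInput P σ.sup (v 1) G)
    (hU : setAt G false false = setAt (levelInput w' (v 1)) false false) (hp : PredSet σ v w')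
    (ht : ∀ σ' : DyckStore P dyckLoc n, σ'.loc = σ.loc → t.eval A σ' v = o) :
    ∃ G' : LevelInput k n, HasInput P ((DynFO.fixAt δ t).exec A v σ).sup (v 1) G' ∧
      Fixed (v 1) G G' (levelInput w' (v 1)) o := by
  cases o with
  | none =>
    rw [fixAt_of_none ht]
    exact ⟨G, hG, fun _ => rfl, fun h => h, fun _ hc => absurd hc (by simp), fun _ h => h⟩
  | some c =>
    have hδ' := hδ (by simp)
    obtain ⟨G1, a1, a2, a3⟩ := hG.fixSet hA hU hp (ht _ rfl) false
    have l1 := (confined_fixSet false t A v σ).1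
    have p1 := hp.exec (A := A) (confined_fixSet false t)
    have u1 : setAt G1 false false = setAt (levelInput w' (v 1)) false false :=
      (a2 (.set false false) (by simp)).trans hU
    obtain ⟨G2, b1, b2, b3⟩ := a1.fixSet hA u1 p1 (ht _ l1) true
    have l2 := (confined_fixSet true t A v _).1.trans l1
    have p2 := p1.exec (A := A) (confined_fixSet true t)
    have u2 : setAt G2 false false = setAt (levelInput w' (v 1)) false false :=
      (b2 (.set false false) (by simp)).trans u1
    obtain ⟨G3, c1, c2, c3⟩ := b1.resetWords hA (t := t) (c := c)
      fun σ' hσ' => ht σ' (hσ'.trans l2)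
    have l3 := (confined_resetWords t A v _).1.trans l2
    have p3 := p2.exec (A := A) (confined_resetWords t)
    have u3 : setAt G3 false false = setAt (levelInput w' (v 1)) false false :=
      (c2 (.set false false) (by simp)).trans u2
    obtain ⟨G4, d1, d2, d3, d4⟩ := c1.setWords hA hδ' hw u3 p3 (ht _ l3)
      fun s => by rw [c3, if_pos rfl]
    have hset : ∀ r y, y ∈ setAt G4 true r ↔
        (y = worldPos r c ∧ MatchedAt (height w'.letter) dyadicLevels (v 1) c) ∨
          (y ≠ worldPos r c ∧ y ∈ setAt G true r) := by
      intro r y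
      have e1 : setAt G4 true r = setAt G2 true r :=
        (d2 (.set true r) (by simp)).trans (c2 (.set true r) (by simp))
      rw [e1]
      cases r
      · have e2 : setAt G2 true false = setAt G1 true false := b2 (.set true false) (by simp)
        rw [e2]
        exact a3 y
      · have e2 : setAt G1 true true = setAt G true true := a2 (.set true true) (by simp)
        rw [← e2]
        exact b3 y
    have hword : ∀ s y, y ≠ inBlock 0 (slot (v 1) s c) → wordsAt G4 s y = wordsAt G s y := by
      intro s y hy
      have e1 : G2 .eq = G .eq := (b2 .eq (by simp)).trans (a2 .eq (by simp))
      have e2 : wordsAt G2 s y = wordsAt G s y := by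
        cases s <;> simp only [wordsAt, e1]
      rw [d4 s y hy, c3, if_neg hy, e2]
    have hself : AgreeAt (v 1) G4 (levelInput w' (v 1)) c := by
      refine ⟨fun r => ?_, fun s => ?_⟩
      · rw [hset]
        have h5 : ((worldPos r c : Fin n) : ℕ) ∈ setAt (levelInput w' (v 1)) true r ↔
            MatchedAt (height w'.letter) dyadicLevels (v 1) c := matchedAt_world r c
        rw [h5]
        simp
      · rw [d3, wordsAt_levelInput]
    refine ⟨G4, d1, fun r => ?_, fun h r y hy => ?_, fun c' hc' => ?_, fun x hx => ?_⟩
    · exact (d2 (.set false r) (by simp)).trans ((c2 (.set false r) (by simp)).trans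
        ((b2 (.set false r) (by simp)).trans (a2 (.set false r) (by simp))))
    · rcases (hset r y).1 hy with ⟨rfl, -⟩ | ⟨-, h5⟩
      · exact Fin.isLt _
      · exact h r y h5
    · obtain rfl := Option.some.inj hc'
      exact hself
    · by_cases hxc : x = c
      · rw [hxc]
        exact hself
      · refine ⟨fun r => ?_, fun s => ?_⟩
        · rw [hset]
          have h5 : ((worldPos r x : Fin n) : ℕ) ≠ worldPos r c := fun h =>
            hxc (worldPos_val_inj.1 h)
          rw [← hx.1 r]
          simp [h5]
        · rw [hword s _ (fun h => hxc (slot_inj h)), hx.2 s]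

/-- Every position of a word is the slot of some `x`, and every element of a set is the
direction-adjusted image of some `x`. Agreement at all `x`, once the sets are known to lie in the
domain, is therefore equality. -/
theorem levelInput_eq_of_agree {z : ℕ}
    (hU : ∀ r, setAt G false r = setAt (levelInput w' z) false r)
    (hlt : ∀ r, ∀ y ∈ setAt G true r, y < n) (h : ∀ x, AgreeAt z G (levelInput w' z) x) :
    G = levelInput w' z := by
  refine LevelInput.ext (fun b r => ?_) fun s => ?_
  · cases b
    · exact hU r
    · ext y
      constructor
      · intro hy
        have := (h (worldPos r ⟨y, hlt r y hy⟩)).1 r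
        rw [worldPos_worldPos] at this
        exact this.1 hy
      · intro hy
        obtain ⟨x, rfl, -⟩ := (mem_levelSet_iff _ _ _ _ _).1 hy
        exact ((h x).1 r).2 hy
  · funext y
    obtain ⟨x, rfl⟩ : ∃ x : Fin n, y = inBlock 0 (slot z s x) := by
      refine ⟨slot z s ⟨y, by have := y.isLt; omega⟩, ?_⟩
      rw [slot_slot]
      exact Fin.ext (by simp)
    exact (h x).2 s

theorem Word.ne_none_of_unm {i : Fin n} {z : ℕ}
    (h : Unm (height w.letter) dyadicLevels z i) : w i ≠ none := by
  intro h1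
  have h2 := height_succ (l := w.letter) i
  rw [w.letter_val, h1] at h2
  simp only [step, add_zero] at h2
  rcases h with h | h <;> have := h.1 <;> omega

theorem Word.ne_none_of_matchedAt {i : Fin n} {z : ℕ}
    (h : MatchedAt (height w.letter) dyadicLevels z i) : w i ≠ none := by
  cases z with
  | zero => exact h.elim
  | succ z => exact Word.ne_none_of_unm h.1

/-- The inputs of the level after the changes. -/
theorem HasInput.fixLevel (hA : DyckAux A w) {δ : LetterOp (Paren k)}
    (hw : w.apply (v 0) δ = w') (hz : (v 1 : ℕ) ≤ logBound.fn n)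
    (hG : HasInput P σ.sup (v 1) (midInput w w' (v 1))) (hp : PredSet σ v w')
    (hδ : ∀ z d : Fin n, (σ.loc true fun _ => z) = some d → ∀ b, δ = .set b → w (v 0) = none)
    (ht : ∀ z : Fin n, (z : ℕ) ≤ logBound.fn n →
      TogglesAt (Unm (height w.letter) dyadicLevels z) (Unm (height w'.letter) dyadicLevels z)
        (σ.loc true fun _ => z)) :
    HasInput P ((DynFO.fixLevel δ).exec A v σ).sup (v 1) (levelInput w' (v 1)) := by
  have h1 : ∀ σ' : DyckStore P dyckLoc n,
      (Expr.var 1 : Expr (dyckEnv k) dyckLoc .term 2).eval A σ' v = some (v 1) := fun _ => rfl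
  -- the two positions
  obtain ⟨o, ho, hod, hoz⟩ : ∃ o : Option (Fin n),
      (∀ σ' : DyckStore P dyckLoc n, σ'.loc = σ.loc →
        (localTerm true (predTerm (.var 1)) : Expr (dyckEnv k) dyckLoc .term 2).eval A σ' v = o) ∧
      (o ≠ none → ∃ z d : Fin n, (σ.loc true fun _ => z) = some d) ∧
      ∀ z : ℕ, z + 1 = v 1 → TogglesAt (Unm (height w.letter) dyadicLevels z)
        (Unm (height w'.letter) dyadicLevels z) o := by
    cases hv : ((v 1 : Fin n) : ℕ) with
    | zero =>
      refine ⟨none, fun σ' _ => eval_local_none ?_, fun h => absurd rfl h, fun z hz => by omega⟩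
      rw [hA.eval_pred (h1 σ'), theUnique_eq_none]
      rintro ⟨y, hy, -⟩
      omega
    | succ z =>
      have hz' : z < n := by have := (v 1).isLt; omega
      refine ⟨σ.loc true fun _ => ⟨z, hz'⟩, fun σ' hσ' => ?_, fun h => ?_, fun z2 hz2 => ?_⟩
      · rw [← hσ']
        refine eval_local (z := ⟨z, hz'⟩) ?_
        rw [hA.eval_pred (h1 σ'), theUnique_eq_some]
        refine ⟨hv.symm, fun b hb => Fin.ext ?_⟩
        simp only at hb ⊢
        omega
      · obtain ⟨d, hd⟩ := Option.ne_none_iff_exists'.1 h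
        exact ⟨_, d, hd⟩
      · obtain rfl : z2 = z := by omega
        exact ht ⟨z2, hz'⟩ (by simp only; omega)
  have ho2 : ∀ σ' : DyckStore P dyckLoc n, σ'.loc = σ.loc →
      (localTerm true (.var 1) : Expr (dyckEnv k) dyckLoc .term 2).eval A σ' v =
        (σ.loc true fun _ => v 1) := fun σ' hσ' => by
    rw [← hσ']
    exact eval_local (h1 σ')
  have ht1 := ht (v 1) hz
  obtain ⟨G1, a1, a2⟩ := hG.fixAt hA (δ := δ) (fun h => by
    obtain ⟨z, d, hd⟩ := hod h
    exact hδ z d hd) hw rfl hp ho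
  have l1 := (confined_fixAt δ (localTerm true (predTerm (.var 1))) A v σ).1
  have p1 := hp.exec (A := A) (confined_fixAt δ (localTerm true (predTerm (.var 1))))
  obtain ⟨G2, b1, b2⟩ := a1.fixAt hA (δ := δ) (fun h => by
    obtain ⟨d, hd⟩ := Option.ne_none_iff_exists'.1 h
    exact hδ _ d hd) hw (a2.unm false) p1 fun σ' hσ' => ho2 σ' (hσ'.trans l1)
  have hfin : G2 = levelInput w' (v 1) := by
    refine levelInput_eq_of_agree (fun r => (b2.unm r).trans ((a2.unm r).trans rfl))
      (b2.lt (a2.lt fun r y hy => ?_)) fun x => ?_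
    · obtain ⟨x, rfl, -⟩ := (mem_levelSet_iff w (v 1) true r y).1 hy
      exact Fin.isLt _
    by_cases hx2 : (σ.loc true fun _ => v 1) = some x
    · exact b2.self x hx2
    refine b2.other x ?_
    by_cases hx1 : o = some x
    · exact a2.self x hx1
    refine a2.other x ?_
    -- nothing changes at the other positions
    have hm : MatchedAt (height w.letter) dyadicLevels (v 1) x ↔
        MatchedAt (height w'.letter) dyadicLevels (v 1) x := by
      have e2 := ht1 x
      simp only [hx2, false_and, ne_eq, not_false_eq_true, true_and, false_or] at e2
      cases hv : ((v 1 : Fin n) : ℕ) with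
      | zero => exact Iff.rfl
      | succ z =>
        have e1 := hoz z hv.symm x
        simp only [hx1, false_and, ne_eq, not_false_eq_true, true_and, false_or] at e1
        rw [hv] at e2
        exact and_congr e1.symm (not_congr e2.symm)
    refine ⟨fun r => ?_, fun s => ?_⟩
    · have e1 : ((worldPos r x : Fin n) : ℕ) ∈ setAt (midInput w w' (v 1)) true r ↔
          MatchedAt (height w.letter) dyadicLevels (v 1) x := matchedAt_world r x
      have e2 : ((worldPos r x : Fin n) : ℕ) ∈ setAt (levelInput w' (v 1)) true r ↔
          MatchedAt (height w'.letter) dyadicLevels (v 1) x := matchedAt_world r x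
      rw [e1, e2, hm]
    · have e1 : wordsAt (midInput w w' (v 1)) s = wordsAt (levelInput w (v 1)) s := by
        cases s <;> rfl
      rw [e1, wordsAt_levelInput, wordsAt_levelInput]
      by_cases hmx : MatchedAt (height w.letter) dyadicLevels (v 1) x
      · have hmx' := hm.1 hmx
        have e2 : w' x = w x := by
          rw [← hw]
          by_cases hxp : x = v 0
          -- If the changed position belongs to the level before and after, then it is nonempty both
          -- times. This excludes a reset and makes setting a letter ineffective, so the letter is
          -- the same.
          · have g1 := Word.ne_none_of_matchedAt hmx
            have g2 := Word.ne_none_of_matchedAt hmx'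
            rw [← hw, hxp] at g2
            rw [hxp] at g1 ⊢
            cases δ with
            | set b =>
              rw [Word.apply_set_self]
              obtain ⟨a, ha⟩ := Option.ne_none_iff_exists'.1 g1
              rw [ha]
              rfl
            | reset => exact absurd (Word.apply_reset_self _ _) g2
          · exact Word.apply_of_ne _ hxp _
        rw [e2, propext (iff_of_true hmx hmx')]
      · have hmx' := mt hm.2 hmx
        have e3 : ∀ (q : Prop) (a : Option (Paren k)), ¬ q → typeEntry q s a = none := by
          intro q a hq
          cases a with
          | none => rfl
          | some a => rw [typeEntry, choice_false fun h => hq h.1]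
        rw [e3 _ _ hmx, e3 _ _ hmx']
  rw [← hfin]
  exact b1

end levels

/-! ### The program for well-balanced strings -/

section program

variable {k : ℕ}

def trueCond {E : Env} {L : Schema} {m : ℕ} : Expr E L .cond (m + 1) := .eq (.var 0) (.var 0)

def falseCond {E : Env} {L : Schema} {m : ℕ} : Expr E L .cond (m + 1) := .not trueCond

/-- The change increases the heights behind the position (`false`), or decreases them (`true`). -/
def activeCond (δ : LetterOp (Paren k)) (r : Bool) : Expr (dyckEnv k) dyckLoc .cond 1 :=
  match δ with
  | .set a => choice (a.isCl = r) (emptyCond (.var 0)) falseCond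
  | .reset => sgnCond (!r) (.var 0)

def findStmt (δ : LetterOp (Paren k)) : Stmt (dyckEnv k) dyckLoc 1 .initial 1 :=
  .ite (activeCond δ false) (findToggles false)
    (.ite (activeCond δ true) (findToggles true) .skip)

def dyckStmt (δ : LetterOp (Paren k)) : Stmt (dyckEnv k) dyckLoc 1 .initial 1 :=
  .seq (findStmt δ) (.seq (levelwise toggleSets) (levelwise (fixLevel δ)))

/-- The rule for `flip` also changes the supplementary instances. -/
def flipRule (δ : LetterOp (Paren k)) : UpdateRule (dyckEnv k) 1 .term 1 where
  L := dyckLoc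
  initial := dyckStmt δ
  numVars := 0
  bound := Fin.elim0
  target := fun _ => .var 0
  main := .ret (flipTerm true (.var 0))

/-- The rule for the set of positions with a letter that satisfies `q`. -/
def letterRule (δ : LetterOp (Paren k)) (q : Paren k → Prop)
    (e : Expr (dyckEnv k) noSymbols .cond 1) : UpdateRule (dyckEnv k) 1 .cond 1 where
  L := noSymbols
  initial := .skip
  numVars := 0
  bound := Fin.elim0
  target := fun _ => .var 0
  main := .ret (match δ with
    | .set a => .ite (emptyCond (.var 0)) (choice (q a) trueCond falseCond) e
    | .reset => falseCond)

/-- The term `base(z, z)` denotes `0`, and the successor query from there is undefined exactly if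
the set is empty. -/
def noUnmatchedCond : Expr (dyckEnv k) noSymbols .cond 1 :=
  .not (.eq (setTerm false false (.var 0) (baseTerm (.var 0) (.var 0)))
    (setTerm false false (.var 0) (baseTerm (.var 0) (.var 0))))

/-- The last existential condition only fails on the empty domain. There no level exists, but the
empty string has to be accepted. -/
def dyckQuery : QueryRule (dyckEnv k) 0 .cond where
  L := noSymbols
  body := .ret (.and (.not (.exist logBound (.not (eqCond (.var 0)))))
    (.not (.and (.not (.exist logBound noUnmatchedCond)) (.exist logBound trueCond))))

def dyckProgram (P : Program (stringEqualitySig (Fin k))) : Program (memberSig (Paren k)) :=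
  .mk (dyckEnv k) (dyckSup P)
    (fun s => match s with
      | .lett _ => (FODef.false (α := Fin 1)).choose
      | .sgn _ => (FODef.false (α := Fin 1)).choose
      | .base => (FODef.dyadicBase (0 : Fin 3) 1 2).choose
      | .rev => (FODef.dyadicRev (0 : Fin 3) 1 2).choose
      | .flip => (FODef.flip (0 : Fin 2) 1).choose
      | .pred => (FODef.pred (0 : Fin 2) 1).choose)
    (fun δ s => match s with
      | .lett c => letterRule δ (· = c) (lettCond c (.var 0))
      | .sgn b => letterRule δ (fun c => c.isCl = b) (sgnCond b (.var 0))
      | .base => staticRule (dyckEnv k) .base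
      | .rev => staticRule (dyckEnv k) .rev
      | .flip => flipRule δ
      | .pred => staticRule (dyckEnv k) .pred)
    (fun _ => dyckQuery)
    -- Only the rule for `flip` has an initial procedure that invokes changes.
    (fun _ _ s s' h h' => by
      cases s <;> first | exact h.elim | skip
      cases s' <;> first | exact h'.elim | rfl)

theorem invokes_dyckStmt (δ : LetterOp (Paren k)) (i : DyckSup) : (dyckStmt δ).Invokes i := by
  rcases i with _ | ⟨_ | _, _ | _⟩
  · exact Or.inr (Or.inr (Or.inl (Or.inr (Or.inl (Or.inl rfl)))))
  · exact Or.inr (Or.inl (Or.inl (Or.inl rfl)))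
  · exact Or.inr (Or.inl (Or.inr (Or.inl rfl)))
  · exact Or.inr (Or.inr (Or.inl (Or.inl (Or.inl (Or.inl rfl)))))
  · exact Or.inr (Or.inr (Or.inl (Or.inl (Or.inr (Or.inl rfl)))))

variable {n : ℕ} {P : Program (stringEqualitySig (Fin k))} {A : Str (dyckEnv k).aux n}
  {w w' : Word (Paren k) n} {σ : DyckStore P dyckLoc n} {δ : LetterOp (Paren k)}

/-! ### Changes -/

theorem eval_trueCond {E : Env} {L : Schema} {D : ∀ i, DataType (E.sig i) (E.scale i * n)}
    {A : Str E.aux n} {σ : Store E L n D} {m : ℕ} {v : Fin (m + 1) → Fin n} :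
    (trueCond : Expr E L .cond (m + 1)).eval A σ v := ⟨v 0, rfl, rfl⟩

theorem not_eval_falseCond {E : Env} {L : Schema} {D : ∀ i, DataType (E.sig i) (E.scale i * n)}
    {A : Str E.aux n} {σ : Store E L n D} {m : ℕ} {v : Fin (m + 1) → Fin n} :
    ¬ (falseCond : Expr E L .cond (m + 1)).eval A σ v := fun h => h eval_trueCond

theorem DyckAux.eval_active (hA : DyckAux A w) (r : Bool) (v : Fin 1 → Fin n) :
    (activeCond δ r).eval A σ v ↔ match δ with
      | .set a => a.isCl = r ∧ w (v 0) = none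
      | .reset => ∃ c, w (v 0) = some c ∧ c.isCl = !r := by
  have h0 : (Expr.var 0 : Expr (dyckEnv k) dyckLoc .term 1).eval A σ v = some (v 0) := rfl
  cases δ with
  | set a =>
    by_cases h : a.isCl = r
    · rw [show activeCond (.set a) r = _ from choice_true h _ _]
      exact (hA.eval_empty h0).trans (and_iff_right h).symm
    · rw [show activeCond (.set a) r = _ from choice_false h _ _]
      exact iff_of_false not_eval_falseCond fun h' => h h'.1
  | reset => exact hA.eval_sgn (!r) h0

theorem togglesAt_some {U U' : ℤ → Prop} {d : Fin n} (h : Toggles U U' d) :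
    TogglesAt U U' (some d) := by
  intro x
  by_cases hx : x = d
  · subst hx
    simpa using h.2
  · have h1 := h.1 x (by exact_mod_cast fun h => hx (Fin.ext h))
    simpa [Ne.symm hx] using h1

theorem togglesAt_refl (U : ℤ → Prop) : TogglesAt (n := n) U U none := fun x => by simp

theorem Word.letter_apply_of_ne (w : Word (Paren k) n) (p : Fin n) (δ : LetterOp (Paren k)) {x : ℕ}
    (hx : x ≠ p) : (w.apply p δ).letter x = w.letter x := by
  unfold Word.letter
  split_ifs with h
  · exact Word.apply_of_ne _ (fun hc => hx (congrArg Fin.val hc)) _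
  · rfl

/-- The change of the step at `p` is by `+1` or `-1` according to the direction `r`. Since no step
exceeds one in absolute value, the old step has the sign that the toggle results require. -/
theorem togglesAt_of_isToggle {z : ℕ} (r : Bool) (p d : Fin n)
    (hstep : step (w.apply p δ p) = step (w p) + if r then -1 else 1)
    (hd : IsToggle (worldHeight n (height w.letter) r) (worldLevels n dyadicLevels r) z
      (worldPos r p : Fin n) d) :
    TogglesAt (Unm (height w.letter) dyadicLevels z)
      (Unm (height (w.apply p δ).letter) dyadicLevels z) (some (worldPos r d)) := by
  refine togglesAt_some ?_
  have hother : ∀ x : ℕ, x ≠ p → (w.apply p δ).letter x = w.letter x := fun x hx =>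
    w.letter_apply_of_ne p δ hx
  have hh := height_succ (l := w.letter) p
  have b1 := step_bounds (w.apply p δ p)
  rw [w.letter_val] at hh
  cases r with
  | false =>
    have h1 : height (w.apply p δ).letter = bump (height w.letter) p :=
      height_eq_bump (by rw [Word.letter_val, Word.letter_val]; simpa using hstep) hother
    rw [h1]
    simp only [Bool.false_eq_true, if_false] at hstep
    exact hd.toggles levels_dyadic (steps_height _) (by omega)
  | true =>
    have h1 : height (w.apply p δ).letter = unbump (height w.letter) p :=
      height_eq_unbump (by rw [Word.letter_val, Word.letter_val]; simpa [sub_eq_add_neg] using hstep)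
        hother
    rw [h1]
    simp only [if_true] at hstep
    refine IsToggle.toggles_mirror (N := n) levels_dyadic (steps_height _) (by omega) ?_
    have e1 : (n : ℤ) - 1 - ((worldPos true d : Fin n) : ℕ) = (d : ℕ) := by
      rw [worldPos, cast_rev]
      ring
    rw [e1, ← cast_rev]
    exact hd

theorem DyckAux.findStmt (hA : DyckAux A w) (v : Fin 1 → Fin n)
    (hG : ∀ z : Fin n, (z : ℕ) ≤ logBound.fn n → HasInput P σ.sup z (levelInput w z))
    (hloc : ∀ z : Fin n, (σ.loc true fun _ => z) = (none : Option (Fin n))) :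
    ((findStmt δ).exec A v σ).sup = σ.sup ∧
      (∀ z : Fin n, (z : ℕ) ≤ logBound.fn n → TogglesAt (Unm (height w.letter) dyadicLevels z)
        (Unm (height (w.apply (v 0) δ).letter) dyadicLevels z)
        (((DynFO.findStmt δ).exec A v σ).loc true fun _ => z)) ∧
      ∀ z d : Fin n, (((DynFO.findStmt δ).exec A v σ).loc true fun _ => z) = some d →
        ∀ b, δ = .set b → w (v 0) = none := by
  have hact := fun r => hA.eval_active (δ := δ) (σ := σ) r v
  have hspec : ∀ r, (activeCond δ r).eval A σ v →
      step (w.apply (v 0) δ (v 0)) = step (w (v 0)) + if r then -1 else 1 := by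
    intro r hr
    have hr := (hact r).1 hr
    cases δ with
    | set a =>
      obtain ⟨rfl, h2⟩ := hr
      rw [Word.apply_set_self, h2]
      cases a <;> rfl
    | reset =>
      obtain ⟨c, h1, h2⟩ := hr
      rw [Word.apply_reset_self, h1]
      cases c <;> cases r <;> simp_all [Paren.isCl, step]
  have hset : ∀ r, (activeCond δ r).eval A σ v → ∀ b, δ = .set b → w (v 0) = none := by
    rintro r hr b rfl
    exact ((hact r).1 hr).2
  have hfind : ∀ r, (activeCond δ r).eval A σ v →
      (DynFO.findStmt δ).exec A v σ = (findToggles r).exec A v σ →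
      ((DynFO.findStmt δ).exec A v σ).sup = σ.sup ∧
      (∀ z : Fin n, (z : ℕ) ≤ logBound.fn n → TogglesAt (Unm (height w.letter) dyadicLevels z)
        (Unm (height (w.apply (v 0) δ).letter) dyadicLevels z)
        (((DynFO.findStmt δ).exec A v σ).loc true fun _ => z)) ∧
      ∀ z d : Fin n, (((DynFO.findStmt δ).exec A v σ).loc true fun _ => z) = some d →
        ∀ b, δ = .set b → w (v 0) = none := by
    intro r hr he
    obtain ⟨h1, h2⟩ := findToggles_spec hA r v hG
    rw [he]
    refine ⟨h1, fun z hz => ?_, fun _ _ _ => hset r hr⟩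
    obtain ⟨d, hd, hd'⟩ := h2 z hz
    rw [hd]
    exact togglesAt_of_isToggle r (v 0) d (hspec r hr) hd'
  by_cases h1 : (activeCond δ false).eval A σ v
  · exact hfind false h1 (choice_true h1 _ _)
  by_cases h2 : (activeCond δ true).eval A σ v
  · exact hfind true h2 ((choice_false h1 _ _).trans (choice_true h2 _ _))
  have he : (DynFO.findStmt δ).exec A v σ = σ := (choice_false h1 _ _).trans (choice_false h2 _ _)
  -- If neither direction is active, then a letter is set at a nonempty position or an empty
  -- position is reset. The word stays the same, and the recorded positions stay undefined.
  have hw : w.apply (v 0) δ = w := by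
    rw [hact] at h1 h2
    funext x
    by_cases hx : x = v 0
    · subst hx
      cases hc : w (v 0) with
      | none =>
        cases δ with
        | set a =>
          cases ha : a.isCl
          · exact absurd ⟨ha, hc⟩ h1
          · exact absurd ⟨ha, hc⟩ h2
        | reset => exact Word.apply_reset_self _ _
      | some c =>
        cases δ with
        | set a =>
          rw [Word.apply_set_self, hc]
          rfl
        | reset =>
          cases ha : c.isCl
          · exact absurd ⟨c, hc, ha⟩ h2
          · exact absurd ⟨c, hc, ha⟩ h1
    · exact Word.apply_of_ne _ hx _
  rw [he, hw]
  refine ⟨rfl, fun z _ => ?_, fun z d hd => ?_⟩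
  · rw [hloc]
    exact togglesAt_refl _
  · rw [hloc] at hd
    cases hd

/-- The sets of unmatched parentheses are changed in a loop of their own, so that each branch of the
second loop finds the new set of the level below. -/
theorem DyckAux.dyckStmt (hA : DyckAux A w) (v : Fin 1 → Fin n)
    (hG : ∀ z : Fin n, (z : ℕ) ≤ logBound.fn n → HasInput P σ.sup z (levelInput w z))
    (hloc : ∀ z : Fin n, (σ.loc true fun _ => z) = (none : Option (Fin n))) (z : Fin n)
    (hz : (z : ℕ) ≤ logBound.fn n) :
    HasInput P ((dyckStmt δ).exec A v σ).sup z (levelInput (w.apply (v 0) δ) z) := by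
  obtain ⟨h1, h2, h3⟩ := hA.findStmt (δ := δ) v hG hloc
  obtain ⟨σ₁, hσ₁⟩ : ∃ σ₁, σ₁ = (DynFO.findStmt δ).exec A v σ := ⟨_, rfl⟩
  obtain ⟨σ₂, hσ₂⟩ : ∃ σ₂, σ₂ = (DynFO.levelwise toggleSets).exec A v σ₁ := ⟨_, rfl⟩
  rw [← hσ₁] at h1 h2 h3
  have hl : σ₂.loc = σ₁.loc := by
    rw [hσ₂]
    exact levelwise_loc confined_toggleSets v
  have hG2 : ∀ z : Fin n, (z : ℕ) ≤ logBound.fn n →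
      HasInput P σ₂.sup z (midInput w (w.apply (v 0) δ) z) := by
    intro z hz
    rw [hσ₂]
    refine HasInput.levelwise confined_toggleSets hz
      (HasInput.toggleSets (v := ![v 0, z]) hA ?_ (h2 z hz))
    rw [h1]
    exact hG z hz
  have he : (DynFO.dyckStmt δ).exec A v σ = (DynFO.levelwise (DynFO.fixLevel δ)).exec A v σ₂ := by
    rw [hσ₂, hσ₁]
    rfl
  rw [he]
  refine HasInput.levelwise (confined_fixLevel δ) hz
    (HasInput.fixLevel (v := ![v 0, z]) hA rfl hz (hG2 z hz) (fun z' hz' => ?_) ?_ ?_)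
  · have hz'' : (z' : ℕ) + 1 = z := hz'
    exact hG2 z' (by omega) (.set false false)
  · rw [hl]
    exact h3
  · rw [hl]
    exact h2

theorem letterRule_newValue (hA : DyckAux A w) {q : Paren k → Prop}
    {e : Expr (dyckEnv k) noSymbols .cond 1}
    (he : ∀ (σ : DyckStore P noSymbols n) v, e.eval A σ v ↔ ∃ c, w (v 0) = some c ∧ q c)
    (sup : ∀ i : DyckSup, (Fin 1 → Fin n) → ((dyckSup P i).sem (1 * n)).State) (p : Fin 1 → Fin n)
    {old : (Fin 1 → Fin n) → Prop} (hold : ∀ a, old a ↔ ∃ c, w (a 0) = some c ∧ q c)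
    (a : Fin 1 → Fin n) :
    ((letterRule δ q e).newValue (D := fun i => (dyckSup P i).sem (1 * n)) A sup p old a : Prop) ↔
      ∃ c, w.apply (p 0) δ (a 0) = some c ∧ q c := by
  have happ : ∀ x : Fin 0 → Fin n, (Fin.append p x : Fin 1 → Fin n) = p := fun x => by
    rw [append_one_zero]
    funext j
    fin_cases j
    rfl
  have h0 : ∀ σ : DyckStore P noSymbols n,
    (Expr.var 0 : Expr (dyckEnv k) noSymbols .term 1).eval A σ p = some (p 0) := fun _ => rfl
  refine iff_of_eq (Val.write_eq (κ := .cond) (fun x hx => ?_) fun hx => ?_)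
  · have ha : a 0 = p 0 := by
      have h1 := congrFun (Option.some.inj ((allSome_of_forall (a := fun _ => p 0) fun _ => ?_).symm.trans
        hx.2)) 0
      · exact h1.symm
      · exact congrArg some (congrFun (happ x) 0)
    refine (congrArg (fun u => Expr.eval A _ _ u) (happ x)).trans (propext ?_)
    rw [ha]
    cases δ with
    | set b =>
      rw [Word.apply_set_self]
      by_cases hp : w (p 0) = none
      · refine (iff_of_eq (Expr.eval_ite_of_true ((hA.eval_empty (h0 _)).2 hp))).trans ?_
        rw [hp]
        by_cases hq : q b
        · rw [choice_true hq]
          exact iff_of_true eval_trueCond ⟨b, rfl, hq⟩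
        · rw [choice_false hq]
          refine iff_of_false not_eval_falseCond ?_
          rintro ⟨c, hc, hqc⟩
          cases hc
          exact hq hqc
      · refine (iff_of_eq (Expr.eval_ite_of_false (mt (hA.eval_empty (h0 _)).1 hp))).trans
          ((he _ p).trans ?_)
        obtain ⟨c, hc⟩ := Option.ne_none_iff_exists'.1 hp
        rw [hc]
        rfl
    | reset =>
      rw [Word.apply_reset_self]
      refine iff_of_false not_eval_falseCond ?_
      rintro ⟨c, hc, -⟩
      cases hc
  · refine propext ((hold a).trans ?_)
    rw [Word.apply_of_ne]
    intro ha
    refine hx Fin.elim0 ⟨fun j => j.elim0, ?_⟩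
    refine allSome_of_forall fun j => ?_
    refine congrArg some ((congrFun (happ _) 0).trans ?_)
    rw [← ha, Subsingleton.elim j 0]

theorem dyckProgram_change {st : ((dyckProgram P).sem n).State} (hA : DyckAux st.1 w)
    (hG : ∀ z : Fin n, (z : ℕ) ≤ logBound.fn n → HasInput P st.2 z (levelInput w z))
    (p : Fin 1 → Fin n) :
    DyckAux (((dyckProgram P).sem n).change δ p st).1 (w.apply (p 0) δ) ∧
      ∀ z : Fin n, (z : ℕ) ≤ logBound.fn n →
        HasInput P (((dyckProgram P).sem n).change δ p st).2 z (levelInput (w.apply (p 0) δ) z) := by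
  have hstatic : ∀ s : DyckSym k, s = .base ∨ s = .rev ∨ s = .flip ∨ s = .pred → ∀ a,
      (((dyckProgram P).sem n).change δ p st).1 s a = st.1 s a := by
    rintro s (rfl | rfl | rfl | rfl) a <;>
    exact (Program.sem_mk_change_aux n δ p st _ a).trans
      (Val.write_of_same fun y hy => Expr.eval_aux_of hy.2)
  refine ⟨⟨fun z x => (hstatic .base (by simp) _).trans (hA.base z x),
    fun z x => (hstatic .rev (by simp) _).trans (hA.rev z x),
    fun a => (hstatic .flip (by simp) _).trans (hA.flip a),
    fun a => (hstatic .pred (by simp) _).trans (hA.pred a), fun c a => ?_, fun b a => ?_⟩,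
    fun z hz i => ?_⟩
  · refine (letterRule_newValue hA (P := P) (q := (· = c)) (fun σ v => ?_) st.2 p (fun a => ?_)
      a).trans (by simp)
    · exact (hA.eval_lett c rfl).trans (by simp)
    · exact (hA.lett c a).trans (by simp)
  · exact letterRule_newValue hA (P := P) (q := fun c => c.isCl = b)
      (fun σ v => hA.eval_sgn b rfl) st.2 p (hA.sgn b) a
  · have h1 : (((dyckProgram P).sem n).change δ p st).2 i = _ :=
      Program.sem_mk_change_sup (S := memberSig (Paren k)) n δ p st i .flip (invokes_dyckStmt δ i)
    rw [h1]
    exact hA.dyckStmt (δ := δ) (P := P) (σ := ⟨fun _ _ => none, st.2⟩) p hG (fun _ => rfl) z hz i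

theorem dyckProgram_start (n : ℕ) :
    DyckAux ((dyckProgram P).sem n).start.1 (fun _ : Fin n => (none : Option (Paren k))) ∧
      ∀ z : Fin n, (z : ℕ) ≤ logBound.fn n →
        HasInput P ((dyckProgram P).sem n).start.2 z (levelInput (fun _ => none) z) := by
  refine ⟨⟨fun z x => ?_, fun z x => ?_, fun a => ?_, fun a => ?_, fun c a => ?_, fun b a => ?_⟩,
    fun z _ i => ?_⟩
  · refine Eq.trans ?_ (toDomain_eq_theUnique _ _).symm
    refine theUnique_congr fun q => ?_
    exact (FODef.dyadicBase (0 : Fin 3) 1 2).choose_spec n _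
  · refine Eq.trans ?_ (toDomain_eq_theUnique _ _).symm
    refine theUnique_congr fun q => ?_
    exact (FODef.dyadicRev (0 : Fin 3) 1 2).choose_spec n _
  · refine (StartDef.eval_term (FODef.flip (0 : Fin 2) 1) n a).trans ?_
    refine theUnique_of ?_ fun b hb => ?_
    · show ((a 0).rev : ℕ) = n - 1 - (a 0 : ℕ)
      rw [Fin.val_rev]; omega
    · have hb' : (b : ℕ) = n - 1 - (a 0 : ℕ) := hb
      ext
      rw [Fin.val_rev]; omega
  · exact StartDef.eval_term (FODef.pred (0 : Fin 2) 1) n a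
  · refine (iff_of_eq (StartDef.eval_cond (FODef.false (α := Fin 1)) n a)).trans ?_
    simp
  · refine (iff_of_eq (StartDef.eval_cond (FODef.false (α := Fin 1)) n a)).trans ?_
    simp
  · have hlett : ∀ x, (Word.letter (fun _ : Fin n => (none : Option (Paren k)))) x = none :=
      fun x => by unfold Word.letter; split_ifs <;> rfl
    have h1 : levelInput (fun _ : Fin n => (none : Option (Paren k))) z i =
        (dyckProblem k i (1 * n)).start := by
      cases i with
      | eq =>
        refine Prod.ext (funext fun x => ?_) (funext fun x => ?_)
        · refine Option.eq_none_iff_forall_ne_some.2 fun a ha => ?_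
          have h2 := ((levelTypes_false_eq_some (n := n)).1 ha).2
          rw [hlett] at h2
          cases h2
        · refine Option.eq_none_iff_forall_ne_some.2 fun a ha => ?_
          have h2 := ((levelTypes_true_eq_some (n := n)).1 ha).2
          rw [hlett] at h2
          cases h2
      | set b r =>
        refine Set.eq_empty_iff_forall_notMem.2 fun y hy => ?_
        obtain ⟨x, -, hx⟩ := (mem_levelSet_iff _ z b r y).1 hy
        cases b
        · exact Word.ne_none_of_unm hx rfl
        · exact Word.ne_none_of_matchedAt hx rfl
    rw [h1]
    exact Reps.start _ _ _

/-! ### Queries -/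

theorem DyckAux.eval_noUnmatched {σ : DyckStore P noSymbols n} (hA : DyckAux A w) {z : Fin n}
    (hG : HasInput P σ.sup z (levelInput w z)) {v : Fin 1 → Fin n} (hv : v 0 = z) :
    noUnmatchedCond.eval A σ v ↔ ∀ i, ¬ Unm (height w.letter) dyadicLevels z i := by
  subst hv
  have h0 : (Expr.var 0 : Expr (dyckEnv k) noSymbols .term 1).eval A σ v = some (v 0) := rfl
  have hs := eval_set (hG (.set false false)) h0 (hA.eval_base h0 h0)
  refine (not_congr Expr.eval_eq_self).trans ?_
  rw [hs, ← Option.ne_none_iff_exists', not_not, leastIn_eq_none, Set.eq_empty_iff_forall_notMem]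
  · constructor
    · intro h i hi
      obtain ⟨x, rfl⟩ := inDomain_word w _ i hi
      exact h x ⟨hi, by simp only [dyadicBase_self]; omega⟩
    · rintro h y ⟨hy, -⟩
      exact h y hy
  · rintro y ⟨hy, -⟩
    obtain ⟨x, hx⟩ := inDomain_word w _ _ hy
    have h2 := x.isLt
    omega

theorem DyckAux.eval_query {σ : DyckStore P noSymbols n} (hA : DyckAux A w)
    (hP : P.Maintains (StringEquality (Fin k)))
    (hG : ∀ z : Fin n, (z : ℕ) ≤ logBound.fn n → HasInput P σ.sup z (levelInput w z))
    (v : Fin 0 → Fin n) : dyckQuery.body.eval A v σ ↔ Balanced w.str := by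
  have hsnoc : ∀ z : Fin n, (Fin.snoc v z : Fin 1 → Fin n) 0 = z := fun z => rfl
  have h1 : (Expr.not (.exist logBound (.not (eqCond (.var 0)))) :
      Expr (dyckEnv k) noSymbols .cond 0).eval A σ v ↔
      ∀ z : Fin n, (z : ℕ) ≤ logBound.fn n →
        Word.str (fun x : Fin (1 * n) => levelTypes w.letter n z false x) =
          Word.str (fun x : Fin (1 * n) => levelTypes w.letter n z true x) := by
    refine not_exists.trans (forall_congr' fun z => not_and.trans
      (forall_congr' fun hz => not_not.trans ?_))
    exact eval_eqCond hP (hG z hz .eq) (congrArg some (hsnoc z))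
  have h2 : (Expr.exist logBound noUnmatchedCond :
      Expr (dyckEnv k) noSymbols .cond 0).eval A σ v ↔ ∃ z : Fin n, (z : ℕ) ≤ logBound.fn n ∧
        ∀ i, ¬ Unm (height w.letter) dyadicLevels z i :=
    exists_congr fun z => and_congr_right fun hz => hA.eval_noUnmatched (hG z hz) (hsnoc z)
  have h3 : (Expr.exist logBound trueCond :
      Expr (dyckEnv k) noSymbols .cond 0).eval A σ v ↔ 1 ≤ n := by
    refine ⟨fun ⟨z, _⟩ => z.pos, fun hn => ⟨⟨0, hn⟩, Nat.zero_le _, eval_trueCond⟩⟩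
  refine (and_congr h1 (not_congr (and_congr (not_congr h2) h3))).trans ?_
  rcases Nat.eq_zero_or_pos n with rfl | hn
  · have hs : w.str = [] := by simp [Word.str]
    rw [hs]
    exact iff_of_true ⟨fun z => z.elim0, fun h => absurd h.2 (by omega)⟩ .nil
  · rw [balanced_str_iff (one_mul n) hn]
    refine and_congr_right fun _ => ?_
    rw [not_and, not_imp_comm]
    exact ⟨fun h => h (not_not.2 hn), fun h _ => h⟩

theorem dyckProgram_maintains (hP : P.Maintains (StringEquality (Fin k))) :
    (dyckProgram P).Maintains (Member (dyck k)) := by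
  refine maintains_of_invariant (fun n st w => DyckAux st.1 w ∧
    ∀ z : Fin n, (z : ℕ) ≤ logBound.fn n → HasInput P st.2 z (levelInput w z)) dyckProgram_start
    (fun n st w h δ p => dyckProgram_change h.1 h.2 p) fun n st w h Q a => ?_
  refine (Program.sem_mk_query n st Q a).trans (propext ?_)
  exact h.1.eval_query (P := P) hP h.2 a

end program

/-! ### The work of the program for well-balanced strings -/

section work

variable {k n B m : ℕ} {L : Schema} {c : ∀ i : (dyckEnv k).Sup, Cost ((dyckEnv k).sig i)}

/-- `B` bounds the work of all operations of the supplementary instances. -/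
structure CostBound (n : ℕ) (c : ∀ i : (dyckEnv k).Sup, Cost ((dyckEnv k).sig i)) (B : ℕ) :
    Prop where
  pos : 1 ≤ n
  sq : logBound.count n * logBound.count n ≤ B
  change : ∀ i δ, (c i).change δ ≤ B
  query : ∀ i Q, (c i).query Q ≤ B

theorem CostBound.count_le (h : CostBound n c B) : logBound.count n ≤ B :=
  (Nat.le_mul_of_pos_right _ (logBound.one_le_count h.pos)).trans h.sq

theorem CostBound.one_le (h : CostBound n c B) : 1 ≤ B :=
  (logBound.one_le_count h.pos).trans h.count_le

theorem sup_fin_one_le {f : Fin 1 → ℕ} (h : f 0 ≤ B) : Finset.univ.sup f ≤ B :=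
  Finset.sup_le fun j _ => by rwa [Subsingleton.elim j 0]

theorem sup_fin_zero_le {f : Fin 0 → ℕ} : Finset.univ.sup f ≤ B :=
  Finset.sup_le fun j _ => j.elim0

variable {z t : Expr (dyckEnv k) L .term m}

theorem var_work (hB : 1 ≤ B) (i : Fin m) : (Expr.var i : Expr (dyckEnv k) L .term m).work n c ≤ B :=
  hB

theorem flipTerm_work (hB : 1 ≤ B) (r : Bool) (ht : t.work n c ≤ B) :
    (flipTerm r t).work n c ≤ B := by
  cases r
  · exact ht
  · exact max_le hB (sup_fin_one_le ht)

theorem baseTerm_work (hB : 1 ≤ B) (hz : z.work n c ≤ B) (ht : t.work n c ≤ B) :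
    (baseTerm z t).work n c ≤ B := max_le hB (sup_fin_two_le hz ht)

theorem revTerm_work (hB : 1 ≤ B) (hz : z.work n c ≤ B) (ht : t.work n c ≤ B) :
    (revTerm z t).work n c ≤ B := max_le hB (sup_fin_two_le hz ht)

theorem predTerm_work (hB : 1 ≤ B) (hz : z.work n c ≤ B) : (predTerm z).work n c ≤ B :=
  max_le hB (sup_fin_one_le hz)

theorem sgnCond_work (hB : 1 ≤ B) (b : Bool) (ht : t.work n c ≤ B) :
    (sgnCond b t).work n c ≤ B := max_le hB (sup_fin_one_le ht)

theorem lettCond_work (hB : 1 ≤ B) (a : Paren k) (ht : t.work n c ≤ B) :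
    (lettCond a t).work n c ≤ B := max_le hB (sup_fin_one_le ht)

theorem emptyCond_work (hB : 1 ≤ B) (ht : t.work n c ≤ B) : (emptyCond t).work n c ≤ B :=
  max_le (sgnCond_work hB _ ht) (sgnCond_work hB _ ht)

theorem slotTerm_work (hB : 1 ≤ B) (s : Bool) (hz : z.work n c ≤ B) (ht : t.work n c ≤ B) :
    (slotTerm s z t).work n c ≤ B := by
  cases s
  · exact ht
  · exact revTerm_work hB hz ht

theorem localTerm_work (hB : 1 ≤ B) (s : Bool) {t : Expr (dyckEnv k) dyckLoc .term m}
    (ht : t.work n c ≤ B) : (localTerm s t).work n c ≤ B := max_le hB (sup_fin_one_le ht)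

theorem CostBound.setTerm (h : CostBound n c B) (b r : Bool) (hz : z.work n c ≤ B)
    (ht : t.work n c ≤ B) : (setTerm b r z t).work n c ≤ B :=
  max_le (max_le h.one_le (h.query (.set b r) ())) (max_le (sup_fin_one_le hz) (sup_fin_one_le ht))

theorem CostBound.memCond (h : CostBound n c B) (b r : Bool) (hz : z.work n c ≤ B)
    (ht : t.work n c ≤ B) : (memCond b r z t).work n c ≤ B :=
  max_le (h.setTerm b r hz ht) ht

theorem CostBound.eqCond (h : CostBound n c B) (hz : z.work n c ≤ B) : (eqCond z).work n c ≤ B :=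
  max_le (max_le h.one_le (h.query .eq ())) (max_le (sup_fin_one_le hz) sup_fin_zero_le)

theorem trueCond_work (hB : 1 ≤ B) : (trueCond : Expr (dyckEnv k) L .cond (m + 1)).work n c ≤ B :=
  max_le hB hB

theorem CostBound.firstTerm (h : CostBound n c B) (r : Bool) :
    (firstTerm (k := k) r).work n c ≤ B := by
  have hB := h.one_le
  cases r
  · exact baseTerm_work hB hB hB
  · exact flipTerm_work (L := dyckLoc) (m := 2) hB true (revTerm_work hB (var_work hB 1)
      (baseTerm_work hB (var_work hB 1) (var_work hB 0)))

theorem CostBound.leftTerm (h : CostBound n c B) (r : Bool) :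
    (leftTerm (k := k) r).work n c ≤ B := by
  have hB := h.one_le
  have h1 := h.setTerm (L := dyckLoc) (m := 2) true r (z := .var 1) hB (h.firstTerm r)
  refine max_le (max_le (max_le h1 (flipTerm_work hB r hB)) (max_le ?_ ?_)) (max_le h1 hB)
  · exact baseTerm_work hB hB (flipTerm_work hB r (h.setTerm true r hB (flipTerm_work hB r hB)))
  · exact baseTerm_work hB hB hB

/-- As in the successor search, two nested quantifiers over levels cost the square of their number;
here their bodies only read local values, so no further factor arises. -/
theorem CostBound.pairLevel (h : CostBound n c B) : (pairLevel (k := k)).work n c ≤ B := by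
  have h1 := logBound.one_le_count h.pos
  have hl : ∀ {m : ℕ} (i : Fin m),
      (localTerm (k := k) false (.var i) : Expr (dyckEnv k) dyckLoc .term m).work n c ≤ 1 :=
    fun i => localTerm_work le_rfl _ le_rfl
  refine (Nat.mul_le_mul le_rfl ?_).trans h.sq
  refine max_le (max_le h1 h1) (max_le (max_le ((hl _).trans h1) ((hl _).trans h1)) ?_)
  refine (Nat.mul_le_mul le_rfl ?_).trans (mul_one _).le
  exact max_le (max_le le_rfl le_rfl) (max_le (max_le le_rfl le_rfl) (max_le (hl _) (hl _)))

theorem CostBound.toggleTerm (h : CostBound n c B) (r : Bool) :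
    (toggleTerm (k := k) r).work n c ≤ B := by
  have hB := h.one_le
  have hf := flipTerm_work (k := k) (L := dyckLoc) (m := 2) (n := n) (c := c) (t := .var 0) hB r hB
  have hs := h.setTerm (L := dyckLoc) (m := 2) false r (z := .var 1) hB hf
  have hl := localTerm_work hB false h.pairLevel
  refine flipTerm_work hB r (max_le (max_le (max_le ?_ ?_) ?_) (max_le hs
    (max_le (max_le hl hl) (max_le hl hf))))
  · exact baseTerm_work hB hB (flipTerm_work hB r hs)
  · exact baseTerm_work hB hB hB
  · exact sgnCond_work hB _ (flipTerm_work hB r hs)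

theorem CostBound.findToggles (h : CostBound n c B) (r : Bool) :
    (findToggles (k := k) r).work n c ≤ logBound.count n * B :=
  max_le (Nat.mul_le_mul le_rfl (max_le (h.leftTerm r) (sup_fin_one_le h.one_le)))
    (Nat.mul_le_mul le_rfl (max_le (h.toggleTerm r) (sup_fin_one_le h.one_le)))

theorem CostBound.le_count_mul (h : CostBound n c B) : B ≤ logBound.count n * B :=
  Nat.le_mul_of_pos_left _ (logBound.one_le_count h.pos)

theorem CostBound.activeCond (h : CostBound n c B) (δ : LetterOp (Paren k)) (r : Bool) :
    (activeCond δ r).work n c ≤ B := by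
  have hB := h.one_le
  cases δ with
  | set a =>
    by_cases ha : a.isCl = r
    · rw [show DynFO.activeCond (.set a) r = _ from choice_true ha _ _]
      exact emptyCond_work hB hB
    · rw [show DynFO.activeCond (.set a) r = _ from choice_false ha _ _]
      exact trueCond_work hB
  | reset => exact sgnCond_work hB _ hB

variable {t : Expr (dyckEnv k) dyckLoc .term 2}

theorem CostBound.setChange (h : CostBound n c B) (b r : Bool) (op : SetOp)
    (ht : t.work n c ≤ B) : (setChange b r op t).work n c ≤ B :=
  max_le (max_le h.one_le (h.change (.set b r) op))
    (max_le (sup_fin_one_le h.one_le) (sup_fin_one_le ht))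

theorem CostBound.eqChange (h : CostBound n c B) (op : Bool × LetterOp (Fin k))
    (ht : t.work n c ≤ B) : (eqChange op t).work n c ≤ B :=
  max_le (max_le h.one_le (h.change .eq op))
    (max_le (sup_fin_one_le h.one_le) (sup_fin_one_le ht))

theorem CostBound.toggleSet (h : CostBound n c B) (r : Bool) :
    (toggleSet (k := k) r).work n c ≤ B := by
  have hB := h.one_le
  have hf := flipTerm_work hB r (localTerm_work (k := k) (n := n) (c := c) (m := 2) hB true
    (t := .var 1) hB)
  exact max_le (h.memCond _ _ hB hf) (max_le (h.setChange _ _ _ hf) (h.setChange _ _ _ hf))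

theorem CostBound.matchedCond (h : CostBound n c B) (ht : t.work n c ≤ B) :
    (matchedCond t).work n c ≤ B :=
  max_le (h.memCond _ _ (predTerm_work h.one_le h.one_le) ht) (h.memCond _ _ h.one_le ht)

theorem CostBound.changedLett (h : CostBound n c B) (δ : LetterOp (Paren k)) (a : Paren k)
    (ht : t.work n c ≤ B) : (changedLett δ a t).work n c ≤ B := by
  have hB := h.one_le
  cases δ with
  | set b =>
    refine max_le (max_le ht hB) (max_le ?_ (lettCond_work hB a ht))
    by_cases hb : a = b
    · rw [choice_true hb]
      exact max_le hB hB
    · rw [choice_false hb]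
      exact max_le hB hB
  | reset => exact max_le (max_le ht hB) (lettCond_work hB a ht)

theorem CostBound.fixSet (h : CostBound n c B) (r : Bool) (ht : t.work n c ≤ B) :
    (fixSet r t).work n c ≤ B := by
  have hf := flipTerm_work h.one_le r ht
  exact max_le (h.matchedCond ht) (max_le (h.setChange _ _ _ hf) (h.setChange _ _ _ hf))

theorem CostBound.setWords (h : CostBound n c B) (δ : LetterOp (Paren k)) (ht : t.work n c ≤ B)
    (l : List (Paren k)) : (setWords δ t l).work n c ≤ B := by
  induction l with
  | nil => exact h.one_le
  | cons a l ih =>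
    exact max_le (h.changedLett δ a ht)
      (max_le (h.eqChange _ (slotTerm_work h.one_le _ h.one_le ht)) ih)

theorem CostBound.fixAt (h : CostBound n c B) (δ : LetterOp (Paren k)) (ht : t.work n c ≤ B) :
    (fixAt δ t).work n c ≤ B := by
  have hs := fun s => slotTerm_work h.one_le s (var_work h.one_le 1) ht
  refine max_le (max_le (h.fixSet _ ht) (h.fixSet _ ht)) (max_le (max_le ?_ ?_)
    (max_le (h.matchedCond ht) (max_le (h.setWords δ ht _) h.one_le)))
  · exact h.eqChange _ (hs false)
  · exact h.eqChange _ (hs true)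

theorem CostBound.fixLevel (h : CostBound n c B) (δ : LetterOp (Paren k)) :
    (fixLevel δ).work n c ≤ B :=
  max_le (h.fixAt δ (localTerm_work h.one_le _ (predTerm_work h.one_le h.one_le)))
    (h.fixAt δ (localTerm_work h.one_le _ h.one_le))

/-- Loops over the levels are executed one after the other and never nested, so they contribute a
single factor to the bound `B` for one level. -/
theorem CostBound.dyckStmt (h : CostBound n c B) (δ : LetterOp (Paren k)) :
    (dyckStmt δ).work n c ≤ logBound.count n * B := by
  have h1 := h.le_count_mul
  refine max_le (max_le ((h.activeCond δ _).trans h1) (max_le (h.findToggles _)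
    (max_le ((h.activeCond δ _).trans h1) (max_le (h.findToggles _) (h.one_le.trans h1)))))
    (max_le (Nat.mul_le_mul le_rfl (max_le (h.toggleSet _) (h.toggleSet _)))
      (Nat.mul_le_mul le_rfl (h.fixLevel δ)))

theorem CostBound.letterRule (h : CostBound n c B) (δ : LetterOp (Paren k)) (q : Paren k → Prop)
    {e : Expr (dyckEnv k) noSymbols .cond 1} (he : e.work n c ≤ B) :
    (letterRule δ q e).work n c ≤ B := by
  have hB := h.one_le
  refine UpdateRule.work_le_of_numVars_zero rfl hB ?_ fun _ => hB
  cases δ with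
  | set a =>
    refine max_le (emptyCond_work hB hB) (max_le ?_ he)
    by_cases hq : q a
    · rw [choice_true hq]
      exact trueCond_work hB
    · rw [choice_false hq]
      exact trueCond_work hB
  | reset => exact trueCond_work hB

theorem CostBound.dyckQuery (h : CostBound n c B) :
    (dyckQuery (k := k)).body.work n c ≤ logBound.count n * B := by
  have hB := h.one_le
  have hs := h.setTerm (L := noSymbols) (m := 1) false false (var_work hB 0)
    (baseTerm_work hB (var_work hB 0) (var_work hB 0))
  exact max_le (Nat.mul_le_mul le_rfl (h.eqCond hB))
    (max_le (Nat.mul_le_mul le_rfl (max_le hs hs)) (Nat.mul_le_mul le_rfl (trueCond_work hB)))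

end work

/-! ### Asymptotic work bounds -/

section cost

variable {k : ℕ} {P : Program (stringEqualitySig (Fin k))} {n B : ℕ}

theorem dyckProgram_cost_change
    (h : CostBound n (fun i => (dyckSup P i).cost (1 * n)) B) (δ : LetterOp (Paren k)) :
    ((dyckProgram P).cost n).change δ ≤ logBound.count n * B := by
  have h1 := h.le_count_mul
  have hB := h.one_le
  refine (Program.cost_mk_change (S := memberSig (Paren k)) n δ).trans_le
    (Finset.sup_le fun s _ => ?_)
  cases s with
  | lett a => exact (h.letterRule δ _ (lettCond_work hB a (var_work hB 0))).trans h1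
  | sgn b => exact (h.letterRule δ _ (sgnCond_work hB b (var_work hB 0))).trans h1
  | base => exact (staticRule_work _ _ _ _).trans (hB.trans h1)
  | rev => exact (staticRule_work _ _ _ _).trans (hB.trans h1)
  | flip =>
    exact UpdateRule.work_le_of_numVars_zero rfl (h.dyckStmt δ)
      ((flipTerm_work hB true (var_work hB 0)).trans h1) fun _ => hB.trans h1
  | pred => exact (staticRule_work _ _ _ _).trans (hB.trans h1)

theorem dyckProgram_cost_query
    (h : CostBound n (fun i => (dyckSup P i).cost (1 * n)) B) (Q : Unit) :
    ((dyckProgram P).cost n).query Q ≤ logBound.count n * B := h.dyckQuery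

instance (A : Type) [Finite A] : Finite (LetterOp A) :=
  Finite.of_surjective (α := Option A) (fun a => a.elim .reset .set) fun
    | .set a => ⟨some a, rfl⟩
    | .reset => ⟨none, rfl⟩

instance : Fintype (Bool × LetterOp (Fin k)) := Fintype.ofFinite _

/-- The sum of the work of all operations of `P`. -/
def totalCost (P : Program (stringEqualitySig (Fin k))) (n : ℕ) : ℕ :=
  (∑ δ : Bool × LetterOp (Fin k), (P.cost n).change δ) + (P.cost n).query ()

theorem costBound_dyckSup (hn : 1 ≤ n) : CostBound n (fun i => (dyckSup P i).cost (1 * n))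
    (totalCost P n + logBound.count n * logBound.count n) := by
  have e : 1 * n = n := one_mul n
  refine ⟨hn, Nat.le_add_left _ _, ?_, ?_⟩
  · rintro (_ | ⟨b, r⟩) δ
    · simp only [e]
      refine ((Finset.single_le_sum (f := fun δ => (P.cost n).change δ) (fun _ _ => Nat.zero_le _)
        (Finset.mem_univ δ)).trans (Nat.le_add_right _ _)).trans (Nat.le_add_right _ _)
    · simp only [e]
      exact (succProgram_cost_change hn δ).trans (Nat.le_add_left _ _)
  · rintro (_ | ⟨b, r⟩) Q
    · simp only [e]
      exact (Nat.le_add_left _ _).trans (Nat.le_add_right _ _)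
    · simp only [e]
      exact (succProgram_cost_query hn Q).trans (Nat.le_add_left _ _)

theorem isBigO_totalCost {W : ℕ → ℝ}
    (hc : ∀ δ : Bool × LetterOp (Fin k), (fun n => ((P.cost n).change δ : ℝ)) =O[atTop] W)
    (hq : ∀ Q : Unit, (fun n => ((P.cost n).query Q : ℝ)) =O[atTop] W) :
    (fun n => (totalCost P n : ℝ)) =O[atTop] W := by
  simp only [totalCost, Nat.cast_add, Nat.cast_sum]
  refine IsBigO.add ?_ (hq ())
  exact IsBigO.fun_sum fun δ _ => hc δ

theorem isBigO_count_logBound :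
    (fun n => (logBound.count n : ℝ)) =O[atTop] fun n : ℕ => Real.log n := by
  -- The number of levels is at most `log₂ (n - 1) + 2`. Multiplied by `log 2`, the logarithm and
  -- each of the two additional levels contribute at most `log n` for `n ≥ 2`.
  refine IsBigO.of_bound (3 / Real.log 2) ?_
  filter_upwards [eventually_ge_atTop 2] with n hn
  have hl2 : 0 < Real.log 2 := Real.log_pos (by norm_num)
  have hn' : (2 : ℝ) ≤ n := by exact_mod_cast hn
  have h1 : Real.log 2 ≤ Real.log n := Real.log_le_log (by norm_num) hn'
  have h2 : (Nat.log 2 (n - 1) : ℝ) * Real.log 2 ≤ Real.log n := by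
    rw [← Real.log_pow]
    refine Real.log_le_log (by positivity) ?_
    have h3 : 2 ^ Nat.log 2 (n - 1) ≤ n :=
      (Nat.pow_log_le_self 2 (by omega)).trans (Nat.sub_le _ _)
    exact_mod_cast h3
  have h4 : (logBound.count n : ℝ) ≤ Nat.log 2 (n - 1) + 2 := by
    have : logBound.count n ≤ Nat.log 2 (n - 1) + 2 := min_le_left _ _
    exact_mod_cast this
  rw [Real.norm_of_nonneg (by positivity), Real.norm_of_nonneg (by linarith), div_mul_eq_mul_div,
    le_div_iff₀ hl2]
  nlinarith

/-- With `O(log n)` levels of work `O(W(n) + (log n) ^ 2)` each, the product splits into the two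
summands of the bound. Since `W` is nonnegative, the sum dominates each of them. -/
theorem member_of_stringEquality {W : ℕ → ℝ} (hW : ∀ n, 0 ≤ W n)
    (h : MaintainableWithWork (StringEquality (Fin k)) W) :
    MaintainableWithWork (Member (dyck k)) fun n => W n * Real.log n + Real.log n ^ 3 := by
  obtain ⟨P, hP, hc, hq⟩ := h
  have hL := isBigO_count_logBound
  have hlog : ∀ n : ℕ, 0 ≤ Real.log n := fun n => Real.log_natCast_nonneg n
  have h1 : (fun n : ℕ => W n * Real.log n) =O[atTop]
      fun n => W n * Real.log n + Real.log n ^ 3 := by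
    refine IsBigO.of_bound 1 (Eventually.of_forall fun n => ?_)
    have ha := mul_nonneg (hW n) (hlog n)
    have hb := pow_nonneg (hlog n) 3
    rw [one_mul, Real.norm_of_nonneg ha, Real.norm_of_nonneg (by linarith)]
    linarith
  have h2 : (fun n : ℕ => Real.log n ^ 3) =O[atTop]
      fun n => W n * Real.log n + Real.log n ^ 3 := by
    refine IsBigO.of_bound 1 (Eventually.of_forall fun n => ?_)
    have ha := mul_nonneg (hW n) (hlog n)
    have hb := pow_nonneg (hlog n) 3
    rw [one_mul, Real.norm_of_nonneg hb, Real.norm_of_nonneg (by linarith)]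
    linarith
  have h3 : (fun n => ((logBound.count n * (totalCost P n +
      logBound.count n * logBound.count n) : ℕ) : ℝ)) =O[atTop]
      fun n => W n * Real.log n + Real.log n ^ 3 := by
    have h4 := ((isBigO_totalCost hc hq).mul hL).trans h1
    have h5 := ((hL.pow 3)).trans h2
    refine (h4.add h5).congr_left fun n => ?_
    push_cast
    ring
  have key : ∀ f : ℕ → ℕ, (∀ n, 1 ≤ n → f n ≤ logBound.count n * (totalCost P n +
      logBound.count n * logBound.count n)) →
      (fun n => (f n : ℝ)) =O[atTop] fun n => W n * Real.log n + Real.log n ^ 3 := by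
    intro f hf
    refine IsBigO.trans (IsBigO.of_bound 1 ?_) h3
    filter_upwards [eventually_ge_atTop 1] with n hn
    rw [one_mul, Real.norm_of_nonneg (by positivity), Real.norm_of_nonneg (by positivity)]
    exact_mod_cast hf n hn
  exact ⟨dyckProgram P, dyckProgram_maintains hP,
    fun δ => key _ fun n hn => dyckProgram_cost_change (costBound_dyckSup hn) δ,
    fun Q => key _ fun n hn => dyckProgram_cost_query (costBound_dyckSup hn) Q⟩

end cost

end DynFO

end

theorem mainTheorem9 (W : ℕ → ℝ) (hW : ∀ n, 0 ≤ W n) :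
    (∀ k : ℕ, 1 ≤ k → DynFO.MaintainableWithWork (DynFO.StringEquality (Fin k)) W →
      DynFO.MaintainableWithWork (DynFO.Member (DynFO.dyck k))
        (fun n => W n * Real.log n + Real.log n ^ 3)) ∧
    ((∀ k : ℕ, 1 ≤ k → DynFO.MaintainableWithWork (DynFO.Member (DynFO.dyck k)) W) →
      ∀ (A : Type) [Fintype A],
        DynFO.MaintainableWithWork (DynFO.StringEquality A) (fun n => W (2 * n)) ∧
        ((fun n => W (2 * n)) =O[atTop] W →
          DynFO.MaintainableWithWork (DynFO.StringEquality A) W)) := by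
  refine ⟨fun k _ h => DynFO.member_of_stringEquality hW h, fun h A _ => ?_⟩
  obtain ⟨P, hP, hc, hq⟩ := DynFO.stringEquality_of_member h A
  exact ⟨⟨P, hP, hc, hq⟩, fun hO => ⟨P, hP, fun δ => (hc δ).trans hO, fun Q => (hq Q).trans hO⟩⟩
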